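/- **Setting.** Let $r\ge 2$, let $\mathcal A=\{A_1,\dots,A_r\}$ be a partition of $[n]$ with $|A_p|\ge 2$ for all $p$, and let $f:\{0,1\}^n\to\mathbf R\cup\{+\infty\}$ be the *VCSP-quadratic function of type $\mathcal A$* given by real numbers $a_i$ and by $a_{ij}=a_{ji}\in\mathbf R\cup\{+\infty\}$ with $a_{ij}=+\infty$ exactly when $i,j$ lie in the same block: $f(x)=\sum_{i<j}a_{ij}x_ix_j+\sum_i a_ix_i$ if $\sum_i x_i=r$, and $f(x)=+\infty$ otherwise. The input consists of $\mathcal A$ and these coefficients. A function of this form ($+\infty$ unless $\sum_i x_i=r$), with arbitrary coefficients $a_i\in\mathbf R$ and $a_{ij}=a_{ji}\in\mathbf R\cup\{+\infty\}$, is *quadratic*. A function $g$ is *M-convex* if for all $x,y$ with $g(x),g(y)<+\infty$ and all $i$ with $x_i>y_i$ there is $j$ with $y_j>x_j$ and $g(x)+g(y)\ge g(x-\chi_i+\chi_j)+g(y+\chi_i-\chi_j)$. The function $f$ is *QR-M$_2$-convex* if it is the sum of two quadratic M-convex functions. A set $X$ *cuts* $A_p$ if $\emptyset\ne X\cap A_p\ne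 A_p$; $X$ is an *$\mathcal A$-cut* if it cuts at least two blocks; $\langle X\rangle$ is the union of the blocks cut by $X$. For a set $Q$ of block indices, $A_Q=\bigcup_{p\in Q}A_p$, an *$\mathcal A_Q$-cut* is a subset of $A_Q$ cutting at least two blocks $A_p$, $p\in Q$, and, with $\langle X\rangle_Q=\langle X\rangle\cap A_Q$, we write $X\sim_Q Y$ if $\{\langle X\rangle_Q\cap X,\langle X\rangle_Q\setminus X\}=\{\langle Y\rangle_Q\cap Y,\langle Y\rangle_Q\setminus Y\}$; $\sim$ is $\sim_{[r]}$. A family is *non-redundant* if no two distinct members are related by $\sim$. It is *laminar* if any two members are disjoint or comparable by inclusion. An $\mathcal A$-cut family is *laminarizable* if there is a laminar $\mathcal A$-cut family representing the same $\sim$-classes. Put $\ell_X(x)=\sum_{i,j\in X,\,i<j}x_ix_j$, and write $f\simeq g$ if $f-g$ coincides with an affine function on $U_{\mathcal A}=\{x\in\{0,1\}^n:\sum_{i\in A_p}x_i=1\ \forall p\}$. The problem *Decomposition*: given $f$, either answer "$f$ is not QR-M$_2$-convex" (allowed only if this is true) or output a non-redundant $\mathcal A$-cut family $\mathcal F$ and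 a weight $c:\mathcal F\to\mathbf R_{>0}$ with $f\simeq\sum_{X\in\mathcal F}c(X)\ell_X$, where $\mathcal F$ must be laminarizable if $f$ is QR-M$_2$-convex. **Algorithm 1** (two blocks $A_1,A_2$, ground set $S=A_1\cup A_2$). Let $\alpha^*=\min_{i\ne j}a_{ij}$. For each $i\in S$ in increasing order subtract $b_i=\min_{j\ne i}a_{ij}-\alpha^*$ (computed from the current matrix) from $a_{ij}$ and $a_{ji}$ for all $j\ne i$. Let $\alpha_1>\dots>\alpha_m$ be the distinct values $a_{ij}$ ($i\in A_1,j\in A_2$), and $G_\alpha$ the graph with edges $\{i,j\}$, $i\in A_1$, $j\in A_2$, $a_{ij}\ge\alpha$. If for some $s<m$ a connected component of $G_{\alpha_s}$ with at least one edge is not a complete bipartite graph, answer "not QR-M$_2$-convex". Otherwise let $\mathcal L$ consist of the node sets of the components with at least one edge of $G_{\alpha_1},\dots,G_{\alpha_{m-1}}$; let $\alpha_S=\alpha_m$ and, for $L\in\mathcal L$, let $\alpha_L$ be the largest $\alpha_s$ for which $L$ is such a component, $L^+$ the least member of $\mathcal L\cup\{S\}$ properly containing $L$, and $c(L)=\alpha_L-\alpha_{L^+}$.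 From each complementary pair $X,S\setminus X\in\mathcal L$ delete one set, adding its weight to that of the other. Output $(\mathcal L,c)$. **Algorithm 2** (extension from blocks $A_1,\dots,A_{t-1}$ to $A_1,\dots,A_t$; input $(\mathcal F',c')$). Run Algorithm 1 on each pair $A_p,A_t$ ($p<t$); if one run answers "not QR-M$_2$-convex", so does Algorithm 2; otherwise this gives $(\mathcal L_{pt},c_{pt})$. Start with $\mathcal F=\emptyset$. While $\mathcal F'\ne\emptyset$, choose $X_0\in\mathcal F'$ with $\langle X_0\rangle$ inclusion-maximal; let $P$ be the set of $p<t$ such that $X_0$ cuts $A_p$. If there are $X_p\in\mathcal L_{pt}$ ($p\in P$), each an $\mathcal A_{\{p,t\}}$-cut, and an $\mathcal A_{[t]}$-cut $X^*$ with $X^*\sim_{[t-1]}X_0$ and $X^*\sim_{\{p,t\}}X_p$ for all $p\in P$, choose such sets, let $\lambda$ be the minimum of $c'(X_0)$ and the $c_{pt}(X_p)$, put $X^*$ into $\mathcal F$ with $c(X^*)=\lambda$, decrease the weights of $X_0$ and of the $X_p$ by $\lambda$, and delete those whose weight becomes $0$ from $\mathcal F'$ and $\mathcal L_{pt}$, respectively.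 Otherwise move $X_0$ with its weight from $\mathcal F'$ to $\mathcal F$. At the end add all remaining $\mathcal L_{pt}$ with their weights to $\mathcal F$. Output $(\mathcal F,c)$ if $|\mathcal F|\le 2|A_1\cup\dots\cup A_t|$, and answer "not QR-M$_2$-convex" otherwise. **Algorithm 3.** Rename the blocks so that $|A_1|\ge\dots\ge|A_r|$. Run Algorithm 1 on $A_1,A_2$, then Algorithm 2 for $t=3,\dots,r$ in turn, each time on the preceding output. If one of these runs answers "not QR-M$_2$-convex", give that answer and stop; otherwise output the last pair $(\mathcal F,c)$. **Theorem.** Algorithm 3 solves Decomposition in $O(rn^2)$ time. That is: (a) whichever choices are made, every answer of Algorithm 3 on input $f$ is a correct answer to Decomposition for $f$; (b) whichever choices are made, the loop in Algorithm 2 terminates; (c) there are a single real-RAM program (unit-cost addition, subtraction and comparison of naturals and of reals, unit-cost access to arrays of dimension at most two) and a constant $C$ such that on every input with parameters $n,r$ the program halts within $C\,r\,n^2$ steps and its output is a possible answer of Algorithm 3 on that input. -/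

import Mathlib

noncomputable section

namespace QRM2

/-! ### Functions on the 0-1 vectors

A vector `x ∈ {0,1}^n` is identified with its support, a `Finset (Fin n)`.
The extended reals `ℝ ∪ {+∞}` are `WithTop ℝ`. -/

/-- The function equal to `∑_{i<j} a_ij x_i x_j + ∑_i u_i x_i` on the vectors with exactly `r` ones
and to `+∞` elsewhere (with `0 * (+∞) = 0`). -/
def quadFun {n : ℕ} (r : ℕ) (a : Fin n → Fin n → WithTop ℝ) (u : Fin n → ℝ)
    (x : Finset (Fin n)) : WithTop ℝ :=
  if x.card = r then
    (∑ i ∈ x, ∑ j ∈ x with i < j, a i j) + ∑ i ∈ x, ((u i : ℝ) : WithTop ℝ)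
  else ⊤

/-- `g` is quadratic (on the vectors with exactly `r` ones, `+∞` coefficients being allowed). -/
def IsQuadratic {n : ℕ} (r : ℕ) (g : Finset (Fin n) → WithTop ℝ) : Prop :=
  ∃ (a : Fin n → Fin n → WithTop ℝ) (u : Fin n → ℝ),
    (∀ i j, a i j = a j i) ∧ ∀ x, g x = quadFun r a u x

/-- M-convexity of a function on `{0,1}^n`. -/
def IsMConvex {n : ℕ} (f : Finset (Fin n) → WithTop ℝ) : Prop :=
  ∀ x y : Finset (Fin n), f x < ⊤ → f y < ⊤ → ∀ i ∈ x \ y, ∃ j ∈ y \ x,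
    f (insert j (x.erase i)) + f (insert i (y.erase j)) ≤ f x + f y

/-- `f` is the sum of two quadratic M-convex functions. -/
def IsQRM2Convex {n : ℕ} (r : ℕ) (f : Finset (Fin n) → WithTop ℝ) : Prop :=
  ∃ f₁ f₂ : Finset (Fin n) → WithTop ℝ,
    IsQuadratic r f₁ ∧ IsMConvex f₁ ∧ IsQuadratic r f₂ ∧ IsMConvex f₂ ∧ ∀ x, f x = f₁ x + f₂ x

/-- `ℓ_X(x) = ∑_{i,j ∈ X, i<j} x_i x_j`. -/
def ell {n : ℕ} (X x : Finset (Fin n)) : ℝ :=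
  ∑ i ∈ X, ∑ j ∈ X with i < j, (if i ∈ x then 1 else 0) * (if j ∈ x then 1 else 0)

/-! ### Cuts, for a family of pairwise disjoint blocks `B p` and a finite set `Q` of indices -/

/-- `X` cuts the block `A`. -/
def Cuts {n : ℕ} (A X : Finset (Fin n)) : Prop := X ∩ A ≠ ∅ ∧ X ∩ A ≠ A

/-- The indices in `Q` of the blocks that are cut by `X`. -/
def cutIdx {n : ℕ} {ι : Type} (B : ι → Finset (Fin n)) (Q : Finset ι) (X : Finset (Fin n)) :
    Finset ι := by
  classical exact Q.filter fun p => Cuts (B p) X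

/-- The cutting support of `X` within the blocks indexed by `Q`: the union of those cut by `X`. -/
def cutSupport {n : ℕ} {ι : Type} (B : ι → Finset (Fin n)) (Q : Finset ι)
    (X : Finset (Fin n)) : Finset (Fin n) :=
  (cutIdx B Q X).biUnion B

/-- `X` is a subset of the union of the blocks indexed by `Q` and cuts at least two of them. -/
def IsCut {n : ℕ} {ι : Type} (B : ι → Finset (Fin n)) (Q : Finset ι) (X : Finset (Fin n)) :
    Prop :=
  X ⊆ Q.biUnion B ∧ ∃ p ∈ Q, ∃ q ∈ Q, p ≠ q ∧ Cuts (B p) X ∧ Cuts (B q) X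

/-- `X ∼_Q Y`: both sets have the same cutting support within `Q` and induce the same
(unordered) bipartition on it. -/
def CutEquiv {n : ℕ} {ι : Type} (B : ι → Finset (Fin n)) (Q : Finset ι)
    (X Y : Finset (Fin n)) : Prop :=
  ({cutSupport B Q X ∩ X, cutSupport B Q X \ X} : Set (Finset (Fin n))) =
    {cutSupport B Q Y ∩ Y, cutSupport B Q Y \ Y}

/-- Laminar family of sets. -/
def IsLaminar {n : ℕ} (F : Finset (Finset (Fin n))) : Prop :=
  ∀ X ∈ F, ∀ Y ∈ F, X ⊆ Y ∨ Y ⊆ X ∨ X ∩ Y = ∅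

/-- A family of sets with a weight on it; only the values of `wt` on `fam` are meaningful. -/
structure WFam (n : ℕ) where
  fam : Finset (Finset (Fin n))
  wt : Finset (Fin n) → ℝ

/-! ### VCSP-quadratic functions -/

/-- The data of a VCSP-quadratic function of type `{A_1, …, A_r}`: the partition of `[n]` into `r`
blocks of at least two elements (`blk i` is the index of the block of `i`), the linear coefficients,
and the quadratic coefficients, which are infinite exactly inside the blocks. -/
structure VCSPQuadratic (n r : ℕ) where
  blk : Fin n → Fin r
  lin : Fin n → ℝ
  quad : Fin n → Fin n → WithTop ℝ
  two_le_card : ∀ p, 2 ≤ (Finset.univ.filter fun i => blk i = p).card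
  quad_symm : ∀ i j, quad i j = quad j i
  quad_eq_top_iff : ∀ i j, quad i j = ⊤ ↔ blk i = blk j

namespace VCSPQuadratic

variable {n r : ℕ} (I : VCSPQuadratic n r)

/-- The block `A_p`. -/
def block (p : Fin r) : Finset (Fin n) := Finset.univ.filter fun i => I.blk i = p

/-- The function `f` itself. -/
def toFun (x : Finset (Fin n)) : WithTop ℝ := quadFun r I.quad I.lin x

/-- `f` is QR-M₂-convex. -/
def IsQRM2 : Prop := IsQRM2Convex r I.toFun

/-- `X` is an `𝒜`-cut. -/
def ACut (X : Finset (Fin n)) : Prop := IsCut I.block Finset.univ X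

/-- `𝒜`-equivalence of sets. -/
def Sim (X Y : Finset (Fin n)) : Prop := CutEquiv I.block Finset.univ X Y

/-- The indicator function `δ_𝒜` of the base family of the partition matroid. -/
def delta (x : Finset (Fin n)) : WithTop ℝ := by
  classical exact if ∀ p, (x ∩ I.block p).card = 1 then 0 else ⊤

/-- `h` is `𝒜`-linear. -/
def ALinear (h : Finset (Fin n) → WithTop ℝ) : Prop :=
  ∃ (u : Fin n → ℝ) (γ : ℝ), ∀ x, h x = I.delta x + (((∑ i ∈ x, u i) + γ : ℝ) : WithTop ℝ)

/-- `𝒜`-linear equivalence `f ≃ g`. -/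
def LinEquiv (f g : Finset (Fin n) → WithTop ℝ) : Prop :=
  ∃ h, I.ALinear h ∧ ∀ x, f x + I.delta x = g x + h x

/-- No two distinct members of `F` are `𝒜`-equivalent. -/
def NonRedundant (F : Finset (Finset (Fin n))) : Prop :=
  ∀ X ∈ F, ∀ Y ∈ F, I.Sim X Y → X = Y

/-- The `𝒜`-cut family `F` is `𝒜`-equivalent to a laminar (`𝒜`-cut) family. -/
def Laminarizable (F : Finset (Finset (Fin n))) : Prop :=
  ∃ G : Finset (Finset (Fin n)), (∀ Y ∈ G, I.ACut Y) ∧ IsLaminar G ∧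
    (∀ X ∈ F, ∃ Y ∈ G, I.Sim X Y) ∧ ∀ Y ∈ G, ∃ X ∈ F, I.Sim X Y

/-- `o` is a correct answer to Decomposition for `f`: `none` is the answer
"`f` is not QR-M₂-convex", and `some W` is the answer consisting of a weighted family. -/
def IsDecompositionAnswer : Option (WFam n) → Prop
  | none => ¬ I.IsQRM2
  | some W =>
      (∀ X ∈ W.fam, I.ACut X) ∧ I.NonRedundant W.fam ∧ (∀ X ∈ W.fam, 0 < W.wt X) ∧
      I.LinEquiv I.toFun (fun x => ((∑ X ∈ W.fam, W.wt X * ell X x : ℝ) : WithTop ℝ)) ∧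
      (I.IsQRM2 → I.Laminarizable W.fam)

end VCSPQuadratic

/-! ### Algorithm 1: two blocks `A₁`, `A₂`, on the ground set `A₁ ∪ A₂`

`a` is the matrix of quadratic coefficients; only its entries on `A₁ ∪ A₂` are used. -/

/-- Step 0: `α* = min_{i ≠ j} a_ij` over the ground set `S`. -/
def minEntry {n : ℕ} (S : Finset (Fin n)) (a : Fin n → Fin n → WithTop ℝ) : ℝ :=
  (((S ×ˢ S).filter fun ij => ij.1 ≠ ij.2).inf fun ij => a ij.1 ij.2).untopD 0

/-- One pass of Step 1: subtract `b_i = min_{j ≠ i} a_ij - α*` from row and column `i`. -/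
def normStep {n : ℕ} (S : Finset (Fin n)) (αs : ℝ) (a : Fin n → Fin n → WithTop ℝ) (i : Fin n) :
    Fin n → Fin n → WithTop ℝ :=
  let b : ℝ := ((S.erase i).inf (a i)).untopD 0 - αs
  fun k l => if (k = i ∧ l ∈ S.erase i) ∨ (l = i ∧ k ∈ S.erase i)
    then a k l + ((-b : ℝ) : WithTop ℝ) else a k l

/-- Steps 0 and 1: the passes for all `i ∈ S` in increasing order. -/
def normalize {n : ℕ} (S : Finset (Fin n)) (a : Fin n → Fin n → WithTop ℝ) :
    Fin n → Fin n → WithTop ℝ :=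
  (S.sort (· ≤ ·)).foldl (normStep S (minEntry S a)) a

/-- The distinct values `α_1 > ⋯ > α_m` of `a_ij`, `i ∈ A₁`, `j ∈ A₂`. -/
def levels {n : ℕ} (A₁ A₂ : Finset (Fin n)) (a : Fin n → Fin n → WithTop ℝ) : Finset ℝ :=
  (A₁ ×ˢ A₂).image fun ij => (a ij.1 ij.2).untopD 0

/-- The smallest level `α_m`. -/
def lowLevel {n : ℕ} (A₁ A₂ : Finset (Fin n)) (a : Fin n → Fin n → WithTop ℝ) : ℝ :=
  (levels A₁ A₂ a).min.untopD 0

/-- The levels `α_1, …, α_{m-1}`. -/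
def upperLevels {n : ℕ} (A₁ A₂ : Finset (Fin n)) (a : Fin n → Fin n → WithTop ℝ) : Finset ℝ :=
  (levels A₁ A₂ a).erase (lowLevel A₁ A₂ a)

/-- The bipartite graph `G_α`. -/
def levelGraph {n : ℕ} (A₁ A₂ : Finset (Fin n)) (a : Fin n → Fin n → WithTop ℝ) (α : ℝ) :
    SimpleGraph (Fin n) :=
  SimpleGraph.fromRel fun i j => i ∈ A₁ ∧ j ∈ A₂ ∧ (α : WithTop ℝ) ≤ a i j

/-- The node sets of the non-isolated connected components of `G_α`. -/
def comps {n : ℕ} (A₁ A₂ : Finset (Fin n)) (a : Fin n → Fin n → WithTop ℝ) (α : ℝ) :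
    Finset (Finset (Fin n)) := by
  classical exact Finset.univ.filter fun L => ∃ i j, (levelGraph A₁ A₂ a α).Adj i j ∧
    ∀ k, k ∈ L ↔ (levelGraph A₁ A₂ a α).Reachable i k

/-- Condition (CB): for each level above the lowest one, every non-isolated connected component is
a complete bipartite graph. -/
def CB {n : ℕ} (A₁ A₂ : Finset (Fin n)) (a : Fin n → Fin n → WithTop ℝ) : Prop :=
  ∀ α ∈ upperLevels A₁ A₂ a, ∀ L ∈ comps A₁ A₂ a α,
    ∀ i ∈ L ∩ A₁, ∀ j ∈ L ∩ A₂, (levelGraph A₁ A₂ a α).Adj i j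

/-- The family `𝓛` of Step 3. -/
def rawFam {n : ℕ} (A₁ A₂ : Finset (Fin n)) (a : Fin n → Fin n → WithTop ℝ) :
    Finset (Finset (Fin n)) :=
  (upperLevels A₁ A₂ a).biUnion (comps A₁ A₂ a)

/-- The value `α_L`: the lowest level for the whole ground set, and otherwise the highest level at
which `L` is a component. -/
def levelOf {n : ℕ} (A₁ A₂ : Finset (Fin n)) (a : Fin n → Fin n → WithTop ℝ)
    (L : Finset (Fin n)) : ℝ :=
  if L = A₁ ∪ A₂ then lowLevel A₁ A₂ a
  else ((upperLevels A₁ A₂ a).filter fun α => L ∈ comps A₁ A₂ a α).max.unbotD 0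

/-- `L⁺`: the least member of `𝓛 ∪ {A₁ ∪ A₂}` that properly contains `L`
(these members form a chain when (CB) holds). -/
def parent {n : ℕ} (A₁ A₂ : Finset (Fin n)) (a : Fin n → Fin n → WithTop ℝ)
    (L : Finset (Fin n)) : Finset (Fin n) :=
  ((insert (A₁ ∪ A₂) (rawFam A₁ A₂ a)).filter fun L' => L ⊂ L').inf id

/-- The weight `c(L) = α_L - α_{L⁺}` of Step 3. -/
def rawWt {n : ℕ} (A₁ A₂ : Finset (Fin n)) (a : Fin n → Fin n → WithTop ℝ)
    (L : Finset (Fin n)) : ℝ :=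
  levelOf A₁ A₂ a L - levelOf A₁ A₂ a (parent A₁ A₂ a L)

/-- Step 4: of each pair of complementary members of `F` one (either one) is removed, and its
weight is added to that of the other. -/
def MergeComplements {n : ℕ} (S : Finset (Fin n)) (F : Finset (Finset (Fin n)))
    (c : Finset (Fin n) → ℝ) (W : WFam n) : Prop :=
  W.fam ⊆ F ∧
  (∀ X ∈ F, (X ∈ W.fam ∧ S \ X ∉ W.fam) ∨ (X ∉ W.fam ∧ S \ X ∈ W.fam)) ∧
  ∀ X ∈ W.fam, W.wt X = c X + if S \ X ∈ F then c (S \ X) else 0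

/-- `Algorithm1 a A₁ A₂ o`: for the function with quadratic coefficients `a` on the two blocks
`A₁`, `A₂`, Algorithm 1 can return `o` (`none` being the answer "not QR-M₂-convex"). -/
def Algorithm1 {n : ℕ} (a : Fin n → Fin n → WithTop ℝ) (A₁ A₂ : Finset (Fin n)) :
    Option (WFam n) → Prop
  | none => ¬ CB A₁ A₂ (normalize (A₁ ∪ A₂) a)
  | some W =>
      CB A₁ A₂ (normalize (A₁ ∪ A₂) a) ∧
      MergeComplements (A₁ ∪ A₂) (rawFam A₁ A₂ (normalize (A₁ ∪ A₂) a))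
        (rawWt A₁ A₂ (normalize (A₁ ∪ A₂) a)) W

/-! ### Algorithm 2: from the blocks `B 0, …, B (t-1)` to the blocks `B 0, …, B t` -/

/-- `Xs` is a composition of `X₀` and the tuple `(X p)`, `p` ranging over the indices `p < t` of the
blocks cut by `X₀`. -/
def IsComposition {n : ℕ} (B : ℕ → Finset (Fin n)) (t : ℕ) (X₀ : Finset (Fin n))
    (X : ℕ → Finset (Fin n)) (Xs : Finset (Fin n)) : Prop :=
  IsCut B (Finset.range (t + 1)) Xs ∧ CutEquiv B (Finset.range t) Xs X₀ ∧
    ∀ p ∈ cutIdx B (Finset.range t) X₀, CutEquiv B {p, t} Xs (X p)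

/-- The tuple `(X p)` is composable to `X₀`. -/
def IsComposable {n : ℕ} (B : ℕ → Finset (Fin n)) (t : ℕ) (X₀ : Finset (Fin n))
    (X : ℕ → Finset (Fin n)) : Prop :=
  (∀ p ∈ cutIdx B (Finset.range t) X₀, IsCut B {p, t} (X p)) ∧ ∃ Xs, IsComposition B t X₀ X Xs

/-- Set the weight of `X` to `w`, adding `X` to the family. -/
def WFam.put {n : ℕ} (W : WFam n) (X : Finset (Fin n)) (w : ℝ) : WFam n where
  fam := insert X W.fam
  wt := Function.update W.wt X w

/-- Decrease the weight of `X` by `w`, and remove `X` if its new weight is `0`. -/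
def WFam.dec {n : ℕ} (W : WFam n) (X : Finset (Fin n)) (w : ℝ) : WFam n where
  fam := if W.wt X - w = 0 then W.fam.erase X else W.fam
  wt := Function.update W.wt X (W.wt X - w)

/-- The variables of Step 2: the remaining input family `(𝓕', c')`, the families
`(𝓛_{pt}, c_{pt})` for `p < t`, and the family `(𝓕, c)` under construction. -/
structure Alg2State (n : ℕ) where
  old : WFam n
  pairs : ℕ → WFam n
  new : WFam n

/-- `X₀` may be selected in an iteration of Step 2: it is a member of the remaining input family
with maximal cutting support. -/
def Selectable {n : ℕ} (B : ℕ → Finset (Fin n)) (t : ℕ) (s : Alg2State n)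
    (X₀ : Finset (Fin n)) : Prop :=
  X₀ ∈ s.old.fam ∧
    ∀ Y ∈ s.old.fam, ¬ cutSupport B (Finset.range t) X₀ ⊂ cutSupport B (Finset.range t) Y

/-- `(X p)` is a composable tuple to `X₀` whose members are taken from the current `𝓛_{pt}`. -/
def Available {n : ℕ} (B : ℕ → Finset (Fin n)) (t : ℕ) (s : Alg2State n) (X₀ : Finset (Fin n))
    (X : ℕ → Finset (Fin n)) : Prop :=
  IsComposable B t X₀ X ∧ ∀ p ∈ cutIdx B (Finset.range t) X₀, X p ∈ (s.pairs p).fam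

/-- One iteration of the loop of Step 2. -/
inductive Alg2Step {n : ℕ} (B : ℕ → Finset (Fin n)) (t : ℕ) : Alg2State n → Alg2State n → Prop
  | compose (s : Alg2State n) (X₀ : Finset (Fin n)) (X : ℕ → Finset (Fin n))
      (Xs : Finset (Fin n)) (w : ℝ)
      (hX₀ : Selectable B t s X₀) (hX : Available B t s X₀ X) (hXs : IsComposition B t X₀ X Xs)
      (hw : IsLeast (insert (s.old.wt X₀)
        {y | ∃ p ∈ cutIdx B (Finset.range t) X₀, y = (s.pairs p).wt (X p)}) w) :
      Alg2Step B t s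
        { old := s.old.dec X₀ w
          pairs := fun p => if p ∈ cutIdx B (Finset.range t) X₀ then (s.pairs p).dec (X p) w
            else s.pairs p
          new := s.new.put Xs w }
  | keep (s : Alg2State n) (X₀ : Finset (Fin n))
      (hX₀ : Selectable B t s X₀) (hX : ¬ ∃ X, Available B t s X₀ X) :
      Alg2Step B t s
        { old := { fam := s.old.fam.erase X₀, wt := s.old.wt }
          pairs := s.pairs
          new := s.new.put X₀ (s.old.wt X₀) }

/-- Step 3, first half: `W` is the family under construction together with what remains of the
families `𝓛_{pt}`. -/
def Collect {n : ℕ} (t : ℕ) (s : Alg2State n) (W : WFam n) : Prop :=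
  W.fam = s.new.fam ∪ (Finset.range t).biUnion (fun p => (s.pairs p).fam) ∧
  (∀ p < t, ∀ X ∈ (s.pairs p).fam, W.wt X = (s.pairs p).wt X) ∧
  ∀ X ∈ s.new.fam, (∀ p < t, X ∉ (s.pairs p).fam) → W.wt X = s.new.wt X

/-- `Algorithm2 a B t W' o`: Algorithm 2 can return `o` when it extends the weighted family `W'`
from the blocks `B 0, …, B (t-1)` to the blocks `B 0, …, B t`. -/
inductive Algorithm2 {n : ℕ} (a : Fin n → Fin n → WithTop ℝ) (B : ℕ → Finset (Fin n)) (t : ℕ)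
    (W' : WFam n) : Option (WFam n) → Prop
  | failPair (p : ℕ) (hp : p < t) (h : Algorithm1 a (B p) (B t) none) : Algorithm2 a B t W' none
  | tooLarge (L : ℕ → WFam n) (s : Alg2State n) (W : WFam n)
      (hL : ∀ p < t, Algorithm1 a (B p) (B t) (some (L p)))
      (hrun : Relation.ReflTransGen (Alg2Step B t)
        { old := W', pairs := L, new := { fam := ∅, wt := fun _ => 0 } } s)
      (hend : s.old.fam = ∅) (hW : Collect t s W)
      (hcard : 2 * ((Finset.range (t + 1)).biUnion B).card < W.fam.card) :
      Algorithm2 a B t W' none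
  | done (L : ℕ → WFam n) (s : Alg2State n) (W : WFam n)
      (hL : ∀ p < t, Algorithm1 a (B p) (B t) (some (L p)))
      (hrun : Relation.ReflTransGen (Alg2Step B t)
        { old := W', pairs := L, new := { fam := ∅, wt := fun _ => 0 } } s)
      (hend : s.old.fam = ∅) (hW : Collect t s W)
      (hcard : W.fam.card ≤ 2 * ((Finset.range (t + 1)).biUnion B).card) :
      Algorithm2 a B t W' (some W)

/-! ### Algorithm 3 -/

/-- `Alg3Run a B t o`: after the first `t` blocks have been treated, the outcome can be `o`. -/
inductive Alg3Run {n : ℕ} (a : Fin n → Fin n → WithTop ℝ) (B : ℕ → Finset (Fin n)) :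
    ℕ → Option (WFam n) → Prop
  | init (o : Option (WFam n)) (h : Algorithm1 a (B 0) (B 1) o) : Alg3Run a B 2 o
  | stopped (t : ℕ) (h : Alg3Run a B t none) : Alg3Run a B (t + 1) none
  | extend (t : ℕ) (W : WFam n) (o : Option (WFam n)) (h : Alg3Run a B t (some W))
      (h' : Algorithm2 a B t W o) : Alg3Run a B (t + 1) o

/-- The blocks after renaming by `σ`, numbered from `0`. -/
def VCSPQuadratic.renamed {n r : ℕ} (I : VCSPQuadratic n r) (σ : Equiv.Perm (Fin r)) (s : ℕ) :
    Finset (Fin n) :=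
  if h : s < r then I.block (σ ⟨s, h⟩) else ∅

/-- `I.Algorithm3 o`: on the input `I`, Algorithm 3 can return `o`. -/
def VCSPQuadratic.Algorithm3 {n r : ℕ} (I : VCSPQuadratic n r) (o : Option (WFam n)) : Prop :=
  ∃ σ : Equiv.Perm (Fin r), (Antitone fun s => (I.block (σ s)).card) ∧
    Alg3Run I.quad (I.renamed σ) r o

/-! ### Cost model: a real RAM

Programs of a small imperative language with natural-number variables, real variables, and
two-dimensional arrays of both kinds, all addressed by numerals. Naturals can be added, subtracted
(truncated) and compared, reals can be added, subtracted and compared, and there are no other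
arithmetic operations. Each operation and each test costs one time unit. -/

/-- The memory. -/
structure Store where
  nvar : ℕ → ℕ
  rvar : ℕ → ℝ
  narr : ℕ → ℕ → ℕ → ℕ
  rarr : ℕ → ℕ → ℕ → ℝ

/-- Natural-number expressions. -/
inductive NExp
  | lit (c : ℕ)
  | var (x : ℕ)
  | get (A : ℕ) (i j : NExp)
  | add (e₁ e₂ : NExp)
  | sub (e₁ e₂ : NExp)

/-- Real expressions. -/
inductive RExp
  | zero
  | var (x : ℕ)
  | get (A : ℕ) (i j : NExp)
  | add (e₁ e₂ : RExp)
  | sub (e₁ e₂ : RExp)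

/-- Tests. -/
inductive Test
  | nlt (e₁ e₂ : NExp)
  | neq (e₁ e₂ : NExp)
  | rlt (e₁ e₂ : RExp)
  | not (b : Test)
  | and (b₁ b₂ : Test)

/-- Programs. -/
inductive Prog
  | skip
  | nset (x : ℕ) (e : NExp)
  | rset (x : ℕ) (e : RExp)
  | nput (A : ℕ) (i j e : NExp)
  | rput (A : ℕ) (i j : NExp) (e : RExp)
  | seq (P Q : Prog)
  | ite (b : Test) (P Q : Prog)
  | loop (b : Test) (P : Prog)

/-- Value of a natural-number expression. -/
def NExp.eval (m : Store) : NExp → ℕ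
  | .lit c => c
  | .var x => m.nvar x
  | .get A i j => m.narr A (i.eval m) (j.eval m)
  | .add e₁ e₂ => e₁.eval m + e₂.eval m
  | .sub e₁ e₂ => e₁.eval m - e₂.eval m

/-- Number of operations in the evaluation of a natural-number expression. -/
def NExp.cost : NExp → ℕ
  | .lit _ => 1
  | .var _ => 1
  | .get _ i j => i.cost + j.cost + 1
  | .add e₁ e₂ => e₁.cost + e₂.cost + 1
  | .sub e₁ e₂ => e₁.cost + e₂.cost + 1

/-- Value of a real expression. -/
def RExp.eval (m : Store) : RExp → ℝ
  | .zero => 0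
  | .var x => m.rvar x
  | .get A i j => m.rarr A (i.eval m) (j.eval m)
  | .add e₁ e₂ => e₁.eval m + e₂.eval m
  | .sub e₁ e₂ => e₁.eval m - e₂.eval m

/-- Number of operations in the evaluation of a real expression. -/
def RExp.cost : RExp → ℕ
  | .zero => 1
  | .var _ => 1
  | .get _ i j => i.cost + j.cost + 1
  | .add e₁ e₂ => e₁.cost + e₂.cost + 1
  | .sub e₁ e₂ => e₁.cost + e₂.cost + 1

/-- Truth of a test (`neq` tests whether two naturals are equal). -/
def Test.holds (m : Store) : Test → Prop
  | .nlt e₁ e₂ => e₁.eval m < e₂.eval m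
  | .neq e₁ e₂ => e₁.eval m = e₂.eval m
  | .rlt e₁ e₂ => e₁.eval m < e₂.eval m
  | .not b => ¬ b.holds m
  | .and b₁ b₂ => b₁.holds m ∧ b₂.holds m

/-- Number of operations in the evaluation of a test. -/
def Test.cost : Test → ℕ
  | .nlt e₁ e₂ => e₁.cost + e₂.cost + 1
  | .neq e₁ e₂ => e₁.cost + e₂.cost + 1
  | .rlt e₁ e₂ => e₁.cost + e₂.cost + 1
  | .not b => b.cost + 1
  | .and b₁ b₂ => b₁.cost + b₂.cost + 1

/-- Overwrite one cell of an array of arrays. -/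
def putCell {α : Type} (M : ℕ → ℕ → ℕ → α) (A i j : ℕ) (v : α) : ℕ → ℕ → ℕ → α :=
  fun A' i' j' => if A' = A ∧ i' = i ∧ j' = j then v else M A' i' j'

/-- `Exec P m m' T`: started in the memory `m`, the program `P` halts in the memory `m'` after
exactly `T` time units. -/
inductive Exec : Prog → Store → Store → ℕ → Prop
  | skip (m : Store) : Exec .skip m m 1
  | nset (x : ℕ) (e : NExp) (m : Store) :
      Exec (.nset x e) m { m with nvar := Function.update m.nvar x (e.eval m) } (e.cost + 1)
  | rset (x : ℕ) (e : RExp) (m : Store) :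
      Exec (.rset x e) m { m with rvar := Function.update m.rvar x (e.eval m) } (e.cost + 1)
  | nput (A : ℕ) (i j e : NExp) (m : Store) :
      Exec (.nput A i j e) m
        { m with narr := putCell m.narr A (i.eval m) (j.eval m) (e.eval m) }
        (i.cost + j.cost + e.cost + 1)
  | rput (A : ℕ) (i j : NExp) (e : RExp) (m : Store) :
      Exec (.rput A i j e) m
        { m with rarr := putCell m.rarr A (i.eval m) (j.eval m) (e.eval m) }
        (i.cost + j.cost + e.cost + 1)
  | seq (P Q : Prog) (m m₁ m₂ : Store) (T₁ T₂ : ℕ) (h₁ : Exec P m m₁ T₁) (h₂ : Exec Q m₁ m₂ T₂) :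
      Exec (.seq P Q) m m₂ (T₁ + T₂)
  | iteTrue (b : Test) (P Q : Prog) (m m' : Store) (T : ℕ) (hb : b.holds m) (h : Exec P m m' T) :
      Exec (.ite b P Q) m m' (b.cost + T)
  | iteFalse (b : Test) (P Q : Prog) (m m' : Store) (T : ℕ) (hb : ¬ b.holds m)
      (h : Exec Q m m' T) : Exec (.ite b P Q) m m' (b.cost + T)
  | loopTrue (b : Test) (P : Prog) (m m₁ m₂ : Store) (T₁ T₂ : ℕ) (hb : b.holds m)
      (h₁ : Exec P m m₁ T₁) (h₂ : Exec (.loop b P) m₁ m₂ T₂) :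
      Exec (.loop b P) m m₂ (b.cost + T₁ + T₂)
  | loopFalse (b : Test) (P : Prog) (m : Store) (hb : ¬ b.holds m) :
      Exec (.loop b P) m m b.cost

/-- The initial memory for the input `I`: `n` and `r` are in the natural variables `0` and `1`, the
block indices in row `0` of the natural array `0`, the linear coefficients in row `0` of the real
array `0`, the finite quadratic coefficients in the real array `1`; everything else is `0`. -/
def VCSPQuadratic.encode {n r : ℕ} (I : VCSPQuadratic n r) : Store where
  nvar := fun x => if x = 0 then n else if x = 1 then r else 0
  rvar := fun _ => 0
  narr := fun A i j => if h : j < n then (if A = 0 ∧ i = 0 then (I.blk ⟨j, h⟩ : ℕ) else 0) else 0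
  rarr := fun A i j =>
    if hj : j < n then
      if A = 0 ∧ i = 0 then I.lin ⟨j, hj⟩
      else if hi : i < n then
        if A = 1 then (I.quad ⟨i, hi⟩ ⟨j, hj⟩).untopD 0 else 0
      else 0
    else 0

/-- The subset of `[n]` whose 0-1 indicator vector is row `s` of the natural array `1`. -/
def rowSet (n : ℕ) (m : Store) (s : ℕ) : Finset (Fin n) :=
  Finset.univ.filter fun i => m.narr 1 s i = 1

/-- The final memory `m` represents the answer `o`. The natural variable `0` is `0` for the answer
"not QR-M₂-convex" and `1` otherwise. In the second case the natural variable `1` holds the number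
of members of the family, which are listed without repetition in the rows of the natural array `1`
as 0-1 vectors, and row `0` of the real array `2` holds their weights. -/
def Represents {n : ℕ} (m : Store) : Option (WFam n) → Prop
  | none => m.nvar 0 = 0
  | some W =>
      m.nvar 0 = 1 ∧
      (∀ s < m.nvar 1, ∀ i < n, m.narr 1 s i = 0 ∨ m.narr 1 s i = 1) ∧
      Set.InjOn (rowSet n m) {s | s < m.nvar 1} ∧
      W.fam = (Finset.range (m.nvar 1)).image (rowSet n m) ∧
      ∀ s < m.nvar 1, W.wt (rowSet n m s) = m.rarr 2 0 s

end QRM2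

end

namespace QRM2

open Finset Function

section Basics

variable {n : ℕ} {ι : Type}
variable {A : Finset (Fin n)} {B : ι → Finset (Fin n)} {Q : Finset ι} {W : WFam n}
variable {X Y Z : Finset (Fin n)} {i j k l : Fin n} {p : ι} {w : ℝ}

theorem cuts_iff : Cuts A X ↔ (∃ i ∈ A, i ∈ X) ∧ ∃ i ∈ A, i ∉ X := by
  unfold Cuts
  constructor
  · grind
  · rintro ⟨⟨i, hi, hi'⟩, j, hj, hj'⟩
    refine ⟨nonempty_iff_ne_empty.mp ⟨i, by simp [hi, hi']⟩, fun h => hj' ?_⟩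
    grind

theorem mem_iff_of_not_cuts (h : ¬ Cuts A X) (hi : i ∈ A)
    (hk : k ∈ A) : i ∈ X ↔ k ∈ X := by
  rw [cuts_iff] at h
  grind

theorem mem_cutIdx :
    p ∈ cutIdx B Q X ↔ p ∈ Q ∧ Cuts (B p) X := by
  classical
  simp [cutIdx]

theorem mem_cutSupport :
    i ∈ cutSupport B Q X ↔ ∃ p ∈ Q, Cuts (B p) X ∧ i ∈ B p := by
  classical
  simp [cutSupport, mem_cutIdx, and_assoc]

/-- Coordinate form of the equivalence of cuts. -/
theorem cutEquiv_iff
    (hB : ∀ p ∈ Q, ∀ q ∈ Q, ∀ i, i ∈ B p → i ∈ B q → p = q) :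
    CutEquiv B Q X Y ↔ (∀ p ∈ Q, Cuts (B p) X ↔ Cuts (B p) Y) ∧
      ∃ ε : Prop, ∀ p ∈ Q, Cuts (B p) X → ∀ i ∈ B p, (i ∈ X ↔ (i ∈ Y ↔ ε)) := by
  classical
  unfold CutEquiv
  rw [Set.pair_eq_pair_iff]
  constructor
  · intro h
    have hS : ∀ i, i ∈ cutSupport B Q X ↔ i ∈ cutSupport B Q Y := by
      intro i
      rcases h with ⟨h1, h2⟩ | ⟨h1, h2⟩ <;>
      · have e1 := Finset.ext_iff.mp h1 i
        have e2 := Finset.ext_iff.mp h2 i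
        grind
    have hcut : ∀ p ∈ Q, Cuts (B p) X ↔ Cuts (B p) Y := by
      intro p hp
      constructor
      · intro hc
        obtain ⟨i, hi, -⟩ := (cuts_iff.mp hc).1
        obtain ⟨q, hq, hq', hiq⟩ := mem_cutSupport.mp ((hS i).mp (mem_cutSupport.mpr ⟨p, hp, hc, hi⟩))
        grind
      · intro hc
        obtain ⟨i, hi, -⟩ := (cuts_iff.mp hc).1
        obtain ⟨q, hq, hq', hiq⟩ := mem_cutSupport.mp ((hS i).mpr (mem_cutSupport.mpr ⟨p, hp, hc, hi⟩))
        grind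
    refine ⟨hcut, ?_⟩
    rcases h with ⟨h1, h2⟩ | ⟨h1, h2⟩
    · refine ⟨True, fun p hp hc i hi => ?_⟩
      have e1 := Finset.ext_iff.mp h1 i
      have hX := mem_cutSupport.mpr ⟨p, hp, hc, hi⟩
      grind
    · refine ⟨False, fun p hp hc i hi => ?_⟩
      have e1 := Finset.ext_iff.mp h1 i
      have hX := mem_cutSupport.mpr ⟨p, hp, hc, hi⟩
      grind
  · rintro ⟨hc, ε, he⟩
    have hS : cutSupport B Q X = cutSupport B Q Y := by
      ext i
      simp only [mem_cutSupport]
      grind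
    have he' : ∀ i ∈ cutSupport B Q Y, (i ∈ X ↔ (i ∈ Y ↔ ε)) := by
      intro i hi
      rw [← hS] at hi
      obtain ⟨p, hp, hp', hi⟩ := mem_cutSupport.mp hi
      grind
    grind

theorem CutEquiv.refl (B : ι → Finset (Fin n)) (Q : Finset ι) (X : Finset (Fin n)) :
    CutEquiv B Q X X := rfl

theorem CutEquiv.symm
    (h : CutEquiv B Q X Y) : CutEquiv B Q Y X := Eq.symm h

theorem CutEquiv.trans
    (h : CutEquiv B Q X Y) (h' : CutEquiv B Q Y Z) : CutEquiv B Q X Z := Eq.trans h h'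

theorem CutEquiv.mono {Q' : Finset ι}
    (hB : ∀ p ∈ Q, ∀ q ∈ Q, ∀ i, i ∈ B p → i ∈ B q → p = q) (hQ : Q' ⊆ Q) (h : CutEquiv B Q X Y) : CutEquiv B Q' X Y := by
  rw [cutEquiv_iff hB] at h
  rw [cutEquiv_iff fun p hp q hq => hB p (hQ hp) q (hQ hq)]
  obtain ⟨h1, ε, h2⟩ := h
  exact ⟨fun p hp => h1 p (hQ hp), ε, fun p hp => h2 p (hQ hp)⟩

theorem CutEquiv.cuts_iff
    (hB : ∀ p ∈ Q, ∀ q ∈ Q, ∀ i, i ∈ B p → i ∈ B q → p = q) (h : CutEquiv B Q X Y) (hp : p ∈ Q) :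
    Cuts (B p) X ↔ Cuts (B p) Y :=
  ((cutEquiv_iff hB).mp h).1 p hp

/-- Two sets that agree on the blocks indexed by `Q` are equivalent. -/
theorem cutEquiv_of_agree
    (hB : ∀ p ∈ Q, ∀ q ∈ Q, ∀ i, i ∈ B p → i ∈ B q → p = q) (h : ∀ p ∈ Q, ∀ i ∈ B p, (i ∈ X ↔ i ∈ Y)) : CutEquiv B Q X Y := by
  rw [cutEquiv_iff hB]
  refine ⟨fun p hp => ?_, True, fun p hp _ i hi => by grind⟩
  rw [QRM2.cuts_iff, QRM2.cuts_iff]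
  grind

/-- The indicator of a set. -/
def ind (X : Finset (Fin n)) (i : Fin n) : ℝ := if i ∈ X then 1 else 0

/-- The second difference of the product of two indicators. -/
def chi (X : Finset (Fin n)) (i j k l : Fin n) : ℝ := (ind X i - ind X k) * (ind X j - ind X l)

/-- The second difference of a matrix. -/
def quadDiff (e : Fin n → Fin n → ℝ) (i j k l : Fin n) : ℝ := e i j + e k l - e i l - e k j

theorem ind_eq_of_not_cuts (h : ¬ Cuts A X) (hi : i ∈ A)
    (hk : k ∈ A) : ind X i = ind X k := by
  simp [ind, mem_iff_of_not_cuts h hi hk]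

theorem chi_eq_zero_left (h : ¬ Cuts A X) (hi : i ∈ A)
    (hk : k ∈ A) (j l : Fin n) : chi X i j k l = 0 := by
  simp [chi, ind_eq_of_not_cuts h hi hk]

theorem chi_eq_zero_right (h : ¬ Cuts A X) (hj : j ∈ A)
    (hl : l ∈ A) (i k : Fin n) : chi X i j k l = 0 := by
  simp [chi, ind_eq_of_not_cuts h hj hl]

theorem chi_congr
    (hB : ∀ p ∈ Q, ∀ q ∈ Q, ∀ i, i ∈ B p → i ∈ B q → p = q)
    (h : CutEquiv B Q X Y) {q : ι} (hp : p ∈ Q) (hq : q ∈ Q)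
    (hi : i ∈ B p) (hk : k ∈ B p) (hj : j ∈ B q) (hl : l ∈ B q) :
    chi X i j k l = chi Y i j k l := by
  obtain ⟨h1, ε, h2⟩ := (cutEquiv_iff hB).mp h
  by_cases hcp : Cuts (B p) X
  swap
  · rw [chi_eq_zero_left hcp hi hk, chi_eq_zero_left (fun h => hcp ((h1 p hp).mpr h)) hi hk]
  by_cases hcq : Cuts (B q) X
  swap
  · rw [chi_eq_zero_right hcq hj hl, chi_eq_zero_right (fun h => hcq ((h1 q hq).mpr h)) hj hl]
  have ei := h2 p hp hcp i hi
  have ek := h2 p hp hcp k hk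
  have ej := h2 q hq hcq j hj
  have el := h2 q hq hcq l hl
  unfold chi ind
  grind

/-- The total weight of a function over a weighted family. -/
def WFam.sum (W : WFam n) (φ : Finset (Fin n) → ℝ) : ℝ := ∑ X ∈ W.fam, W.wt X * φ X

theorem WFam.sum_dec (W : WFam n) (hX : X ∈ W.fam) (w : ℝ)
    (φ : Finset (Fin n) → ℝ) : (W.dec X w).sum φ = W.sum φ - w * φ X := by
  classical
  have h1 : (W.dec X w).sum φ = ∑ Y ∈ W.fam, (W.dec X w).wt Y * φ Y := by
    unfold WFam.sum WFam.dec
    simp only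
    split_ifs with h
    · rw [← sum_erase_add _ _ hX]
      simp [h]
    · rfl
  rw [h1, WFam.sum, ← sum_erase_add _ _ hX, ← sum_erase_add W.fam _ hX]
  have : ∑ Y ∈ W.fam.erase X, (W.dec X w).wt Y * φ Y = ∑ Y ∈ W.fam.erase X, W.wt Y * φ Y := by
    refine sum_congr rfl fun Y hY => ?_
    simp [WFam.dec, update_of_ne (ne_of_mem_erase hY)]
  rw [this]
  simp [WFam.dec]
  ring

theorem WFam.sum_put (W : WFam n) (hX : X ∉ W.fam) (w : ℝ)
    (φ : Finset (Fin n) → ℝ) : (W.put X w).sum φ = W.sum φ + w * φ X := by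
  classical
  unfold WFam.sum WFam.put
  simp only
  rw [sum_insert hX, add_comm]
  congr 1
  · refine sum_congr rfl fun Y hY => ?_
    grind
  · simp

theorem WFam.sum_erase (W : WFam n) (hX : X ∈ W.fam)
    (φ : Finset (Fin n) → ℝ) :
    WFam.sum ⟨W.fam.erase X, W.wt⟩ φ = W.sum φ - W.wt X * φ X := by
  classical
  unfold WFam.sum
  simp only
  rw [← sum_erase_add W.fam _ hX]
  ring

theorem WFam.mem_dec (h : Y ∈ (W.dec X w).fam) :
    Y ∈ W.fam := by
  unfold WFam.dec at h
  grind

theorem WFam.card_dec_le (W : WFam n) (X : Finset (Fin n)) (w : ℝ) :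
    (W.dec X w).fam.card ≤ W.fam.card :=
  card_le_card fun _ h => WFam.mem_dec h

theorem WFam.card_dec_lt (hX : X ∈ W.fam) :
    (W.dec X (W.wt X)).fam.card < W.fam.card := by
  simp [WFam.dec, card_erase_lt_of_mem hX]

theorem WFam.dec_pos (hW : ∀ X ∈ W.fam, 0 < W.wt X)
    (hw : w ≤ W.wt X) : ∀ Y ∈ (W.dec X w).fam, 0 < (W.dec X w).wt Y := by
  intro Y hY
  have hY' := WFam.mem_dec hY
  by_cases hYX : Y = X
  · subst hYX
    unfold WFam.dec at hY ⊢
    grind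
  · simp [WFam.dec, update_of_ne hYX, hW Y hY']

/-! ### Termination of the loop of Algorithm 2 -/

/-- The number of sets that are still present. -/
def Alg2State.measure (t : ℕ) (s : Alg2State n) : ℕ :=
  s.old.fam.card + ∑ p ∈ range t, (s.pairs p).fam.card

theorem Alg2Step.measure_lt {B : ℕ → Finset (Fin n)} {t : ℕ} {s s' : Alg2State n}
    (h : Alg2Step B t s s') : s'.measure t < s.measure t := by
  cases h with
  | keep X0 hX0 hX =>
    unfold Alg2State.measure
    simp only
    have := card_erase_lt_of_mem hX0.1
    omega
  | compose X0 X Xs w hX0 hX hXs hw =>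
    unfold Alg2State.measure
    simp only
    have hle : ∀ p ∈ range t, (if p ∈ cutIdx B (range t) X0 then (s.pairs p).dec (X p) w
        else s.pairs p).fam.card ≤ (s.pairs p).fam.card := by
      intro p _
      split_ifs
      · exact WFam.card_dec_le _ _ _
      · exact le_rfl
    rcases hw.1 with h | ⟨p, hp, h⟩
    · subst h
      have h1 := WFam.card_dec_lt hX0.1
      have h2 := sum_le_sum hle
      omega
    · have h1 := WFam.card_dec_le s.old X0 w
      have h2 := sum_lt_sum hle ⟨p, (mem_cutIdx.mp hp).1, by
        rw [if_pos hp, h]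
        exact WFam.card_dec_lt (hX.2 p hp)⟩
      omega

theorem wellFounded_alg2Step (B : ℕ → Finset (Fin n)) (t : ℕ) :
    WellFounded fun s' s : Alg2State n => Alg2Step B t s s' :=
  Subrelation.wf (fun h => Alg2Step.measure_lt h)
    (InvImage.wf (Alg2State.measure t) (measure id).wf)

end Basics

section Normalization

variable {n : ℕ}
variable {A1 A2 : Finset (Fin n)} {P : Fin n → Prop} {S : Finset (Fin n)}
variable {a : Fin n → Fin n → WithTop ℝ} {i : Fin n} {w : Fin n → ℝ} {αs : ℝ}

/-- The matrix of a two-block function: infinite exactly inside the blocks. -/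
structure TwoBlock (a : Fin n → Fin n → WithTop ℝ) (A1 A2 : Finset (Fin n)) : Prop where
  disj : ∀ i ∈ A1, i ∉ A2
  ne1 : A1.Nonempty
  ne2 : A2.Nonempty
  symm : ∀ i j, a i j = a j i
  top1 : ∀ i ∈ A1, ∀ j ∈ A1, a i j = ⊤
  top2 : ∀ i ∈ A2, ∀ j ∈ A2, a i j = ⊤
  fin : ∀ i ∈ A1, ∀ j ∈ A2, a i j ≠ ⊤

theorem TwoBlock.swap (h : TwoBlock a A1 A2) : TwoBlock a A2 A1 :=
  ⟨fun i hi hi' => h.disj i hi' hi, h.ne2, h.ne1, h.symm, h.top2, h.top1,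
    fun i hi j hj => h.symm j i ▸ h.fin j hj i hi⟩

/-- The finite part of a matrix. -/
def realPart (a : Fin n → Fin n → WithTop ℝ) (i j : Fin n) : ℝ := (a i j).untopD 0

theorem realPart_symm (h : TwoBlock a A1 A2) (i j : Fin n) : realPart a i j = realPart a j i := by
  simp [realPart, h.symm i j]

theorem TwoBlock.coe_realPart (h : TwoBlock a A1 A2) {j : Fin n} (hi : i ∈ A1) (hj : j ∈ A2) :
    ((realPart a i j : ℝ) : WithTop ℝ) = a i j := by
  unfold realPart
  obtain ⟨x, hx⟩ := WithTop.ne_top_iff_exists.mp (h.fin i hi j hj)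
  rw [← hx]
  rfl

theorem exists_inf_eq_coe {α : Type*} {T : Finset α} {g : α → WithTop ℝ} (h : ∃ x ∈ T, g x ≠ ⊤) :
    ∃ m : ℝ, T.inf g = m ∧ (∃ x ∈ T, g x = m) ∧ ∀ x ∈ T, (m : WithTop ℝ) ≤ g x := by
  obtain ⟨x, hx, hx'⟩ := h
  obtain ⟨y, hy, hy'⟩ := exists_mem_eq_inf T ⟨x, hx⟩ g
  have hle : ∀ z ∈ T, T.inf g ≤ g z := fun z hz => inf_le hz
  have hne : T.inf g ≠ ⊤ := fun h => hx' (top_le_iff.mp (h ▸ hle x hx))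
  obtain ⟨m, hm⟩ := WithTop.ne_top_iff_exists.mp hne
  grind

/-- One pass of the normalization, in terms of the subtracted potentials. -/
def potStep (S : Finset (Fin n)) (αs : ℝ) (a : Fin n → Fin n → WithTop ℝ) (w : Fin n → ℝ)
    (i : Fin n) : Fin n → ℝ :=
  update w i
    (((S.erase i).inf fun l => a i l + ((-(w l) : ℝ) : WithTop ℝ)).untopD 0 - αs)

/-- The matrix after subtraction of potentials. -/
def subPot (S : Finset (Fin n)) (a : Fin n → Fin n → WithTop ℝ) (w : Fin n → ℝ) (k l : Fin n) :
    WithTop ℝ :=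
  if k ∈ S ∧ l ∈ S ∧ k ≠ l then a k l + ((-(w k + w l) : ℝ) : WithTop ℝ) else a k l

theorem normStep_subPot (hi : i ∈ S) (hw : w i = 0) :
    normStep S αs (subPot S a w) i = subPot S a (potStep S αs a w i) := by
  have h1 : (S.erase i).inf (subPot S a w i) =
      (S.erase i).inf fun l => a i l + ((-(w l) : ℝ) : WithTop ℝ) := by
    refine inf_congr rfl fun l hl => ?_
    obtain ⟨h1, h2⟩ := mem_erase.mp hl
    simp [subPot, hi, h1.symm, h2, hw]
  funext k l
  unfold normStep
  simp only [h1]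
  set b := (((S.erase i).inf fun l => a i l + ((-(w l) : ℝ) : WithTop ℝ)).untopD 0 - αs) with hb
  have hp : potStep S αs a w i = update w i b := rfl
  rw [hp]
  by_cases hkl : k ∈ S ∧ l ∈ S ∧ k ≠ l
  · obtain ⟨hk, hl, hne⟩ := hkl
    simp only [subPot, hk, hl, true_and, mem_erase, and_true, update_apply]
    by_cases h2 : k = i
    · subst h2
      simp only [hne, Ne, not_false_eq_true, if_true, true_and, hne.symm, true_or, if_false, hw,
        zero_add]
      rw [add_assoc, ← WithTop.coe_add]
      congr 2
      ring
    · by_cases h3 : l = i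
      · subst h3
        simp only [hne, Ne, not_false_eq_true, if_true, true_and, or_true, if_false, hw]
        rw [add_assoc, ← WithTop.coe_add]
        congr 2
        ring
      grind
  · have h2 : ¬ ((k = i ∧ l ∈ S.erase i) ∨ (l = i ∧ k ∈ S.erase i)) := by grind
    rw [if_neg h2]
    simp only [subPot, hkl, if_false]

theorem foldl_normStep (L : List (Fin n)) (hL : L.Nodup) (hS : ∀ i ∈ L, i ∈ S) (w : Fin n → ℝ)
    (hw : ∀ i ∈ L, w i = 0) :
    L.foldl (normStep S αs) (subPot S a w) = subPot S a (L.foldl (potStep S αs a) w) := by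
  induction L generalizing w with
  | nil => rfl
  | cons i L ih =>
    rw [List.foldl_cons, List.foldl_cons, normStep_subPot (hS i (by simp)) (hw i (by simp))]
    refine ih (List.nodup_cons.mp hL).2 (fun j hj => hS j (by simp [hj])) _ fun j hj => ?_
    rw [potStep, update_of_ne]
    · grind
    grind

/-- The potentials found by the normalization. -/
def potentials (S : Finset (Fin n)) (a : Fin n → Fin n → WithTop ℝ) : Fin n → ℝ :=
  (S.sort (· ≤ ·)).foldl (potStep S (minEntry S a) a) fun _ => 0

theorem normalize_eq_subPot (S : Finset (Fin n)) (a : Fin n → Fin n → WithTop ℝ) :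
    normalize S a = subPot S a (potentials S a) := by
  have h := foldl_normStep (S := S) (αs := minEntry S a) (a := a) (S.sort (· ≤ ·))
    (sort_nodup S _) (fun i hi => (mem_sort _).mp hi) (fun _ => 0) fun _ _ => rfl
  rw [← potentials] at h
  rw [← h]
  unfold normalize
  congr 1
  funext k l
  simp [subPot]

/-- The invariant of the normalization: `P` holds for the rows treated so far. -/
structure PotInv (q : Fin n → Fin n → ℝ) (A1 A2 : Finset (Fin n)) (αs : ℝ) (w : Fin n → ℝ)
    (P : Fin n → Prop) : Prop where
  le : ∀ i ∈ A1, ∀ j ∈ A2, αs ≤ q i j - w i - w j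
  row : ∀ i ∈ A1, P i → ∃ j ∈ A2, q i j - w i - w j = αs
  col : ∀ j ∈ A2, P j → ∃ i ∈ A1, q i j - w i - w j = αs
  zero : ∀ i, ¬ P i → w i = 0

theorem PotInv.swap {q : Fin n → Fin n → ℝ} (hq : ∀ i j, q i j = q j i)
    (h : PotInv q A1 A2 αs w P) : PotInv q A2 A1 αs w P := by
  obtain ⟨h1, h2, h3, h4⟩ := h
  exact ⟨by grind, by grind, by grind, h4⟩

theorem potStep_value (h : TwoBlock a A1 A2) (w : Fin n → ℝ) (hi : i ∈ A1) :
    ∃ m : ℝ, (((A1 ∪ A2).erase i).inf fun l => a i l + ((-(w l) : ℝ) : WithTop ℝ)) = m ∧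
      (∃ j ∈ A2, realPart a i j - w j = m) ∧ ∀ j ∈ A2, m ≤ realPart a i j - w j := by
  have hval : ∀ j ∈ A2, a i j + ((-(w j) : ℝ) : WithTop ℝ) =
      ((realPart a i j - w j : ℝ) : WithTop ℝ) := fun j hj => by
    rw [← h.coe_realPart hi hj, ← WithTop.coe_add, sub_eq_add_neg]
  have hmem : ∀ j ∈ A2, j ∈ (A1 ∪ A2).erase i := by grind [h.disj i hi]
  obtain ⟨j0, hj0⟩ := h.ne2
  obtain ⟨m, h1, ⟨x, hx, hx'⟩, h3⟩ := exists_inf_eq_coe (T := (A1 ∪ A2).erase i)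
    (g := fun l => a i l + ((-(w l) : ℝ) : WithTop ℝ))
    ⟨j0, hmem j0 hj0, by rw [hval j0 hj0]; exact WithTop.coe_ne_top⟩
  refine ⟨m, h1, ?_, fun j hj => WithTop.coe_le_coe.mp (hval j hj ▸ h3 j (hmem j hj))⟩
  rcases mem_union.mp (mem_erase.mp hx).2 with hx1 | hx2
  · simp [h.top1 i hi x hx1] at hx'
  · exact ⟨x, hx2, WithTop.coe_injective ((hval x hx2).symm.trans hx')⟩

theorem PotInv.step (h : TwoBlock a A1 A2)
    (hI : PotInv (realPart a) A1 A2 αs w P) (hi : i ∈ A1) (hP : ¬ P i) :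
    PotInv (realPart a) A1 A2 αs (potStep (A1 ∪ A2) αs a w i) fun k => P k ∨ k = i := by
  obtain ⟨m, hm, ⟨j0, hj0, hj0'⟩, hle⟩ := potStep_value h w hi
  rw [potStep, hm, WithTop.untopD_coe]
  have hne := h.disj
  obtain ⟨h1, h2, h3, h4⟩ := hI
  have hwi := h4 i hP
  refine ⟨by grind, by grind, by grind, by grind⟩

theorem PotInv.foldl (h : TwoBlock a A1 A2) (L : List (Fin n)) (hL : L.Nodup)
    (hS : ∀ i ∈ L, i ∈ A1 ∪ A2) (w : Fin n → ℝ) (P : Fin n → Prop) (hP : ∀ i ∈ L, ¬ P i)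
    (hI : PotInv (realPart a) A1 A2 αs w P) :
    PotInv (realPart a) A1 A2 αs (L.foldl (potStep (A1 ∪ A2) αs a) w) fun k => P k ∨ k ∈ L := by
  induction L generalizing w P with
  | nil => simpa using hI
  | cons i L ih =>
    have hI' : PotInv (realPart a) A1 A2 αs (potStep (A1 ∪ A2) αs a w i)
        fun k => P k ∨ k = i := by
      rcases mem_union.mp (hS i (by simp)) with hi | hi
      · exact hI.step h hi (hP i (by simp))
      · have := (hI.swap (realPart_symm h)).step h.swap hi (hP i (by simp))
        rw [union_comm] at this
        exact this.swap (realPart_symm h)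
    have := ih (List.nodup_cons.mp hL).2 (fun j hj => hS j (by simp [hj])) _ _
      (fun j hj hj' => by grind) hI'
    grind

theorem minEntry_spec (h : TwoBlock a A1 A2) :
    (∃ i ∈ A1, ∃ j ∈ A2, realPart a i j = minEntry (A1 ∪ A2) a) ∧
      ∀ i ∈ A1, ∀ j ∈ A2, minEntry (A1 ∪ A2) a ≤ realPart a i j := by
  obtain ⟨i0, hi0⟩ := h.ne1
  obtain ⟨j0, hj0⟩ := h.ne2
  have hmem : ∀ i ∈ A1, ∀ j ∈ A2,
      (i, j) ∈ ((A1 ∪ A2) ×ˢ (A1 ∪ A2)).filter fun ij => ij.1 ≠ ij.2 := by grind [h.disj]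
  obtain ⟨m, h1, ⟨⟨x, y⟩, hx, hx'⟩, h3⟩ := exists_inf_eq_coe
    (T := ((A1 ∪ A2) ×ˢ (A1 ∪ A2)).filter fun ij => ij.1 ≠ ij.2) (g := fun ij => a ij.1 ij.2)
    ⟨(i0, j0), hmem i0 hi0 j0 hj0, h.fin i0 hi0 j0 hj0⟩
  rw [minEntry, h1, WithTop.untopD_coe]
  refine ⟨?_, fun i hi j hj =>
    WithTop.coe_le_coe.mp ((h.coe_realPart hi hj).symm ▸ h3 _ (hmem i hi j hj))⟩
  simp only [mem_filter, mem_product, mem_union] at hx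
  rcases hx.1 with ⟨hx1 | hx1, hy1 | hy1⟩
  · simp [h.top1 x hx1 y hy1] at hx'
  · exact ⟨x, hx1, y, hy1, by simp [realPart, hx']⟩
  · exact ⟨y, hy1, x, hx1, by simp [realPart, h.symm y x, hx']⟩
  · simp [h.top2 x hx1 y hy1] at hx'

/-- The entries of the normalized matrix. -/
def normEntry (a : Fin n → Fin n → WithTop ℝ) (S : Finset (Fin n)) (i j : Fin n) : ℝ :=
  realPart a i j - potentials S a i - potentials S a j

/-- A matrix `a` that is finite between the blocks, with entries `e`, and such that every row and
every column attains the minimum `low`. -/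
structure NormData (a : Fin n → Fin n → WithTop ℝ) (A1 A2 : Finset (Fin n))
    (e : Fin n → Fin n → ℝ) (low : ℝ) : Prop where
  disj : ∀ i ∈ A1, i ∉ A2
  ne1 : A1.Nonempty
  coe : ∀ i ∈ A1, ∀ j ∈ A2, a i j = e i j
  le : ∀ i ∈ A1, ∀ j ∈ A2, low ≤ e i j
  row : ∀ i ∈ A1, ∃ j ∈ A2, e i j = low
  col : ∀ j ∈ A2, ∃ i ∈ A1, e i j = low

theorem TwoBlock.normData
    (h : TwoBlock a A1 A2) : NormData (normalize (A1 ∪ A2) a) A1 A2 (normEntry a (A1 ∪ A2))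
      (minEntry (A1 ∪ A2) a) := by
  have hI : PotInv (realPart a) A1 A2 (minEntry (A1 ∪ A2) a) (fun _ => 0) fun _ => False :=
    ⟨fun i hi j hj => by simpa using (minEntry_spec h).2 i hi j hj, fun _ _ h => h.elim,
      fun _ _ h => h.elim, fun _ _ => rfl⟩
  have hI := hI.foldl h ((A1 ∪ A2).sort (· ≤ ·)) (sort_nodup _ _)
    (fun i hi => (mem_sort _).mp hi) _ _ fun _ _ => id
  rw [← potentials] at hI
  refine ⟨h.disj, h.ne1, fun i hi j hj => ?_, hI.le, fun i hi => hI.row i hi (by simp [hi]),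
    fun j hj => hI.col j hj (by simp [hj])⟩
  rw [normalize_eq_subPot, subPot, if_pos (by grind [h.disj]), ← h.coe_realPart hi hj,
    ← WithTop.coe_add, normEntry]
  grind

theorem quadDiff_normEntry (a : Fin n → Fin n → WithTop ℝ) (S : Finset (Fin n))
    (i j k l : Fin n) : quadDiff (normEntry a S) i j k l = quadDiff (realPart a) i j k l := by
  simp only [quadDiff, normEntry]
  ring

end Normalization

section Levels

variable {n : ℕ} {a : Fin n → Fin n → WithTop ℝ} {A1 A2 : Finset (Fin n)}
  {e : Fin n → Fin n → ℝ} {low : ℝ}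
variable {L : Finset (Fin n)} {i j x y : Fin n} {α α' : ℝ}

theorem mem_comps : L ∈ comps A1 A2 a α ↔ ∃ i j, (levelGraph A1 A2 a α).Adj i j ∧
      ∀ k, k ∈ L ↔ (levelGraph A1 A2 a α).Reachable i k := by
  classical
  simp [comps]

theorem mem_iff_reachable_of_mem_comps (hL : L ∈ comps A1 A2 a α) (hx : x ∈ L) (y : Fin n) : y ∈ L ↔ (levelGraph A1 A2 a α).Reachable x y := by
  obtain ⟨i, j, -, h⟩ := mem_comps.mp hL
  rw [h] at hx ⊢
  exact ⟨fun h' => hx.symm.trans h', fun h' => hx.trans h'⟩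

theorem reachable_mono (hα : α ≤ α')
    (h : (levelGraph A1 A2 a α').Reachable x y) : (levelGraph A1 A2 a α).Reachable x y := by
  refine h.mono ?_
  intro u v huv
  rw [levelGraph, SimpleGraph.fromRel_adj] at huv ⊢
  have hα' : (α : WithTop ℝ) ≤ α' := WithTop.coe_le_coe.mpr hα
  grind

theorem comp_subset_comp (hα : α ≤ α') {L' : Finset (Fin n)}
    (hL : L ∈ comps A1 A2 a α) (hL' : L' ∈ comps A1 A2 a α') (hx : x ∈ L)
    (hx' : x ∈ L') : L' ⊆ L := by
  intro y hy
  rw [mem_iff_reachable_of_mem_comps hL hx]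
  exact reachable_mono hα ((mem_iff_reachable_of_mem_comps hL' hx' y).mp hy)

theorem mem_rawFam : L ∈ rawFam A1 A2 a ↔ ∃ α ∈ upperLevels A1 A2 a, L ∈ comps A1 A2 a α := by
  classical
  simp [rawFam]

theorem rawFam_laminar {X Y : Finset (Fin n)} (hX : X ∈ rawFam A1 A2 a)
    (hY : Y ∈ rawFam A1 A2 a) : X ⊆ Y ∨ Y ⊆ X ∨ X ∩ Y = ∅ := by
  obtain ⟨α, -, hα⟩ := mem_rawFam.mp hX
  obtain ⟨β, -, hβ⟩ := mem_rawFam.mp hY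
  by_cases h : X ∩ Y = ∅
  · grind
  · obtain ⟨x, hx⟩ := nonempty_iff_ne_empty.mpr h
    rw [mem_inter] at hx
    rcases le_total α β with h' | h'
    · exact .inr (.inl (comp_subset_comp h' hα hβ hx.1 hx.2))
    · exact .inl (comp_subset_comp h' hβ hα hx.2 hx.1)

/-- The least proper superset of a member in the family completed by the ground set. -/
theorem parent_eq_of_least {P : Finset (Fin n)}
    (hP : P ∈ insert (A1 ∪ A2) (rawFam A1 A2 a)) (hLP : L ⊂ P)
    (hmin : ∀ L' ∈ insert (A1 ∪ A2) (rawFam A1 A2 a), L ⊂ L' → P ⊆ L') :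
    parent A1 A2 a L = P :=
  le_antisymm (inf_le (f := id) (mem_filter.mpr ⟨hP, hLP⟩))
    (Finset.le_inf fun L' hL' => hmin L' (mem_filter.mp hL').1 (mem_filter.mp hL').2)

variable (h : NormData a A1 A2 e low)

include h

theorem NormData.mem_levels :
    α ∈ levels A1 A2 a ↔ ∃ i ∈ A1, ∃ j ∈ A2, e i j = α := by
  have : ∀ i ∈ A1, ∀ j ∈ A2, (a i j).untopD 0 = e i j := fun i hi j hj => by
    rw [h.coe i hi j hj, WithTop.untopD_coe]
  simp only [levels, mem_image, mem_product, Prod.exists]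
  grind

theorem NormData.lowLevel_eq : lowLevel A1 A2 a = low := by
  obtain ⟨i, hi⟩ := h.ne1
  obtain ⟨j, hj, hij⟩ := h.row i hi
  have hmem : low ∈ levels A1 A2 a := h.mem_levels.mpr ⟨i, hi, j, hj, hij⟩
  obtain ⟨m, hm⟩ := min_of_mem hmem
  obtain ⟨k, hk, l, hl, hkl⟩ := h.mem_levels.mp (mem_of_min hm)
  rw [lowLevel, hm]
  exact le_antisymm (min_le_of_eq hmem hm) (hkl ▸ h.le k hk l hl)

theorem NormData.mem_upperLevels :
    α ∈ upperLevels A1 A2 a ↔ low < α ∧ ∃ i ∈ A1, ∃ j ∈ A2, e i j = α := by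
  rw [upperLevels, mem_erase, h.mem_levels, h.lowLevel_eq]
  constructor
  · rintro ⟨h1, i, hi, j, hj, h2⟩
    exact ⟨lt_of_le_of_ne (h2 ▸ h.le i hi j hj) h1.symm, i, hi, j, hj, h2⟩
  grind

theorem NormData.adj_iff : (levelGraph A1 A2 a α).Adj x y ↔
      (x ∈ A1 ∧ y ∈ A2 ∧ α ≤ e x y) ∨ (y ∈ A1 ∧ x ∈ A2 ∧ α ≤ e y x) := by
  have key : ∀ x ∈ A1, ∀ y ∈ A2, (α : WithTop ℝ) ≤ a x y ↔ α ≤ e x y := fun x hx y hy => by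
    rw [h.coe _ hx _ hy, WithTop.coe_le_coe]
  rw [levelGraph, SimpleGraph.fromRel_adj]
  grind [h.disj]

theorem NormData.exists_edge
    (hL : L ∈ comps A1 A2 a α) : ∃ i ∈ A1, ∃ j ∈ A2, i ∈ L ∧ j ∈ L ∧ α ≤ e i j := by
  obtain ⟨i, j, hadj, h'⟩ := mem_comps.mp hL
  have hi : i ∈ L := (h' i).mpr (SimpleGraph.Reachable.refl _)
  have hj : j ∈ L := (h' j).mpr hadj.reachable
  grind [h.adj_iff.mp hadj]

/-- The component of a node that is incident with an edge. -/
theorem NormData.exists_comp (hi : i ∈ A1)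
    (hj : j ∈ A2) (hij : α ≤ e i j) : ∃ L ∈ comps A1 A2 a α, i ∈ L ∧ j ∈ L := by
  classical
  have hadj := h.adj_iff.mpr (.inl ⟨hi, hj, hij⟩)
  refine ⟨univ.filter fun k => (levelGraph A1 A2 a α).Reachable i k,
    mem_comps.mpr ⟨i, j, hadj, by simp⟩, by simp, by simpa using hadj.reachable⟩

theorem NormData.mem_union_of_reachable
    (hxy : (levelGraph A1 A2 a α).Reachable x y) (hx : x ∈ A1 ∪ A2) : y ∈ A1 ∪ A2 := by
  rw [SimpleGraph.reachable_iff_reflTransGen] at hxy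
  induction hxy with
  | refl => exact hx
  | tail _ hadj _ => grind [h.adj_iff.mp hadj]

theorem NormData.comp_subset
    (hL : L ∈ comps A1 A2 a α) : L ⊆ A1 ∪ A2 := by
  obtain ⟨i, hi, j, hj, hi', -⟩ := h.exists_edge hL
  intro x hx
  exact h.mem_union_of_reachable ((mem_iff_reachable_of_mem_comps hL hi' x).mp hx)
    (mem_union_left _ hi)

theorem NormData.levelOf_union : levelOf A1 A2 a (A1 ∪ A2) = low := by
  rw [levelOf, if_pos rfl, h.lowLevel_eq]

theorem NormData.subset_union_of_mem
    (hL : L ∈ insert (A1 ∪ A2) (rawFam A1 A2 a)) : L ⊆ A1 ∪ A2 := by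
  rcases mem_insert.mp hL with rfl | hL
  · exact subset_rfl
  · obtain ⟨α, -, hα⟩ := mem_rawFam.mp hL
    exact h.comp_subset hα

variable (hCB : CB A1 A2 a)

include hCB

/-- Under (CB), all entries inside a component reach its level. -/
theorem NormData.le_of_CB
    (hα : α ∈ upperLevels A1 A2 a) (hL : L ∈ comps A1 A2 a α)
    (hi : i ∈ A1) (hi' : i ∈ L) (hj : j ∈ A2) (hj' : j ∈ L) : α ≤ e i j := by
  have := h.adj_iff.mp (hCB α hα L hL i (mem_inter.mpr ⟨hi', hi⟩) j (mem_inter.mpr ⟨hj', hj⟩))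
  grind [h.disj]

theorem NormData.cuts_of_mem_rawFam
    (hL : L ∈ rawFam A1 A2 a) : Cuts A1 L ∧ Cuts A2 L := by
  obtain ⟨α, hα, hLα⟩ := mem_rawFam.mp hL
  have hlow := (h.mem_upperLevels.mp hα).1
  obtain ⟨i, hi, j, hj, hi', hj', hij⟩ := h.exists_edge hLα
  obtain ⟨l, hl, hil⟩ := h.row i hi
  obtain ⟨k, hk, hkj⟩ := h.col j hj
  rw [cuts_iff, cuts_iff]
  exact ⟨⟨⟨i, hi, hi'⟩, k, hk, fun hk' => by linarith [h.le_of_CB hCB hα hLα hk hk' hj hj']⟩,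
    ⟨j, hj, hj'⟩, l, hl, fun hl' => by linarith [h.le_of_CB hCB hα hLα hi hi' hl hl']⟩

theorem NormData.ne_union_of_mem_rawFam (hL : L ∈ rawFam A1 A2 a) : L ≠ A1 ∪ A2 := by
  rintro rfl
  obtain ⟨-, i, hi, hi'⟩ := cuts_iff.mp (h.cuts_of_mem_rawFam hCB hL).1
  grind

theorem NormData.levelOf_spec (hL : L ∈ rawFam A1 A2 a) :
    levelOf A1 A2 a L ∈ upperLevels A1 A2 a ∧ L ∈ comps A1 A2 a (levelOf A1 A2 a L) ∧
      ∀ α ∈ upperLevels A1 A2 a, L ∈ comps A1 A2 a α → α ≤ levelOf A1 A2 a L := by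
  classical
  obtain ⟨α, hα, hLα⟩ := mem_rawFam.mp hL
  obtain ⟨m, hm⟩ := max_of_mem (mem_filter (p := fun α => L ∈ comps A1 A2 a α).mpr ⟨hα, hLα⟩)
  have h2 : levelOf A1 A2 a L = m := by
    rw [levelOf, if_neg (h.ne_union_of_mem_rawFam hCB hL)]
    convert congrArg (WithBot.unbotD 0) hm
    rfl
  exact h2 ▸ ⟨(mem_filter.mp (mem_of_max hm)).1, (mem_filter.mp (mem_of_max hm)).2,
    fun β hβ hLβ => le_max_of_eq (mem_filter.mpr ⟨hβ, hLβ⟩) hm⟩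

theorem NormData.parent_spec (hL : L ∈ rawFam A1 A2 a) :
    parent A1 A2 a L ∈ insert (A1 ∪ A2) (rawFam A1 A2 a) ∧ L ⊂ parent A1 A2 a L ∧
      ∀ L' ∈ insert (A1 ∪ A2) (rawFam A1 A2 a), L ⊂ L' → parent A1 A2 a L ⊆ L' := by
  classical
  have hsub : ∀ {X}, X ∈ insert (A1 ∪ A2) (rawFam A1 A2 a) → X ⊆ A1 ∪ A2 := h.subset_union_of_mem
  obtain ⟨P, hP, hPmin⟩ := ((insert (A1 ∪ A2) (rawFam A1 A2 a)).filter (L ⊂ ·)).exists_min_image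
    card ⟨_, mem_filter.mpr ⟨mem_insert_self _ _, Finset.ssubset_iff_subset_ne.mpr
      ⟨hsub (mem_insert_of_mem hL), h.ne_union_of_mem_rawFam hCB hL⟩⟩⟩
  obtain ⟨hP1, hP2⟩ := mem_filter.mp hP
  have key : ∀ L' ∈ insert (A1 ∪ A2) (rawFam A1 A2 a), L ⊂ L' → P ⊆ L' := fun L' hL' hLL' => by
    have hcard := hPmin L' (mem_filter.mpr ⟨hL', hLL'⟩)
    have hlam : P ⊆ L' ∨ L' ⊆ P ∨ P ∩ L' = ∅ := by
      rcases mem_insert.mp hL' with rfl | hL1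
      · exact .inl (hsub hP1)
      rcases mem_insert.mp hP1 with rfl | hP1
      · exact .inr (.inl (hsub hL'))
      exact rawFam_laminar hP1 hL1
    rcases hlam with h1 | h1 | h1
    · exact h1
    · exact (eq_of_subset_of_card_le h1 hcard).symm.subset
    · obtain ⟨α, -, hα⟩ := mem_rawFam.mp hL
      obtain ⟨i, -, -, -, hi, -⟩ := h.exists_edge hα
      grind [mem_inter.mpr ⟨hP2.1 hi, hLL'.1 hi⟩]
  rw [parent_eq_of_least hP1 hP2 key]
  exact ⟨hP1, hP2, key⟩

theorem NormData.levelOf_parent_lt (hL : L ∈ rawFam A1 A2 a) :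
    levelOf A1 A2 a (parent A1 A2 a L) < levelOf A1 A2 a L := by
  obtain ⟨h1, h2, h3⟩ := h.levelOf_spec hCB hL
  obtain ⟨h4, h5, -⟩ := h.parent_spec hCB hL
  rcases mem_insert.mp h4 with h6 | h6
  · rw [h6, h.levelOf_union]
    exact (h.mem_upperLevels.mp h1).1
  · obtain ⟨h7, h8, -⟩ := h.levelOf_spec hCB h6
    by_contra! hle
    obtain ⟨i, -, -, -, hi, -⟩ := h.exists_edge h2
    exact h5.2 (comp_subset_comp hle h2 h8 hi (h5.1 hi))

theorem NormData.rawWt_pos (hL : L ∈ rawFam A1 A2 a) : 0 < rawWt A1 A2 a L := by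
  have := h.levelOf_parent_lt hCB hL
  unfold rawWt
  linarith

theorem NormData.sum_rawWt_superset (k : ℕ)
    (L : Finset (Fin n)) (hL : L ∈ insert (A1 ∪ A2) (rawFam A1 A2 a))
    (hk : (A1 ∪ A2).card - L.card ≤ k) :
    ∑ L' ∈ (rawFam A1 A2 a).filter (fun L' => L ⊆ L'), rawWt A1 A2 a L' =
      levelOf A1 A2 a L - low := by
  induction k using Nat.strong_induction_on generalizing L with
  | _ k ih =>
    by_cases hL' : L = A1 ∪ A2
    · subst hL'
      rw [h.levelOf_union, sub_self]
      refine sum_eq_zero fun L' hL' => ?_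
      obtain ⟨h1, h2⟩ := mem_filter.mp hL'
      exact absurd (subset_antisymm (h.subset_union_of_mem (mem_insert_of_mem h1)) h2)
        (h.ne_union_of_mem_rawFam hCB h1)
    · have hL1 : L ∈ rawFam A1 A2 a := (mem_insert.mp hL).resolve_left hL'
      obtain ⟨h4, h5, h6⟩ := h.parent_spec hCB hL1
      have hcard := card_lt_card h5
      have hcard' := card_le_card (h.subset_union_of_mem h4)
      have hih := ih (k - 1) (by omega) _ h4 (by omega)
      have hset : (rawFam A1 A2 a).filter (fun L' => L ⊆ L') =
          insert L ((rawFam A1 A2 a).filter fun L' => parent A1 A2 a L ⊆ L') := by grind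
      rw [hset, sum_insert, hih, rawWt]
      · ring
      grind

theorem NormData.sum_rawWt
    (hi : i ∈ A1) (hj : j ∈ A2) :
    ∑ L ∈ rawFam A1 A2 a, rawWt A1 A2 a L * (ind L i * ind L j) = e i j - low := by
  have h1 : ∑ L ∈ rawFam A1 A2 a, rawWt A1 A2 a L * (ind L i * ind L j) =
      ∑ L ∈ (rawFam A1 A2 a).filter (fun L => i ∈ L ∧ j ∈ L), rawWt A1 A2 a L := by
    rw [sum_filter]
    refine sum_congr rfl fun L _ => ?_
    unfold ind
    grind
  rw [h1]
  rcases (h.le i hi j hj).eq_or_lt with hlow | hlow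
  · rw [← hlow, sub_self]
    refine sum_eq_zero fun L hL => ?_
    obtain ⟨hL, hiL, hjL⟩ := mem_filter.mp hL
    obtain ⟨α, hα, hLα⟩ := mem_rawFam.mp hL
    have h2 := h.le_of_CB hCB hα hLα hi hiL hj hjL
    have h3 := (h.mem_upperLevels.mp hα).1
    linarith
  · have hα : e i j ∈ upperLevels A1 A2 a := h.mem_upperLevels.mpr ⟨hlow, i, hi, j, hj, rfl⟩
    obtain ⟨L0, hL0, hiL0, hjL0⟩ := h.exists_comp hi hj le_rfl
    have hL0' : L0 ∈ rawFam A1 A2 a := mem_rawFam.mpr ⟨_, hα, hL0⟩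
    have hset : (rawFam A1 A2 a).filter (fun L => i ∈ L ∧ j ∈ L) =
        (rawFam A1 A2 a).filter fun L => L0 ⊆ L := by
      refine filter_congr fun L hL => ⟨fun ⟨hiL, hjL⟩ => ?_, fun hs => ⟨hs hiL0, hs hjL0⟩⟩
      obtain ⟨β, hβ, hLβ⟩ := mem_rawFam.mp hL
      exact comp_subset_comp (h.le_of_CB hCB hβ hLβ hi hiL hj hjL) hLβ hL0 hiL hiL0
    rw [hset, h.sum_rawWt_superset hCB _ L0 (mem_insert_of_mem hL0') le_rfl]
    obtain ⟨h4, h5, h6⟩ := h.levelOf_spec hCB hL0'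
    have h7 := h.le_of_CB hCB h4 h5 hi hiL0 hj hjL0
    grind

end Levels

section LaminarPair

variable {n : ℕ}
variable {A1 A2 : Finset (Fin n)} {G : Finset (Finset (Fin n))} {W : WFam n}
variable {X Y Z : Finset (Fin n)} {a : Fin n → Fin n → WithTop ℝ} {c : Finset (Fin n) → ℝ}
variable {e : Fin n → Fin n → ℝ} {i j k l : Fin n} {low : ℝ} {α : Type*} {ι : Type} {Q : Finset ι}
variable {T : Finset α}

/-- `Z` is a member of `G` or the complement of one. -/
def Oriented (G : Finset (Finset (Fin n))) (Z : Finset (Fin n)) : Prop := Z ∈ G ∨ Zᶜ ∈ G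

/-- Members of a laminar family and their complements are cross-free. -/
theorem Oriented.subset_or_subset (hG : IsLaminar G) {Z' : Finset (Fin n)} (hZ : Oriented G Z) (hZ' : Oriented G Z') {x y : Fin n} (hx : x ∈ Z)
    (hx' : x ∈ Z') (hy : y ∉ Z) (hy' : y ∉ Z') : Z ⊆ Z' ∨ Z' ⊆ Z := by
  have key : ∀ i, i ∈ Zᶜ ↔ i ∉ Z := fun i => mem_compl
  have key' : ∀ i, i ∈ Z'ᶜ ↔ i ∉ Z' := fun i => mem_compl
  rcases hZ with hZ | hZ <;> rcases hZ' with hZ' | hZ' <;> have := hG _ hZ _ hZ' <;>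
    simp only [eq_empty_iff_forall_notMem, mem_inter] at this <;> grind

theorem exists_top_of_chain (hT : T.Nonempty)
    (f : α → Finset (Fin n)) (hf : ∀ x ∈ T, ∀ y ∈ T, f x ⊆ f y ∨ f y ⊆ f x) :
    ∃ x ∈ T, ∀ y ∈ T, f y ⊆ f x := by
  obtain ⟨x, hx, hmax⟩ := T.exists_max_image (fun x => (f x).card) hT
  exact ⟨x, hx, fun y hy => (hf x hx y hy).elim
    (fun h => (eq_of_subset_of_card_le h (hmax y hy)).ge) id⟩

theorem exists_bot_of_chain (hT : T.Nonempty)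
    (f : α → Finset (Fin n)) (hf : ∀ x ∈ T, ∀ y ∈ T, f x ⊆ f y ∨ f y ⊆ f x) :
    ∃ x ∈ T, ∀ y ∈ T, f x ⊆ f y := by
  obtain ⟨x, hx, hmin⟩ := T.exists_min_image (fun x => (f x).card) hT
  exact ⟨x, hx, fun y hy => (hf x hx y hy).elim id
    fun h => (eq_of_subset_of_card_le h (hmin y hy)).ge⟩

theorem exists_oriented_of_chain (hG : IsLaminar G) (hT : T.Nonempty) {u v : Fin n}
    {R : α → Finset (Fin n) → Prop} (h : ∀ x ∈ T, ∃ Z, (Oriented G Z ∧ u ∈ Z ∧ v ∉ Z) ∧ R x Z) :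
    (∃ Z, (Oriented G Z ∧ u ∈ Z ∧ v ∉ Z) ∧ (∃ x ∈ T, R x Z) ∧ ∀ y ∈ T, ∃ Z' ⊆ Z, R y Z') ∧
      ∃ Z, (Oriented G Z ∧ u ∈ Z ∧ v ∉ Z) ∧ (∃ x ∈ T, R x Z) ∧ ∀ y ∈ T, ∃ Z', Z ⊆ Z' ∧ R y Z' := by
  choose! f hf using h
  have key : ∀ x ∈ T, ∀ y ∈ T, f x ⊆ f y ∨ f y ⊆ f x := fun x hx y hy =>
    (hf x hx).1.1.subset_or_subset hG (hf y hy).1.1 (hf x hx).1.2.1 (hf y hy).1.2.1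
      (hf x hx).1.2.2 (hf y hy).1.2.2
  obtain ⟨x, hx, hmax⟩ := exists_top_of_chain hT f key
  obtain ⟨z, hz, hmin⟩ := exists_bot_of_chain hT f key
  exact ⟨⟨f x, by grind⟩, f z, by grind⟩

theorem chi_trichotomy (X : Finset (Fin n)) (i j k l : Fin n) : chi X i j k l = 0 ∨
    (chi X i j k l = 1 ∧ ((i ∈ X ∧ j ∈ X ∧ k ∉ X ∧ l ∉ X) ∨ (i ∉ X ∧ j ∉ X ∧ k ∈ X ∧ l ∈ X))) ∨
    (chi X i j k l = -1 ∧ ((i ∈ X ∧ j ∉ X ∧ k ∉ X ∧ l ∈ X) ∨ (i ∉ X ∧ j ∈ X ∧ k ∈ X ∧ l ∉ X))) := by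
  unfold chi ind
  grind

/-- If every quadruple that is split by `W` is split by a positive total weight of `G`, then `G`
has a member inducing the same bipartition as `W` on the two blocks. -/
theorem exists_member_of_split (hG : IsLaminar G) (hc : ∀ X ∈ G, 0 < c X) {W : Finset (Fin n)}
    (h1 : Cuts A1 W) (h2 : Cuts A2 W)
    (hpos : ∀ i ∈ A1, ∀ j ∈ A2, ∀ k ∈ A1, ∀ l ∈ A2, i ∈ W → j ∈ W → k ∉ W → l ∉ W →
      0 < ∑ X ∈ G, c X * chi X i j k l) :
    ∃ Z, Oriented G Z ∧ ∀ x ∈ A1 ∪ A2, (x ∈ Z ↔ x ∈ W) := by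
  classical
  obtain ⟨⟨i0, hi0, hi0'⟩, k0, hk0, hk0'⟩ := cuts_iff.mp h1
  obtain ⟨⟨j0, hj0, hj0'⟩, l0, hl0, hl0'⟩ := cuts_iff.mp h2
  have step1 : ∀ i ∈ A1, ∀ j ∈ A2, ∀ k ∈ A1, ∀ l ∈ A2, i ∈ W → j ∈ W → k ∉ W → l ∉ W →
      ∃ Z, (Oriented G Z ∧ j ∈ Z ∧ l ∉ Z) ∧ i ∈ Z ∧ k ∉ Z := by
    intro i hi j hj k hk l hl hi' hj' hk' hl'
    obtain ⟨X, hX, hX'⟩ := exists_lt_of_sum_lt ((sum_const_zero (s := G)).trans_lt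
      (hpos i hi j hj k hk l hl hi' hj' hk' hl'))
    have hchi := pos_of_mul_pos_right hX' (hc X hX).le
    clear hpos hc hG
    rcases chi_trichotomy X i j k l with h | ⟨-, h | h⟩ | ⟨h, -⟩
    · grind
    · exact ⟨X, ⟨.inl hX, h.2.1, h.2.2.2⟩, h.1, h.2.2.1⟩
    · exact ⟨Xᶜ, by simp_all [Oriented]⟩
    grind
  have step2 : ∀ j ∈ A2, ∀ k ∈ A1, ∀ l ∈ A2, j ∈ W → k ∉ W → l ∉ W →
      ∃ Z, (Oriented G Z ∧ j ∈ Z ∧ l ∉ Z) ∧ (∀ i ∈ A1, i ∈ W → i ∈ Z) ∧ k ∉ Z := by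
    intro j hj k hk l hl hj' hk' hl'
    obtain ⟨Z, hZ, h, h'⟩ := (exists_oriented_of_chain (T := A1 ∩ W) (u := j) (v := l)
      (R := fun i Z => i ∈ Z ∧ k ∉ Z) hG ⟨i0, by simp [*]⟩ fun i hi =>
        step1 i (mem_inter.mp hi).1 j hj k hk l hl (mem_inter.mp hi).2 hj' hk' hl').1
    clear step1 hpos
    simp only [mem_inter, mem_sdiff] at h h'
    exact ⟨Z, by grind⟩
  have step3 : ∀ j ∈ A2, ∀ l ∈ A2, j ∈ W → l ∉ W →
      ∃ Z, (Oriented G Z ∧ i0 ∈ Z ∧ k0 ∉ Z) ∧ (∀ i ∈ A1, (i ∈ Z ↔ i ∈ W)) ∧ j ∈ Z ∧ l ∉ Z := by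
    intro j hj l hl hj' hl'
    obtain ⟨Z, hZ, h, h'⟩ := (exists_oriented_of_chain (T := A1 \ W) (u := j) (v := l)
      (R := fun k Z => (∀ i ∈ A1, i ∈ W → i ∈ Z) ∧ k ∉ Z) hG ⟨k0, by simp [*]⟩ fun k hk =>
        step2 j hj k (mem_sdiff.mp hk).1 l hl hj' (mem_sdiff.mp hk).2 hl').2
    clear step1 step2 hpos
    simp only [mem_inter, mem_sdiff] at h h'
    exact ⟨Z, by grind⟩
  have step4 : ∀ l ∈ A2, l ∉ W → ∃ Z, (Oriented G Z ∧ i0 ∈ Z ∧ k0 ∉ Z) ∧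
      (∀ i ∈ A1, (i ∈ Z ↔ i ∈ W)) ∧ (∀ j ∈ A2, j ∈ W → j ∈ Z) ∧ l ∉ Z := by
    intro l hl hl'
    obtain ⟨Z, hZ, h, h'⟩ := (exists_oriented_of_chain (T := A2 ∩ W) (u := i0) (v := k0)
      (R := fun j Z => (∀ i ∈ A1, (i ∈ Z ↔ i ∈ W)) ∧ j ∈ Z ∧ l ∉ Z) hG ⟨j0, by simp [*]⟩
      fun j hj => step3 j (mem_inter.mp hj).1 l hl (mem_inter.mp hj).2 hl').1
    clear step1 step2 step3 hpos
    simp only [mem_inter, mem_sdiff] at h h'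
    exact ⟨Z, by grind⟩
  obtain ⟨Z, hZ, h, h'⟩ := (exists_oriented_of_chain (T := A2 \ W) (u := i0) (v := k0)
    (R := fun l Z => (∀ i ∈ A1, (i ∈ Z ↔ i ∈ W)) ∧ (∀ j ∈ A2, j ∈ W → j ∈ Z) ∧ l ∉ Z) hG
    ⟨l0, by simp [*]⟩ fun l hl => step4 l (mem_sdiff.mp hl).1 (mem_sdiff.mp hl).2).2
  clear step1 step2 step3 step4 hpos
  simp only [mem_inter, mem_sdiff] at h h'
  exact ⟨Z, by grind⟩

/-- The indicator of the class of `X`. -/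
noncomputable def eqInd {ι : Type} (B : ι → Finset (Fin n)) (Q : Finset ι)
    (X Y : Finset (Fin n)) : ℝ := by
  classical exact if CutEquiv B Q Y X then 1 else 0

theorem eqInd_pos {B : ι → Finset (Fin n)} (h : CutEquiv B Q Y X) : eqInd B Q X Y = 1 := by
  simp [eqInd, h]

theorem eqInd_neg {B : ι → Finset (Fin n)} (h : ¬ CutEquiv B Q Y X) : eqInd B Q X Y = 0 := by
  simp [eqInd, h]

theorem eqInd_congr {B : ι → Finset (Fin n)} {Y' : Finset (Fin n)}
    (h : CutEquiv B Q Y Y') : eqInd B Q X Y = eqInd B Q X Y' := by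
  grind [eqInd, CutEquiv.symm, CutEquiv.trans]

/-- Total weight of the members of `G` that are equivalent to `X`. -/
noncomputable def classWt {ι : Type} (B : ι → Finset (Fin n)) (Q : Finset ι)
    (G : Finset (Finset (Fin n))) (c : Finset (Fin n) → ℝ) (X : Finset (Fin n)) : ℝ :=
  ∑ Y ∈ G, c Y * eqInd B Q X Y

theorem classWt_eq_sum_filter (B : ι → Finset (Fin n)) (Q : Finset ι)
    (G : Finset (Finset (Fin n))) (c : Finset (Fin n) → ℝ) (X : Finset (Fin n))
    [DecidablePred fun Y => CutEquiv B Q Y X] :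
    classWt B Q G c X = ∑ Y ∈ G.filter fun Y => CutEquiv B Q Y X, c Y := by
  simp [classWt, sum_filter, eqInd]

theorem classWt_nonneg {B : ι → Finset (Fin n)} (hc : ∀ X ∈ G, 0 < c X)
    (X : Finset (Fin n)) : 0 ≤ classWt B Q G c X := by
  classical
  rw [classWt_eq_sum_filter]
  exact sum_nonneg fun Y hY => (hc Y (mem_filter.mp hY).1).le

theorem classWt_pos_iff {B : ι → Finset (Fin n)} (hc : ∀ X ∈ G, 0 < c X) : 0 < classWt B Q G c X ↔ ∃ Y ∈ G, CutEquiv B Q Y X := by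
  classical
  rw [classWt_eq_sum_filter, sum_pos_iff_of_nonneg (by grind)]
  grind

theorem classWt_eq_zero {B : ι → Finset (Fin n)} (h : ∀ Y ∈ G, ¬ CutEquiv B Q Y X) : classWt B Q G c X = 0 := by
  classical
  rw [classWt_eq_sum_filter, filter_false_of_mem h, sum_empty]

section Pair

variable {B : ℕ → Finset (Fin n)} {p t : ℕ}

theorem disj_pair (hd : ∀ i ∈ B p, i ∉ B t) :
    ∀ x ∈ ({p, t} : Finset ℕ), ∀ y ∈ ({p, t} : Finset ℕ), ∀ i, i ∈ B x → i ∈ B y → x = y := by grind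

theorem cutEquiv_pair_iff (hd : ∀ i ∈ B p, i ∉ B t) (h1 : Cuts (B p) X)
    (h2 : Cuts (B t) X) : CutEquiv B {p, t} Y X ↔
      ∃ ε : Prop, ∀ i ∈ B p ∪ B t, (i ∈ Y ↔ (i ∈ X ↔ ε)) := by
  rw [cutEquiv_iff (disj_pair hd)]
  simp only [mem_insert, mem_singleton, forall_eq_or_imp, forall_eq, mem_union]
  constructor
  · rintro ⟨⟨h3, h4⟩, ε, h5, h6⟩
    exact ⟨ε, by grind⟩
  · rintro ⟨ε, h⟩
    have hcut : ∀ {A : Finset (Fin n)}, (∀ i ∈ A, (i ∈ Y ↔ (i ∈ X ↔ ε))) → Cuts A X → Cuts A Y := by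
      intro A hA hX
      rw [cuts_iff] at hX ⊢
      grind
    exact ⟨by grind, ε, by grind⟩

theorem chi_eq_one_of_cutEquiv (hd : ∀ i ∈ B p, i ∉ B t)
    (h : CutEquiv B {p, t} Y X) (hi : i ∈ B p) (hj : j ∈ B t) (hk : k ∈ B p)
    (hl : l ∈ B t) (hi' : i ∈ X) (hj' : j ∈ X) (hk' : k ∉ X) (hl' : l ∉ X) :
    chi Y i j k l = 1 := by
  rw [chi_congr (disj_pair hd) h (p := p) (q := t) (by simp) (by simp) hi hk hj hl]
  simp [chi, ind, hi', hj', hk', hl']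

theorem exists_oriented_of_cutEquiv (hd : ∀ i ∈ B p, i ∉ B t) (hY : Y ∈ G) (h1 : Cuts (B p) X) (h2 : Cuts (B t) X)
    (h : CutEquiv B {p, t} Y X) : ∃ Z, Oriented G Z ∧ ∀ x ∈ B p ∪ B t, (x ∈ Z ↔ x ∈ X) := by
  obtain ⟨ε, hε⟩ := (cutEquiv_pair_iff hd h1 h2).mp h
  by_cases h' : ε
  · exact ⟨Y, .inl hY, by grind⟩
  · exact ⟨Yᶜ, by simpa [Oriented] using .inr hY, by simp_all⟩

theorem cutEquiv_of_oriented (hd : ∀ i ∈ B p, i ∉ B t) (hZ : Oriented G Z) (h1 : Cuts (B p) X) (h2 : Cuts (B t) X)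
    (h : ∀ x ∈ B p ∪ B t, (x ∈ Z ↔ x ∈ X)) : ∃ Y ∈ G, CutEquiv B {p, t} Y X := by
  rcases hZ with hZ | hZ
  · exact ⟨Z, hZ, (cutEquiv_pair_iff hd h1 h2).mpr ⟨True, fun i hi => by grind⟩⟩
  · exact ⟨Zᶜ, hZ, (cutEquiv_pair_iff hd h1 h2).mpr ⟨False, fun i hi => by simp [h i hi]⟩⟩

/-- The class weight is a lower bound of the second differences at the quadruples it splits. -/
theorem classWt_le_sum_chi (hd : ∀ i ∈ B p, i ∉ B t) (hG : IsLaminar G) (hc : ∀ X ∈ G, 0 < c X)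
    (h₁ : Cuts (B p) X) (h₂ : Cuts (B t) X) (hX : ∃ Y ∈ G, CutEquiv B {p, t} Y X) (hi : i ∈ B p) (hj : j ∈ B t) (hk : k ∈ B p)
    (hl : l ∈ B t) (hi' : i ∈ X) (hj' : j ∈ X) (hk' : k ∉ X) (hl' : l ∉ X) :
    classWt B {p, t} G c X ≤ ∑ Y ∈ G, c Y * chi Y i j k l := by
  classical
  unfold classWt
  refine sum_le_sum fun Y hY => mul_le_mul_of_nonneg_left ?_ (hc Y hY).le
  unfold eqInd
  split_ifs with h
  · rw [chi_eq_one_of_cutEquiv hd h hi hj hk hl hi' hj' hk' hl']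
  · obtain ⟨V, hV, hVX⟩ := hX
    obtain ⟨Z, hZ, hZX⟩ := exists_oriented_of_cutEquiv hd hV h₁ h₂ hVX
    have hiZ := (hZX i (mem_union_left _ hi)).mpr hi'
    have hjZ := (hZX j (mem_union_right _ hj)).mpr hj'
    have hkZ := mt (hZX k (mem_union_left _ hk)).mp hk'
    have hlZ := mt (hZX l (mem_union_right _ hl)).mp hl'
    rcases chi_trichotomy Y i j k l with h1 | ⟨h1, -⟩ | ⟨-, h1 | h1⟩
    · rw [h1]
    · grind
    · rcases hZ.subset_or_subset hG (.inl hY) hiZ h1.1 hkZ h1.2.2.1 with h2 | h2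
      · grind
      grind
    · rcases hZ.subset_or_subset hG (.inl hY) hjZ h1.2.1 hlZ h1.2.2.2 with h2 | h2
      · grind
      grind

/-- The class weight is attained as a second difference. -/
theorem exists_sum_chi_le_classWt (hd : ∀ i ∈ B p, i ∉ B t)
    (hG : IsLaminar G) (hc : ∀ X ∈ G, 0 < c X)
    (h₁ : Cuts (B p) X) (h₂ : Cuts (B t) X) :
    ∃ i ∈ B p, ∃ j ∈ B t, ∃ k ∈ B p, ∃ l ∈ B t, i ∈ X ∧ j ∈ X ∧ k ∉ X ∧ l ∉ X ∧
      ∑ Y ∈ G, c Y * chi Y i j k l ≤ classWt B {p, t} G c X := by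
  classical
  set G' := G.filter fun Y => ¬ CutEquiv B {p, t} Y X with hG'
  have hsub : G' ⊆ G := filter_subset _ _
  have hlam : IsLaminar G' := fun U hU V hV => hG U (hsub hU) V (hsub hV)
  by_contra! hcon
  obtain ⟨Z, hZ, hZX⟩ := exists_member_of_split hlam (fun U hU => hc U (hsub hU)) h₁ h₂
    (by
      intro i hi j hj k hk l hl hi' hj' hk' hl'
      have h1 := hcon i hi j hj k hk l hl hi' hj' hk' hl'
      rw [← sum_filter_add_sum_filter_not G fun Y => CutEquiv B {p, t} Y X,
        classWt_eq_sum_filter] at h1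
      have h2 : ∑ Y ∈ G.filter (fun Y => CutEquiv B {p, t} Y X), c Y * chi Y i j k l =
          ∑ Y ∈ G.filter (fun Y => CutEquiv B {p, t} Y X), c Y := by
        refine sum_congr rfl fun Y hY => ?_
        rw [chi_eq_one_of_cutEquiv hd (mem_filter.mp hY).2 hi hj hk hl hi' hj' hk' hl', mul_one]
      linarith)
  obtain ⟨Y, hY, hYX⟩ := cutEquiv_of_oriented hd hZ h₁ h₂ hZX
  grind

/-- Uniqueness of laminar decompositions over two blocks. -/
theorem classWt_eq_of_sum_chi_eq (hd : ∀ i ∈ B p, i ∉ B t) {G' : Finset (Finset (Fin n))}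
    (hG : IsLaminar G) {c' : Finset (Fin n) → ℝ} (hc : ∀ X ∈ G, 0 < c X)
    (hG' : IsLaminar G') (hc' : ∀ X ∈ G', 0 < c' X)
    (heq : ∀ i ∈ B p, ∀ j ∈ B t, ∀ k ∈ B p, ∀ l ∈ B t,
      ∑ Y ∈ G, c Y * chi Y i j k l = ∑ Y ∈ G', c' Y * chi Y i j k l) (h1 : Cuts (B p) X) (h2 : Cuts (B t) X) :
    classWt B {p, t} G c X = classWt B {p, t} G' c' X := by
  have key : ∀ {F F' : Finset (Finset (Fin n))} {d d' : Finset (Fin n) → ℝ}, IsLaminar F →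
      (∀ X ∈ F, 0 < d X) → IsLaminar F' → (∀ X ∈ F', 0 < d' X) →
      (∀ i ∈ B p, ∀ j ∈ B t, ∀ k ∈ B p, ∀ l ∈ B t,
        ∑ Y ∈ F, d Y * chi Y i j k l = ∑ Y ∈ F', d' Y * chi Y i j k l) →
      classWt B {p, t} F d X ≤ classWt B {p, t} F' d' X := by
    intro F F' d d' hF hd1 hF' hd2 h
    rcases (classWt_nonneg hd1 X (B := B) (Q := {p, t})).eq_or_lt with h0 | h0
    · rw [← h0]
      exact classWt_nonneg hd2 X
    · obtain ⟨i, hi, j, hj, k, hk, l, hl, hi', hj', hk', hl', hle⟩ :=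
        exists_sum_chi_le_classWt hd hF' hd2 h1 h2
      have := classWt_le_sum_chi hd hF hd1 h1 h2 ((classWt_pos_iff hd1).mp h0) hi hj hk hl hi' hj'
        hk' hl'
      grind
  exact le_antisymm (key hG hc hG' hc' heq)
    (key hG' hc' hG hc fun i hi j hj k hk l hl => (heq i hi j hj k hk l hl).symm)

end Pair

/-! ### The four-point condition and condition (CB) -/

/-- Common weight of two nodes. -/
def simil (G : Finset (Finset (Fin n))) (c : Finset (Fin n) → ℝ) (x y : Fin n) : ℝ :=
  ∑ X ∈ G, c X * (ind X x * ind X y)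

theorem simil_symm (G : Finset (Finset (Fin n))) (c : Finset (Fin n) → ℝ) (x y : Fin n) :
    simil G c x y = simil G c y x := by
  unfold simil
  grind

theorem sum_mul_chi (G : Finset (Finset (Fin n))) (c : Finset (Fin n) → ℝ) (i j k l : Fin n) :
    ∑ X ∈ G, c X * chi X i j k l =
      simil G c i j + simil G c k l - simil G c i l - simil G c k j := by
  simp only [simil, chi, ← sum_add_distrib, ← sum_sub_distrib]
  exact sum_congr rfl fun X _ => by ring

theorem min_le_simil (hG : IsLaminar G) (hc : ∀ X ∈ G, 0 < c X) (x y z : Fin n) :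
    simil G c x z ≤ simil G c x y ∨ simil G c z y ≤ simil G c x y := by
  have key : (∀ X ∈ G, x ∈ X → z ∈ X → y ∈ X) ∨ ∀ X ∈ G, z ∈ X → y ∈ X → x ∈ X := by
    simp only [IsLaminar, eq_empty_iff_forall_notMem, mem_inter] at hG
    grind
  refine key.imp ?_ ?_ <;>
    exact fun h => sum_le_sum fun X hX => mul_le_mul_of_nonneg_left
      (by have := h X hX; unfold ind; split_ifs <;> simp_all) (hc X hX).le

theorem simil_four_point (hG : IsLaminar G) (hc : ∀ X ∈ G, 0 < c X) (x y z u : Fin n) :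
    simil G c x z + simil G c y u ≤ simil G c x y + simil G c z u ∨
      simil G c x u + simil G c y z ≤ simil G c x y + simil G c z u := by
  grind [min_le_simil hG hc x y z, min_le_simil hG hc x y u, min_le_simil hG hc z u x,
    min_le_simil hG hc z u y, simil_symm]

/-- The bipartite ultrametric inequality. -/
theorem NormData.ultra_of_laminar (h : NormData a A1 A2 e low) (hG : IsLaminar G)
    (hc : ∀ X ∈ G, 0 < c X)
    (hD : ∀ i ∈ A1, ∀ j ∈ A2, ∀ k ∈ A1, ∀ l ∈ A2, quadDiff e i j k l = ∑ X ∈ G, c X * chi X i j k l)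
    {m : ℝ} (hm : low < m) (hi : i ∈ A1) (hj : j ∈ A2) (hk : k ∈ A1)
    (hl : l ∈ A2) (hil : m ≤ e i l) (hkl : m ≤ e k l) (hkj : m ≤ e k j) : m ≤ e i j := by
  classical
  obtain ⟨w, hw⟩ : ∃ w : Fin n → ℝ, ∀ x ∈ A1, ∀ y ∈ A2, e x y - low = simil G c x y + w x + w y := by
    refine ⟨fun x => if x ∈ A1 then e x j - low - simil G c x j else
      e i x - simil G c i x - (e i j - simil G c i j), fun x hx y hy => ?_⟩
    have hD' := hD x hx y hy i hi j hj
    rw [sum_mul_chi, quadDiff] at hD'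
    grind [h.disj]
  obtain ⟨s, hs, sw, fp⟩ : ∃ s : Fin n → Fin n → ℝ, (∀ x ∈ A1, ∀ y ∈ A2, e x y = low + s x y) ∧
      (∀ x y, s x y = s y x) ∧ ∀ x y z u, s x z + s y u ≤ s x y + s z u ∨
        s x u + s y z ≤ s x y + s z u := by
    refine ⟨fun x y => simil G c x y + w x + w y, by grind, by grind [simil_symm], ?_⟩
    intro x y z u
    have := simil_four_point hG hc x y z u
    grind
  obtain ⟨i0, hi0, hil0⟩ := h.col l hl
  obtain ⟨j0, hj0, hkj0⟩ := h.row k hk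
  have hle : ∀ i ∈ A1, ∀ j ∈ A2, low ≤ e i j := h.le
  clear h hG hc hD hw
  have c1 : s k i0 + s l j0 = 0 := by grind [fp k j0 l i0, fp k i0 l j0]
  have c2 : s k i0 ≤ s i i0 := by grind [fp i i0 l j0]
  have c3 : m - low + s k i0 ≤ s i k := by grind [fp i k l i0]
  grind [fp i j k i0]

/-- A laminar decomposition forces condition (CB). -/
theorem NormData.CB_of_laminar (h : NormData a A1 A2 e low) (hG : IsLaminar G)
    (hc : ∀ X ∈ G, 0 < c X)
    (hD : ∀ i ∈ A1, ∀ j ∈ A2, ∀ k ∈ A1, ∀ l ∈ A2,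
      quadDiff e i j k l = ∑ X ∈ G, c X * chi X i j k l) : CB A1 A2 a := by
  intro α hα L hL i hi j hj
  obtain ⟨hi, hi'⟩ := mem_inter.mp hi
  obtain ⟨hj, hj'⟩ := mem_inter.mp hj
  have hlow := (h.mem_upperLevels.mp hα).1
  have hr := (mem_iff_reachable_of_mem_comps hL hi j).mp hj
  rw [SimpleGraph.reachable_iff_reflTransGen] at hr
  have key : ∀ x, Relation.ReflTransGen (levelGraph A1 A2 a α).Adj i x →
      (x ∈ A2 → α ≤ e i x) ∧ (x ∈ A1 → x = i ∨ ∃ l ∈ A2, α ≤ e i l ∧ α ≤ e x l) := by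
    intro x hx
    induction hx with
    | refl => exact ⟨fun h2 => absurd h2 (h.disj i hi'), fun _ => .inl rfl⟩
    | @tail y z _ hadj ih =>
      rcases h.adj_iff.mp hadj with ⟨hy, hz, hyz⟩ | ⟨hz, hy, hzy⟩
      · refine ⟨fun _ => ?_, fun hz' => absurd hz (h.disj z hz')⟩
        rcases ih.2 hy with rfl | ⟨l, hl, h1, h2⟩
        · exact hyz
        · exact h.ultra_of_laminar hG hc hD hlow hi' hz hy hl h1 h2 hyz
      · exact ⟨fun hz' => absurd hz' (h.disj z hz), fun _ => .inr ⟨y, hy, ih.1 hy, hzy⟩⟩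
  exact h.adj_iff.mpr (.inl ⟨hi', hj', (key j hr).1 hj'⟩)

/-! ### The output of Algorithm 1 -/

theorem MergeComplements.sum_eq {S : Finset (Fin n)} {F : Finset (Finset (Fin n))} (h : MergeComplements S F c W)
    (hS : ∀ X ∈ F, X ⊆ S) (φ : Finset (Fin n) → ℝ) (hφ : ∀ X ∈ F, φ (S \ X) = φ X) :
    W.sum φ = ∑ X ∈ F, c X * φ X := by
  classical
  obtain ⟨h1, h2, h3⟩ := h
  have hS' : ∀ X ∈ F, S \ (S \ X) = X := fun X hX => Finset.sdiff_sdiff_eq_self (hS X hX)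
  have hWF : F.filter (fun X => X ∈ W.fam) = W.fam := by grind
  rw [← sum_filter_add_sum_filter_not F fun X => X ∈ W.fam, hWF]
  have hsum : ∑ X ∈ F.filter (fun X => X ∉ W.fam), c X * φ X =
      ∑ X ∈ W.fam.filter (fun X => S \ X ∈ F), c (S \ X) * φ X := by
    refine sum_bij' (fun X _ => S \ X) (fun X _ => S \ X) ?_ ?_ ?_ ?_ ?_ <;> grind
  rw [hsum, sum_filter, ← sum_add_distrib, WFam.sum]
  exact sum_congr rfl fun X hX => by grind

/-- What is needed of the output of Algorithm 1. -/
structure PairOutput (a : Fin n → Fin n → WithTop ℝ) (A1 A2 : Finset (Fin n)) (W : WFam n) :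
    Prop where
  sub : ∀ X ∈ W.fam, X ⊆ A1 ∪ A2
  cut1 : ∀ X ∈ W.fam, Cuts A1 X
  cut2 : ∀ X ∈ W.fam, Cuts A2 X
  pos : ∀ X ∈ W.fam, 0 < W.wt X
  lam : IsLaminar W.fam
  compl : ∀ X ∈ W.fam, (A1 ∪ A2) \ X ∉ W.fam
  diff : ∀ i ∈ A1, ∀ j ∈ A2, ∀ k ∈ A1, ∀ l ∈ A2,
    quadDiff (realPart a) i j k l = W.sum fun X => chi X i j k l

theorem TwoBlock.pairOutput (h : TwoBlock a A1 A2) (hW : Algorithm1 a A1 A2 (some W)) :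
    PairOutput a A1 A2 W := by
  classical
  obtain ⟨hCB, hM⟩ := hW
  have hN := h.normData
  have hS : ∀ X ∈ rawFam A1 A2 (normalize (A1 ∪ A2) a), X ⊆ A1 ∪ A2 := fun X hX =>
    hN.subset_union_of_mem (mem_insert_of_mem hX)
  refine ⟨fun X hX => hS X (hM.1 hX), fun X hX => (hN.cuts_of_mem_rawFam hCB (hM.1 hX)).1,
    fun X hX => (hN.cuts_of_mem_rawFam hCB (hM.1 hX)).2, fun X hX => ?_,
    fun X hX Y hY => rawFam_laminar (hM.1 hX) (hM.1 hY), fun X hX => ?_,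
    fun i hi j hj k hk l hl => ?_⟩
  · have h1 := hN.rawWt_pos hCB (hM.1 hX)
    rw [hM.2.2 X hX]
    split_ifs with h2
    · linarith [hN.rawWt_pos hCB h2]
    · linarith
  · grind [hM.2.1 X (hM.1 hX)]
  · rw [hM.sum_eq hS (fun X => chi X i j k l) (by grind [chi, ind]),
      ← quadDiff_normEntry a (A1 ∪ A2), quadDiff]
    have e : ∀ i ∈ A1, ∀ j ∈ A2, simil _ _ i j = _ := fun i hi j hj => hN.sum_rawWt hCB hi hj
    rw [sum_mul_chi, e i hi j hj, e k hk l hl, e i hi l hl, e k hk j hj]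
    ring

/-- Distinct members of the output of Algorithm 1 are not equivalent. -/
theorem PairOutput.eq_of_cutEquiv {B : ℕ → Finset (Fin n)}
    {p t : ℕ} (hW : PairOutput a (B p) (B t) W) (hd : ∀ i ∈ B p, i ∉ B t) (hX : X ∈ W.fam) (hY : Y ∈ W.fam) (h : CutEquiv B {p, t} X Y) :
    X = Y := by
  obtain ⟨ε, hε⟩ := (cutEquiv_pair_iff hd (hW.cut1 Y hY) (hW.cut2 Y hY)).mp h
  have hX' := hW.sub X hX
  have hY' := hW.sub Y hY
  by_cases h' : ε
  · grind
  · exact (hW.compl Y hY (by convert hX using 1; grind)).elim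

end LaminarPair

section Extension

variable {n : ℕ} {B : ℕ → Finset (Fin n)}
variable {Q : Finset ℕ} {W : WFam n} {X X0 Xs Y Z : Finset (Fin n)} {p : ℕ} {s : Alg2State n}
variable {w : ℝ}

/-- The blocks are pairwise disjoint. -/
def DisjBlocks (B : ℕ → Finset (Fin n)) : Prop := ∀ p q i, i ∈ B p → i ∈ B q → p = q

theorem DisjBlocks.on (hB : DisjBlocks B) (Q : Finset ℕ) :
    ∀ p ∈ Q, ∀ q ∈ Q, ∀ i, i ∈ B p → i ∈ B q → p = q := fun p _ q _ => hB p q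

theorem DisjBlocks.not_mem (hB : DisjBlocks B) {t : ℕ} (h : p ≠ t) : ∀ i ∈ B p, i ∉ B t :=
  fun i hi hi' => h (hB p t i hi hi')

/-- `X` cuts two of the blocks indexed by `Q`. -/
def TwoCuts (B : ℕ → Finset (Fin n)) (Q : Finset ℕ) (X : Finset (Fin n)) : Prop :=
  ∃ p ∈ Q, ∃ q ∈ Q, p ≠ q ∧ Cuts (B p) X ∧ Cuts (B q) X

theorem TwoCuts.congr (hB : DisjBlocks B)
    (h : CutEquiv B Q X Y) (hX : TwoCuts B Q X) : TwoCuts B Q Y := by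
  obtain ⟨p, hp, q, hq, hpq, h1, h2⟩ := hX
  exact ⟨p, hp, q, hq, hpq, (h.cuts_iff (hB.on Q) hp).mp h1, (h.cuts_iff (hB.on Q) hq).mp h2⟩

theorem cutIdx_congr (hB : DisjBlocks B)
    (h : CutEquiv B Q X Y) : cutIdx B Q X = cutIdx B Q Y := by
  ext p
  rw [mem_cutIdx, mem_cutIdx]
  exact and_congr_right fun hp => h.cuts_iff (hB.on Q) hp

theorem not_cuts_of_forall_not_mem {A : Finset (Fin n)} (h : ∀ i ∈ A, i ∉ X) : ¬ Cuts A X := by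
  rw [cuts_iff]
  grind

theorem not_mem_block_of_subset (hB : DisjBlocks B)
    (hX : X ⊆ Q.biUnion B) (hp : p ∉ Q) : ∀ i ∈ B p, i ∉ X := by
  grind [DisjBlocks]

/-- The members of a partial output are cuts, pairwise inequivalent, of positive weight, and
decompose the matrix `q`. -/
structure StageOutput (q : Fin n → Fin n → ℝ) (B : ℕ → Finset (Fin n)) (T : ℕ) (W : WFam n) :
    Prop where
  cut : ∀ X ∈ W.fam, IsCut B (range T) X
  nonred : ∀ X ∈ W.fam, ∀ Y ∈ W.fam, CutEquiv B (range T) X Y → X = Y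
  pos : ∀ X ∈ W.fam, 0 < W.wt X
  diff : ∀ p p', p < p' → p' < T → ∀ i ∈ B p, ∀ j ∈ B p', ∀ k ∈ B p, ∀ l ∈ B p',
    quadDiff q i j k l = W.sum fun X => chi X i j k l

/-- The initial state. -/
def startState (W' : WFam n) (L : ℕ → WFam n) : Alg2State n where
  old := W'
  pairs := L
  new := { fam := ∅, wt := fun _ => 0 }

variable {a : Fin n → Fin n → WithTop ℝ} {t : ℕ} {W' : WFam n} {L : ℕ → WFam n}

/-- The invariant of the loop of Algorithm 2, started in `startState W' L`. -/
structure LoopInv (a : Fin n → Fin n → WithTop ℝ) (B : ℕ → Finset (Fin n)) (t : ℕ)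
    (W' : WFam n) (L : ℕ → WFam n) (s : Alg2State n) : Prop where
  disj : DisjBlocks B
  out : StageOutput (realPart a) B t W'
  pair : ∀ p < t, PairOutput a (B p) (B t) (L p)
  old_sub : s.old.fam ⊆ W'.fam
  pairs_sub : ∀ p, (s.pairs p).fam ⊆ (L p).fam
  old_pos : ∀ X ∈ s.old.fam, 0 < s.old.wt X
  pairs_pos : ∀ p < t, ∀ X ∈ (s.pairs p).fam, 0 < (s.pairs p).wt X
  new_pos : ∀ X ∈ s.new.fam, 0 < s.new.wt X
  new_cut : ∀ X ∈ s.new.fam, IsCut B (range (t + 1)) X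
  new_src : ∀ X ∈ s.new.fam, Cuts (B t) X → ∃ X0 ∈ W'.fam, ∃ Y : ℕ → Finset (Fin n),
    IsComposition B t X0 Y X ∧ (∀ p ∈ cutIdx B (range t) X0, Y p ∈ (L p).fam) ∧
    (X0 ∉ s.old.fam ∨ ∃ p ∈ cutIdx B (range t) X0, Y p ∉ (s.pairs p).fam)
  new_kept : ∀ X ∈ s.new.fam, ¬ Cuts (B t) X → X ∈ W'.fam ∧ X ∉ s.old.fam
  nonred : ∀ X ∈ s.new.fam, ∀ Y ∈ s.new.fam, CutEquiv B (range (t + 1)) X Y → X = Y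
  diff : ∀ p p', p < p' → p' < t + 1 → ∀ i ∈ B p, ∀ j ∈ B p', ∀ k ∈ B p, ∀ l ∈ B p',
    (s.old.sum fun X => chi X i j k l) + ∑ u ∈ range t, ((s.pairs u).sum fun X => chi X i j k l) +
      (s.new.sum fun X => chi X i j k l) =
    (W'.sum fun X => chi X i j k l) + ∑ u ∈ range t, (L u).sum fun X => chi X i j k l

theorem loopInv_start (hB : DisjBlocks B) (hW' : StageOutput (realPart a) B t W')
    (hL : ∀ p < t, PairOutput a (B p) (B t) (L p)) : LoopInv a B t W' L (startState W' L) := by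
  refine ⟨hB, hW', hL, subset_rfl, fun _ => subset_rfl, hW'.pos, fun p hp => (hL p hp).pos,
    ?_, ?_, ?_, ?_, ?_, ?_⟩ <;> simp [startState, WFam.sum]

theorem mem_cutIdx_range :
    p ∈ cutIdx B (range t) X ↔ p < t ∧ Cuts (B p) X := by
  rw [mem_cutIdx, mem_range]

attribute [grind =] mem_cutIdx mem_cutIdx_range mem_cutSupport

attribute [grind] DisjBlocks

/-- Facts about a composition. -/
theorem IsComposition.cuts_last (hB : DisjBlocks B)
    {X : ℕ → Finset (Fin n)} (h : IsComposition B t X0 X Xs) (hX0 : IsCut B (range t) X0)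
    (hX : ∀ p ∈ cutIdx B (range t) X0, Cuts (B t) (X p)) : Cuts (B t) Xs := by
  obtain ⟨-, p, hp, -, -, -, hc, -⟩ := hX0
  exact ((h.2.2 p (by grind)).cuts_iff (hB.on _) (by simp)).mpr (hX p (by grind))

theorem range_subset_succ : range t ⊆ range (t + 1) := by grind

theorem pair_subset_range (hp : p < t) : ({p, t} : Finset ℕ) ⊆ range (t + 1) := by grind

theorem chi_composition (hB : DisjBlocks B) {X : ℕ → Finset (Fin n)}
    (h : IsComposition B t X0 X Xs) (hX0 : X0 ⊆ (range t).biUnion B)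
    (hX : ∀ p ∈ cutIdx B (range t) X0, X p ⊆ B p ∪ B t) {p' : ℕ} (hpp : p < p')
    (hp' : p' < t + 1) {i j k l : Fin n} (hi : i ∈ B p) (hj : j ∈ B p') (hk : k ∈ B p)
    (hl : l ∈ B p') :
    chi Xs i j k l = chi X0 i j k l + ∑ u ∈ cutIdx B (range t) X0, chi (X u) i j k l := by
  have hpt : p < t := by omega
  have hout : ∀ u ∈ cutIdx B (range t) X0, ∀ v, v ≠ u → v ≠ t → ¬ Cuts (B v) (X u) :=
    fun u hu v hvu hvt => not_cuts_of_forall_not_mem fun x hx hxX => by grind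
  have hzero : ∀ u ∈ cutIdx B (range t) X0, u ≠ p → chi (X u) i j k l = 0 := fun u hu hup =>
    chi_eq_zero_left (hout u hu p hup.symm hpt.ne) hi hk j l
  by_cases hpt' : p' = t
  · subst hpt'
    rw [chi_eq_zero_right (not_cuts_of_forall_not_mem
      (not_mem_block_of_subset hB hX0 (by simp))) hj hl, zero_add]
    by_cases hp : p ∈ cutIdx B (range p') X0
    · rw [sum_eq_single_of_mem p hp hzero]
      exact chi_congr (hB.on _) (h.2.2 p hp) (by simp) (by simp) hi hk hj hl
    · rw [sum_eq_zero fun u hu => hzero u hu (by grind)]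
      refine chi_eq_zero_left (A := B p) (fun hc => hp ?_) hi hk j l
      exact mem_cutIdx_range.mpr ⟨hpt, (h.2.1.cuts_iff (hB.on _) (by simpa using hpt)).mp hc⟩
  · rw [sum_eq_zero, add_zero]
    · exact chi_congr (hB.on _) h.2.1 (p := p) (q := p') (by simpa using hpt)
        (by grind) hi hk hj hl
    · intro u hu
      by_cases hup : u = p
      · exact chi_eq_zero_right (hout u hu p' (by omega) hpt') hj hl i k
      grind

theorem LoopInv.nonred_compose (h : LoopInv a B t W' L s) {X : ℕ → Finset (Fin n)}
    (hX0 : X0 ∈ s.old.fam) (hX : ∀ p ∈ cutIdx B (range t) X0, X p ∈ (s.pairs p).fam)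
    (hXs : IsComposition B t X0 X Xs) :
    ∀ Z ∈ s.new.fam, ¬ CutEquiv B (range (t + 1)) Z Xs := by
  intro Z hZ hZX
  have hB := h.disj
  have hXt := hXs.cuts_last hB (h.out.cut X0 (h.old_sub hX0)) fun p hp =>
    (h.pair p (mem_cutIdx_range.mp hp).1).cut2 _ (h.pairs_sub p (hX p hp))
  obtain ⟨X0', hX0', Y, hY, hYL, hsrc⟩ := h.new_src Z hZ ((hZX.cuts_iff (hB.on _) (by simp)).mpr hXt)
  obtain rfl : X0' = X0 := h.out.nonred _ hX0' _ (h.old_sub hX0)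
    (hY.2.1.symm.trans ((hZX.mono (hB.on _) range_subset_succ).trans hXs.2.1))
  rcases hsrc with h3 | ⟨p, hp, h3⟩
  · exact h3 hX0
  · have hpt := (mem_cutIdx_range.mp hp).1
    have h5 := (h.pair p hpt).eq_of_cutEquiv (hB.not_mem (by omega)) (hYL p hp)
      (h.pairs_sub p (hX p hp)) ((hY.2.2 p hp).symm.trans
        ((hZX.mono (hB.on _) (pair_subset_range hpt)).trans (hXs.2.2 p hp)))
    grind

theorem LoopInv.not_cuts (h : LoopInv a B t W' L s) (hX : X ∈ W'.fam) : ¬ Cuts (B t) X :=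
  not_cuts_of_forall_not_mem (not_mem_block_of_subset h.disj (h.out.cut X hX).1 (by simp))

theorem LoopInv.nonred_keep (h : LoopInv a B t W' L s) (hX0 : X0 ∈ s.old.fam) :
    ∀ Z ∈ s.new.fam, ¬ CutEquiv B (range (t + 1)) Z X0 := by
  intro Z hZ hZX
  obtain ⟨h1, h2⟩ := h.new_kept Z hZ fun hc =>
    h.not_cuts (h.old_sub hX0) ((hZX.cuts_iff (h.disj.on _) (by simp)).mp hc)
  have := h.out.nonred Z h1 X0 (h.old_sub hX0) (hZX.mono (h.disj.on _) range_subset_succ)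
  grind

theorem put_nonred (h : ∀ X ∈ W.fam, ∀ Y ∈ W.fam,
    CutEquiv B Q X Y → X = Y) (hZ : ∀ X ∈ W.fam, ¬ CutEquiv B Q X Z)
    (w : ℝ) : ∀ X ∈ (W.put Z w).fam, ∀ Y ∈ (W.put Z w).fam, CutEquiv B Q X Y → X = Y := by
  grind [WFam.put, CutEquiv.symm]

theorem put_pos (h : ∀ X ∈ W.fam, 0 < W.wt X)
    (hw : 0 < w) : ∀ X ∈ (W.put Z w).fam, 0 < (W.put Z w).wt X := by
  simp only [WFam.put]
  grind

theorem loopInv_of_run (hB : DisjBlocks B) (hW' : StageOutput (realPart a) B t W')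
    (hL : ∀ p < t, PairOutput a (B p) (B t) (L p))
    (hs : Relation.ReflTransGen (Alg2Step B t) (startState W' L) s) : LoopInv a B t W' L s := by
  induction hs with
  | refl => exact loopInv_start hB hW' hL
  | @tail s _ _ hstep h =>
  cases hstep with
  | compose X0 X Xs w hX0 hX hXs hw =>
    replace hX0 := hX0.1
    replace hX := hX.2
    have hred := h.nonred_compose hX0 hX hXs
    have hcut := hW'.cut X0 (h.old_sub hX0)
    have hpt : ∀ p ∈ cutIdx B (range t) X0, p < t := fun p hp => (mem_cutIdx_range.mp hp).1
    have hnew : Xs ∉ s.new.fam := fun h' => hred Xs h' (CutEquiv.refl _ _ _)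
    have hwpos : 0 < w := by
      rcases hw.1 with rfl | ⟨p, hp, rfl⟩
      exacts [h.old_pos X0 hX0, h.pairs_pos p (hpt p hp) _ (hX p hp)]
    have hsubp : ∀ p, (if p ∈ cutIdx B (range t) X0 then (s.pairs p).dec (X p) w
        else s.pairs p).fam ⊆ (s.pairs p).fam := by
      intro p
      split_ifs
      exacts [fun _ => WFam.mem_dec, subset_rfl]
    refine
      { h with
        old_sub := fun Y hY => h.old_sub (WFam.mem_dec hY)
        pairs_sub := fun p => (hsubp p).trans (h.pairs_sub p)
        old_pos := WFam.dec_pos h.old_pos (hw.2 (Set.mem_insert _ _))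
        pairs_pos := fun p hp => ?_
        new_pos := put_pos h.new_pos hwpos
        new_cut := fun Y hY => ?_
        new_src := fun Y hY hYc => ?_
        new_kept := fun Y hY hYc => ?_
        nonred := put_nonred h.nonred hred _
        diff := fun p p' hpp hp' i hi j hj k hk l hl => ?_ }
    · simp only
      split_ifs with hp'
      · exact WFam.dec_pos (h.pairs_pos p hp) (hw.2 (Set.mem_insert_of_mem _ ⟨p, hp', rfl⟩))
      · exact h.pairs_pos p hp
    · rcases mem_insert.mp hY with rfl | hY
      exacts [hXs.1, h.new_cut Y hY]
    · rcases mem_insert.mp hY with rfl | hY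
      · refine ⟨X0, h.old_sub hX0, X, hXs, fun p hp => h.pairs_sub p (hX p hp), ?_⟩
        rcases hw.1 with h1 | ⟨p, hp, h1⟩
        · simp [WFam.dec, h1]
        · exact .inr ⟨p, hp, by simp [WFam.dec, h1, hp]⟩
      · obtain ⟨X0', h1, Z, h2, h3, h4⟩ := h.new_src Y hY hYc
        refine ⟨X0', h1, Z, h2, h3, h4.imp (fun h5 h6 => h5 (WFam.mem_dec h6)) ?_⟩
        grind
    · rcases mem_insert.mp hY with rfl | hY
      · exact (hYc (hXs.cuts_last hB hcut fun p hp =>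
          (hL p (hpt p hp)).cut2 _ (h.pairs_sub p (hX p hp)))).elim
      · exact (h.new_kept Y hY hYc).imp_right fun h2 h6 => h2 (WFam.mem_dec h6)
    · rw [← h.diff p p' hpp hp' i hi j hj k hk l hl]
      simp only
      rw [WFam.sum_dec _ hX0, WFam.sum_put _ hnew]
      have hsum : ∑ u ∈ range t, ((if u ∈ cutIdx B (range t) X0 then (s.pairs u).dec (X u) w
          else s.pairs u).sum fun Y => chi Y i j k l) =
          ∑ u ∈ range t, ((s.pairs u).sum fun Y => chi Y i j k l) -
            w * ∑ u ∈ cutIdx B (range t) X0, chi (X u) i j k l := by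
        rw [mul_sum, ← inter_eq_right.mpr fun p hp => mem_range.mpr (hpt p hp),
          ← filter_mem_eq_inter, sum_filter, ← sum_sub_distrib]
        refine sum_congr rfl fun u _ => ?_
        split_ifs with hu <;> grind [WFam.sum_dec]
      rw [hsum, chi_composition hB hXs hcut.1 (fun p hp =>
        (hL p (hpt p hp)).sub _ (h.pairs_sub p (hX p hp))) hpp hp' hi hj hk hl]
      ring
  | keep X0 hX0 hX =>
    replace hX0 := hX0.1
    have hred := h.nonred_keep hX0
    have hnew : X0 ∉ s.new.fam := fun h' => hred X0 h' (CutEquiv.refl _ _ _)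
    refine
      { h with
        old_sub := (erase_subset _ _).trans h.old_sub
        old_pos := fun X hX => h.old_pos X (mem_of_mem_erase hX)
        new_pos := put_pos h.new_pos (h.old_pos X0 hX0)
        new_cut := fun X hX => ?_
        new_src := fun X hX hXc => ?_
        new_kept := fun X hX hXc => ?_
        nonred := put_nonred h.nonred hred _
        diff := fun p p' hpp hp' i hi j hj k hk l hl => ?_ }
    · rcases mem_insert.mp hX with rfl | hX
      · obtain ⟨h1, p, hp, q, hq, h2⟩ := hW'.cut X (h.old_sub hX0)
        exact ⟨h1.trans (biUnion_subset_biUnion_of_subset_left _ range_subset_succ), p, by grind, q,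
          by grind, h2⟩
      · exact h.new_cut X hX
    · rcases mem_insert.mp hX with rfl | hX
      · exact (h.not_cuts (h.old_sub hX0) hXc).elim
      · obtain ⟨X0', h1, Y, h2, h3, h4⟩ := h.new_src X hX hXc
        grind
    · rcases mem_insert.mp hX with rfl | hX
      · exact ⟨h.old_sub hX0, notMem_erase _ _⟩
      · grind [h.new_kept X hX hXc]
    · rw [← h.diff p p' hpp hp' i hi j hj k hk l hl]
      simp only
      rw [WFam.sum_erase _ hX0, WFam.sum_put _ hnew]
      ring

/-! ### Collecting the output -/

theorem LoopInv.pairs_not_cuts (h : LoopInv a B t W' L s) (hp : p < t)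
    (hX : X ∈ (s.pairs p).fam) {q : ℕ} (hqp : q ≠ p) (hqt : q ≠ t) : ¬ Cuts (B q) X :=
  not_cuts_of_forall_not_mem fun x hx hxX => by
    have := (h.pair p hp).sub X (h.pairs_sub p hX) hxX
    have := h.disj
    grind

theorem LoopInv.new_twoCuts (h : LoopInv a B t W' L s)
    (hX : X ∈ s.new.fam) : TwoCuts B (range t) X := by
  by_cases hXt : Cuts (B t) X
  · obtain ⟨X0, hX0, Y, hY, -⟩ := h.new_src X hX hXt
    exact TwoCuts.congr h.disj hY.2.1.symm (h.out.cut X0 hX0).2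
  · exact (h.out.cut X (h.new_kept X hX hXt).1).2

theorem LoopInv.pairs_not_twoCuts (h : LoopInv a B t W' L s) (hp : p < t)
    (hX : X ∈ (s.pairs p).fam) : ¬ TwoCuts B (range t) X := by
  rintro ⟨q, hq, q', hq', hne, h1, h2⟩
  grind [h.pairs_not_cuts hp hX (q := q), h.pairs_not_cuts hp hX (q := q')]

theorem LoopInv.collect_sum (h : LoopInv a B t W' L s) (hW : Collect t s W)
    (φ : Finset (Fin n) → ℝ) :
    W.sum φ = s.new.sum φ + ∑ p ∈ range t, (s.pairs p).sum φ := by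
  classical
  have h1 : ∀ p < t, ∀ X ∈ (s.pairs p).fam, X ∉ s.new.fam := fun p hp X hX hX' =>
    h.pairs_not_twoCuts hp hX (h.new_twoCuts hX')
  have h2 : ∀ p < t, ∀ q < t, ∀ X, X ∈ (s.pairs p).fam → X ∈ (s.pairs q).fam → p = q :=
    fun p hp q hq X hXp hXq => by_contra fun hpq => h.pairs_not_cuts hq hXq hpq (by omega)
      ((h.pair p hp).cut1 X (h.pairs_sub p hXp))
  obtain ⟨hf, hw1, hw2⟩ := hW
  clear h
  unfold WFam.sum
  rw [hf, sum_union, sum_biUnion]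
  · congr 1
    · exact sum_congr rfl fun X hX => by grind
    · exact sum_congr rfl fun p hp => sum_congr rfl fun X hX => by grind
  · intro p hp q hq hpq
    rw [onFun, disjoint_left]
    grind
  · rw [disjoint_right]
    grind

theorem stageOutput_collect (hB : DisjBlocks B) (hW' : StageOutput (realPart a) B t W')
    (hL : ∀ p < t, PairOutput a (B p) (B t) (L p))
    (hs : Relation.ReflTransGen (Alg2Step B t) (startState W' L) s) (hend : s.old.fam = ∅) (hW : Collect t s W) : StageOutput (realPart a) B (t + 1) W := by
  have h := loopInv_of_run hB hW' hL hs
  have hmem : ∀ X ∈ W.fam, X ∈ s.new.fam ∨ ∃ p < t, X ∈ (s.pairs p).fam := by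
    simp [hW.1]
  have hdisj1 : ∀ p < t, ∀ X ∈ (s.pairs p).fam, X ∉ s.new.fam := fun p hp X hX hX' =>
    h.pairs_not_twoCuts hp hX (h.new_twoCuts hX')
  have hmix : ∀ X ∈ s.new.fam, ∀ p < t, ∀ Y ∈ (s.pairs p).fam,
      ¬ CutEquiv B (range (t + 1)) X Y := fun X hX p hp Y hY hXY =>
    h.pairs_not_twoCuts hp hY (TwoCuts.congr hB
      (hXY.mono (hB.on _) range_subset_succ) (h.new_twoCuts hX))
  refine ⟨fun X hX => ?_, fun X hX Y hY hXY => ?_, fun X hX => ?_,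
    fun p p' hpp hp' i hi j hj k hk l hl => ?_⟩
  · rcases hmem X hX with hX | ⟨p, hp, hX⟩
    · exact h.new_cut X hX
    · have hX := h.pairs_sub p hX
      refine ⟨fun x hx => ?_, p, by grind, t, by simp, hp.ne, (hL p hp).cut1 X hX,
        (hL p hp).cut2 X hX⟩
      have := (hL p hp).sub X hX hx
      grind
  · rcases hmem X hX with hX | ⟨p, hp, hX⟩ <;> rcases hmem Y hY with hY | ⟨q, hq, hY⟩
    · exact h.nonred X hX Y hY hXY
    · grind
    · exact (hmix Y hY p hp X hX hXY.symm).elim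
    · have hX' := h.pairs_sub p hX
      have hpc := (hXY.cuts_iff (hB.on _) (p := p) (by grind)).mp ((hL p hp).cut1 X hX')
      obtain rfl : p = q := by_contra fun hpq => h.pairs_not_cuts hq hY hpq hp.ne hpc
      exact (hL p hp).eq_of_cutEquiv (hB.not_mem hp.ne) hX' (h.pairs_sub p hY)
        (hXY.mono (hB.on _) (pair_subset_range hp))
  · rcases hmem X hX with hX' | ⟨p, hp, hX'⟩
    · rw [hW.2.2 X hX' fun p hp hXp => hdisj1 p hp X hXp hX']
      exact h.new_pos X hX'
    · rw [hW.2.1 p hp X hX']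
      exact h.pairs_pos p hp X hX'
  · have h0 := loopInv_start hB hW' hL
    have hz : ∀ u < t, ∀ q, q = p ∨ q = p' → q ≠ u → q ≠ t →
        (L u).sum (fun X => chi X i j k l) = 0 := fun u hu q hq hqu hqt =>
      sum_eq_zero fun X hX => by
        have := h0.pairs_not_cuts hu hX hqu hqt
        beta_reduce
        rcases hq with rfl | rfl
        · rw [chi_eq_zero_left this hi hk, mul_zero]
        · rw [chi_eq_zero_right this hj hl, mul_zero]
    have h1 := h.diff p p' hpp hp' i hi j hj k hk l hl
    rw [WFam.sum, hend, sum_empty, zero_add, add_comm] at h1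
    rw [h.collect_sum hW, h1]
    by_cases hpt : p' = t
    · subst hpt
      have h3 : W'.sum (fun X => chi X i j k l) = 0 := sum_eq_zero fun X hX => by
        beta_reduce
        rw [chi_eq_zero_right (h.not_cuts hX) hj hl, mul_zero]
      rw [h3, zero_add, sum_eq_single_of_mem p (by simpa using hpp)]
      · exact (hL p hpp).diff i hi j hj k hk l hl
      · exact fun u hu hup => hz u (by simpa using hu) p (.inl rfl) hup.symm hpp.ne
    · rw [hW'.diff p p' hpp (by omega) i hi j hj k hk l hl, sum_eq_zero, add_zero]
      intro u hu
      by_cases hup : p = u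
      · exact hz u (by grind) p' (.inr rfl) (by omega) hpt
      · exact hz u (by grind) p (.inl rfl) hup (by omega)

end Extension

section Tracking

variable {n : ℕ} {B : ℕ → Finset (Fin n)}
variable {Q : Finset ℕ} {W : WFam n} {X X0 Xs Y : Finset (Fin n)} {p : ℕ} {s : Alg2State n}

/-- Oriented members that agree with `Xs` on the pairs of blocks `p`, `t` and a member that agrees
with it on all the blocks `p` can be replaced by a single member. -/
theorem exists_oriented_agree {G : Finset (Finset (Fin n))} (hG : IsLaminar G)
    {P : Finset ℕ} (hP : P.Nonempty) {t : ℕ} {Z0 : Finset (Fin n)} (hcP : ∀ p ∈ P, Cuts (B p) Xs)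
    (hct : Cuts (B t) Xs) (hZ0 : Oriented G Z0) (hZ₀X : ∀ p ∈ P, ∀ i ∈ B p, (i ∈ Z0 ↔ i ∈ Xs))
    (f : ℕ → Finset (Fin n)) (hf : ∀ p ∈ P, Oriented G (f p))
    (hfX : ∀ p ∈ P, ∀ i ∈ B p ∪ B t, (i ∈ f p ↔ i ∈ Xs)) :
    ∃ Z, Oriented G Z ∧ (∀ p ∈ P, ∀ i ∈ B p, (i ∈ Z ↔ i ∈ Xs)) ∧ ∀ i ∈ B t, (i ∈ Z ↔ i ∈ Xs) := by
  obtain ⟨⟨u, hu, hu'⟩, v, hv, hv'⟩ := cuts_iff.mp hct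
  have hft : ∀ p ∈ P, ∀ i ∈ B t, (i ∈ f p ↔ i ∈ Xs) := by grind
  have hfp : ∀ p ∈ P, ∀ i ∈ B p, (i ∈ f p ↔ i ∈ Xs) := by grind
  have hchain : ∀ p ∈ P, ∀ q ∈ P, f p ⊆ f q ∨ f q ⊆ f p := fun p hp q hq =>
    (hf p hp).subset_or_subset hG (hf q hq) ((hft p hp u hu).mpr hu') ((hft q hq u hu).mpr hu')
      (mt (hft p hp v hv).mp hv') (mt (hft q hq v hv).mp hv')
  have hchain₀ : ∀ p ∈ P, Z0 ⊆ f p ∨ f p ⊆ Z0 := by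
    intro p hp
    obtain ⟨⟨x, hx, hx'⟩, y, hy, hy'⟩ := cuts_iff.mp (hcP p hp)
    exact hZ0.subset_or_subset hG (hf p hp) ((hZ₀X p hp x hx).mpr hx') ((hfp p hp x hx).mpr hx')
      (mt (hZ₀X p hp y hy).mp hy') (mt (hfp p hp y hy).mp hy')
  by_cases h1 : ∀ p ∈ P, Z0 ⊆ f p
  · obtain ⟨x, hx, hbot⟩ := exists_bot_of_chain hP f hchain
    grind
  by_cases h2 : ∀ p ∈ P, f p ⊆ Z0
  · obtain ⟨x, hx, htop⟩ := exists_top_of_chain hP f hchain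
    exact ⟨f x, hf x hx, by grind, hft x hx⟩
  grind

/-- An oriented member agreeing with `X` on the cut blocks. -/
theorem exists_oriented_of_equiv (hB : DisjBlocks B)
    {G : Finset (Finset (Fin n))} (hY : Y ∈ G) (h : CutEquiv B Q Y X) :
    ∃ Z, Oriented G Z ∧ ∀ p ∈ cutIdx B Q X, ∀ x ∈ B p, (x ∈ Z ↔ x ∈ X) := by
  obtain ⟨h1, ε, h2⟩ := (cutEquiv_iff (hB.on Q)).mp h
  have h3 : ∀ p ∈ cutIdx B Q X, ∀ i ∈ B p, (i ∈ Y ↔ (i ∈ X ↔ ε)) := fun p hp =>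
    h2 p (mem_cutIdx.mp hp).1 ((h1 p (mem_cutIdx.mp hp).1).mpr (mem_cutIdx.mp hp).2)
  by_cases h' : ε
  · exact ⟨Y, .inl hY, by grind⟩
  · exact ⟨Yᶜ, by simpa [Oriented] using .inr hY, by simp only [mem_compl]; grind⟩

theorem cutSupport_ssubset (hB : DisjBlocks B)
    (h : cutIdx B Q X ⊂ cutIdx B Q Y) : cutSupport B Q X ⊂ cutSupport B Q Y := by
  obtain ⟨h1, h2⟩ := h
  constructor
  · intro i hi
    obtain ⟨p, hp, hc, hi⟩ := mem_cutSupport.mp hi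
    have := mem_cutIdx.mp (h1 (mem_cutIdx.mpr ⟨hp, hc⟩))
    grind
  · intro h3
    refine h2 fun p hp => ?_
    obtain ⟨hp, hc⟩ := mem_cutIdx.mp hp
    obtain ⟨⟨i, hi, -⟩, -⟩ := cuts_iff.mp hc
    obtain ⟨q, hq, hc', hi'⟩ := mem_cutSupport.mp (h3 (mem_cutSupport.mpr ⟨p, hp, hc, hi⟩))
    grind

theorem classWt_sdiff {ι : Type} {B : ι → Finset (Fin n)} {Q : Finset ι}
    {G G' : Finset (Finset (Fin n))} (h : G' ⊆ G) (c : Finset (Fin n) → ℝ) (X : Finset (Fin n)) :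
    classWt B Q (G \ G') c X = classWt B Q G c X - classWt B Q G' c X := by
  classical
  unfold classWt
  rw [← sum_sdiff h]
  ring

theorem classWt_mem
    (hW : ∀ X ∈ W.fam, ∀ Y ∈ W.fam, CutEquiv B Q X Y → X = Y)
    (hX : X ∈ W.fam) : classWt B Q W.fam W.wt X = W.wt X := by
  unfold classWt
  rw [sum_eq_single_of_mem X hX]
  · rw [eqInd_pos (CutEquiv.refl _ _ _), mul_one]
  · intro Y hY hYX
    rw [eqInd_neg fun h => hYX (hW Y hY X hX h), mul_zero]

theorem classWt_filter_not (hB : DisjBlocks B) {Q' : Finset ℕ} (hQ : Q ⊆ Q')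
    (G : Finset (Finset (Fin n))) (c : Finset (Fin n) → ℝ) (X Xs : Finset (Fin n))
    [DecidablePred fun Y => ¬ CutEquiv B Q' Y Xs] :
    classWt B Q (G.filter fun Y => ¬ CutEquiv B Q' Y Xs) c X =
      classWt B Q G c X - classWt B Q' G c Xs * eqInd B Q X Xs := by
  classical
  unfold classWt
  rw [sum_filter, sum_mul, ← sum_sub_distrib]
  refine sum_congr rfl fun Y _ => ?_
  by_cases h : CutEquiv B Q' Y Xs
  · rw [if_neg (by simpa using h), eqInd_pos h, eqInd_congr (h.mono (hB.on _) hQ)]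
    ring
  · rw [if_pos h, eqInd_neg h]
    ring

/-- The class weights of the laminar family `G` agree with those of the weighted family `W` over
the first `T` blocks. -/
def Tracks (B : ℕ → Finset (Fin n)) (T : ℕ) (G : Finset (Finset (Fin n))) (c : Finset (Fin n) → ℝ)
    (W : WFam n) : Prop :=
  ∀ X, TwoCuts B (range T) X → classWt B (range T) G c X = classWt B (range T) W.fam W.wt X

/-- The state `s` agrees with the remaining part `G'` of `G`. -/
structure Track (B : ℕ → Finset (Fin n)) (t : ℕ) (G : Finset (Finset (Fin n)))
    (c : Finset (Fin n) → ℝ) (G' : Finset (Finset (Fin n))) (s : Alg2State n) : Prop where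
  sub : G' ⊆ G
  old : Tracks B t G' c s.old
  pairs : ∀ p < t, ∀ X, Cuts (B p) X → Cuts (B t) X →
    classWt B {p, t} G' c X = classWt B {p, t} (s.pairs p).fam (s.pairs p).wt X
  new : Tracks B (t + 1) (G \ G') c s.new

variable {a : Fin n → Fin n → WithTop ℝ} {t : ℕ} {W' : WFam n} {L : ℕ → WFam n}
  {G G' : Finset (Finset (Fin n))} {c : Finset (Fin n) → ℝ}

/-- A composition is represented in every subfamily of the remaining family that represents its
components. -/
theorem Track.exists_member (h : LoopInv a B t W' L s) (hG : IsLaminar G) (hc : ∀ X ∈ G, 0 < c X) (hT : Track B t G c G' s)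
    {X : ℕ → Finset (Fin n)} (hcut0 : TwoCuts B (range t) X0) (hX0 : Selectable B t s X0)
    (hXt : Cuts (B t) Xs) (hXs : IsComposition B t X0 X Xs) {G'' : Finset (Finset (Fin n))}
    (hsub : G'' ⊆ G') (h0 : ∃ Y ∈ G'', CutEquiv B (range t) Y X0)
    (hp : ∀ p ∈ cutIdx B (range t) X0, ∃ Y ∈ G'', CutEquiv B {p, t} Y (X p)) :
    ∃ Y ∈ G'', CutEquiv B (range (t + 1)) Y Xs := by
  classical
  have hB := h.disj
  have hsubG := hsub.trans hT.sub
  have hlam : IsLaminar G'' := fun U hU V hV => hG U (hsubG hU) V (hsubG hV)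
  set P := cutIdx B (range t) X0 with hP
  have hPs : cutIdx B (range t) Xs = P := cutIdx_congr hB hXs.2.1
  have hPt : ∀ p ∈ P, p < t := fun p hp => (mem_cutIdx_range.mp hp).1
  have hPc : ∀ p ∈ P, Cuts (B p) Xs := fun p hp => (mem_cutIdx_range.mp (hPs ▸ hp)).2
  obtain ⟨Y0, hY0, hY₀X⟩ := h0
  obtain ⟨Z0, hZ0, hZ₀X⟩ := exists_oriented_of_equiv hB hY0 (hY₀X.trans hXs.2.1.symm)
  rw [hPs] at hZ₀X
  have hex : ∀ p ∈ P, ∃ Z, Oriented G'' Z ∧ ∀ i ∈ B p ∪ B t, (i ∈ Z ↔ i ∈ Xs) := by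
    intro p hpP
    obtain ⟨Y, hY, hYX⟩ := hp p hpP
    exact exists_oriented_of_cutEquiv (hB.not_mem (hPt p hpP).ne) hY (hPc p hpP) hXt
      (hYX.trans (hXs.2.2 p hpP).symm)
  choose! f hf using hex
  have hPne : P.Nonempty := by
    obtain ⟨p, hp, -, -, -, hc, -⟩ := hcut0
    grind
  obtain ⟨Z, hZ, hZP, hZt⟩ := exists_oriented_agree hlam hPne hPc hXt hZ0 hZ₀X f
    (fun p hp => (hf p hp).1) fun p hp => (hf p hp).2
  obtain ⟨Y, hY, ε, hε⟩ : ∃ Y ∈ G'', ∃ ε : Prop, ∀ i, (i ∈ Y ↔ (i ∈ Z ↔ ε)) := by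
    rcases hZ with hZ | hZ
    · exact ⟨Z, hZ, True, fun i => by simp⟩
    · exact ⟨Zᶜ, hZ, False, fun i => by simp⟩
  have hYP : ∀ p, p ∈ P ∨ p = t → ∀ i ∈ B p, (i ∈ Y ↔ (i ∈ Xs ↔ ε)) := by grind
  have hYcut : ∀ p, p ∈ P ∨ p = t → Cuts (B p) Xs → Cuts (B p) Y := by
    intro p hp hcp
    rw [cuts_iff] at hcp ⊢
    grind
  have hPY : P ⊆ cutIdx B (range t) Y := by grind
  have hYtwo : TwoCuts B (range t) Y := by
    obtain ⟨p, hp, q, hq, hpq, h1, h2⟩ := hcut0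
    exact ⟨p, hp, q, hq, hpq, by grind, by grind⟩
  have hYold : ∃ V ∈ s.old.fam, CutEquiv B (range t) V Y := by
    rw [← classWt_pos_iff h.old_pos, ← hT.old Y hYtwo,
      classWt_pos_iff fun X hX => hc X (hT.sub hX)]
    exact ⟨Y, hsub hY, CutEquiv.refl _ _ _⟩
  obtain ⟨V, hV, hVY⟩ := hYold
  have hPeq : cutIdx B (range t) Y = P := by
    by_contra hne
    refine hX0.2 V hV (cutSupport_ssubset hB ?_)
    rw [cutIdx_congr hB hVY]
    grind
  refine ⟨Y, hY, (cutEquiv_iff (hB.on _)).mpr ⟨by grind, ε, by grind⟩⟩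

theorem eqInd_pair_eq_zero (hB : DisjBlocks B)
    (hX : Cuts (B p) X) (h : ¬ Cuts (B p) Xs) : eqInd B {p, t} X Xs = 0 :=
  eqInd_neg fun h' => h ((h'.cuts_iff (hB.on _) (by simp)).mpr hX)

theorem track_of_run (hB : DisjBlocks B) (hG : IsLaminar G) (hc : ∀ X ∈ G, 0 < c X)
    (hW' : StageOutput (realPart a) B t W')
    (hL : ∀ p < t, PairOutput a (B p) (B t) (L p)) (hT' : Tracks B t G c W')
    (hTL : ∀ p < t, ∀ X, Cuts (B p) X → Cuts (B t) X →
      classWt B {p, t} G c X = classWt B {p, t} (L p).fam (L p).wt X)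
    (hs : Relation.ReflTransGen (Alg2Step B t) (startState W' L) s) :
    ∃ G', Track B t G c G' s := by
  classical
  induction hs with
  | refl => exact ⟨G, subset_rfl, hT', hTL, fun X _ => by simp [classWt, startState]⟩
  | @tail s _ hrun hstep ih =>
  obtain ⟨G', hT⟩ := ih
  have h := loopInv_of_run hB hW' hL hrun
  have hcG' : ∀ X ∈ G', 0 < c X := fun X hX => hc X (hT.sub hX)
  have hred0 : ∀ X ∈ s.old.fam, ∀ Y ∈ s.old.fam, CutEquiv B (range t) X Y → X = Y :=
    fun X hX Y hY => hW'.nonred X (h.old_sub hX) Y (h.old_sub hY)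
  have fin : ∀ {Xs w} {old' : WFam n} {pairs' : ℕ → WFam n}, Xs ∉ s.new.fam →
      classWt B (range (t + 1)) G' c Xs = w →
      (∀ Y, classWt B (range t) s.old.fam s.old.wt Y - w * eqInd B (range t) Y Xs =
        classWt B (range t) old'.fam old'.wt Y) →
      (∀ p < t, ∀ Y, Cuts (B p) Y → Cuts (B t) Y →
        classWt B {p, t} (s.pairs p).fam (s.pairs p).wt Y - w * eqInd B {p, t} Y Xs =
          classWt B {p, t} (pairs' p).fam (pairs' p).wt Y) →
      ∃ G'', Track B t G c G'' ⟨old', pairs', s.new.put Xs w⟩ := by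
    intro Xs w old' pairs' hnew hw h1 h2
    have hsub : G'.filter (fun Y => ¬ CutEquiv B (range (t + 1)) Y Xs) ⊆ G' := filter_subset _ _
    refine ⟨_, hsub.trans hT.sub, fun Y hY => ?_, fun p hp Y hY1 hY2 => ?_, fun Y hY => ?_⟩
    · rw [classWt_filter_not hB range_subset_succ, hw, hT.old Y hY, h1]
    · rw [classWt_filter_not hB (pair_subset_range hp), hw, hT.pairs p hp Y hY1 hY2,
        h2 p hp Y hY1 hY2]
    · have h3 := hT.new Y hY
      rw [classWt_sdiff hT.sub] at h3
      rw [classWt_sdiff (hsub.trans hT.sub), classWt_filter_not hB subset_rfl, hw]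
      have h4 : classWt B (range (t + 1)) (s.new.put Xs w).fam (s.new.put Xs w).wt Y = _ :=
        WFam.sum_put s.new hnew w (eqInd B (range (t + 1)) Y)
      rw [h4]
      simp only [WFam.sum, classWt] at h3 ⊢
      linarith
  cases hstep with
  | compose X0 X Xs w hX0 hX hXs hw =>
    replace hX := hX.2
    have hcut := hW'.cut X0 (h.old_sub hX0.1)
    have hpt : ∀ p ∈ cutIdx B (range t) X0, p < t := fun p hp => (mem_cutIdx_range.mp hp).1
    have hXt := hXs.cuts_last hB hcut fun p hp =>
      (hL p (hpt p hp)).cut2 _ (h.pairs_sub p (hX p hp))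
    have hwt0 : classWt B (range t) G' c X0 = s.old.wt X0 := by
      rw [hT.old X0 hcut.2, classWt_mem hred0 hX0.1]
    have hwtp : ∀ p ∈ cutIdx B (range t) X0,
        classWt B {p, t} G' c (X p) = (s.pairs p).wt (X p) := by
      intro p hp
      have hLp := hL p (hpt p hp)
      have hXp := h.pairs_sub p (hX p hp)
      rw [hT.pairs p (hpt p hp) _ (hLp.cut1 _ hXp) (hLp.cut2 _ hXp),
        classWt_mem (fun X hX Y hY => hLp.eq_of_cutEquiv (hB.not_mem (hpt p hp).ne)
          (h.pairs_sub p hX) (h.pairs_sub p hY)) (hX p hp)]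
    have hsub : G'.filter (fun Y => ¬ CutEquiv B (range (t + 1)) Y Xs) ⊆ G' := filter_subset _ _
    have hcG'' := fun X hX => hcG' X (hsub hX)
    have hwκ : classWt B (range (t + 1)) G' c Xs = w := by
      apply le_antisymm
      · rcases hw.1 with rfl | ⟨p, hp, rfl⟩
        · have h2 := classWt_nonneg hcG'' X0 (B := B) (Q := range t)
          rw [classWt_filter_not hB range_subset_succ, eqInd_pos hXs.2.1, hwt0] at h2
          linarith
        · have h2 := classWt_nonneg hcG'' (X p) (B := B) (Q := {p, t})
          rw [classWt_filter_not hB (pair_subset_range (hpt p hp)), eqInd_pos (hXs.2.2 p hp),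
            hwtp p hp] at h2
          linarith
      · by_contra! hlt
        obtain ⟨Y, hY, hYX⟩ := hT.exists_member h hG hc hcut.2 hX0 hXt hXs hsub
          (by
            rw [← classWt_pos_iff hcG'', classWt_filter_not hB range_subset_succ,
              eqInd_pos hXs.2.1, hwt0]
            linarith [hw.2 (Set.mem_insert _ _)])
          (by
            intro p hp
            rw [← classWt_pos_iff hcG'', classWt_filter_not hB (pair_subset_range (hpt p hp)),
              eqInd_pos (hXs.2.2 p hp), hwtp p hp]
            linarith [hw.2 (Set.mem_insert_of_mem _ ⟨p, hp, rfl⟩)])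
        grind
    refine fin (fun h' => h.nonred_compose hX0.1 hX hXs Xs h' (CutEquiv.refl _ _ _)) hwκ
      (fun Y => ?_) fun p hp Y hY1 _ => ?_
    · rw [eqInd_congr hXs.2.1]
      exact (WFam.sum_dec s.old hX0.1 w (eqInd B (range t) Y)).symm
    · split_ifs with hpP
      · rw [eqInd_congr (hXs.2.2 p hpP)]
        exact (WFam.sum_dec (s.pairs p) (hX p hpP) w (eqInd B {p, t} Y)).symm
      · rw [eqInd_pair_eq_zero hB hY1, mul_zero, sub_zero]
        exact fun hcp => hpP (mem_cutIdx_range.mpr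
          ⟨hp, (hXs.2.1.cuts_iff (hB.on _) (by simpa using hp)).mp hcp⟩)
  | keep X0 hX0 hX =>
    have hcut := hW'.cut X0 (h.old_sub hX0.1)
    have hnoc : ∀ Y ∈ G', CutEquiv B (range t) Y X0 → ¬ Cuts (B t) Y := by
      intro Y hY hYX hYt
      apply hX
      have hex : ∀ p ∈ cutIdx B (range t) X0, ∃ V ∈ (s.pairs p).fam, CutEquiv B {p, t} V Y := by
        intro p hp
        have hpt := (mem_cutIdx_range.mp hp).1
        rw [← classWt_pos_iff (h.pairs_pos p hpt), ← hT.pairs p hpt Y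
          (mem_cutIdx_range.mp ((cutIdx_congr hB hYX).symm ▸ hp)).2 hYt, classWt_pos_iff hcG']
        exact ⟨Y, hY, CutEquiv.refl _ _ _⟩
      choose! X hX' using hex
      have hagree : ∀ {Q : Finset ℕ}, Q ⊆ range (t + 1) →
          CutEquiv B Q (Y ∩ (range (t + 1)).biUnion B) Y := fun hQ =>
        cutEquiv_of_agree (hB.on _) fun p hp i hi => by grind
      refine ⟨X, ⟨fun p hp => ?_, Y ∩ (range (t + 1)).biUnion B, ⟨inter_subset_right, ?_⟩,
        (hagree range_subset_succ).trans hYX, fun p hp => ?_⟩, fun p hp => (hX' p hp).1⟩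
      · have hpt := (mem_cutIdx_range.mp hp).1
        have hmem := h.pairs_sub p (hX' p hp).1
        exact ⟨fun x hx => by simpa using (hL p hpt).sub _ hmem hx, p, by simp, t, by simp,
          hpt.ne, (hL p hpt).cut1 _ hmem, (hL p hpt).cut2 _ hmem⟩
      · obtain ⟨p, hp, q, hq, h1⟩ := TwoCuts.congr hB
          ((hagree range_subset_succ).trans hYX).symm hcut.2
        exact ⟨p, range_subset_succ hp, q, range_subset_succ hq, h1⟩
      · exact (hagree (pair_subset_range (mem_cutIdx_range.mp hp).1)).trans (hX' p hp).2.symm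
    have hup : ∀ Y ∈ G', CutEquiv B (range t) Y X0 → CutEquiv B (range (t + 1)) Y X0 := by
      intro Y hY hYX
      have h3 := hnoc Y hY hYX
      have h4 := h.not_cuts (h.old_sub hX0.1)
      obtain ⟨h1, ε, h2⟩ := (cutEquiv_iff (hB.on _)).mp hYX
      exact (cutEquiv_iff (hB.on _)).mpr ⟨by grind, ε, by grind⟩
    refine fin (fun h' => h.nonred_keep hX0.1 X0 h' (CutEquiv.refl _ _ _)) ?_
      (fun Y => (WFam.sum_erase s.old hX0.1 (eqInd B (range t) Y)).symm) fun p _ Y _ hY2 => ?_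
    · rw [← classWt_mem hred0 hX0.1, ← hT.old X0 hcut.2]
      refine sum_congr rfl fun Y hY => ?_
      by_cases h1 : CutEquiv B (range t) Y X0
      · rw [eqInd_pos h1, eqInd_pos (hup Y hY h1)]
      · rw [eqInd_neg h1, eqInd_neg fun h2 => h1 (h2.mono (hB.on _) range_subset_succ)]
    · rw [eqInd_neg, mul_zero, sub_zero]
      exact fun h' => h.not_cuts (h.old_sub hX0.1) ((h'.cuts_iff (hB.on _) (by simp)).mpr hY2)

theorem tracks_collect (hB : DisjBlocks B) (hG : IsLaminar G) (hc : ∀ X ∈ G, 0 < c X)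
    (hW' : StageOutput (realPart a) B t W')
    (hL : ∀ p < t, PairOutput a (B p) (B t) (L p)) (hT' : Tracks B t G c W')
    (hTL : ∀ p < t, ∀ X, Cuts (B p) X → Cuts (B t) X →
      classWt B {p, t} G c X = classWt B {p, t} (L p).fam (L p).wt X)
    (hs : Relation.ReflTransGen (Alg2Step B t) (startState W' L) s) (hend : s.old.fam = ∅) (hW : Collect t s W) : Tracks B (t + 1) G c W := by
  classical
  obtain ⟨G', hT⟩ := track_of_run hB hG hc hW' hL hT' hTL hs
  have h := loopInv_of_run hB hW' hL hs
  have hcG' : ∀ X ∈ G', 0 < c X := fun X hX => hc X (hT.sub hX)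
  have hnotwo : ∀ Y ∈ G', ¬ TwoCuts B (range t) Y := by
    intro Y hY hY2
    have h1 := (classWt_pos_iff hcG' (B := B) (Q := range t)).mpr ⟨Y, hY, CutEquiv.refl _ _ _⟩
    rw [hT.old Y hY2, hend] at h1
    simp [classWt] at h1
  intro X hX
  have h1 : classWt B (range (t + 1)) W.fam W.wt X =
      classWt B (range (t + 1)) s.new.fam s.new.wt X +
        ∑ p ∈ range t, classWt B (range (t + 1)) (s.pairs p).fam (s.pairs p).wt X :=
    h.collect_sum hW (eqInd B (range (t + 1)) X)
  have h2 := hT.new X hX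
  rw [classWt_sdiff hT.sub] at h2
  rw [h1, ← h2]
  have hrest : classWt B (range (t + 1)) G' c X =
      ∑ p ∈ range t, classWt B (range (t + 1)) (s.pairs p).fam (s.pairs p).wt X := by
    by_cases hX2 : TwoCuts B (range t) X
    · rw [classWt_eq_zero, sum_eq_zero]
      · intro p hp
        refine classWt_eq_zero fun Y hY hYX => ?_
        exact h.pairs_not_twoCuts (mem_range.mp hp) hY (TwoCuts.congr hB
          (hYX.mono (hB.on _) range_subset_succ).symm hX2)
      · exact fun Y hY hYX => hnotwo Y hY (TwoCuts.congr hB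
          (hYX.mono (hB.on _) range_subset_succ).symm hX2)
    · obtain ⟨p, hp, hpc, htc⟩ : ∃ p < t, Cuts (B p) X ∧ Cuts (B t) X := by
        obtain ⟨p, hp, q, hq, hpq, h3, h4⟩ := hX
        simp only [mem_range] at hp hq
        rcases Nat.lt_succ_iff_lt_or_eq.mp hp with hp' | rfl
        · rcases Nat.lt_succ_iff_lt_or_eq.mp hq with hq' | rfl
          · exact absurd ⟨p, by simpa using hp', q, by simpa using hq', hpq, h3, h4⟩ hX2
          grind
        grind
      have hother : ∀ {Y : Finset (Fin n)}, ¬ TwoCuts B (range t) Y → Cuts (B p) Y →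
          ∀ q, q < t → q ≠ p → ¬ Cuts (B q) Y := fun hY hYp q hq hqp hYq =>
        hY ⟨p, by simpa using hp, q, by simpa using hq, hqp.symm, hYp, hYq⟩
      have hiff : ∀ {Y : Finset (Fin n)}, ¬ TwoCuts B (range t) Y →
          eqInd B (range (t + 1)) X Y = eqInd B {p, t} X Y := by
        intro Y hY
        by_cases h3 : CutEquiv B {p, t} Y X
        · rw [eqInd_pos h3, eqInd_pos]
          have hYp := (h3.cuts_iff (hB.on _) (by simp : p ∈ ({p, t} : Finset ℕ))).mpr hpc
          obtain ⟨h4, ε, h5⟩ := (cutEquiv_iff (hB.on _)).mp h3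
          exact (cutEquiv_iff (hB.on _)).mpr ⟨by grind, ε, by grind⟩
        · rw [eqInd_neg h3, eqInd_neg]
          exact fun h4 => h3 (h4.mono (hB.on _) (pair_subset_range hp))
      have e1 : classWt B (range (t + 1)) G' c X = classWt B {p, t} G' c X :=
        sum_congr rfl fun Y hY => by grind
      have e2 : classWt B (range (t + 1)) (s.pairs p).fam (s.pairs p).wt X =
          classWt B {p, t} (s.pairs p).fam (s.pairs p).wt X :=
        sum_congr rfl fun Y hY => by rw [hiff (h.pairs_not_twoCuts hp hY)]
      rw [e1, hT.pairs p hp X hpc htc, sum_eq_single_of_mem p (by simpa using hp), e2]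
      intro q hq hqp
      refine classWt_eq_zero fun Y hY hYX => ?_
      simp only [mem_range] at hq
      exact h.pairs_not_cuts hq hY (Ne.symm hqp) hp.ne
        ((hYX.cuts_iff (hB.on _) (by simp; omega)).mpr hpc)
  grind

/-! ### The size of laminar families -/

theorem IsLaminar.card_add_one_le {S : Finset (Fin n)} (hS : S.Nonempty) :
    ∀ {F : Finset (Finset (Fin n))}, IsLaminar F → (∀ X ∈ F, X ⊆ S ∧ X.Nonempty) →
      F.card + 1 ≤ 2 * S.card := by
  classical
  induction hS using Finset.Nonempty.cons_induction with
  | singleton a =>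
    intro F _ hF
    have : F ⊆ {{a}} := by grind
    have := card_le_card this
    grind
  | cons x S hx hS ih =>
    intro F hlam hF
    set D := F.filter fun X => x ∈ X ∧ (X.erase x = ∅ ∨ X.erase x ∈ F) with hD
    set F' := (F \ D).image fun X => X.erase x with hF'
    have hinj : Set.InjOn (fun X : Finset (Fin n) => X.erase x) (F \ D : Finset _) := by
      intro X hX Y hY hXY
      simp only [coe_sdiff, Set.mem_sdiff, mem_coe] at hX hY hXY
      by_cases h1 : x ∈ X <;> by_cases h2 : x ∈ Y <;> grind [erase_eq_of_notMem]
    simp only [IsLaminar, eq_empty_iff_forall_notMem, mem_inter] at hlam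
    have hlam' : IsLaminar F' := by
      intro U hU V hV
      obtain ⟨X, hX, rfl⟩ := mem_image.mp hU
      obtain ⟨Y, hY, rfl⟩ := mem_image.mp hV
      have := hlam X (mem_sdiff.mp hX).1 Y (mem_sdiff.mp hY).1
      simp only [eq_empty_iff_forall_notMem, mem_inter]
      grind
    have hne' : ∀ U ∈ F', U ⊆ S ∧ U.Nonempty := by grind
    have hcard := ih hlam' hne'
    rw [hF', card_image_of_injOn hinj, card_sdiff_of_subset (filter_subset _ _),
      ← hD] at hcard
    have hDcard : D.card ≤ 2 := by
      have h1 : (D.erase {x}).card ≤ 1 := by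
        rw [card_le_one]
        have key : ∀ X ∈ D.erase {x}, x ∈ X ∧ X ∈ F ∧ X.erase x ∈ F ∧ ∃ i ∈ X, i ≠ x := by
          grind
        intro X hX Y hY
        obtain ⟨h1, h2, h3, i, h4⟩ := key X hX
        obtain ⟨h5, h6, h7, j, h8⟩ := key Y hY
        have e1 := hlam X h2 Y h6
        have e2 := hlam X h2 _ h7
        have e3 := hlam Y h6 _ h3
        clear * - e1 e2 e3 h1 h5 h4 h8
        grind
      have h2 := pred_card_le_card_erase (s := D) (a := {x})
      omega
    grind

/-- A non-redundant family whose classes are all represented in a laminar family is small. -/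
theorem StageOutput.card_le (hB : DisjBlocks B) {q : Fin n → Fin n → ℝ} {T : ℕ}
    (hW : StageOutput q B T W) (hG : IsLaminar G)
    (h : ∀ X ∈ W.fam, ∃ Y ∈ G, CutEquiv B (range T) Y X) :
    W.fam.card ≤ 2 * ((range T).biUnion B).card := by
  classical
  choose! f hf using h
  set S := (range T).biUnion B with hS
  have hagree : ∀ X, CutEquiv B (range T) (X ∩ S) X := by
    exact fun X => cutEquiv_of_agree (hB.on _) fun p hp i hi => by grind
  have hinj : Set.InjOn (fun X => f X ∩ S) W.fam := by
    intro X hX Y hY hXY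
    simp only at hXY
    refine hW.nonred X hX Y hY ?_
    have h1 := (hf X hX).2.symm.trans (hagree (f X)).symm
    rw [hXY] at h1
    exact h1.trans ((hagree (f Y)).trans (hf Y hY).2)
  rw [← card_image_of_injOn hinj]
  rcases S.eq_empty_or_nonempty with h0 | h0
  · have : W.fam = ∅ := by
      rw [eq_empty_iff_forall_notMem]
      intro X hX
      obtain ⟨h1, p, hp, -, -, -, hc, -⟩ := hW.cut X hX
      obtain ⟨⟨i, hi, -⟩, -⟩ := cuts_iff.mp hc
      have : i ∈ S := mem_biUnion.mpr ⟨p, hp, hi⟩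
      grind
    simp [this]
  · have := IsLaminar.card_add_one_le h0 (F := W.fam.image fun X => f X ∩ S) ?_ ?_
    · omega
    · intro U hU V hV
      obtain ⟨X, hX, rfl⟩ := mem_image.mp hU
      obtain ⟨Y, hY, rfl⟩ := mem_image.mp hV
      have := hG _ (hf X hX).1 _ (hf Y hY).1
      simp only [eq_empty_iff_forall_notMem, mem_inter] at this ⊢
      grind
    · intro U hU
      obtain ⟨X, hX, rfl⟩ := mem_image.mp hU
      refine ⟨inter_subset_right, ?_⟩
      obtain ⟨-, p, hp, -, -, -, hc, -⟩ := hW.cut X hX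
      have hc' : Cuts (B p) (f X ∩ S) :=
        (((hagree (f X)).trans (hf X hX).2).cuts_iff (hB.on _) hp).mpr hc
      obtain ⟨⟨i, -, hi⟩, -⟩ := cuts_iff.mp hc'
      exact ⟨i, hi⟩

end Tracking

section Trees

variable {n : ℕ}
variable {V : Finset (Fin n)}

theorem exists_simil_eq_self {G : Finset (Finset (Fin n))} (hG : IsLaminar G)
    (h2 : ∀ X ∈ G, 2 ≤ X.card) (c : Finset (Fin n) → ℝ)
    (hV : ∀ X ∈ G, X ⊆ V) {x k0 : Fin n} (hk0 : k0 ∈ V) (hne : k0 ≠ x) :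
    ∃ k ∈ V, k ≠ x ∧ simil G c x k = simil G c x x := by
  classical
  by_cases hT : (G.filter fun X => x ∈ X).Nonempty
  · obtain ⟨X, hX, hbot⟩ := exists_bot_of_chain hT id (by
      simp only [IsLaminar, eq_empty_iff_forall_notMem, mem_inter] at hG
      grind)
    obtain ⟨hX, hxX⟩ := mem_filter.mp hX
    obtain ⟨k, hk, hkx⟩ := exists_mem_ne (h2 X hX) x
    refine ⟨k, hV X hX hk, hkx, sum_congr rfl fun Y hY => ?_⟩
    by_cases hxY : x ∈ Y
    · have := hbot Y (mem_filter.mpr ⟨hY, hxY⟩) hk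
      simp only [id] at this
      simp [ind, hxY, this]
    · simp [ind, hxY]
  · rw [not_nonempty_iff_eq_empty, filter_eq_empty_iff] at hT
    refine ⟨k0, hk0, hne, sum_congr rfl fun Y hY => ?_⟩
    simp [ind, hT hY]

/-- An ultrametric is represented by a laminar family. -/
theorem exists_laminar_of_ultrametric (s : Fin n → Fin n → ℝ) (hs : ∀ i j, s i j = s j i)
    (V : Finset (Fin n)) (hult : ∀ i ∈ V, ∀ j ∈ V, ∀ k ∈ V, i ≠ j → i ≠ k → j ≠ k →
      s i k ≤ s i j ∨ s k j ≤ s i j) :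
    ∃ (κ : ℝ) (G : Finset (Finset (Fin n))) (c : Finset (Fin n) → ℝ), IsLaminar G ∧
      (∀ X ∈ G, 0 ≤ c X) ∧ (∀ X ∈ G, X ⊆ V ∧ 2 ≤ X.card) ∧
      ∀ i ∈ V, ∀ j ∈ V, i ≠ j → s i j = κ + simil G c i j := by
  classical
  induction V using Finset.strongInduction with
  | H V ih =>
    obtain hone | hoff := V.offDiag.eq_empty_or_nonempty
    · exact ⟨0, ∅, 0, by simp [IsLaminar], by simp, by simp, fun i hi j hj hij =>
        absurd (mem_offDiag.mpr ⟨hi, hj, hij⟩ : (i, j) ∈ V.offDiag) (by simp [hone])⟩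
    obtain ⟨⟨x, y⟩, hxy, hmax⟩ := V.offDiag.exists_max_image (fun z => s z.1 z.2) hoff
    obtain ⟨hx, hy, hne⟩ := mem_offDiag.mp hxy
    have hmax' : ∀ i ∈ V, ∀ j ∈ V, i ≠ j → s i j ≤ s x y := fun i hi j hj hij =>
      hmax (i, j) (mem_offDiag.mpr ⟨hi, hj, hij⟩)
    have htwin : ∀ i ∈ V, i ≠ x → i ≠ y → s i y = s i x := fun i hi hix hiy => by
      have e1 := hs x y
      have h1 := hmax' i hi x hx hix
      have h2 := hmax' i hi y hy hiy
      rcases hult i hi x hx y hy hix hiy hne with h3 | h3 <;>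
        rcases hult i hi y hy x hx hiy hix hne.symm with h4 | h4 <;> linarith
    obtain ⟨κ, G, c, hG, hc, hGV, hrep⟩ := ih (V.erase y) (erase_ssubset hy) fun i hi j hj k hk =>
      hult i (mem_of_mem_erase hi) j (mem_of_mem_erase hj) k (mem_of_mem_erase hk)
    by_cases htwo : ∃ k ∈ V.erase y, k ≠ x
    swap
    · exact ⟨s x y, ∅, 0, by simp [IsLaminar], by simp, by simp, fun i hi j hj hij => by
        have := hs x y
        simp only [simil, sum_empty]
        grind⟩
    obtain ⟨k0, hk0, hk0x⟩ := htwo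
    obtain ⟨k, hk, hkx, hsk⟩ := exists_simil_eq_self hG (fun X hX => (hGV X hX).2) c
      (fun X hX => (hGV X hX).1) hk0 hk0x
    have hxV' : x ∈ V.erase y := mem_erase.mpr ⟨hne, hx⟩
    have hw0 : 0 ≤ s x y - κ - simil G c x x := by
      linarith [hrep x hxV' k hk hkx.symm, hmax' x hx k (mem_of_mem_erase hk) hkx.symm]
    have hyG : ∀ X ∈ G, y ∉ X := fun X hX hyX => (mem_erase.mp ((hGV X hX).1 hyX)).1 rfl
    obtain ⟨φ, hφ⟩ : ∃ φ : Finset (Fin n) → Finset (Fin n), ∀ X i, i ∈ φ X ↔ i ∈ X ∨ i = y ∧ x ∈ X :=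
      ⟨fun X => if x ∈ X then insert y X else X, by grind⟩
    have herase : ∀ X ∈ G, (φ X).erase y = X := by grind
    have hpair : ∀ X ∈ G, φ X ≠ {x, y} := fun X hX h => by
      obtain ⟨z, hz, hzx⟩ := exists_mem_ne (hGV X hX).2 x
      grind
    let c' : Finset (Fin n) → ℝ := fun X =>
      if X = {x, y} then s x y - κ - simil G c x x else c (X.erase y)
    have hsum : ∀ i j, simil (insert {x, y} (G.image φ)) c' i j =
        (s x y - κ - simil G c x x) * (ind {x, y} i * ind {x, y} j) +
          ∑ X ∈ G, c X * (ind (φ X) i * ind (φ X) j) := fun i j => by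
      unfold simil
      rw [sum_insert (by grind), sum_image fun X hX Y hY h => by rw [← herase X hX, h, herase Y hY]]
      congr 1
      · simp [c', simil]
      · exact sum_congr rfl fun X hX => by simp only [c', if_neg (hpair X hX), herase X hX]
    refine ⟨κ, insert {x, y} (G.image φ), c', ?_, ?_, ?_, ?_⟩
    · have h0 : ∀ X ∈ G, {x, y} ⊆ φ X ∨ {x, y} ∩ φ X = ∅ := fun X hX => by
        have := hyG X hX
        clear * - hφ this
        by_cases x ∈ X <;> grind
      have h1 : ∀ X ∈ G, ∀ Y ∈ G, X ∩ Y = ∅ → φ X ∩ φ Y = ∅ := by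
        clear * - hyG hφ
        simp only [eq_empty_iff_forall_notMem, mem_inter]
        grind
      intro U hU U' hU'
      rcases mem_insert.mp hU with rfl | hU <;> rcases mem_insert.mp hU' with rfl | hU'
      · exact .inl subset_rfl
      · obtain ⟨X, hX, rfl⟩ := mem_image.mp hU'
        exact (h0 X hX).imp_right .inr
      · obtain ⟨X, hX, rfl⟩ := mem_image.mp hU
        exact .inr ((h0 X hX).imp_right fun h => by rwa [inter_comm])
      · obtain ⟨X, hX, rfl⟩ := mem_image.mp hU
        obtain ⟨Y, hY, rfl⟩ := mem_image.mp hU'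
        have h2 : ∀ X Y, X ⊆ Y → φ X ⊆ φ Y := fun X Y h i => by
          simpa only [hφ] using Or.imp (h ·) (And.imp_right (h ·))
        rcases hG X hX Y hY with h | h | h
        · exact .inl (h2 X Y h)
        · exact .inr (.inl (h2 Y X h))
        · exact .inr (.inr (h1 X hX Y hY h))
    · intro U hU
      rcases mem_insert.mp hU with rfl | hU
      · simpa [c'] using hw0
      · obtain ⟨X, hX, rfl⟩ := mem_image.mp hU
        simpa only [c', if_neg (hpair X hX), herase X hX] using hc X hX
    · intro U hU
      rcases mem_insert.mp hU with rfl | hU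
      · exact ⟨by grind, by rw [card_pair hne]⟩
      · obtain ⟨X, hX, rfl⟩ := mem_image.mp hU
        exact ⟨by grind, (hGV X hX).2.trans (card_le_card (by grind))⟩
    · have h1 : ∀ i j, i ≠ y → j ≠ y → ∑ X ∈ G, c X * (ind (φ X) i * ind (φ X) j) = simil G c i j :=
        fun i j hi hj => sum_congr rfl fun X hX => by simp [ind, hφ, hi, hj]
      have h2 : ∀ i, i ≠ y → ∑ X ∈ G, c X * (ind (φ X) i * ind (φ X) y) = simil G c i x :=
        fun i hi => sum_congr rfl fun X hX => by simp [ind, hφ, hi, hyG X hX]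
      have hcase : ∀ i ∈ V, i ≠ y → s i y = κ + simil (insert {x, y} (G.image φ)) c' i y := by
        intro i hi hiy
        rw [hsum, h2 i hiy]
        by_cases hix : i = x
        · simp [ind, hix]
        · rw [htwin i hi hix hiy, hrep i (mem_erase.mpr ⟨hiy, hi⟩) x hxV' hix]
          simp [ind, hix, hiy]
      intro i hi j hj hij
      by_cases hjy : j = y
      · exact hjy ▸ hcase i hi (hjy ▸ hij)
      by_cases hiy : i = y
      · rw [hs, simil_symm, hiy]
        exact hcase j hj hjy
      · rw [hrep i (mem_erase.mpr ⟨hiy, hi⟩) j (mem_erase.mpr ⟨hjy, hj⟩) hij, hsum, h1 i j hiy hjy]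
        simp only [ind]
        grind

/-- The four-point condition gives a representation by a laminar family. -/
theorem exists_laminar_of_four_point (α : Fin n → Fin n → ℝ) (hα : ∀ i j, α i j = α j i) (hV : V.Nonempty)
    (h4 : ∀ i ∈ V, ∀ j ∈ V, ∀ k ∈ V, ∀ l ∈ V, i ≠ j → i ≠ k → i ≠ l → j ≠ k → j ≠ l → k ≠ l →
      α i k + α j l ≤ α i j + α k l ∨ α i l + α j k ≤ α i j + α k l) :
    ∃ (G : Finset (Finset (Fin n))) (c : Finset (Fin n) → ℝ) (w : Fin n → ℝ), IsLaminar G ∧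
      (∀ X ∈ G, 0 < c X) ∧ ∀ i ∈ V, ∀ j ∈ V, i ≠ j → α i j = simil G c i j + w i + w j := by
  classical
  obtain ⟨ρ, hρ⟩ := hV
  obtain ⟨κ, G, c, hG, hc, hGV, hrep⟩ := exists_laminar_of_ultrametric
    (fun i j => α i j - α i ρ - α j ρ) (fun i j => by rw [hα i j]; ring) (V.erase ρ) (by
      intro i hi j hj k hk hij hik hjk
      obtain ⟨hiρ, hi⟩ := mem_erase.mp hi
      obtain ⟨hjρ, hj⟩ := mem_erase.mp hj
      obtain ⟨hkρ, hk⟩ := mem_erase.mp hk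
      rcases h4 i hi j hj k hk ρ hρ hij hik hiρ hjk hjρ hkρ with h | h
      · left; linarith
      · right; linarith [hα j k])
  refine ⟨G.filter fun X => 0 < c X, c, fun i => if i = ρ then -(κ / 2) else α i ρ + κ / 2,
    fun X hX Y hY => hG X (mem_filter.mp hX).1 Y (mem_filter.mp hY).1,
    fun X hX => (mem_filter.mp hX).2, fun i hi j hj hij => ?_⟩
  have hsim : simil (G.filter fun X => 0 < c X) c i j = simil G c i j := by
    unfold simil
    rw [sum_filter]
    refine sum_congr rfl fun X hX => ?_
    split_ifs with h
    · rfl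
    · rw [le_antisymm (not_lt.mp h) (hc X hX), zero_mul]
  have hzero : ∀ k, simil G c ρ k = 0 := by
    intro k
    refine sum_eq_zero fun X hX => ?_
    have : ρ ∉ X := fun h => (mem_erase.mp ((hGV X hX).1 h)).1 rfl
    simp [ind, this]
  rw [hsim]
  beta_reduce
  by_cases hiρ : i = ρ
  · subst hiρ
    rw [hzero, if_pos rfl, if_neg hij.symm, hα]
    ring
  · by_cases hjρ : j = ρ
    · subst hjρ
      rw [simil_symm, hzero, if_pos rfl, if_neg hij]
      ring
    · have := hrep i (mem_erase.mpr ⟨hiρ, hi⟩) j (mem_erase.mpr ⟨hjρ, hj⟩) hij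
      rw [if_neg hiρ, if_neg hjρ]
      linarith

end Trees

section Quadratic

variable {n : ℕ}
variable {S : Finset (Fin n)} {a : Fin n → Fin n → WithTop ℝ} {g : Finset (Fin n) → WithTop ℝ}
variable {i j k : Fin n} {r : ℕ} {u : Fin n → ℝ} {x : Finset (Fin n)} {α : Fin n → Fin n → ℝ}

/-- The real value of a quadratic function at a point where it is finite. -/
noncomputable def quadVal (α : Fin n → Fin n → ℝ) (u : Fin n → ℝ) (x : Finset (Fin n)) : ℝ :=
  (∑ i ∈ x, ∑ j ∈ x with i < j, α i j) + ∑ i ∈ x, u i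

theorem quadVal_insert (hα : ∀ i j, α i j = α j i) (u : Fin n → ℝ) (hi : i ∉ x) :
    quadVal α u (insert i x) = quadVal α u x + (u i + ∑ s ∈ x, α i s) := by
  have h1 : ∀ k ∈ x, ∑ j ∈ insert i x with k < j, α k j =
      (∑ j ∈ x with k < j, α k j) + if k < i then α k i else 0 := by
    intro k _
    rw [filter_insert]
    split_ifs with h
    · rw [sum_insert (by simp [hi]), add_comm]
    · rw [add_zero]
  have h2 : ∑ j ∈ insert i x with i < j, α i j = ∑ j ∈ x, if i < j then α i j else 0 := by
    rw [filter_insert, if_neg (lt_irrefl i), sum_filter]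
  unfold quadVal
  rw [sum_insert hi, sum_insert hi, sum_congr rfl h1, h2, sum_add_distrib]
  have h3 : (∑ j ∈ x, if i < j then α i j else 0) + (∑ k ∈ x, if k < i then α k i else 0) =
      ∑ s ∈ x, α i s := by
    rw [← sum_add_distrib]
    refine sum_congr rfl fun s hs => ?_
    have hne : s ≠ i := fun h => hi (h ▸ hs)
    rcases lt_or_gt_of_ne hne with h | h
    · simp [h, h.not_gt, hα s i]
    · simp [h, h.not_gt]
  linarith

theorem quadVal_insert₂ (hα : ∀ i j, α i j = α j i) (u : Fin n → ℝ) (hi : i ∉ S) (hj : j ∉ S) (hij : i ≠ j) :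
    quadVal α u (insert i (insert j S)) =
      quadVal α u S + (u i + ∑ s ∈ S, α i s) + (u j + ∑ s ∈ S, α j s) + α i j := by
  rw [quadVal_insert hα u (by simp [hij, hi]), quadVal_insert hα u hj, sum_insert hj]
  ring

theorem quadFun_lt_top_iff (ha : ∀ i j, a i j = a j i) :
    quadFun r a u x < ⊤ ↔ x.card = r ∧ ∀ i ∈ x, ∀ j ∈ x, i ≠ j → a i j ≠ ⊤ := by
  unfold quadFun
  split_ifs with h
  · have h1 : (∑ i ∈ x, ((u i : ℝ) : WithTop ℝ)) ≠ ⊤ := by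
      rw [← WithTop.coe_sum]
      exact WithTop.coe_ne_top
    rw [lt_top_iff_ne_top, Ne, WithTop.add_eq_top, not_or, and_iff_left h1]
    simp only [WithTop.sum_eq_top, mem_filter, not_exists, not_and, h, true_and]
    constructor
    · intro h2 i hi j hj hij
      rcases lt_or_gt_of_ne hij with h3 | h3
      · exact h2 i hi j ⟨hj, h3⟩
      · rw [ha]
        exact h2 j hj i ⟨hi, h3⟩
    · exact fun h2 i hi j hj => h2 i hi j hj.1 hj.2.ne
  · simp [h]

theorem quadFun_eq_coe (ha : ∀ i j, a i j = a j i) (hx : quadFun r a u x < ⊤) :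
    quadFun r a u x = (quadVal (realPart a) u x : ℝ) := by
  obtain ⟨h1, h2⟩ := (quadFun_lt_top_iff ha).mp hx
  unfold quadFun quadVal
  rw [if_pos h1, WithTop.coe_add, WithTop.coe_sum, WithTop.coe_sum]
  congr 1
  refine sum_congr rfl fun i hi => ?_
  rw [WithTop.coe_sum]
  refine sum_congr rfl fun j hj => ?_
  obtain ⟨hj, hij⟩ := mem_filter.mp hj
  obtain ⟨b, hb⟩ := WithTop.ne_top_iff_exists.mp (h2 i hi j hj hij.ne)
  rw [realPart, ← hb]
  rfl

theorem quadDiff_eq_quadVal (hα : ∀ i j, α i j = α j i) (u : Fin n → ℝ) {l : Fin n} (hi : i ∉ S) (hj : j ∉ S) (hk : k ∉ S) (hl : l ∉ S)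
    (hij : i ≠ j) (hkl : k ≠ l) (hil : i ≠ l) (hkj : k ≠ j) :
    quadDiff α i j k l = quadVal α u (insert i (insert j S)) + quadVal α u (insert k (insert l S)) -
      quadVal α u (insert i (insert l S)) - quadVal α u (insert k (insert j S)) := by
  rw [quadVal_insert₂ hα u hi hj hij, quadVal_insert₂ hα u hk hl hkl,
    quadVal_insert₂ hα u hi hl hil, quadVal_insert₂ hα u hk hj hkj, quadDiff]
  ring

/-- No point of the effective domain contains both `i` and `j`, or `i = j`. -/
def Parallel (g : Finset (Fin n) → WithTop ℝ) (i j : Fin n) : Prop :=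
  ∀ x, g x < ⊤ → i ∈ x → j ∈ x → i = j

theorem Parallel.symm (h : Parallel g i j) : Parallel g j i := fun x hx hj hi => (h x hx hi hj).symm

theorem Parallel.trans (hg : IsMConvex g) (hcov : ∀ j, ∃ x, g x < ⊤ ∧ j ∈ x) (h : Parallel g i j)
    (h' : Parallel g j k) : Parallel g i k := by
  intro x hx hi hk
  by_contra hik
  have hj : j ∉ x := fun hj => hik ((h x hx hi hj).trans (h' x hx hj hk))
  obtain ⟨y, hy, hjy⟩ := hcov j
  obtain ⟨l, hl, hle⟩ := hg y x hy hx j (mem_sdiff.mpr ⟨hjy, hj⟩)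
  have hfin : g (insert j (x.erase l)) < ⊤ :=
    (WithTop.add_lt_top.mp (lt_of_le_of_lt hle (WithTop.add_lt_top.mpr ⟨hy, hx⟩))).2
  by_cases hli : l = i
  · have : j = k := h' _ hfin (mem_insert_self _ _) (mem_insert_of_mem
      (mem_erase.mpr ⟨fun h => hik (hli.symm.trans h.symm), hk⟩))
    exact hj (this ▸ hk)
  · have : i = j := h _ hfin (mem_insert_of_mem
      (mem_erase.mpr ⟨fun h => hli h.symm, hi⟩)) (mem_insert_self _ _)
    exact hj (this ▸ hi)

end Quadratic

section Summands

variable {n r : ℕ} {I : VCSPQuadratic n r}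
variable {S : Finset (Fin n)} {i j k l : Fin n} {p q : Fin r} {x : Finset (Fin n)}

theorem VCSPQuadratic.toFun_lt_top_iff :
    I.toFun x < ⊤ ↔ x.card = r ∧ ∀ i ∈ x, ∀ j ∈ x, i ≠ j → I.blk i ≠ I.blk j := by
  rw [VCSPQuadratic.toFun, quadFun_lt_top_iff I.quad_symm]
  simp only [ne_eq, I.quad_eq_top_iff]

theorem VCSPQuadratic.exists_blk_eq (I : VCSPQuadratic n r) (p : Fin r) : ∃ i, I.blk i = p := by
  have h := I.two_le_card p
  obtain ⟨i, hi⟩ := card_pos.mp (by omega : 0 < (univ.filter fun i => I.blk i = p).card)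
  grind

/-- A set meeting once each block other than the blocks `p` and `q`. -/
def Transversal (I : VCSPQuadratic n r) (p q : Fin r) (S : Finset (Fin n)) : Prop :=
  S.card + 2 = r ∧ (∀ s ∈ S, I.blk s ≠ p ∧ I.blk s ≠ q) ∧
    ∀ s ∈ S, ∀ t ∈ S, s ≠ t → I.blk s ≠ I.blk t

theorem exists_transversal (I : VCSPQuadratic n r) (hpq : p ≠ q) :
    ∃ S, Transversal I p q S := by
  classical
  choose ρ hρ using I.exists_blk_eq
  refine ⟨(univ \ {p, q}).image ρ, ?_, by grind, by grind⟩
  rw [card_image_of_injective _ fun p q h => by grind,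
    card_sdiff_of_subset (subset_univ _), card_pair hpq, card_univ, Fintype.card_fin]
  omega

theorem Transversal.not_mem (hS : Transversal I p q S) (hi : I.blk i = p ∨ I.blk i = q) : i ∉ S := fun h => by
  rcases hi with hi | hi
  · exact (hS.2.1 i h).1 hi
  · exact (hS.2.1 i h).2 hi

theorem Transversal.lt_top (hS : Transversal I p q S)
    (hpq : p ≠ q) (hi : I.blk i = p) (hj : I.blk j = q) :
    I.toFun (insert i (insert j S)) < ⊤ := by
  rw [VCSPQuadratic.toFun_lt_top_iff]
  have hjS := hS.not_mem (.inr hj)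
  have hiS := hS.not_mem (.inl hi)
  obtain ⟨h1, h2, h3⟩ := hS
  grind

/-- A quadratic M-convex function whose effective domain contains that of `I`. -/
structure Summand (I : VCSPQuadratic n r) (a : Fin n → Fin n → WithTop ℝ) (u : Fin n → ℝ) :
    Prop where
  symm : ∀ i j, a i j = a j i
  conv : IsMConvex (quadFun r a u)
  dom : ∀ x, I.toFun x < ⊤ → quadFun r a u x < ⊤

variable {a : Fin n → Fin n → WithTop ℝ} {u : Fin n → ℝ}

theorem Summand.realPart_symm (h : Summand I a u) (i j : Fin n) :
    realPart a i j = realPart a j i := by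
  rw [realPart, h.symm, realPart]

theorem Summand.not_parallel (h : Summand I a u) (hij : I.blk i ≠ I.blk j) :
    ¬ Parallel (quadFun r a u) i j := fun hp => by
  classical
  obtain ⟨S, hS⟩ := exists_transversal I hij
  have := hp _ (h.dom _ (hS.lt_top hij rfl rfl)) (by simp) (by simp)
  grind

theorem Summand.lt_top_of_not_parallel (h : Summand I a u)
    (hx : x.card = r) (hp : ∀ i ∈ x, ∀ j ∈ x, i ≠ j → ¬ Parallel (quadFun r a u) i j) :
    quadFun r a u x < ⊤ := by
  rw [quadFun_lt_top_iff h.symm]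
  refine ⟨hx, fun i hi j hj hij htop => hp i hi j hj hij fun y hy hiy hjy => ?_⟩
  by_contra hne
  exact ((quadFun_lt_top_iff h.symm).mp hy).2 i hiy j hjy hne htop

theorem Summand.covers (h : Summand I a u) (hr : 2 ≤ r) (j : Fin n) :
    ∃ x, quadFun r a u x < ⊤ ∧ j ∈ x := by
  have : Nontrivial (Fin r) := Fin.nontrivial_iff_two_le.mpr hr
  obtain ⟨q, hq⟩ := exists_ne (I.blk j)
  obtain ⟨S, hS⟩ := exists_transversal I hq.symm
  obtain ⟨i, hi⟩ := I.exists_blk_eq q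
  exact ⟨_, h.dom _ (hS.lt_top hq.symm rfl hi), by simp⟩

/-- The exchange property for two sets that differ by two elements. -/
theorem Summand.exchange (h : Summand I a u)
    (hi : i ∉ S) (hj : j ∉ S) (hk : k ∉ S) (hl : l ∉ S)
    (hij : i ≠ j) (hik : i ≠ k) (hil : i ≠ l) (hjk : j ≠ k) (hjl : j ≠ l) (hkl : k ≠ l)
    (hx : quadFun r a u (insert i (insert j S)) < ⊤)
    (hy : quadFun r a u (insert k (insert l S)) < ⊤) :
    (quadFun r a u (insert i (insert l S)) < ⊤ ∧
      realPart a i l + realPart a j k ≤ realPart a i j + realPart a k l) ∨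
    (quadFun r a u (insert i (insert k S)) < ⊤ ∧
      realPart a i k + realPart a j l ≤ realPart a i j + realPart a k l) := by
  classical
  obtain ⟨s, hs, hle⟩ := h.conv _ _ hx hy i (by simp [hi, hik, hil])
  have hsum := h.realPart_symm
  obtain ⟨hf1, hf2⟩ := WithTop.add_lt_top.mp (hle.trans_lt (WithTop.add_lt_top.mpr ⟨hx, hy⟩))
  rw [quadFun_eq_coe h.symm hx, quadFun_eq_coe h.symm hy, quadFun_eq_coe h.symm hf1,
    quadFun_eq_coe h.symm hf2, ← WithTop.coe_add, ← WithTop.coe_add, WithTop.coe_le_coe,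
    show (insert i (insert j S)).erase i = insert j S by grind,
    quadVal_insert₂ hsum u hi hj hij, quadVal_insert₂ hsum u hk hl hkl] at hle
  obtain rfl | rfl : s = k ∨ s = l := by grind
  · rw [show (insert s (insert l S)).erase s = insert l S by grind] at hle hf2
    rw [quadVal_insert₂ hsum u hk hj hjk.symm, quadVal_insert₂ hsum u hi hl hil] at hle
    grind
  · rw [show (insert k (insert s S)).erase s = insert k S by grind] at hle hf2
    rw [quadVal_insert₂ hsum u hl hj hjl.symm, quadVal_insert₂ hsum u hi hk hik] at hle
    grind

theorem Summand.quadDiff_nonneg (h : Summand I a u) (hpq : p ≠ q)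
    (hi : I.blk i = p) (hk : I.blk k = p) (hj : I.blk j = q) (hl : I.blk l = q)
    (hik : Parallel (quadFun r a u) i k) : 0 ≤ quadDiff (realPart a) i j k l := by
  classical
  unfold quadDiff
  by_cases hne : i = k
  · grind
  by_cases hjl : j = l
  · grind
  obtain ⟨S, hS⟩ := exists_transversal I hpq
  rcases h.exchange (hS.not_mem (.inl hi)) (hS.not_mem (.inr hj)) (hS.not_mem (.inl hk))
    (hS.not_mem (.inr hl)) (by grind) hne (by grind) (by grind) hjl (by grind)
    (h.dom _ (hS.lt_top hpq hi hj)) (h.dom _ (hS.lt_top hpq hk hl)) with ⟨-, h1⟩ | ⟨h1, -⟩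
  · linarith [h.realPart_symm j k]
  · exact absurd (hik _ h1 (by simp) (by simp)) hne

theorem Summand.quadDiff_eq_zero (h : Summand I a u) (hpq : p ≠ q)
    (hi : I.blk i = p) (hk : I.blk k = p) (hj : I.blk j = q) (hl : I.blk l = q)
    (hik : Parallel (quadFun r a u) i k) : quadDiff (realPart a) i j k l = 0 := by
  have h1 := h.quadDiff_nonneg hpq hi hk hj hl hik
  have h2 := h.quadDiff_nonneg hpq hi hk hl hj hik
  unfold quadDiff at *
  linarith

theorem Summand.quadDiff_eq_zero' (h : Summand I a u) (hpq : p ≠ q)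
    (hi : I.blk i = p) (hk : I.blk k = p) (hj : I.blk j = q) (hl : I.blk l = q)
    (hjl : Parallel (quadFun r a u) j l) : quadDiff (realPart a) i j k l = 0 := by
  have h1 := h.quadDiff_eq_zero hpq.symm hj hl hi hk hjl
  have hsum := h.realPart_symm
  unfold quadDiff at *
  grind

/-- Some two elements of the block `p` are not parallel. -/
def Splits (I : VCSPQuadratic n r) (g : Finset (Fin n) → WithTop ℝ) (p : Fin r) : Prop :=
  ∃ i k, I.blk i = p ∧ I.blk k = p ∧ ¬ Parallel g i k

theorem IsLaminar.image {G : Finset (Finset (Fin n))} (hG : IsLaminar G)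
    (φ : Finset (Fin n) → Finset (Fin n)) (hmono : ∀ X Y, X ⊆ Y → φ X ⊆ φ Y)
    (hdisj : ∀ X Y, X ∩ Y = ∅ → φ X ∩ φ Y = ∅) : IsLaminar (G.image φ) := by
  intro X' hX' Y' hY'
  obtain ⟨X, hX, rfl⟩ := mem_image.mp hX'
  obtain ⟨Y, hY, rfl⟩ := mem_image.mp hY'
  rcases hG _ hX _ hY with h | h | h
  · grind
  · grind
  grind

theorem sum_image_fiber {ι κ : Type*} [DecidableEq κ] (G : Finset ι) (φ : ι → κ) (c : ι → ℝ)
    (F : κ → ℝ) : ∑ Y ∈ G.image φ, (∑ X ∈ G with φ X = Y, c X) * F Y = ∑ X ∈ G, c X * F (φ X) := by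
  rw [← sum_fiberwise_of_maps_to (g := φ) (t := G.image φ)
    fun X hX => mem_image_of_mem φ hX]
  refine sum_congr rfl fun Y _ => ?_
  rw [sum_mul]
  refine sum_congr rfl fun X hX => ?_
  grind

theorem Summand.exists_laminar (h : Summand I a u) (hr : 2 ≤ r) :
    ∃ (G : Finset (Finset (Fin n))) (c : Finset (Fin n) → ℝ), IsLaminar G ∧ (∀ X ∈ G, 0 < c X) ∧
      (∀ X ∈ G, ∀ i ∈ X, Splits I (quadFun r a u) (I.blk i)) ∧
      ∀ p q, p ≠ q → ∀ i j k l, I.blk i = p → I.blk k = p → I.blk j = q → I.blk l = q →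
        quadDiff (realPart a) i j k l = ∑ X ∈ G, c X * chi X i j k l := by
  classical
  set g := quadFun r a u with hg
  by_cases hQ : ∃ p q, p ≠ q ∧ Splits I g p ∧ Splits I g q
  swap
  · refine ⟨∅, 0, by simp [IsLaminar], by simp, by simp, fun p q hpq i j k l hi hk hj hl => ?_⟩
    rw [sum_empty]
    by_cases hp : Parallel g i k
    · exact h.quadDiff_eq_zero hpq hi hk hj hl hp
    · exact h.quadDiff_eq_zero' hpq hi hk hj hl (by_contra fun hcon =>
        hQ ⟨p, q, hpq, ⟨i, k, hi, hk, hp⟩, j, l, hj, hl, hcon⟩)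
  obtain ⟨p0, q0, hpq0, hp0, hq0⟩ := hQ
  let Z : Setoid (Fin n) := ⟨Parallel g, ⟨fun i x _ _ _ => rfl, fun h => h.symm,
    fun h1 h2 => h1.trans h.conv (h.covers hr) h2⟩⟩
  obtain ⟨ρ, hρ, hρρ⟩ : ∃ ρ : Fin n → Fin n, (∀ i j, ρ i = ρ j ↔ Parallel g i j) ∧
      ∀ i, ρ (ρ i) = ρ i := ⟨fun i => (Quotient.mk Z i).out,
    fun i j => Quotient.out_inj.trans Quotient.eq, fun i => by simp⟩
  have hρp : ∀ i, Parallel g (ρ i) i := fun i => (hρ _ _).mp (hρρ i)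
  have hρblk : ∀ i, I.blk (ρ i) = I.blk i := fun i =>
    by_contra fun hne => h.not_parallel hne (hρp i)
  set R := univ.image ρ with hR
  have hRρ : ∀ i ∈ R, ρ i = i := by grind
  have hRcard : r + 2 ≤ R.card := by
    rw [card_eq_sum_card_fiberwise (f := I.blk) (t := univ) fun i _ => mem_univ _]
    refine le_trans ?_ (sum_le_sum (f := fun p => 1 + if p ∈ ({p0, q0} : Finset _) then 1 else 0)
      fun p _ => ?_)
    · simp only [sum_add_distrib, sum_boole, filter_mem_eq_inter, univ_inter, card_pair hpq0]
      simp
    split_ifs with hp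
    · obtain ⟨i, k, hi, hk, hik⟩ : Splits I g p := by grind
      exact one_lt_card.mpr ⟨ρ i, by grind, ρ k, by grind,
        mt (hρ i k).mp hik⟩
    · obtain ⟨i, hi⟩ := I.exists_blk_eq p
      exact card_pos.mpr ⟨ρ i, by grind⟩
  obtain ⟨G, c, w, hG, hc, hrep⟩ := exists_laminar_of_four_point (realPart a) h.realPart_symm
    (V := R) (card_pos.mp (by omega)) (by
      intro i hi j hj k hk l hl hij hik hil hjk hjl hkl
      have h4 : ({i, j, k, l} : Finset (Fin n)).card ≤ 4 := card_le_four
      have h5 := le_card_sdiff {i, j, k, l} R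
      obtain ⟨S, hS, hScard⟩ := exists_subset_card_eq (n := r - 2)
        (show r - 2 ≤ (R \ {i, j, k, l}).card by omega)
      have hnot : ∀ s ∈ ({i, j, k, l} : Finset (Fin n)), s ∈ R ∧ s ∉ S := by grind
      have hfin : ∀ s ∈ ({i, j, k, l} : Finset (Fin n)), ∀ t ∈ ({i, j, k, l} : Finset (Fin n)),
          s ≠ t → g (insert s (insert t S)) < ⊤ := fun s hs t ht hst => by
        refine h.lt_top_of_not_parallel ?_ fun x hx y hy hxy hp => hxy ?_
        · grind
        · rw [← hρ, hRρ x (by grind), hRρ y (by grind)] at hp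
          exact hp
      exact (h.exchange (hnot i (by simp)).2 (hnot j (by simp)).2 (hnot k (by simp)).2
        (hnot l (by simp)).2 hij hik hil hjk hjl hkl (hfin i (by simp) j (by simp) hij)
        (hfin k (by simp) l (by simp) hkl)).symm.imp And.right And.right)
  obtain ⟨φ, hφ⟩ : ∃ φ : Finset (Fin n) → Finset (Fin n), ∀ X i, i ∈ φ X ↔
    ρ i ∈ X ∧ Splits I g (I.blk i) := 
    ⟨fun X => univ.filter fun i => ρ i ∈ X ∧ Splits I g (I.blk i), by simp⟩
  refine ⟨G.image φ, fun Y => ∑ X ∈ G with φ X = Y, c X, hG.image φ (by grind)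
    (fun X Y h => by simp only [eq_empty_iff_forall_notMem, mem_inter, hφ] at h ⊢; grind),
    fun Y hY => ?_, by grind, ?_⟩
  · obtain ⟨X, hX, hXY⟩ := mem_image.mp hY
    exact sum_pos (fun X hX => hc X (mem_filter.mp hX).1) ⟨X, mem_filter.mpr ⟨hX, hXY⟩⟩
  · intro p q hpq i j k l hi hk hj hl
    have key : ∀ X, ∀ s t, I.blk s = I.blk t →
        ind (φ X) s - ind (φ X) t = ind X (ρ s) - ind X (ρ t) := fun X s t hst => by
      by_cases hsp : Splits I g (I.blk t)
      · simp [ind, hφ, hst, hsp]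
      · simp [ind, hφ, hst, hsp, (hρ s t).mpr (by_contra fun hcon => hsp ⟨s, t, hst, rfl, hcon⟩)]
    have hρi := (hρblk i).trans hi
    have hρj := (hρblk j).trans hj
    have hρk := (hρblk k).trans hk
    have hρl := (hρblk l).trans hl
    have hmove : quadDiff (realPart a) i j k l = quadDiff (realPart a) (ρ i) (ρ j) (ρ k) (ρ l) := by
      have h1 := h.quadDiff_eq_zero hpq hi hρi hj hl (hρp i).symm
      have h2 := h.quadDiff_eq_zero hpq hk hρk hj hl (hρp k).symm
      have h3 := h.quadDiff_eq_zero' hpq hρi hρk hj hρj (hρp j).symm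
      have h4 := h.quadDiff_eq_zero' hpq hρi hρk hl hρl (hρp l).symm
      unfold quadDiff at *
      linarith
    have hrep' : ∀ s t, I.blk s = p → I.blk t = q →
        realPart a (ρ s) (ρ t) = simil G c (ρ s) (ρ t) + w (ρ s) + w (ρ t) := fun s t hs ht =>
      hrep _ (by simp [R]) _ (by simp [R]) (by grind)
    rw [sum_image_fiber G φ c fun Y => chi Y i j k l, hmove, quadDiff, hrep' i j hi hj,
      hrep' k l hk hl, hrep' i l hi hl, hrep' k j hk hj]
    have hs : ∑ X ∈ G, c X * chi (φ X) i j k l = simil G c (ρ i) (ρ j) + simil G c (ρ k) (ρ l) -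
        simil G c (ρ i) (ρ l) - simil G c (ρ k) (ρ j) := by
      simp only [simil, ← sum_add_distrib, ← sum_sub_distrib]
      refine sum_congr rfl fun X _ => ?_
      rw [chi, key X i k (hi.trans hk.symm), key X j l (hj.trans hl.symm)]
      ring
    rw [hs]
    ring

/-- A QR-M2-convex function is represented by a laminar family. -/
theorem VCSPQuadratic.IsQRM2.exists_laminar (hI : I.IsQRM2) (hr : 2 ≤ r) :
    ∃ (G : Finset (Finset (Fin n))) (c : Finset (Fin n) → ℝ), IsLaminar G ∧ (∀ X ∈ G, 0 < c X) ∧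
      ∀ p q, p ≠ q → ∀ i j k l, I.blk i = p → I.blk k = p → I.blk j = q → I.blk l = q →
        quadDiff (realPart I.quad) i j k l = ∑ X ∈ G, c X * chi X i j k l := by
  classical
  obtain ⟨f1, f2, ⟨a1, u1, ha1, hf1⟩, hc1, ⟨a2, u2, ha2, hf2⟩, hc2, hsum⟩ := hI
  obtain rfl : f1 = quadFun r a1 u1 := funext hf1
  obtain rfl : f2 = quadFun r a2 u2 := funext hf2
  have hlt : ∀ x, I.toFun x < ⊤ ↔ quadFun r a1 u1 x < ⊤ ∧ quadFun r a2 u2 x < ⊤ := fun x => by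
    rw [hsum, WithTop.add_lt_top]
  have h1 : Summand I a1 u1 := ⟨ha1, hc1, fun x hx => ((hlt x).mp hx).1⟩
  have h2 : Summand I a2 u2 := ⟨ha2, hc2, fun x hx => ((hlt x).mp hx).2⟩
  have hdiff : ∀ p q, p ≠ q → ∀ i j k l, I.blk i = p → I.blk k = p → I.blk j = q → I.blk l = q →
      quadDiff (realPart I.quad) i j k l =
        quadDiff (realPart a1) i j k l + quadDiff (realPart a2) i j k l := by
    intro p q hpq i j k l hi hk hj hl
    obtain ⟨S, hS⟩ := exists_transversal I hpq
    have hval : ∀ i j, I.blk i = p → I.blk j = q →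
        quadVal (realPart I.quad) I.lin (insert i (insert j S)) =
          quadVal (realPart a1) u1 (insert i (insert j S)) +
            quadVal (realPart a2) u2 (insert i (insert j S)) := fun i j hi hj => by
      have hx := hS.lt_top hpq hi hj
      have h := hsum (insert i (insert j S))
      rwa [quadFun_eq_coe ha1 (h1.dom _ hx), quadFun_eq_coe ha2 (h2.dom _ hx),
        VCSPQuadratic.toFun, quadFun_eq_coe I.quad_symm hx, ← WithTop.coe_add,
        WithTop.coe_inj] at h
    have key : ∀ {α : Fin n → Fin n → ℝ} (hα : ∀ i j, α i j = α j i) w, _ := fun hα w =>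
      quadDiff_eq_quadVal hα w (hS.not_mem (.inl hi)) (hS.not_mem (.inr hj)) (hS.not_mem (.inl hk))
        (hS.not_mem (.inr hl)) (by grind) (by grind) (by grind) (by grind)
    rw [key (fun i j => by rw [realPart, I.quad_symm, realPart]) I.lin, key h1.realPart_symm u1,
      key h2.realPart_symm u2, hval i j hi hj, hval k l hk hl, hval i l hi hl, hval k j hk hj]
    ring
  have hcover : ∀ i j, I.blk i = I.blk j → Parallel (quadFun r a1 u1) i j ∨
      Parallel (quadFun r a2 u2) i j := by
    intro i j hij
    by_contra! ⟨hn1, hn2⟩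
    have hne : i ≠ j := fun h => hn1 (h ▸ fun x _ _ _ => rfl)
    have : Nontrivial (Fin r) := Fin.nontrivial_iff_two_le.mpr hr
    obtain ⟨q, hq⟩ := exists_ne (I.blk i)
    obtain ⟨S, hS⟩ := exists_transversal I hq.symm
    have hiS := hS.not_mem (.inl rfl)
    have hjS := hS.not_mem (.inl hij.symm)
    obtain ⟨hS1, hS2, hS3⟩ := hS
    have hfin : ∀ (a : Fin n → Fin n → WithTop ℝ) (u : Fin n → ℝ), Summand I a u →
        ¬ Parallel (quadFun r a u) i j → quadFun r a u (insert i (insert j S)) < ⊤ :=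
      fun a u h hn => by
        have h3 : ∀ {s t}, Parallel (quadFun r a u) s t → I.blk s = I.blk t :=
          fun hp => by_contra fun h' => h.not_parallel h' hp
        have h4 : ¬ Parallel (quadFun r a u) j i := mt Parallel.symm hn
        exact h.lt_top_of_not_parallel (by grind) (by grind)
    exact (VCSPQuadratic.toFun_lt_top_iff.mp ((hlt _).mpr ⟨hfin _ _ h1 hn1, hfin _ _ h2 hn2⟩)).2
      i (by simp) j (by simp) hne hij
  have hsplit : ∀ p, Splits I (quadFun r a1 u1) p → ¬ Splits I (quadFun r a2 u2) p := by
    rintro p ⟨i, j, hi, hj, hij⟩ ⟨k, l, hk, hl, hkl⟩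
    have key : ∀ k, I.blk k = p → Parallel (quadFun r a2 u2) k i := fun k hk => by
      rcases hcover k i (hk.trans hi.symm) with h | h
      · rcases hcover k j (hk.trans hj.symm) with h' | h'
        · exact absurd (h.symm.trans hc1 (h1.covers hr) h') hij
        · exact h'.trans hc2 (h2.covers hr)
            ((hcover i j (hi.trans hj.symm)).resolve_left hij).symm
      · exact h
    exact hkl ((key k hk).trans hc2 (h2.covers hr) (key l hl).symm)
  obtain ⟨G1, c1, hG1, hpos1, hs1, hrep1⟩ := h1.exists_laminar hr
  obtain ⟨G2, c2, hG2, hpos2, hs2, hrep2⟩ := h2.exists_laminar hr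
  have hdisj : ∀ X ∈ G1, ∀ Y ∈ G2, X ∩ Y = ∅ := fun X hX Y hY =>
    eq_empty_iff_forall_notMem.mpr fun i hi => hsplit _ (hs1 X hX i (mem_inter.mp hi).1)
      (hs2 Y hY i (mem_inter.mp hi).2)
  refine ⟨G1 ∪ G2, fun X => (if X ∈ G1 then c1 X else 0) + if X ∈ G2 then c2 X else 0, ?_, ?_, ?_⟩
  · intro X hX Y hY
    rcases mem_union.mp hX with hX | hX <;> rcases mem_union.mp hY with hY | hY
    · exact hG1 X hX Y hY
    · exact .inr (.inr (hdisj X hX Y hY))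
    · grind
    · exact hG2 X hX Y hY
  · clear * - hpos1 hpos2
    grind
  · intro p q hpq i j k l hi hk hj hl
    rw [hdiff p q hpq i j k l hi hk hj hl, hrep1 p q hpq i j k l hi hk hj hl,
      hrep2 p q hpq i j k l hi hk hj hl]
    simp only [add_mul, ite_mul, zero_mul, sum_add_distrib]
    congr 1 <;> rw [← sum_filter, filter_mem_eq_inter]
    · rw [inter_eq_right.mpr subset_union_left]
    · rw [inter_eq_right.mpr subset_union_right]

end Summands

section Correctness

variable {n : ℕ} {a : Fin n → Fin n → WithTop ℝ} {B : ℕ → Finset (Fin n)} {r : ℕ}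
variable {G : Finset (Finset (Fin n))} {W W' : WFam n} {c : Finset (Fin n) → ℝ}
variable {o : Option (WFam n)} {p t : ℕ}

/-- The blocks `B 0, …, B (r-1)` and the coefficients `a` are as required by the algorithms. -/
structure BlockData (a : Fin n → Fin n → WithTop ℝ) (B : ℕ → Finset (Fin n)) (r : ℕ) : Prop where
  disj : DisjBlocks B
  two : ∀ p < r, ∀ t < r, p ≠ t → TwoBlock a (B p) (B t)

/-- The family `G` with weights `c` is laminar and decomposes `a`. -/
structure LaminarRep (a : Fin n → Fin n → WithTop ℝ) (B : ℕ → Finset (Fin n)) (r : ℕ)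
    (G : Finset (Finset (Fin n))) (c : Finset (Fin n) → ℝ) : Prop where
  lam : IsLaminar G
  pos : ∀ X ∈ G, 0 < c X
  diff : ∀ p < r, ∀ t < r, p ≠ t → ∀ i ∈ B p, ∀ j ∈ B t, ∀ k ∈ B p, ∀ l ∈ B t,
    quadDiff (realPart a) i j k l = ∑ X ∈ G, c X * chi X i j k l

theorem LaminarRep.not_algorithm1_none
    (hG : LaminarRep a B r G c) (hB : BlockData a B r) (hp : p < r) (ht : t < r)
    (hpt : p ≠ t) : ¬ Algorithm1 a (B p) (B t) none := by
  intro h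
  have h2 := hB.two p hp t ht hpt
  refine h (h2.normData.CB_of_laminar hG.lam hG.pos fun i hi j hj k hk l hl => ?_)
  rw [quadDiff_normEntry]
  exact hG.diff p hp t ht hpt i hi j hj k hk l hl

theorem LaminarRep.tracks_pair
    (hG : LaminarRep a B r G c) (hB : BlockData a B r) (hp : p < r) (ht : t < r)
    (hpt : p ≠ t) (hW : PairOutput a (B p) (B t) W) (X : Finset (Fin n))
    (h1 : Cuts (B p) X) (h2 : Cuts (B t) X) :
    classWt B {p, t} G c X = classWt B {p, t} W.fam W.wt X := by
  refine classWt_eq_of_sum_chi_eq (hB.two p hp t ht hpt).disj hG.lam hG.pos hW.lam hW.pos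
    (fun i hi j hj k hk l hl => ?_) h1 h2
  rw [← hG.diff p hp t ht hpt i hi j hj k hk l hl, hW.diff i hi j hj k hk l hl]
  rfl

/-- What is known about the outcome after `t` blocks. -/
def StageCorrect (a : Fin n → Fin n → WithTop ℝ) (B : ℕ → Finset (Fin n)) (r t : ℕ) :
    Option (WFam n) → Prop
  | none => ¬ ∃ G c, LaminarRep a B r G c
  | some W => StageOutput (realPart a) B t W ∧ ∀ G c, LaminarRep a B r G c → Tracks B t G c W

theorem stageCorrect_collect (hB : BlockData a B r) (ht : t < r)
    (hW' : StageCorrect a B r t (some W')) {L : ℕ → WFam n}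
    (hL : ∀ p < t, Algorithm1 a (B p) (B t) (some (L p))) {s : Alg2State n}
    (hs : Relation.ReflTransGen (Alg2Step B t) (startState W' L) s) (hend : s.old.fam = ∅) (hW : Collect t s W) : StageCorrect a B r (t + 1) (some W) := by
  have hL' : ∀ p < t, PairOutput a (B p) (B t) (L p) := fun p hp =>
    (hB.two p (by omega) t ht (by omega)).pairOutput (hL p hp)
  refine ⟨stageOutput_collect hB.disj hW'.1 hL' hs hend hW, fun G c hG => ?_⟩
  exact tracks_collect hB.disj hG.lam hG.pos hW'.1 hL' (hW'.2 G c hG)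
    (fun p hp X h1 h2 => hG.tracks_pair hB (by omega) ht (by omega) (hL' p hp) X h1 h2) hs hend hW

theorem StageCorrect.exists_equiv (h : StageCorrect a B r t (some W)) (hG : LaminarRep a B r G c) :
    ∀ X ∈ W.fam, ∃ Y ∈ G, CutEquiv B (range t) Y X := by
  intro X hX
  rw [← classWt_pos_iff hG.pos, h.2 G c hG X (h.1.cut X hX).2, classWt_pos_iff h.1.pos]
  exact ⟨X, hX, CutEquiv.refl _ _ _⟩

theorem stageCorrect_algorithm2 (hB : BlockData a B r) (ht : t < r)
    (hW' : StageCorrect a B r t (some W')) (h : Algorithm2 a B t W' o) :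
    StageCorrect a B r (t + 1) o := by
  cases h with
  | failPair p hp h =>
    rintro ⟨G, c, hG⟩
    exact hG.not_algorithm1_none hB (by omega) ht (by omega) h
  | tooLarge L s W hL hrun hend hW hcard =>
    rintro ⟨G, c, hG⟩
    have h1 := stageCorrect_collect hB ht hW' hL hrun hend hW
    have h2 := h1.1.card_le hB.disj hG.lam (h1.exists_equiv hG)
    omega
  | done L s W hL hrun hend hW hcard => exact stageCorrect_collect hB ht hW' hL hrun hend hW

/-- The empty family, from which the treatment of the second block starts. -/
def emptyFam (n : ℕ) : WFam n := ⟨∅, fun _ => 0⟩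

theorem stageCorrect_empty : StageCorrect a B r 1 (some (emptyFam n)) := by
  refine ⟨⟨by simp [emptyFam], by simp [emptyFam], by simp [emptyFam], fun p p' h h' => by omega⟩,
    fun G c _ X hX => ?_⟩
  obtain ⟨p, hp, q, hq, hpq, -⟩ := hX
  grind

theorem collect_one (W : WFam n) : Collect 1 (startState (emptyFam n) fun _ => W) W := by
  refine ⟨by simp [startState], fun p _ X _ => rfl, fun X hX => by simp [startState] at hX⟩

theorem stageCorrect_of_run (hB : BlockData a B r)
    (h : Alg3Run a B t o) : t ≤ r → StageCorrect a B r t o := by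
  induction h with
  | init o h =>
    intro hr
    cases o with
    | none =>
      rintro ⟨G, c, hG⟩
      exact hG.not_algorithm1_none hB (by omega) (by omega) (by omega) h
    | some W =>
      refine stageCorrect_collect hB (by omega) stageCorrect_empty (L := fun _ => W) ?_ .refl rfl
        (collect_one W)
      grind
  | stopped t h ih => exact fun ht => ih (by omega)
  | extend t W o h h' ih => exact fun ht => stageCorrect_algorithm2 hB (by omega) (ih (by omega)) h'

end Correctness

section Affine

variable {n : ℕ}

theorem sum_mem_eq_sum_univ (X : Finset (Fin n)) (f : Fin n → ℝ) :
    ∑ i ∈ X, f i = ∑ i, if i ∈ X then f i else 0 := by simp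

theorem ell_eq (X x : Finset (Fin n)) :
    ell X x = ∑ i ∈ x, ∑ j ∈ x with i < j, ind X i * ind X j := by
  unfold ell ind
  simp only [sum_filter]
  rw [sum_mem_eq_sum_univ X, sum_mem_eq_sum_univ x]
  refine sum_congr rfl fun i _ => ?_
  rw [sum_mem_eq_sum_univ X, sum_mem_eq_sum_univ x]
  by_cases hi : i ∈ X <;> by_cases hi' : i ∈ x <;> simp only [hi, hi', if_true, if_false, one_mul,
    zero_mul, ite_self, sum_const_zero]
  grind

theorem two_mul_sum_lt {β : Fin n → Fin n → ℝ} (hβ : ∀ i j, β i j = β j i) (h0 : ∀ i, β i i = 0)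
    (x : Finset (Fin n)) :
    2 * ∑ i ∈ x, ∑ j ∈ x with i < j, β i j = ∑ i ∈ x, ∑ j ∈ x, β i j := by
  classical
  induction x using Finset.induction_on with
  | empty => simp
  | insert i x hi ih =>
    have h := quadVal_insert hβ (fun _ => 0) hi
    simp only [quadVal, sum_const_zero, add_zero, zero_add] at h
    rw [h, mul_add, ih, sum_insert hi, sum_insert hi, h0]
    simp only [sum_insert hi, sum_add_distrib]
    grind

end Affine

namespace VCSPQuadratic

variable {n r : ℕ} (I : VCSPQuadratic n r)
variable {i : Fin n} {s : ℕ}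

theorem mem_block {p : Fin r} : i ∈ I.block p ↔ I.blk i = p := by
  simp [block]

theorem renamed_of_lt (σ : Equiv.Perm (Fin r)) (h : s < r) :
    I.renamed σ s = I.block (σ ⟨s, h⟩) := by
  rw [renamed, dif_pos h]

theorem mem_renamed {σ : Equiv.Perm (Fin r)} :
    i ∈ I.renamed σ s ↔ (σ.symm (I.blk i) : ℕ) = s := by
  unfold renamed
  split_ifs with h
  · rw [I.mem_block, ← Equiv.symm_apply_eq, Fin.ext_iff]
  grind

theorem forall_renamed_iff (σ : Equiv.Perm (Fin r)) (P : Finset (Fin n) → Prop) :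
    (∀ s ∈ range r, P (I.renamed σ s)) ↔ ∀ p ∈ (univ : Finset (Fin r)), P (I.block p) := by
  constructor
  · intro h p _
    simpa [I.renamed_of_lt] using h (σ.symm p) (mem_range.mpr (σ.symm p).isLt)
  · intro h s hs
    rw [I.renamed_of_lt σ (mem_range.mp hs)]
    grind

theorem blockData (σ : Equiv.Perm (Fin r)) : BlockData I.quad (I.renamed σ) r := by
  have hne : ∀ p < r, ∃ i, i ∈ I.renamed σ p := fun p hp => by
    obtain ⟨i, hi⟩ := I.exists_blk_eq (σ ⟨p, hp⟩)
    exact ⟨i, I.mem_renamed.mpr (by simp [hi])⟩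
  have hs : ∀ i j, (σ.symm (I.blk i) : ℕ) = σ.symm (I.blk j) ↔ I.blk i = I.blk j := by
    simp [← Fin.ext_iff]
  refine ⟨?_, fun p hp t ht hpt => ⟨?_, hne p hp, hne t ht, I.quad_symm, ?_, ?_, ?_⟩⟩ <;>
    simp only [DisjBlocks, mem_renamed] <;> clear hne <;> grind [I.quad_eq_top_iff]

theorem sim_iff (σ : Equiv.Perm (Fin r)) (X Y : Finset (Fin n)) :
    I.Sim X Y ↔ CutEquiv (I.renamed σ) (range r) X Y := by
  have hB := (I.blockData σ).disj.on (range r)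
  unfold Sim
  rw [cutEquiv_iff hB, cutEquiv_iff fun p _ q _ i hp hq =>
      (I.mem_block.mp hp).symm.trans (I.mem_block.mp hq),
    I.forall_renamed_iff σ fun A => Cuts A X ↔ Cuts A Y]
  refine and_congr_right fun _ => exists_congr fun ε => ?_
  rw [I.forall_renamed_iff σ fun A => Cuts A X → ∀ i ∈ A, (i ∈ X ↔ (i ∈ Y ↔ ε))]

theorem aCut_of_twoCuts (σ : Equiv.Perm (Fin r)) {X : Finset (Fin n)}
    (h : TwoCuts (I.renamed σ) (range r) X) : I.ACut X := by
  obtain ⟨p, hp, q, hq, hpq, h1, h2⟩ := h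
  rw [mem_range] at hp hq
  rw [I.renamed_of_lt σ hp] at h1
  rw [I.renamed_of_lt σ hq] at h2
  exact ⟨fun i _ => mem_biUnion.mpr ⟨I.blk i, mem_univ _, I.mem_block.mpr rfl⟩,
    _, mem_univ _, _, mem_univ _, fun h => hpq (Fin.mk.inj (σ.injective h)), h1, h2⟩

theorem laminarRep_of_isQRM2 (hr : 2 ≤ r) (σ : Equiv.Perm (Fin r)) (hI : I.IsQRM2) :
    ∃ G c, LaminarRep I.quad (I.renamed σ) r G c := by
  obtain ⟨G, c, hG, hc, h⟩ := hI.exists_laminar hr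
  refine ⟨G, c, hG, hc, fun p hp t ht hpt i hi j hj k hk l hl => ?_⟩
  rw [I.renamed_of_lt σ hp, I.mem_block] at hi hk
  rw [I.renamed_of_lt σ ht, I.mem_block] at hj hl
  exact h (σ ⟨p, hp⟩) (σ ⟨t, ht⟩) (fun h => hpt (Fin.mk.inj (σ.injective h))) i j k l hi hk hj hl

theorem exists_section_of_delta {x : Finset (Fin n)} (hx : ∀ p, (x ∩ I.block p).card = 1) :
    ∃ e : Fin r → Fin n, (∀ p, I.blk (e p) = p) ∧ Function.Injective e ∧
      x = univ.image e := by
  classical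
  choose e he using fun p => card_eq_one.mp (hx p)
  have hmem : ∀ p i, i = e p ↔ i ∈ x ∧ I.blk i = p := fun p i => by
    rw [← I.mem_block, ← mem_inter, he, mem_singleton]
  have hb : ∀ p, e p ∈ x ∧ I.blk (e p) = p := fun p => (hmem p _).mp rfl
  refine ⟨e, fun p => (hb p).2, fun p q h => by grind, ?_⟩
  ext i
  simp only [mem_image, mem_univ, true_and]
  exact ⟨fun hi => ⟨_, ((hmem _ _).mpr ⟨hi, rfl⟩).symm⟩, by grind⟩

/-- Equality of the quadratic parts across the blocks gives `𝒜`-linear equivalence. -/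
theorem linEquiv_of_quadDiff_eq (W : WFam n)
    (hW : ∀ p q, p ≠ q → ∀ i j k l, I.blk i = p → I.blk k = p → I.blk j = q → I.blk l = q →
      quadDiff (realPart I.quad) i j k l = W.sum fun X => chi X i j k l) :
    I.LinEquiv I.toFun (fun x => ((∑ X ∈ W.fam, W.wt X * ell X x : ℝ) : WithTop ℝ)) := by
  classical
  choose ρ hρ using I.exists_blk_eq
  set β : Fin n → Fin n → ℝ := fun i j =>
    if I.blk i = I.blk j then 0 else realPart I.quad i j - simil W.fam W.wt i j with hβ
  have hsymm : ∀ i j, β i j = β j i := by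
    intro i j
    simp only [hβ, eq_comm (a := I.blk i), realPart, I.quad_symm i j, simil_symm _ _ i]
  have hzero : ∀ i, β i i = 0 := fun i => by simp [hβ]
  have hsplit : ∀ i j, β i j = β i (ρ (I.blk j)) + β (ρ (I.blk i)) j -
      β (ρ (I.blk i)) (ρ (I.blk j)) := by
    intro i j
    by_cases hij : I.blk i = I.blk j
    · grind
    · have h := hW _ _ hij i j (ρ (I.blk i)) (ρ (I.blk j)) rfl (hρ _) rfl (hρ _)
      simp only [hβ, hρ, if_neg hij]
      rw [quadDiff, WFam.sum, sum_mul_chi] at h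
      linarith
  refine ⟨fun x => I.delta x + (((∑ i ∈ x, (I.lin i + ∑ q, β i (ρ q))) +
    -((∑ p, ∑ q, β (ρ p) (ρ q)) / 2) : ℝ) : WithTop ℝ),
    ⟨fun i => I.lin i + ∑ q, β i (ρ q), -((∑ p, ∑ q, β (ρ p) (ρ q)) / 2), fun x => rfl⟩,
    fun x => ?_⟩
  by_cases hx : ∀ p, (x ∩ I.block p).card = 1
  swap
  · simp [delta, hx]
  have hδ : I.delta x = 0 := if_pos hx
  obtain ⟨e, he, hinj, rfl⟩ := I.exists_section_of_delta hx
  have hfin : I.toFun (univ.image e) < ⊤ := by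
    rw [toFun_lt_top_iff]
    refine ⟨by simp [card_image_of_injective _ hinj], ?_⟩
    simp only [mem_image]
    grind
  beta_reduce
  rw [hδ, toFun, quadFun_eq_coe I.quad_symm hfin, add_zero, zero_add, ← WithTop.coe_add,
    WithTop.coe_inj]
  set x := univ.image e with hxe
  have h1 : quadVal (realPart I.quad) I.lin x - ∑ X ∈ W.fam, W.wt X * ell X x =
      (∑ i ∈ x, ∑ j ∈ x with i < j, β i j) + ∑ i ∈ x, I.lin i := by
    have h2 : ∑ X ∈ W.fam, W.wt X * ell X x =
        ∑ i ∈ x, ∑ j ∈ x with i < j, simil W.fam W.wt i j := by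
      simp only [ell_eq, mul_sum, simil]
      rw [sum_comm]
      exact sum_congr rfl fun i _ => sum_comm
    rw [h2, quadVal, add_sub_right_comm, ← sum_sub_distrib]
    congr 1
    refine sum_congr rfl fun i hi => (sum_sub_distrib ..).symm.trans (sum_congr rfl fun j hj => ?_)
    obtain ⟨hj, hij⟩ := mem_filter.mp hj
    exact (if_neg ((toFun_lt_top_iff.mp hfin).2 i hi j hj hij.ne)).symm
  have h3 := two_mul_sum_lt hsymm hzero x
  have h4 : ∑ i ∈ x, ∑ j ∈ x, β i j =
      2 * (∑ i ∈ x, ∑ q, β i (ρ q)) - ∑ p, ∑ q, β (ρ p) (ρ q) := by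
    rw [hxe]
    simp only [sum_image fun p _ q _ h => hinj h]
    have h5 : ∀ p q, β (e p) (e q) = β (e p) (ρ q) + β (e q) (ρ p) - β (ρ p) (ρ q) :=
      fun p q => by rw [hsplit (e p) (e q), he, he, hsymm (ρ p) (e q)]
    simp only [h5, sum_sub_distrib, sum_add_distrib]
    rw [sum_comm (f := fun p q => β (e q) (ρ p))]
    ring
  rw [sum_add_distrib]
  linarith

/-- Every answer of Algorithm 3 is correct. -/
theorem isDecompositionAnswer_of_algorithm3 (hr : 2 ≤ r) {o : Option (WFam n)}
    (ho : I.Algorithm3 o) : I.IsDecompositionAnswer o := by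
  classical
  obtain ⟨σ, -, hrun⟩ := ho
  have h := stageCorrect_of_run (I.blockData σ) hrun le_rfl
  cases o with
  | none => exact fun hI => h (I.laminarRep_of_isQRM2 hr σ hI)
  | some W =>
    refine ⟨fun X hX => I.aCut_of_twoCuts σ (h.1.cut X hX).2, fun X hX Y hY hXY =>
      h.1.nonred X hX Y hY ((I.sim_iff σ X Y).mp hXY), h.1.pos, I.linEquiv_of_quadDiff_eq W ?_, ?_⟩
    · have key : ∀ p q, σ.symm p < σ.symm q → ∀ i j k l, I.blk i = p → I.blk k = p → I.blk j = q →
          I.blk l = q → quadDiff (realPart I.quad) i j k l = W.sum fun X => chi X i j k l := by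
        rintro p q hpq i j k l rfl hk rfl hl
        exact h.1.diff _ _ hpq (σ.symm _).isLt i (I.mem_renamed.mpr rfl) j (I.mem_renamed.mpr rfl) k
          (I.mem_renamed.mpr (by rw [hk])) l (I.mem_renamed.mpr (by rw [hl]))
      intro p q hpq i j k l hi hk hj hl
      rcases lt_or_gt_of_ne (fun h => hpq (σ.symm.injective h)) with hlt | hlt
      · grind
      · have h1 := key q p hlt j i l k hj hl hi hk
        have h2 : ∀ X : Finset (Fin n), chi X j i l k = chi X i j k l := fun X => by
          unfold chi
          ring
        simp only [h2] at h1
        simp only [← h1, quadDiff, realPart, I.quad_symm j, I.quad_symm l]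
        ring
    · intro hI
      obtain ⟨G, c, hG⟩ := I.laminarRep_of_isQRM2 hr σ hI
      have hex := h.exists_equiv hG
      refine ⟨G.filter fun Y => ∃ X ∈ W.fam, CutEquiv (I.renamed σ) (range r) X Y, ?_, ?_, ?_, ?_⟩
      · intro Y hY
        obtain ⟨-, X, hX, hXY⟩ := mem_filter.mp hY
        exact I.aCut_of_twoCuts σ (TwoCuts.congr (I.blockData σ).disj hXY (h.1.cut X hX).2)
      · exact fun X hX Y hY =>
          hG.lam X (mem_filter.mp hX).1 Y (mem_filter.mp hY).1
      · intro X hX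
        obtain ⟨Y, hY, hYX⟩ := hex X hX
        exact ⟨Y, mem_filter.mpr ⟨hY, X, hX, hYX.symm⟩, (I.sim_iff σ X Y).mpr hYX.symm⟩
      · intro Y hY
        obtain ⟨-, X, hX, hXY⟩ := mem_filter.mp hY
        exact ⟨X, hX, (I.sim_iff σ X Y).mpr hXY⟩

end VCSPQuadratic

section Machine

/-- Assign a natural variable. -/
def Store.setn (m : Store) (x v : ℕ) : Store := { m with nvar := update m.nvar x v }

/-- Assign a real variable. -/
def Store.setr (m : Store) (x : ℕ) (v : ℝ) : Store := { m with rvar := update m.rvar x v }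

/-- Assign a cell of a natural array. -/
def Store.setN (m : Store) (A i j v : ℕ) : Store := { m with narr := putCell m.narr A i j v }

/-- Assign a cell of a real array. -/
def Store.setR (m : Store) (A i j : ℕ) (v : ℝ) : Store := { m with rarr := putCell m.rarr A i j v }

section Cells

variable (m : Store) (x v y A i j A' i' j' : ℕ) (w : ℝ)

@[simp] theorem Store.setn_nvar : (m.setn x v).nvar y = if y = x then v else m.nvar y := by
  simp [Store.setn, update_apply]
@[simp] theorem Store.setn_rvar : (m.setn x v).rvar = m.rvar := rfl
@[simp] theorem Store.setn_narr : (m.setn x v).narr = m.narr := rfl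
@[simp] theorem Store.setn_rarr : (m.setn x v).rarr = m.rarr := rfl
@[simp] theorem Store.setr_rvar : (m.setr x w).rvar y = if y = x then w else m.rvar y := by
  simp [Store.setr, update_apply]
@[simp] theorem Store.setr_nvar : (m.setr x w).nvar = m.nvar := rfl
@[simp] theorem Store.setr_narr : (m.setr x w).narr = m.narr := rfl
@[simp] theorem Store.setr_rarr : (m.setr x w).rarr = m.rarr := rfl
@[simp] theorem Store.setN_narr : (m.setN A i j v).narr A' i' j' =
    if A' = A ∧ i' = i ∧ j' = j then v else m.narr A' i' j' := rfl
@[simp] theorem Store.setN_nvar : (m.setN A i j v).nvar = m.nvar := rfl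
@[simp] theorem Store.setN_rvar : (m.setN A i j v).rvar = m.rvar := rfl
@[simp] theorem Store.setN_rarr : (m.setN A i j v).rarr = m.rarr := rfl
@[simp] theorem Store.setR_rarr : (m.setR A i j w).rarr A' i' j' =
    if A' = A ∧ i' = i ∧ j' = j then w else m.rarr A' i' j' := rfl
@[simp] theorem Store.setR_nvar : (m.setR A i j w).nvar = m.nvar := rfl
@[simp] theorem Store.setR_rvar : (m.setR A i j w).rvar = m.rvar := rfl
@[simp] theorem Store.setR_narr : (m.setR A i j w).narr = m.narr := rfl

end Cells

attribute [simp] NExp.eval RExp.eval Test.holds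

/-- `P` assigns the natural variable `x`. -/
def Prog.wn : Prog → ℕ → Bool
  | .nset y _, x => x == y
  | .seq P Q, x => P.wn x || Q.wn x
  | .ite _ P Q, x => P.wn x || Q.wn x
  | .loop _ P, x => P.wn x
  | _, _ => false

/-- `P` assigns the real variable `x`. -/
def Prog.wr : Prog → ℕ → Bool
  | .rset y _, x => x == y
  | .seq P Q, x => P.wr x || Q.wr x
  | .ite _ P Q, x => P.wr x || Q.wr x
  | .loop _ P, x => P.wr x
  | _, _ => false

/-- `P` writes into the natural array `A`. -/
def Prog.wN : Prog → ℕ → Bool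
  | .nput y _ _ _, x => x == y
  | .seq P Q, x => P.wN x || Q.wN x
  | .ite _ P Q, x => P.wN x || Q.wN x
  | .loop _ P, x => P.wN x
  | _, _ => false

/-- `P` writes into the real array `A`. -/
def Prog.wR : Prog → ℕ → Bool
  | .rput y _ _ _, x => x == y
  | .seq P Q, x => P.wR x || Q.wR x
  | .ite _ P Q, x => P.wR x || Q.wR x
  | .loop _ P, x => P.wR x
  | _, _ => false

/-- The memories `m` and `m'` agree on what `P` does not assign. -/
structure Frame (P : Prog) (m m' : Store) : Prop where
  n : ∀ x, P.wn x = false → m'.nvar x = m.nvar x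
  r : ∀ x, P.wr x = false → m'.rvar x = m.rvar x
  N : ∀ A, P.wN A = false → m'.narr A = m.narr A
  R : ∀ A, P.wR A = false → m'.rarr A = m.rarr A

theorem Frame.refl (P : Prog) (m : Store) : Frame P m m :=
  ⟨fun _ _ => rfl, fun _ _ => rfl, fun _ _ => rfl, fun _ _ => rfl⟩

theorem Frame.trans {P : Prog} {m1 m2 m3 : Store} (h : Frame P m1 m2) (h' : Frame P m2 m3) :
    Frame P m1 m3 :=
  ⟨fun x hx => (h'.n x hx).trans (h.n x hx), fun x hx => (h'.r x hx).trans (h.r x hx),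
    fun x hx => (h'.N x hx).trans (h.N x hx), fun x hx => (h'.R x hx).trans (h.R x hx)⟩

theorem Frame.mono {P Q : Prog} {m m' : Store} (h : Frame P m m')
    (hn : ∀ x, Q.wn x = false → P.wn x = false) (hr : ∀ x, Q.wr x = false → P.wr x = false)
    (hN : ∀ x, Q.wN x = false → P.wN x = false) (hR : ∀ x, Q.wR x = false → P.wR x = false) :
    Frame Q m m' :=
  ⟨fun x hx => h.n x (hn x hx), fun x hx => h.r x (hr x hx), fun x hx => h.N x (hN x hx),
    fun x hx => h.R x (hR x hx)⟩

theorem Frame.seq_left {P Q : Prog} {m m' : Store} (h : Frame P m m') : Frame (.seq P Q) m m' :=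
  h.mono (by simp +contextual [Prog.wn]) (by simp +contextual [Prog.wr])
    (by simp +contextual [Prog.wN]) (by simp +contextual [Prog.wR])

theorem Frame.seq_right {P Q : Prog} {m m' : Store} (h : Frame Q m m') : Frame (.seq P Q) m m' :=
  h.mono (by simp +contextual [Prog.wn]) (by simp +contextual [Prog.wr])
    (by simp +contextual [Prog.wN]) (by simp +contextual [Prog.wR])

theorem Frame.ite_left {b : Test} {P Q : Prog} {m m' : Store} (h : Frame P m m') :
    Frame (.ite b P Q) m m' :=
  h.mono (by simp +contextual [Prog.wn]) (by simp +contextual [Prog.wr])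
    (by simp +contextual [Prog.wN]) (by simp +contextual [Prog.wR])

theorem Frame.ite_right {b : Test} {P Q : Prog} {m m' : Store} (h : Frame Q m m') :
    Frame (.ite b P Q) m m' :=
  h.mono (by simp +contextual [Prog.wn]) (by simp +contextual [Prog.wr])
    (by simp +contextual [Prog.wN]) (by simp +contextual [Prog.wR])

theorem Exec.frame {P : Prog} {m m' : Store} {T : ℕ} (h : Exec P m m' T) : Frame P m m' := by
  induction h with
  | skip m => exact Frame.refl _ _
  | nset x e m =>
    refine ⟨fun y hy => ?_, fun _ _ => rfl, fun _ _ => rfl, fun _ _ => rfl⟩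
    have : y ≠ x := by simpa [Prog.wn] using hy
    simp [this]
  | rset x e m =>
    refine ⟨fun _ _ => rfl, fun y hy => ?_, fun _ _ => rfl, fun _ _ => rfl⟩
    have : y ≠ x := by simpa [Prog.wr] using hy
    simp [this]
  | nput A i j e m =>
    refine ⟨fun _ _ => rfl, fun _ _ => rfl, fun y hy => ?_, fun _ _ => rfl⟩
    have : y ≠ A := by simpa [Prog.wN] using hy
    funext i' j'
    simp [putCell, this]
  | rput A i j e m =>
    refine ⟨fun _ _ => rfl, fun _ _ => rfl, fun _ _ => rfl, fun y hy => ?_⟩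
    have : y ≠ A := by simpa [Prog.wR] using hy
    funext i' j'
    simp [putCell, this]
  | seq P Q m m1 m2 T1 T2 h1 h2 ih1 ih2 => exact ih1.seq_left.trans ih2.seq_right
  | iteTrue b P Q m m' T hb h ih => exact ih.ite_left
  | iteFalse b P Q m m' T hb h ih => exact ih.ite_right
  | loopTrue b P m m1 m2 T1 T2 hb h1 h2 ih1 ih2 =>
    exact Frame.trans (ih1.mono (Q := .loop b P) (fun _ h => h) (fun _ h => h) (fun _ h => h)
      fun _ h => h) ih2
  | loopFalse b P m hb => exact Frame.refl _ _

/-- Started in `m`, the program `P` halts within `K` time units in a memory satisfying `Q`. -/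
def Ht (P : Prog) (m : Store) (K : ℕ) (Q : Store → Prop) : Prop :=
  ∃ m' T, Exec P m m' T ∧ T ≤ K ∧ Q m'

variable {P P' : Prog} {m : Store} {K K' : ℕ} {Q Q' : Store → Prop}

/-- Consequence rule, with the frame as an additional information. -/
theorem Ht.conseq (h : Ht P m K Q) (hK : K ≤ K') (hQ : ∀ m', Frame P m m' → Q m' → Q' m') :
    Ht P m K' Q' := by
  obtain ⟨m', T, h1, h2, h3⟩ := h
  exact ⟨m', T, h1, h2.trans hK, hQ m' h1.frame h3⟩

theorem Ht.seq (h : Ht P m K Q) (h' : ∀ m', Frame P m m' → Q m' → Ht P' m' K' Q') :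
    Ht (.seq P P') m (K + K') Q' := by
  obtain ⟨m1, T1, h1, h2, h3⟩ := h
  obtain ⟨m2, T2, h4, h5, h6⟩ := h' m1 h1.frame h3
  exact ⟨m2, T1 + T2, .seq _ _ _ _ _ _ _ h1 h4, by omega, h6⟩

theorem Ht.ite {b : Test} (h : b.holds m → Ht P m K Q) (h' : ¬ b.holds m → Ht P' m K Q) :
    Ht (.ite b P P') m (b.cost + K) Q := by
  by_cases hb : b.holds m
  · obtain ⟨m', T, h1, h2, h3⟩ := h hb
    exact ⟨m', b.cost + T, .iteTrue _ _ _ _ _ _ hb h1, by omega, h3⟩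
  · obtain ⟨m', T, h1, h2, h3⟩ := h' hb
    exact ⟨m', b.cost + T, .iteFalse _ _ _ _ _ _ hb h1, by omega, h3⟩

theorem Ht.ite_le {b : Test} (hK : b.cost + K ≤ K') (h : b.holds m → Ht P m K Q)
    (h' : ¬ b.holds m → Ht P' m K Q) : Ht (.ite b P P') m K' Q :=
  (Ht.ite h h').conseq hK fun _ _ h => h

theorem Ht.seq_le {K1 K2 : ℕ} (h : Ht P m K1 Q) (hK : K1 + K2 ≤ K)
    (h' : ∀ m', Frame P m m' → Q m' → Ht P' m' K2 Q') : Ht (.seq P P') m K Q' :=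
  (h.seq h').conseq hK fun _ _ h => h

/-- Weakest preconditions of programs without loops. -/
def wp : Prog → (Store → Prop) → Store → Prop
  | .skip, Q, m => Q m
  | .nset x e, Q, m => Q (m.setn x (e.eval m))
  | .rset x e, Q, m => Q (m.setr x (e.eval m))
  | .nput A i j e, Q, m => Q (m.setN A (i.eval m) (j.eval m) (e.eval m))
  | .rput A i j e, Q, m => Q (m.setR A (i.eval m) (j.eval m) (e.eval m))
  | .seq P P', Q, m => wp P (wp P' Q) m
  | .ite b P P', Q, m => (b.holds m → wp P Q m) ∧ (¬ b.holds m → wp P' Q m)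
  | .loop _ _, _, _ => False

/-- A bound for the running time of programs without loops. -/
def Prog.time : Prog → ℕ
  | .skip => 1
  | .nset _ e => e.cost + 1
  | .rset _ e => e.cost + 1
  | .nput _ i j e => i.cost + j.cost + e.cost + 1
  | .rput _ i j e => i.cost + j.cost + e.cost + 1
  | .seq P P' => P.time + P'.time
  | .ite b P P' => b.cost + (P.time + P'.time)
  | .loop _ _ => 0

theorem Ht.of_wp (h : wp P Q m) (hK : P.time ≤ K) : Ht P m K Q := by
  suffices H : Ht P m P.time Q from H.conseq hK fun _ _ h => h
  clear hK
  induction P generalizing m Q with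
  | skip => exact ⟨_, _, .skip m, le_rfl, h⟩
  | nset x e => exact ⟨_, _, .nset x e m, le_rfl, h⟩
  | rset x e => exact ⟨_, _, .rset x e m, le_rfl, h⟩
  | nput A i j e => exact ⟨_, _, .nput A i j e m, le_rfl, h⟩
  | rput A i j e => exact ⟨_, _, .rput A i j e m, le_rfl, h⟩
  | seq P P' ih ih' => exact (ih h).seq fun m' _ h' => ih' h'
  | ite b P P' ih ih' =>
    exact Ht.ite (fun hb => (ih (h.1 hb)).conseq (by omega) fun _ _ h => h)
      fun hb => (ih' (h.2 hb)).conseq (by omega) fun _ _ h => h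
  | loop b P _ => exact h.elim

/-- A straight sequence. -/
def progs : List Prog → Prog
  | [] => .skip
  | [P] => P
  | P :: Q :: l => .seq P (progs (Q :: l))

theorem Ht.cons {l : List Prog} {K1 K2 : ℕ} (h : Ht P m K1 Q) (hK : K1 + K2 ≤ K)
    (h' : ∀ m', Frame P m m' → Q m' → Ht (progs (P' :: l)) m' K2 Q') :
    Ht (progs (P :: P' :: l)) m K Q' :=
  (h.seq h').conseq hK fun _ _ h => h

/-- `for x := 0, 1, …, y - 1`. -/
def forP (x y : ℕ) (P : Prog) : Prog :=
  .seq (.nset x (.lit 0)) (.loop (.nlt (.var x) (.var y)) (.seq P (.nset x (.add (.var x) (.lit 1)))))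

theorem Ht.for {x y N : ℕ} (Inv : ℕ → Store → Prop) (K : ℕ → ℕ) (hx : P.wn x = false)
    (hy : P.wn y = false) (hxy : y ≠ x) (hN : m.nvar y = N)
    (hI : ∀ k m v, Inv k m → Inv k (m.setn x v)) (h0 : Inv 0 m)
    (hstep : ∀ k m', k < N → Frame (forP x y P) m m' → m'.nvar x = k → m'.nvar y = N → Inv k m' →
      Ht P m' (K k) (Inv (k + 1))) :
    Ht (forP x y P) m (∑ k ∈ range N, (K k + 7) + 5) (Inv N) := by
  have hloop : ∀ d k, k + d = N → ∀ m', Frame (forP x y P) m m' → m'.nvar x = k → Inv k m' →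
      Ht (.loop (.nlt (.var x) (.var y)) (.seq P (.nset x (.add (.var x) (.lit 1))))) m'
        (∑ k ∈ Finset.Ico k N, (K k + 7) + 3) (Inv N) := by
    intro d
    induction d with
    | zero =>
      intro k hk m' hF hk' hInv
      have hy' : m'.nvar y = N := (hF.n y (by simp [forP, Prog.wn, hy, hxy])).trans hN
      obtain rfl : k = N := by omega
      exact ⟨m', _, .loopFalse _ _ _ (by simp [hk', hy']), by simp [Test.cost, NExp.cost], hInv⟩
    | succ d ih =>
      intro k hk m' hF hk' hInv
      have hy' : m'.nvar y = N := (hF.n y (by simp [forP, Prog.wn, hy, hxy])).trans hN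
      obtain ⟨m1, T1, h1, h2, h3⟩ := hstep k m' (by omega) hF hk' hy' hInv
      have hx1 : m1.nvar x = k := (h1.frame.n x hx).trans hk'
      have hset : Exec (.nset x (.add (.var x) (.lit 1))) m1 (m1.setn x (k + 1)) 4 := by
        have := Exec.nset x (.add (.var x) (.lit 1)) m1
        simp only [NExp.eval, hx1] at this
        exact this
      have hseq := Exec.seq _ _ _ _ _ _ _ h1 hset
      have hF' : Frame (forP x y P) m (m1.setn x (k + 1)) := by
        refine hF.trans ((hseq.frame.mono ?_ ?_ ?_ ?_))
        all_goals simp +contextual [forP, Prog.wn, Prog.wr, Prog.wN, Prog.wR]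
      obtain ⟨m2, T2, h4, h5, h6⟩ := ih (k + 1) (by omega) (m1.setn x (k + 1)) hF' (by simp)
        (hI _ _ _ h3)
      refine ⟨m2, _, .loopTrue _ _ _ _ _ _ _ (by simp [hk', hy']; omega) hseq h4, ?_, h6⟩
      rw [sum_eq_sum_Ico_succ_bot (by omega)]
      simp only [Test.cost, NExp.cost]
      omega
  have hfirst : Exec (.nset x (.lit 0)) m (m.setn x 0) 2 := Exec.nset x (.lit 0) m
  have hF0 : Frame (forP x y P) m (m.setn x 0) := hfirst.frame.seq_left
  obtain ⟨m', T, h1, h2, h3⟩ := hloop N 0 (by omega) (m.setn x 0) hF0 (by simp) (hI _ _ _ h0)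
  refine ⟨m', _, .seq _ _ _ _ _ _ _ hfirst h1, ?_, h3⟩
  rw [range_eq_Ico]
  omega

/-- The rule for loops whose passes all have the same time bound. -/
theorem Ht.for_const {x y N : ℕ} (Inv : ℕ → Store → Prop) (K : ℕ) (hx : P.wn x = false)
    (hy : P.wn y = false) (hxy : y ≠ x) (hN : m.nvar y = N)
    (hI : ∀ k m v, Inv k m → Inv k (m.setn x v)) (h0 : Inv 0 m)
    (hstep : ∀ k m', k < N → Frame (forP x y P) m m' → m'.nvar x = k → m'.nvar y = N → Inv k m' →
      Ht P m' K (Inv (k + 1))) :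
    Ht (forP x y P) m (N * (K + 7) + 5) (Inv N) := by
  have := Ht.for Inv (fun _ => K) hx hy hxy hN hI h0 hstep
  simpa using this

end Machine

section Counting

/-- The number of the indices below `k` that satisfy `p`. -/
noncomputable def cnt {n : ℕ} (k : ℕ) (p : Fin n → Prop) : ℕ := by
  classical exact (univ.filter fun i : Fin n => (i : ℕ) < k ∧ p i).card

theorem cnt_zero {n : ℕ} (p : Fin n → Prop) : cnt 0 p = 0 := by simp [cnt]

theorem cnt_succ {n k : ℕ} (hk : k < n) (p : Fin n → Prop) [Decidable (p ⟨k, hk⟩)] :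
    cnt (k + 1) p = cnt k p + if p ⟨k, hk⟩ then 1 else 0 := by
  classical
  unfold cnt
  split_ifs with h
  · have : (univ.filter fun i : Fin n => (i : ℕ) < k + 1 ∧ p i) =
        insert ⟨k, hk⟩ (univ.filter fun i : Fin n => (i : ℕ) < k ∧ p i) := by grind
    grind
  · rw [add_zero]
    congr 1
    grind

theorem cnt_full {n : ℕ} (p : Fin n → Prop) [DecidablePred p] :
    cnt n p = (univ.filter p).card := by
  classical
  unfold cnt
  congr 1
  ext i
  simp

end Counting

section Context

variable {n : ℕ}

/-- The blocks `B 0, …, B (r-1)` partition `[n]`; `nb i` is the index of the block of `i` and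
`fs s` is an element of `B s`. -/
structure Ctx (n r : ℕ) (a : Fin n → Fin n → WithTop ℝ) where
  B : ℕ → Finset (Fin n)
  nb : Fin n → ℕ
  fs : ℕ → Fin n
  mem : ∀ i s, i ∈ B s ↔ nb i = s
  nb_lt : ∀ i, nb i < r
  nb_fs : ∀ s < r, nb (fs s) = s
  data : BlockData a B r

/-- The data that the program keeps in the memory throughout. -/
structure Env {n r : ℕ} {a : Fin n → Fin n → WithTop ℝ} (c : Ctx n r a) (m : Store) : Prop where
  hn : m.nvar 2 = n
  hr : m.nvar 3 = r
  nb : ∀ i : Fin n, m.narr 2 0 i = c.nb i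
  fs : ∀ s < r, m.narr 3 0 s = c.fs s
  quad : ∀ i j : Fin n, m.rarr 1 i j = realPart a i j

/-- The program `P` does not overwrite the data of `Env`. -/
def Prog.keepsEnv (P : Prog) : Bool :=
  !(P.wn 2) && !(P.wn 3) && !(P.wN 2) && !(P.wN 3) && !(P.wR 1)

theorem Env.of_frame {r : ℕ} {a : Fin n → Fin n → WithTop ℝ} {c : Ctx n r a} {m m' : Store}
    (h : Env c m) {P : Prog} (hF : Frame P m m') (hP : P.keepsEnv = true) : Env c m' := by
  simp only [Prog.keepsEnv, Bool.and_eq_true, Bool.not_eq_true'] at hP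
  obtain ⟨⟨⟨⟨h1, h2⟩, h3⟩, h4⟩, h5⟩ := hP
  exact ⟨(hF.n 2 h1).trans h.hn, (hF.n 3 h2).trans h.hr, fun i => by rw [hF.N 2 h3, h.nb],
    fun s hs => by rw [hF.N 3 h4, h.fs s hs], fun i j => by rw [hF.R 1 h5, h.quad]⟩

end Context

namespace VCSPQuadratic

variable {n r : ℕ} (I : VCSPQuadratic n r)

/-- The block `q` precedes the block `p` in the renamed order. -/
def Precedes (q p : Fin r) : Prop :=
  (I.block p).card < (I.block q).card ∨ ((I.block q).card = (I.block p).card ∧ q < p)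

/-- The new name of the block `p`. -/
noncomputable def rank (p : Fin r) : ℕ := cnt r fun q => I.Precedes q p

theorem rank_lt_of_precedes {q p : Fin r} (h : I.Precedes q p) : I.rank q < I.rank p := by
  classical
  unfold rank
  rw [cnt_full, cnt_full]
  refine Finset.card_lt_card (Finset.ssubset_iff_subset_ne.mpr ⟨fun s hs => ?_, fun he => ?_⟩)
  · simp only [Finset.mem_filter, Finset.mem_univ, true_and] at hs ⊢
    unfold Precedes at *
    omega
  · have : q ∈ univ.filter fun q => I.Precedes q p := by simpa using h
    rw [← he] at this
    exact absurd (mem_filter.mp this).2 (by simp [Precedes])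

theorem precedes_or (q p : Fin r) (h : q ≠ p) : I.Precedes q p ∨ I.Precedes p q := by
  unfold Precedes
  omega

theorem rank_lt (p : Fin r) : I.rank p < r := by
  classical
  unfold rank
  rw [cnt_full]
  refine (card_lt_card (filter_ssubset.mpr ⟨p, mem_univ _, ?_⟩)).trans_eq
    (by simp)
  simp [Precedes]

theorem rank_injective : Function.Injective fun p => (⟨I.rank p, I.rank_lt p⟩ : Fin r) := by
  intro p q h
  by_contra hne
  have h' : I.rank p = I.rank q := Fin.mk.inj h
  rcases I.precedes_or p q hne with h1 | h1
  · exact absurd h' (I.rank_lt_of_precedes h1).ne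
  · exact absurd h' (I.rank_lt_of_precedes h1).ne'

/-- The newOrder used by the program. -/
noncomputable def newOrder : Equiv.Perm (Fin r) :=
  (Equiv.ofBijective _ (Finite.injective_iff_bijective.mp I.rank_injective)).symm

theorem newOrder_symm_apply (p : Fin r) : (I.newOrder.symm p : ℕ) = I.rank p := rfl

theorem antitone_newOrder : Antitone fun s => (I.block (I.newOrder s)).card := by
  intro s s' hs
  by_contra hcon
  have h1 := I.rank_lt_of_precedes (.inl (not_le.mp hcon) : I.Precedes (I.newOrder s') (I.newOrder s))
  rw [← newOrder_symm_apply, ← newOrder_symm_apply, Equiv.symm_apply_apply,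
    Equiv.symm_apply_apply] at h1
  grind

/-- The context of the input `I`. -/
noncomputable def ctx (fs : ℕ → Fin n) (hfs : ∀ s < r, I.rank (I.blk (fs s)) = s) :
    Ctx n r I.quad where
  B := I.renamed I.newOrder
  nb i := I.rank (I.blk i)
  fs := fs
  mem i s := by rw [I.mem_renamed, newOrder_symm_apply]
  nb_lt i := I.rank_lt _
  nb_fs := hfs
  data := I.blockData _

/-- Sort the blocks by size, and record the index of the block of each element and an element of
each block. -/
def initP : Prog := progs
  [.nset 2 (.var 0), .nset 3 (.var 1),
   forP 10 2 (.nput 4 (.lit 0) (.get 0 (.lit 0) (.var 10))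
     (.add (.get 4 (.lit 0) (.get 0 (.lit 0) (.var 10))) (.lit 1))),
   forP 10 3 (progs
     [.nset 12 (.lit 0),
      forP 11 3 (.ite (.nlt (.get 4 (.lit 0) (.var 10)) (.get 4 (.lit 0) (.var 11)))
        (.nset 12 (.add (.var 12) (.lit 1)))
        (.ite (.and (.neq (.get 4 (.lit 0) (.var 11)) (.get 4 (.lit 0) (.var 10)))
            (.nlt (.var 11) (.var 10)))
          (.nset 12 (.add (.var 12) (.lit 1))) .skip)),
      .nput 5 (.lit 0) (.var 10) (.var 12)]),
   forP 10 2 (.nput 2 (.lit 0) (.var 10) (.get 5 (.lit 0) (.get 0 (.lit 0) (.var 10)))),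
   forP 10 2 (.nput 3 (.lit 0) (.get 2 (.lit 0) (.var 10)) (.var 10))]

theorem two_mul_le (I : VCSPQuadratic n r) : 2 * r ≤ n := by
  classical
  have h1 : (univ : Finset (Fin n)).card = ∑ p : Fin r, (I.block p).card :=
    card_eq_sum_card_fiberwise fun i _ => mem_univ _
  have h2 : ∑ _p : Fin r, 2 ≤ ∑ p : Fin r, (I.block p).card :=
    sum_le_sum fun p _ => I.two_le_card p
  simp only [card_univ, Fintype.card_fin, sum_const, smul_eq_mul] at h1 h2
  omega

theorem ht_initP (hr : 2 ≤ r) : Ht initP I.encode (1000 * (r * n))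
    (fun m => (∃ fs hfs, Env (I.ctx fs hfs) m) ∧
      (∀ x, initP.wn x = false → m.nvar x = I.encode.nvar x) ∧
      ∀ A, initP.wN A = false → m.narr A = I.encode.narr A) := by
  classical
  have hrn := I.two_mul_le
  have hblk : ∀ i : Fin n, I.encode.narr 0 0 i = I.blk i := fun i => by simp [encode]
  have main : Ht initP I.encode (1000 * (r * n)) fun m => ∃ fs hfs, Env (I.ctx fs hfs) m := by
    unfold initP progs
    refine ((Ht.of_wp (K := 2) (Q := fun m => m.nvar 2 = n ∧ m.narr = I.encode.narr ∧
      m.nvar 1 = r ∧ m.rarr = I.encode.rarr) ?_ le_rfl).seq (K' := 999 * (r * n)) fun m1 _ h1 => ?_).conseq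
        (by nlinarith) fun _ _ h => h
    · simp [wp, encode]
    obtain ⟨hn1, hN1, hr1, hR1⟩ := h1
    unfold progs
    refine ((Ht.of_wp (K := 2) (Q := fun m => m.nvar 2 = n ∧ m.narr = I.encode.narr ∧
      m.nvar 3 = r ∧ m.rarr = I.encode.rarr) ?_ le_rfl).seq (K' := 998 * (r * n)) fun m2 _ h₂ => ?_).conseq
        (by nlinarith) fun _ _ h => h
    · simp [wp, hn1, hN1, hr1, hR1]
    obtain ⟨hn2, hN2, hr2, hR2⟩ := h₂
    unfold progs
    refine ((Ht.for_const (N := n) (fun k m => ∀ q : Fin r,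
      m.narr 4 0 q = cnt k fun i => I.blk i = q) 20 rfl rfl (by decide) hn2 (fun k m v h => h)
      ?_ ?_).seq (K' := 900 * (r * n)) fun m3 hF3 h3 => ?_).conseq
        (by nlinarith) fun _ _ h => h
    · intro q
      simp [hN2, cnt_zero, encode]
    · intro k m' hk hF hk' _ hI
      refine Ht.of_wp ?_ (by decide)
      have hb : m'.narr 0 0 k = I.blk ⟨k, hk⟩ := by
        rw [hF.N 0 rfl, hN2]
        grind
      simp only [wp, NExp.eval, hk', hb]
      intro q
      rw [cnt_succ hk, Store.setN_narr, hI]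
      grind
    have hsz : ∀ q : Fin r, m3.narr 4 0 q = (I.block q).card := fun q => by
      rw [h3 q, cnt_full]
      rfl
    unfold progs
    refine ((Ht.for_const (N := r) (fun k m => ∀ q : Fin r, (q : ℕ) < k → m.narr 5 0 q = I.rank q)
      (r * 50 + 20) rfl rfl (by decide) ((hF3.n 3 rfl).trans hr2) (fun k m v h => h)
      ?_ ?_).seq (K' := 500 * (r * n)) fun m4 hF4 h4 => ?_).conseq
        (by nlinarith) fun _ _ h => h
    · grind
    · intro k m' hk hF hk' hr' hI
      unfold progs
      refine ((Ht.of_wp (K := 2) (Q := fun m => m.nvar 12 = 0) ?_ le_rfl).seq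
        (K' := r * 50 + 18) fun m5 hF5 h5 => ?_).conseq (by omega) fun _ _ h => h
      · simp [wp]
      unfold progs
      refine ((Ht.for_const (N := r) (fun j m => m.nvar 12 = cnt j fun q => I.Precedes q ⟨k, hk⟩)
        30 rfl rfl (by decide) ((hF5.n 3 rfl).trans hr') (fun k m v h => by simpa using h)
        ?_ ?_).seq (K' := 4) fun m6 hF6 h6 => ?_).conseq (by omega) fun _ _ h => h
      · rw [h5, cnt_zero]
      · intro j m' hj hF' hj' _ hI'
        refine Ht.of_wp ?_ (by decide)
        have e1 : m'.nvar 10 = k := by rw [hF'.n 10 rfl, hF5.n 10 rfl, hk']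
        have e2 : ∀ q : Fin r, m'.narr 4 0 q = (I.block q).card := fun q => by
          rw [hF'.N 4 rfl, hF5.N 4 rfl, hF.N 4 rfl, hsz]
        have e3 := e2 ⟨k, hk⟩
        have e4 := e2 ⟨j, hj⟩
        have e5 : I.Precedes ⟨j, hj⟩ ⟨k, hk⟩ ↔ (I.block ⟨k, hk⟩).card < (I.block ⟨j, hj⟩).card ∨
          ((I.block ⟨j, hj⟩).card = (I.block ⟨k, hk⟩).card ∧ j < k) := Iff.rfl
        simp only at e3 e4
        simp only [wp, NExp.eval, Test.holds, e1, hj', e3, e4, Store.setn_nvar, hI', cnt_succ hj,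
          if_true]
        grind
      · unfold progs
        refine Ht.of_wp ?_ (by decide)
        have e1 : m6.nvar 10 = k := by rw [hF6.n 10 rfl, hF5.n 10 rfl, hk']
        simp only [wp, NExp.eval, e1]
        intro q hq
        rw [Store.setN_narr]
        by_cases hqk : (q : ℕ) = k
        · obtain rfl : q = ⟨k, hk⟩ := Fin.ext hqk
          simp [h6, rank]
        · simp only [hqk, and_false, if_false]
          rw [hF6.N 5 rfl, hF5.N 5 rfl, hI q (by omega)]
    have hrk : ∀ q : Fin r, m4.narr 5 0 q = I.rank q := fun q => h4 q q.isLt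
    unfold progs
    refine ((Ht.for_const (N := n) (fun k m => ∀ i : Fin n, (i : ℕ) < k →
      m.narr 2 0 i = I.rank (I.blk i)) 9 rfl rfl (by decide)
      ((hF4.n 2 rfl).trans ((hF3.n 2 rfl).trans hn2)) (fun k m v h => h)
      ?_ ?_).seq (K' := 100 * (r * n)) fun m5 hF5 h5 => ?_).conseq
        (by nlinarith) fun _ _ h => h
    · grind
    · intro k m' hk hF hk' _ hI
      refine Ht.of_wp ?_ (by decide)
      have hb : m'.narr 0 0 k = I.blk ⟨k, hk⟩ := by
        rw [hF.N 0 rfl, hF4.N 0 rfl, hF3.N 0 rfl, hN2]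
        grind
      have hb' : m'.narr 5 0 (I.blk ⟨k, hk⟩) = I.rank (I.blk ⟨k, hk⟩) := by
        rw [hF.N 5 rfl, hrk]
      simp only [wp, NExp.eval, hk', hb, hb']
      intro i hi
      rw [Store.setN_narr]
      grind
    unfold progs
    refine (Ht.for_const (N := n) (fun k m => ∀ i : Fin n, (i : ℕ) < k →
      ∃ j : Fin n, I.rank (I.blk j) = I.rank (I.blk i) ∧ m.narr 3 0 (I.rank (I.blk i)) = j) 7 rfl
      rfl (by decide) ((hF5.n 2 rfl).trans ((hF4.n 2 rfl).trans ((hF3.n 2 rfl).trans hn2)))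
      (fun k m v h => h) ?_ ?_).conseq (by nlinarith) fun m6 hF6 h6 => ?_
    · grind
    · intro k m' hk hF hk' _ hI
      refine Ht.of_wp ?_ (by decide)
      have hb : m'.narr 2 0 k = I.rank (I.blk ⟨k, hk⟩) := by
        rw [hF.N 2 rfl]
        grind
      simp only [wp, NExp.eval, hk', hb]
      intro i hi
      by_cases hik : I.rank (I.blk i) = I.rank (I.blk ⟨k, hk⟩)
      · exact ⟨⟨k, hk⟩, hik.symm, by simp [hik]⟩
      · obtain ⟨j, hj, hj'⟩ := hI i (by grind)
        exact ⟨j, hj, by simp [hik, hj']⟩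
    have hex : ∀ s, ∃ j : Fin n, s < r → I.rank (I.blk j) = s ∧ m6.narr 3 0 s = j := by
      intro s
      by_cases hs : s < r
      · obtain ⟨i, hi⟩ := I.exists_blk_eq (I.newOrder ⟨s, hs⟩)
        have hi' : I.rank (I.blk i) = s := by
          rw [hi, ← newOrder_symm_apply, Equiv.symm_apply_apply]
        grind
      · exact ⟨⟨0, by omega⟩, fun h => absurd h hs⟩
    choose fs hfs using hex
    refine ⟨fs, fun s hs => (hfs s hs).1, ?_, ?_, fun i => ?_, fun s hs => (hfs s hs).2,
      fun i j => ?_⟩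
    · rw [hF6.n 2 rfl, hF5.n 2 rfl, hF4.n 2 rfl, hF3.n 2 rfl, hn2]
    · rw [hF6.n 3 rfl, hF5.n 3 rfl, hF4.n 3 rfl, hF3.n 3 rfl, hr2]
    · rw [hF6.N 2 rfl]
      exact h5 i i.isLt
    · rw [hF6.R 1 rfl, hF5.R 1 rfl, hF4.R 1 rfl, hF3.R 1 rfl, hR2]
      simp [encode, realPart]
  exact main.conseq le_rfl fun m hF h => ⟨h, hF.n, hF.N⟩

end VCSPQuadratic

section Prim

variable {n : ℕ}
variable {L : Finset (Fin n)} {i : Fin n} {k l l' r r' u : ℕ} {x y : Fin n} {α : ℝ}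

/-- The elements `i`, `j` lie in different blocks. -/
def Opp (A1 A2 : Finset (Fin n)) (i j : Fin n) : Prop := (i ∈ A1 ∧ j ∈ A2) ∨ (i ∈ A2 ∧ j ∈ A1)

/-- An order of the ground set in which it is exhausted by the algorithm of Prim for maximum
spanning trees; `d k` is the largest entry between `v k` and its predecessors. -/
structure PrimData (A1 A2 : Finset (Fin n)) (e : Fin n → Fin n → ℝ) (low : ℝ) (N : ℕ)
    (v : ℕ → Fin n) (d : ℕ → ℝ) : Prop where
  inj : ∀ u < N, ∀ w < N, v u = v w → u = w
  mem : ∀ i, i ∈ A1 ∪ A2 ↔ ∃ u < N, v u = i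
  zero : d 0 = low
  last : d N = low
  le : ∀ u < N, low ≤ d u
  prim : ∀ u k l, u < k → k ≤ l → l < N → Opp A1 A2 (v u) (v l) → e (v u) (v l) ≤ d k
  att : ∀ k < N, d k = low ∨ ∃ u < k, Opp A1 A2 (v u) (v k) ∧ e (v u) (v k) = d k

/-- The interval `[l, r)` of the order. -/
noncomputable def seg (v : ℕ → Fin n) (l r : ℕ) : Finset (Fin n) := by
  classical exact univ.filter fun i => ∃ u, l ≤ u ∧ u < r ∧ v u = i

/-- `[l, r)` is the maximal interval with entries at least `d k` behind its first position, and `k`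
is the first position in it where this minimum is attained. -/
structure IsMember (N : ℕ) (d : ℕ → ℝ) (low : ℝ) (k l r : ℕ) : Prop where
  low_lt : low < d k
  lk : l < k
  left : d l < d k
  between : ∀ u, l < u → u < k → d k < d u
  kr : k < r
  rN : r ≤ N
  right : d r < d k
  after : ∀ u, k < u → u < r → d k ≤ d u

theorem IsMember.interior {N : ℕ} {d : ℕ → ℝ} {low : ℝ} (h : IsMember N d low k l r)
    (u : ℕ) (h1 : l < u) (h2 : u < r) : d k ≤ d u := by
  rcases lt_trichotomy u k with hu | rfl | hu
  · exact (h.between u h1 hu).le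
  · exact le_rfl
  · exact h.after u hu h2

theorem IsMember.unique {N : ℕ} {d : ℕ → ℝ} {low : ℝ}
    (h : IsMember N d low k l r) (h' : IsMember N d low k l' r') : l = l' ∧ r = r' := by
  have h1 := h.lk
  have h2 := h'.lk
  have h3 := h.kr
  have h4 := h'.kr
  constructor
  · rcases lt_trichotomy l l' with hl | hl | hl
    · exact absurd (h.between l' hl h2) h'.left.not_gt
    · exact hl
    · exact absurd (h'.between l hl h1) h.left.not_gt
  · rcases lt_trichotomy r r' with hl | hl | hl
    · exact absurd (h'.after r h3 hl) h.right.not_ge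
    · exact hl
    · exact absurd (h.after r' h4 hl) h'.right.not_ge

theorem IsMember.unique' {N : ℕ} {d : ℕ → ℝ} {low : ℝ} {k' : ℕ}
    (h : IsMember N d low k l r) (h' : IsMember N d low k' l r) : k = k' := by
  rcases lt_trichotomy k k' with hl | hl | hl
  · exact absurd (h'.between k h.lk hl) (h.after k' hl h'.kr).not_gt
  · exact hl
  · exact absurd (h.between k' h'.lk hl) (h'.after k hl h.kr).not_gt

theorem Opp.symm {A1 A2 : Finset (Fin n)} {j : Fin n} (h : Opp A1 A2 i j) : Opp A1 A2 j i := by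
  rcases h with ⟨h1, h2⟩ | ⟨h1, h2⟩
  · exact .inr ⟨h2, h1⟩
  · exact .inl ⟨h2, h1⟩

variable {a : Fin n → Fin n → WithTop ℝ} {A1 A2 : Finset (Fin n)} {e : Fin n → Fin n → ℝ} {low : ℝ}
  {N : ℕ} {v : ℕ → Fin n} {d : ℕ → ℝ}

theorem NormData.adj_iff_opp (h : NormData a A1 A2 e low) (he : ∀ i j, e i j = e j i) : (levelGraph A1 A2 a α).Adj x y ↔ Opp A1 A2 x y ∧ α ≤ e x y := by
  rw [h.adj_iff, he y x, Opp]
  tauto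

theorem NormData.opp_le (h : NormData a A1 A2 e low) (he : ∀ i j, e i j = e j i)
    (hxy : Opp A1 A2 x y) : low ≤ e x y := by
  rcases hxy with ⟨h1, h2⟩ | ⟨h1, h2⟩
  · exact h.le x h1 y h2
  · rw [he]
    exact h.le y h2 x h1

theorem PrimData.mem_seg (hP : PrimData A1 A2 e low N v d) (hu : u < N) (hr : r ≤ N) :
    v u ∈ seg v l r ↔ l ≤ u ∧ u < r := by
  simp only [seg, mem_filter, mem_univ, true_and]
  constructor
  · rintro ⟨w, h1, h2, h3⟩
    obtain rfl := hP.inj w (by omega) u hu h3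
    grind
  grind

theorem PrimData.mem_seg_iff (hP : PrimData A1 A2 e low N v d) (hr : r ≤ N) :
    i ∈ seg v l r ↔ i ∈ A1 ∪ A2 ∧ ∃ u < N, v u = i ∧ l ≤ u ∧ u < r := by
  constructor
  · intro hi
    simp only [seg, mem_filter, mem_univ, true_and] at hi
    obtain ⟨u, h1, h2, h3⟩ := hi
    exact ⟨(hP.mem i).mpr ⟨u, by omega, h3⟩, u, by omega, h3, h1, h2⟩
  · rintro ⟨-, u, h1, rfl, h2⟩
    exact (hP.mem_seg h1 hr).mpr h2

theorem PrimData.seg_subset_seg (hP : PrimData A1 A2 e low N v d) (hr' : r' ≤ N)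
    (hlr' : l' < r') (hr : r ≤ N) (h : seg v l' r' ⊆ seg v l r) : l ≤ l' ∧ r' ≤ r := by
  have h1 := (hP.mem_seg (by omega) hr).mp (h ((hP.mem_seg (u := l') (by omega) hr').mpr (by omega)))
  have h2 := (hP.mem_seg (by omega) hr).mp
    (h ((hP.mem_seg (u := r' - 1) (by omega) hr').mpr (by omega)))
  omega

theorem PrimData.seg_inj (hP : PrimData A1 A2 e low N v d) (hr : r ≤ N)
    (hlr : l < r) (hr' : r' ≤ N) (hlr' : l' < r') (h : seg v l r = seg v l' r') :
    l = l' ∧ r = r' := by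
  have h1 := hP.seg_subset_seg hr hlr hr' h.subset
  have h2 := hP.seg_subset_seg hr' hlr' hr h.symm.subset
  omega

theorem exists_left (h0 : d 0 < α) (u : ℕ) :
    ∃ l ≤ u, d l < α ∧ ∀ k, l < k → k ≤ u → α ≤ d k := by
  induction u with
  | zero => grind
  | succ u ih =>
    grind

theorem exists_right (hN : d N < α) (hu : u < N) :
    ∃ r, u < r ∧ r ≤ N ∧ d r < α ∧ ∀ k, u < k → k < r → α ≤ d k := by
  classical
  have hex : ∃ r, u < r ∧ d r < α := ⟨N, hu, hN⟩
  refine ⟨Nat.find hex, (Nat.find_spec hex).1, Nat.find_min' hex ⟨hu, hN⟩, (Nat.find_spec hex).2,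
    fun k hk hk' => ?_⟩
  by_contra hcon
  exact Nat.find_min hex hk' ⟨hk, not_le.mp hcon⟩

/-- Reachability in the graph of level `α` in terms of the order. -/
theorem PrimData.reachable_iff (hP : PrimData A1 A2 e low N v d) (h : NormData a A1 A2 e low)
    (he : ∀ i j, e i j = e j i) (hα : low < α) {w : ℕ} (hw : w < N) (huw : u ≤ w) :
    (levelGraph A1 A2 a α).Reachable (v u) (v w) ↔ ∀ k, u < k → k ≤ w → α ≤ d k := by
  constructor
  · intro hr
    rw [SimpleGraph.reachable_iff_reflTransGen] at hr
    have key : ∀ y, Relation.ReflTransGen (levelGraph A1 A2 a α).Adj (v u) y →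
        ∃ w < N, v w = y ∧ ∀ k, min u w < k → k ≤ max u w → α ≤ d k := by
      intro y hy
      induction hy with
      | refl => grind
      | @tail y z _ hadj ih =>
        obtain ⟨w, hw, rfl, h1⟩ := ih
        obtain ⟨hopp, hle⟩ := (h.adj_iff_opp he).mp hadj
        obtain ⟨w', hw', rfl⟩ := (hP.mem z).mp (by
          rw [mem_union]
          rcases hopp with h | h
          · exact .inr h.2
          · exact .inl h.2)
        refine ⟨w', hw', rfl, fun k h2 h3 => ?_⟩
        by_cases hk : min u w < k ∧ k ≤ max u w
        · grind
        · rcases Nat.lt_or_ge w w' with hlt | hge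
          · exact hle.trans (hP.prim w k w' (by omega) (by omega) hw' hopp)
          · rw [he] at hle
            exact hle.trans (hP.prim w' k w (by omega) (by omega) hw hopp.symm)
    obtain ⟨w', hw', he', hk⟩ := key _ hr
    obtain rfl := hP.inj w' hw' w hw he'
    grind
  · intro hk
    obtain ⟨l, hl, h1, h2⟩ := exists_left (d := d) (by rw [hP.zero]; exact hα) u
    have key : ∀ w, l ≤ w → w < N → (∀ k, l < k → k ≤ w → α ≤ d k) →
        (levelGraph A1 A2 a α).Reachable (v l) (v w) := by
      intro w
      induction w using Nat.strong_induction_on with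
      | _ w ih =>
        intro hlw hw hk
        rcases hlw.eq_or_lt with rfl | hlw
        · exact SimpleGraph.Reachable.refl _
        have hw' := hk w hlw le_rfl
        rcases hP.att w hw with h3 | ⟨x, hx, hopp, h3⟩
        · linarith
        have hlx : l ≤ x := by
          by_contra hcon
          have := hP.prim x l w (by omega) hlw.le hw hopp
          linarith
        have hadj : (levelGraph A1 A2 a α).Adj (v x) (v w) :=
          (h.adj_iff_opp he).mpr ⟨hopp, h3 ▸ hw'⟩
        exact (ih x hx hlx (by omega) fun k h4 h5 => hk k h4 (by omega)).trans hadj.reachable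
    refine (key u hl (by omega) h2).symm.trans (key w (by omega) hw fun k h3 h4 => ?_)
    grind

theorem PrimData.mem_comps_iff (hP : PrimData A1 A2 e low N v d) (h : NormData a A1 A2 e low)
    (he : ∀ i j, e i j = e j i) (hα : low < α) :
    L ∈ comps A1 A2 a α ↔ ∃ l r, l + 1 < r ∧ r ≤ N ∧ d l < α ∧ d r < α ∧
      (∀ k, l < k → k < r → α ≤ d k) ∧ L = seg v l r := by
  have hreach : ∀ l r, r ≤ N → d l < α → d r < α → (∀ k, l < k → k < r → α ≤ d k) →
      ∀ u, l ≤ u → u < r → ∀ i, (levelGraph A1 A2 a α).Reachable (v u) i ↔ i ∈ seg v l r := by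
    intro l r hr hl hdr hk u hlu hur i
    constructor
    · intro hi
      have hiS := h.mem_union_of_reachable hi ((hP.mem _).mpr ⟨u, by omega, rfl⟩)
      obtain ⟨w, hw, rfl⟩ := (hP.mem i).mp hiS
      rw [hP.mem_seg hw hr]
      rcases le_total u w with huw | huw
      · refine ⟨by omega, ?_⟩
        by_contra hcon
        have := (hP.reachable_iff h he hα hw huw).mp hi r (by omega) (by omega)
        linarith
      · refine ⟨?_, by omega⟩
        by_contra hcon
        have := (hP.reachable_iff h he hα (by omega) huw).mp hi.symm l (by omega) (by omega)
        linarith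
    · intro hi
      obtain ⟨-, w, hw, rfl, h1, h2⟩ := (hP.mem_seg_iff hr).mp hi
      rcases le_total u w with huw | huw
      · exact (hP.reachable_iff h he hα hw huw).mpr fun k h3 h4 => hk k (by omega) (by omega)
      · exact ((hP.reachable_iff h he hα (by omega) huw).mpr
          fun k h3 h4 => hk k (by omega) (by omega)).symm
  rw [mem_comps]
  constructor
  · rintro ⟨i, j, hadj, hL⟩
    have hopp := ((h.adj_iff_opp he).mp hadj).1
    have hiS : i ∈ A1 ∪ A2 := by
      rw [mem_union]
      rcases hopp with h | h
      · exact .inl h.1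
      · exact .inr h.1
    obtain ⟨u, hu, rfl⟩ := (hP.mem i).mp hiS
    obtain ⟨l, hl, h1, h2⟩ := exists_left (d := d) (by rw [hP.zero]; exact hα) u
    obtain ⟨r, hr, hrN, h3, h4⟩ := exists_right (d := d) (by rw [hP.last]; exact hα) hu
    have hk : ∀ k, l < k → k < r → α ≤ d k := fun k h5 h6 => by grind
    have hseg := hreach l r hrN h1 h3 hk u hl hr
    refine ⟨l, r, ?_, hrN, h1, h3, hk, ext fun i => by rw [hL, hseg]⟩
    obtain ⟨-, w, hw, hwj, h5, h6⟩ := (hP.mem_seg_iff hrN).mp ((hseg j).mp hadj.reachable)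
    have : w ≠ u := by
      rintro rfl
      exact hadj.ne hwj
    omega
  · rintro ⟨l, r, hlr, hrN, h1, h2, hk, rfl⟩
    have h3 := hk (l + 1) (by omega) hlr
    rcases hP.att (l + 1) (by omega) with h4 | ⟨x, hx, hopp, h4⟩
    · linarith
    obtain rfl : x = l := by
      by_contra hcon
      have := hP.prim x l (l + 1) (by omega) (by omega) (by omega) hopp
      linarith
    exact ⟨v x, v (x + 1), (h.adj_iff_opp he).mpr ⟨hopp, h4 ▸ h3⟩,
      fun i => (hreach x r hrN h1 h2 hk x le_rfl (by omega) i).symm⟩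

theorem PrimData.mem_upperLevels (hP : PrimData A1 A2 e low N v d) (h : NormData a A1 A2 e low)
    (he : ∀ i j, e i j = e j i) (hk : k < N) (hlow : low < d k) :
    d k ∈ upperLevels A1 A2 a := by
  rw [h.mem_upperLevels]
  refine ⟨hlow, ?_⟩
  rcases hP.att k hk with h1 | ⟨u, hu, ⟨h1, h2⟩ | ⟨h1, h2⟩, h3⟩
  · linarith
  · grind
  grind

theorem PrimData.seg_mem_comps (hP : PrimData A1 A2 e low N v d) (h : NormData a A1 A2 e low)
    (he : ∀ i j, e i j = e j i) (hk : IsMember N d low k l r) :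
    seg v l r ∈ comps A1 A2 a (d k) :=
  (hP.mem_comps_iff h he hk.low_lt).mpr ⟨l, r, by have := hk.lk; have := hk.kr; omega, hk.rN,
    hk.left, hk.right, hk.interior, rfl⟩

theorem PrimData.mem_rawFam_iff (hP : PrimData A1 A2 e low N v d) (h : NormData a A1 A2 e low)
    (he : ∀ i j, e i j = e j i) :
    L ∈ rawFam A1 A2 a ↔ ∃ k l r, IsMember N d low k l r ∧ L = seg v l r := by
  classical
  rw [mem_rawFam]
  constructor
  · rintro ⟨α, hα, hL⟩
    have hlow := (h.mem_upperLevels.mp hα).1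
    obtain ⟨l, r, hlr, hrN, h1, h2, h3, rfl⟩ := (hP.mem_comps_iff h he hlow).mp hL
    have hex : ∃ k, l < k ∧ k < r ∧ ∀ u, l < u → u < r → d k ≤ d u := by
      obtain ⟨k, hk, hmin⟩ := (Finset.Ioo l r).exists_min_image d ⟨l + 1, by simp; omega⟩
      rw [mem_Ioo] at hk
      exact ⟨k, hk.1, hk.2, fun u h4 h5 => hmin u (mem_Ioo.mpr ⟨h4, h5⟩)⟩
    obtain ⟨h4, h5, h6⟩ := Nat.find_spec hex
    have h7 := h3 _ h4 h5
    refine ⟨Nat.find hex, l, r, ⟨by linarith, h4, by linarith, fun u h8 h9 => ?_, h5, hrN,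
      by linarith, fun u h8 h9 => h6 u (by omega) h9⟩, rfl⟩
    by_contra hcon
    exact Nat.find_min hex h9 ⟨h8, by omega, fun x hx hx' => (not_lt.mp hcon).trans (h6 x hx hx')⟩
  · rintro ⟨k, l, r, hk, rfl⟩
    exact ⟨d k, hP.mem_upperLevels h he (by have := hk.kr; have := hk.rN; omega) hk.low_lt,
      hP.seg_mem_comps h he hk⟩

theorem PrimData.rawWt_seg (hP : PrimData A1 A2 e low N v d) (h : NormData a A1 A2 e low)
    (he : ∀ i j, e i j = e j i) (hCB : CB A1 A2 a) (hk : IsMember N d low k l r) :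
    rawWt A1 A2 a (seg v l r) = d k - max (d l) (d r) := by
  have hlk := hk.lk
  have hkr := hk.kr
  have hrN := hk.rN
  have hlevel : ∀ {β : ℝ} {l' r' u : ℕ}, low < β → seg v l' r' ∈ comps A1 A2 a β →
      β ∈ upperLevels A1 A2 a → r' ≤ N → l' < u → u < r' → d u = β →
      levelOf A1 A2 a (seg v l' r') = β := by
    intro β l' r' u hβ hc hβu hr' hu hu' hdu
    obtain ⟨h1, h2, h3⟩ := h.levelOf_spec hCB (mem_rawFam.mpr ⟨β, hβu, hc⟩)
    refine le_antisymm ?_ (h3 β hβu hc)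
    obtain ⟨l'', r'', h4, h5, -, -, h6, h7⟩ :=
      (hP.mem_comps_iff h he (h.mem_upperLevels.mp h1).1).mp h2
    obtain ⟨rfl, rfl⟩ := hP.seg_inj hr' (by omega) h5 (by omega) h7
    grind
  have hraw := (hP.mem_rawFam_iff h he).mpr ⟨k, l, r, hk, rfl⟩
  have e1 : levelOf A1 A2 a (seg v l r) = d k := hlevel hk.low_lt (hP.seg_mem_comps h he hk)
    (hP.mem_upperLevels h he (by omega) hk.low_lt) hk.rN hlk hkr rfl
  have hsuper : ∀ L' ∈ rawFam A1 A2 a, seg v l r ⊂ L' → ∃ k' l' r', IsMember N d low k' l' r' ∧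
      L' = seg v l' r' ∧ l' ≤ l ∧ r ≤ r' ∧ (d k' ≤ d l ∨ (d k' ≤ d r ∧ r < N)) := by
    intro L' hL' hss
    obtain ⟨k', l', r', hk', rfl⟩ := (hP.mem_rawFam_iff h he).mp hL'
    have hs := hP.seg_subset_seg hrN (by omega) hk'.rN hss.subset
    refine ⟨k', l', r', hk', rfl, hs.1, hs.2, ?_⟩
    rcases hs.1.lt_or_eq with h1 | h1
    · exact .inl (hk'.interior l h1 (by omega))
    · rcases hs.2.lt_or_eq with h2 | h2
      · exact .inr ⟨hk'.interior r (by omega) h2, by have := hk'.rN; omega⟩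
      grind
  have hlow : low ≤ max (d l) (d r) := le_max_of_le_left (hP.le l (by omega))
  have e2 : levelOf A1 A2 a (parent A1 A2 a (seg v l r)) = max (d l) (d r) := by
    rcases hlow.eq_or_lt with heq | hlt
    · rw [parent_eq_of_least (P := A1 ∪ A2) (mem_insert_self _ _), h.levelOf_union, heq]
      · exact (h.subset_union_of_mem (mem_insert_of_mem hraw)).ssubset_of_ne
          (h.ne_union_of_mem_rawFam hCB hraw)
      · intro L' hL' hss
        rcases mem_insert.mp hL' with rfl | hL'
        · exact subset_rfl
        · obtain ⟨k', l', r', hk', -, -, -, h1⟩ := hsuper L' hL' hss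
          have h2 := hk'.low_lt
          have h3 := le_max_left (d l) (d r)
          grind
    · obtain ⟨l', hl', h1, h2⟩ := exists_left (d := d) (by rw [hP.zero]; exact hlt) l
      have hβk : max (d l) (d r) < d k := max_lt hk.left hk.right
      have hright : ∃ r', r ≤ r' ∧ r' ≤ N ∧ d r' < max (d l) (d r) ∧
          ∀ x, r ≤ x → x < r' → max (d l) (d r) ≤ d x := by
        obtain ⟨r', h3, h4, h5, h6⟩ := exists_right (d := d) (N := N) (u := k)
          (by rw [hP.last]; exact hlt) (by omega)
        refine ⟨r', ?_, h4, h5, fun x hx hx' => h6 x (by omega) hx'⟩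
        by_contra hcon
        have := hk.after r' h3 (by omega)
        linarith
      obtain ⟨r', h3, h4, h5, h6⟩ := hright
      have hint : ∀ x, l' < x → x < r' → max (d l) (d r) ≤ d x := by
        intro x hx hx'
        rcases Nat.lt_or_ge l x with h7 | h7
        · rcases Nat.lt_or_ge x r with h8 | h8
          · exact hβk.le.trans (hk.interior x h7 h8)
          · exact h6 x h8 hx'
        · exact h2 x hx h7
      have hu : ∃ u, l' < u ∧ u < r' ∧ d u = max (d l) (d r) ∧ (u = l ∨ u = r) := by
        rcases max_choice (d l) (d r) with h7 | h7
        · grind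
        grind
      obtain ⟨u, hu1, hu2, hu3, hu4⟩ := hu
      have hβu : max (d l) (d r) ∈ upperLevels A1 A2 a := by
        rw [← hu3]
        exact hP.mem_upperLevels h he (by omega) (hu3 ▸ hlt)
      have hc : seg v l' r' ∈ comps A1 A2 a (max (d l) (d r)) :=
        (hP.mem_comps_iff h he hlt).mpr ⟨l', r', by omega, h4, h1, h5, hint, rfl⟩
      have hsub : seg v l r ⊆ seg v l' r' := by
        intro i hi
        obtain ⟨hiS, w, hw, rfl, hw1, hw2⟩ := (hP.mem_seg_iff hrN).mp hi
        exact (hP.mem_seg hw h4).mpr ⟨by omega, by omega⟩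
      rw [parent_eq_of_least (P := seg v l' r')
        (mem_insert_of_mem (mem_rawFam.mpr ⟨_, hβu, hc⟩)) (hsub.ssubset_of_ne ?_) ?_]
      · grind
      · grind
      · intro L' hL' hss
        rcases mem_insert.mp hL' with rfl | hL'
        · exact h.comp_subset hc
        · obtain ⟨k', l'', r'', hk', rfl, h7, h8, h9⟩ := hsuper L' hL' hss
          have h10 : d k' ≤ max (d l) (d r) := by
            rcases h9 with h9 | h9
            · exact le_max_of_le_left h9
            · exact le_max_of_le_right h9.1
          have hl : l < N := by omega
          exact comp_subset_comp h10 (hP.seg_mem_comps h he hk') hc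
            ((hP.mem_seg hl hk'.rN).mpr ⟨h7, by omega⟩) ((hP.mem_seg hl h4).mpr ⟨hl', by omega⟩)
  rw [rawWt, e1, e2]

/-- Condition (CB) in terms of the order. -/
theorem PrimData.CB_iff (hP : PrimData A1 A2 e low N v d) (h : NormData a A1 A2 e low)
    (he : ∀ i j, e i j = e j i) : CB A1 A2 a ↔
      ∀ u w, u < w → w < N → Opp A1 A2 (v u) (v w) →
        ∃ k, u < k ∧ k ≤ w ∧ d k ≤ e (v u) (v w) := by
  constructor
  · intro hCB u w huw hw hopp
    by_contra! hcon
    obtain ⟨k, hk, hmin⟩ := (Finset.Ioc u w).exists_min_image d ⟨w, by simp; omega⟩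
    rw [mem_Ioc] at hk
    have hlow : low < d k := (h.opp_le he hopp).trans_lt (hcon k hk.1 hk.2)
    have hup := hP.mem_upperLevels h he (by omega) hlow
    have hreach := (hP.reachable_iff h he hlow hw huw.le).mpr fun x h1 h2 =>
      hmin x (mem_Ioc.mpr ⟨h1, h2⟩)
    have hreach' := (hP.reachable_iff h he hlow (by omega : k < N) hk.1.le).mpr fun x h1 h2 =>
      hmin x (mem_Ioc.mpr ⟨h1, by omega⟩)
    obtain ⟨i, hi, j, hj, hij⟩ : ∃ i ∈ A1, ∃ j ∈ A2, d k ≤ e i j ∧ (i = v k ∨ j = v k) := by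
      rcases hP.att k (by omega) with h1 | ⟨x, hx, ⟨h1, h2⟩ | ⟨h1, h2⟩, h3⟩
      · linarith
      · grind
      grind
    obtain ⟨L, hL, hiL, hjL⟩ := h.exists_comp hi hj hij.1
    have hkL : v k ∈ L := by grind
    have huL : v u ∈ L := (mem_iff_reachable_of_mem_comps hL hkL _).mpr hreach'.symm
    have hwL : v w ∈ L := (mem_iff_reachable_of_mem_comps hL huL _).mpr hreach
    have hge : d k ≤ e (v u) (v w) := by
      rcases hopp with ⟨h1, h2⟩ | ⟨h1, h2⟩
      · exact h.le_of_CB hCB hup hL h1 huL h2 hwL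
      · rw [he]
        exact h.le_of_CB hCB hup hL h2 hwL h1 huL
    grind
  · intro H α hα L hL i hi j hj
    have hlow := (h.mem_upperLevels.mp hα).1
    obtain ⟨hiL, hi⟩ := mem_inter.mp hi
    obtain ⟨hjL, hj⟩ := mem_inter.mp hj
    have hr := (mem_iff_reachable_of_mem_comps hL hiL j).mp hjL
    obtain ⟨u, hu, rfl⟩ := (hP.mem i).mp (mem_union_left _ hi)
    obtain ⟨w, hw, rfl⟩ := (hP.mem j).mp (mem_union_right _ hj)
    have hopp : Opp A1 A2 (v u) (v w) := .inl ⟨hi, hj⟩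
    rw [h.adj_iff_opp he]
    refine ⟨hopp, ?_⟩
    have hne : u ≠ w := by
      rintro rfl
      exact h.disj _ hi hj
    rcases lt_or_gt_of_ne hne with huw | huw
    · obtain ⟨k, h1, h2, h3⟩ := H u w huw hw hopp
      exact ((hP.reachable_iff h he hlow hw huw.le).mp hr k h1 h2).trans h3
    · obtain ⟨k, h1, h2, h3⟩ := H w u huw hu hopp.symm
      rw [he]
      exact ((hP.reachable_iff h he hlow hu huw.le).mp hr.symm k h1 h2).trans h3

/-- The member with parameters `k`, `l`, `r` is represented by itself, and not by its
complement. -/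
def Kept (N : ℕ) (d : ℕ → ℝ) (low : ℝ) (k l r : ℕ) : Prop :=
  IsMember N d low k l r ∧ ¬ (r = N ∧ ∃ k', IsMember N d low k' 0 l)

theorem PrimData.compl_zero (hP : PrimData A1 A2 e low N v d) (hr : r ≤ N) :
    (A1 ∪ A2) \ seg v 0 r = seg v r N := by
  ext i
  rw [mem_sdiff, hP.mem_seg_iff hr, hP.mem_seg_iff le_rfl]
  constructor
  · rintro ⟨hi, h1⟩
    obtain ⟨u, hu, rfl⟩ := (hP.mem i).mp hi
    grind
  · rintro ⟨hi, u, hu, rfl, h1, h2⟩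
    refine ⟨hi, fun ⟨_, w, hw, hwu, _, h3⟩ => ?_⟩
    have := hP.inj w hw u hu hwu
    omega

theorem PrimData.compl_eq_seg (hP : PrimData A1 A2 e low N v d) (hlr : l < r)
    (hr : r ≤ N) (hlr' : l' < r') (hr' : r' ≤ N) (h : (A1 ∪ A2) \ seg v l r = seg v l' r') :
    (l = 0 ∧ l' = r ∧ r' = N) ∨ (l' = 0 ∧ r' = l ∧ r = N) := by
  have key : ∀ u < N, ((l' ≤ u ∧ u < r') ↔ ¬ (l ≤ u ∧ u < r)) := by
    intro u hu
    rw [← hP.mem_seg hu hr, ← hP.mem_seg hu hr', ← h, mem_sdiff, hP.mem]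
    grind
  have h0 := key 0 (by omega)
  have h1 := key (N - 1) (by omega)
  have h2 := key l (by omega)
  have h3 := key (r - 1) (by omega)
  have h4 := key l' (by omega)
  have h5 := key (r' - 1) (by omega)
  rcases Nat.eq_zero_or_pos l with hl | hl
  · rcases hr.eq_or_lt with hrN | hrN
    · omega
    grind
  · have h6 := key (l - 1) (by omega)
    grind

theorem PrimData.mergeComplements (hP : PrimData A1 A2 e low N v d) (h : NormData a A1 A2 e low)
    (he : ∀ i j, e i j = e j i) (hCB : CB A1 A2 a) {W : WFam n}
    (hfam : ∀ X, X ∈ W.fam ↔ ∃ k l r, Kept N d low k l r ∧ X = seg v l r)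
    (hwt : ∀ k l r, Kept N d low k l r →
      (∀ k' l' r', IsMember N d low k' l' r' → l = 0 → l' = r → r' = N →
        W.wt (seg v l r) = d k - max (d l) (d r) + (d k' - max (d l') (d r'))) ∧
      ((∀ k', l = 0 → ¬ IsMember N d low k' r N) → W.wt (seg v l r) = d k - max (d l) (d r))) :
    MergeComplements (A1 ∪ A2) (rawFam A1 A2 a) (rawWt A1 A2 a) W := by
  have hlt : ∀ {k l r}, IsMember N d low k l r → l < r := fun hk => hk.lk.trans hk.kr
  have hkept : ∀ {k l r}, IsMember N d low k l r → seg v l r ∈ W.fam → Kept N d low k l r := by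
    intro k l r hk hX
    obtain ⟨k', l', r', hk', he⟩ := (hfam _).mp hX
    obtain ⟨rfl, rfl⟩ := hP.seg_inj hk.rN (hlt hk) hk'.1.rN (hlt hk'.1) he
    obtain rfl := hk.unique' hk'.1
    exact hk'
  refine ⟨fun X hX => ?_, fun X hX => ?_, fun X hX => ?_⟩
  · obtain ⟨k, l, r, hk, rfl⟩ := (hfam X).mp hX
    exact (hP.mem_rawFam_iff h he).mpr ⟨k, l, r, hk.1, rfl⟩
  · obtain ⟨k, l, r, hk, rfl⟩ := (hP.mem_rawFam_iff h he).mp hX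
    by_cases hK : Kept N d low k l r
    · refine .inl ⟨(hfam _).mpr ⟨k, l, r, hK, rfl⟩, fun hc => ?_⟩
      obtain ⟨k', l', r', hk', he'⟩ := (hfam _).mp hc
      rcases hP.compl_eq_seg (hlt hk) hk.rN (hlt hk'.1) hk'.1.rN he' with
        ⟨rfl, rfl, rfl⟩ | ⟨rfl, rfl, rfl⟩
      · exact hk'.2 ⟨rfl, k, hk⟩
      · exact hK.2 ⟨rfl, k', hk'.1⟩
    · have hcon : r = N ∧ ∃ k', IsMember N d low k' 0 l := by
        by_contra hcon
        exact hK ⟨hk, hcon⟩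
      obtain ⟨rfl, k', hk'⟩ := hcon
      refine .inr ⟨fun hc => hK (hkept hk hc), ?_⟩
      have h1 : (A1 ∪ A2) \ seg v l r = seg v 0 l := by
        rw [← hP.compl_zero hk'.rN, Finset.sdiff_sdiff_eq_self]
        exact h.comp_subset (hP.seg_mem_comps h he hk')
      rw [h1, hfam]
      refine ⟨k', 0, l, ⟨hk', ?_⟩, rfl⟩
      grind
  · obtain ⟨k, l, r, hk, rfl⟩ := (hfam X).mp hX
    rw [hP.rawWt_seg h he hCB hk.1]
    split_ifs with hc
    · obtain ⟨k', l', r', hk', he'⟩ := (hP.mem_rawFam_iff h he).mp hc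
      rw [he', hP.rawWt_seg h he hCB hk']
      rcases hP.compl_eq_seg (hlt hk.1) hk.1.rN (hlt hk') hk'.rN he' with
        ⟨h1, h2, h3⟩ | ⟨rfl, rfl, rfl⟩
      · grind
      · exact absurd ⟨rfl, k', hk'⟩ hk.2
    · rw [add_zero]
      refine (hwt k l r hk).2 fun k' hl hk' => hc ?_
      subst hl
      rw [hP.compl_zero hk.1.rN]
      exact (hP.mem_rawFam_iff h he).mpr ⟨k', r, N, hk', rfl⟩

end Prim

attribute [simp] wp

/-- Row `0` of a natural array. -/
abbrev nA (A : ℕ) (j : NExp) : NExp := .get A (.lit 0) j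

/-- Row `0` of a real array. -/
abbrev rA (A : ℕ) (j : NExp) : RExp := .get A (.lit 0) j

theorem lt_succ_cases {n k : ℕ} (hk : k < n) {j : Fin n} (hj : (j : ℕ) < k + 1) :
    j = ⟨k, hk⟩ ∨ (j : ℕ) < k := by grind

section Potentials

variable {n r : ℕ} {a : Fin n → Fin n → WithTop ℝ} (c : Ctx n r a)
variable {q : ℕ} {w : Fin n → ℝ}

/-- The ground set of the pair of blocks `p`, `t`. -/
def Ctx.S (p t : ℕ) : Finset (Fin n) := c.B p ∪ c.B t

theorem Ctx.mem_S {p t : ℕ} {i : Fin n} : i ∈ c.S p t ↔ c.nb i = p ∨ c.nb i = t := by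
  rw [Ctx.S, mem_union, c.mem, c.mem]

/-- The smallest `a (i, j) - w j`, `j` in the block with index in variable `12`, where `i` is in
variable `10` and `w` in array `3`. -/
def rowMinP : Prog := progs
  [.rset 1 (.sub (.get 1 (.var 10) (nA 3 (.var 12))) (rA 3 (nA 3 (.var 12)))),
   forP 11 2 (.ite (.and (.neq (nA 2 (.var 11)) (.var 12))
       (.rlt (.sub (.get 1 (.var 10) (.var 11)) (rA 3 (.var 11))) (.var 1)))
     (.rset 1 (.sub (.get 1 (.var 10) (.var 11)) (rA 3 (.var 11)))) .skip)]

theorem ht_rowMinP {m : Store} (hE : Env c m) {i : Fin n} (hi : m.nvar 10 = i) (hq : q < r)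
    (hq' : m.nvar 12 = q) (hw : ∀ j : Fin n, m.rarr 3 0 j = w j) :
    Ht rowMinP m (60 * n) fun m' =>
      (∃ j ∈ c.B q, realPart a i j - w j = m'.rvar 1) ∧
        ∀ j ∈ c.B q, m'.rvar 1 ≤ realPart a i j - w j := by
  have hn : 1 ≤ n := by grind
  refine (Ht.of_wp (Q := fun m => m.rvar 1 = realPart a i (c.fs q) - w (c.fs q)) ?_ le_rfl).cons
    (K2 := 47 * n) (by simp only [Prog.time, RExp.cost, NExp.cost]; omega) fun m1 hF1 h1 => ?_
  · simp [hi, hq', hE.fs q hq, hE.quad, hw]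
  have hE1 := hE.of_frame hF1 rfl
  refine (Ht.for_const (N := n) (fun k m => (∃ j ∈ c.B q, realPart a i j - w j = m.rvar 1) ∧
    ∀ j ∈ c.B q, (j : ℕ) < k → m.rvar 1 ≤ realPart a i j - w j) 35 rfl rfl (by decide) hE1.hn
    (fun k m v h => h) ⟨⟨c.fs q, (c.mem _ _).mpr (c.nb_fs q hq), h1.symm⟩, by simp⟩
    fun k m2 hk hF hk' _ hI => ?_).conseq (by omega) fun m' _ h => ⟨h.1, fun j hj => h.2 j hj j.isLt⟩
  have hE2 := hE1.of_frame hF rfl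
  refine Ht.of_wp ?_ (by decide)
  have e1 : m2.nvar 10 = i := by rw [hF.n 10 rfl, hF1.n 10 rfl, hi]
  have e2 : m2.nvar 12 = q := by rw [hF.n 12 rfl, hF1.n 12 rfl, hq']
  have e3 : m2.rarr 3 0 k = w ⟨k, hk⟩ := by rw [hF.R 3 rfl, hF1.R 3 rfl, ← hw]
  have e4 := hE2.nb ⟨k, hk⟩
  have e5 := hE2.quad i ⟨k, hk⟩
  simp only at e4 e5
  simp only [wp, Test.holds, NExp.eval, RExp.eval, e1, e2, hk', e3, e4, e5]
  refine ⟨fun h => ⟨⟨⟨k, hk⟩, (c.mem _ _).mpr h.1, by simp⟩, fun j hj hjk => ?_⟩,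
    fun h => ⟨hI.1, fun j hj hjk => ?_⟩⟩
  · rcases lt_succ_cases hk hjk with rfl | h2
    · simp
    · simpa using h.2.le.trans (hI.2 j hj h2)
  · rcases lt_succ_cases hk hjk with rfl | h2
    · exact not_lt.mp fun h3 => h ⟨(c.mem _ _).mp hj, h3⟩
    grind

/-- The smallest entry between the blocks `p` and `t` (variables `5` and `4`), into the real
variable `0`; the potentials in array `3` are reset. -/
def minEntryP : Prog := progs
  [forP 10 2 (.rput 3 (.lit 0) (.var 10) .zero),
   .nset 12 (.var 4), .nset 10 (nA 3 (.var 5)), rowMinP, .rset 0 (.var 1),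
   forP 10 2 (.ite (.neq (nA 2 (.var 10)) (.var 5))
     (.seq rowMinP (.ite (.rlt (.var 1) (.var 0)) (.rset 0 (.var 1)) .skip)) .skip)]

theorem sum_mem_le (X : Finset (Fin n)) (K K' : ℕ) :
    ∑ k ∈ range n, (if h : k < n then (if ⟨k, h⟩ ∈ X then K else K') else 0) ≤
      X.card * K + n * K' := by
  rw [← Fin.sum_univ_eq_sum_range (fun k => if h : k < n then
    (if ⟨k, h⟩ ∈ X then K else K') else 0)]
  simp only [Fin.is_lt, dif_pos, Fin.eta]
  rw [sum_ite, sum_const, sum_const, smul_eq_mul, smul_eq_mul,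
    filter_mem_eq_inter, univ_inter]
  gcongr
  exact (card_filter_le _ _).trans (by simp)

theorem ht_minEntryP {m : Store} (hE : Env c m) {p t : ℕ} (hp : p < r) (ht : t < r) (hpt : p ≠ t)
    (hp' : m.nvar 5 = p) (ht' : m.nvar 4 = t) :
    Ht minEntryP m (400 * (n * (c.S p t).card)) fun m' =>
      m'.rvar 0 = minEntry (c.S p t) a ∧ ∀ j : Fin n, m'.rarr 3 0 j = 0 := by
  have h2 := c.data.two p hp t ht hpt
  have hS1 : 1 ≤ (c.B p).card := card_pos.mpr h2.ne1
  have hSp : (c.B p).card ≤ (c.S p t).card := card_le_card subset_union_left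
  have hn : 1 ≤ n := by have := (c.fs 0).isLt; omega
  have hnS : n ≤ n * (c.S p t).card := Nat.le_mul_of_pos_right _ (by omega)
  have hpS : n * (c.B p).card ≤ n * (c.S p t).card := Nat.mul_le_mul_left _ hSp
  refine (Ht.for_const (N := n) (fun k m => ∀ j : Fin n, (j : ℕ) < k → m.rarr 3 0 j = 0) 4 rfl rfl
    (by decide) hE.hn (fun k m v h => h) (by simp) fun k m2 hk hF hk' _ hI => ?_).cons
    (K2 := 380 * (n * (c.S p t).card)) (by omega) fun m1 hF1 h1 => ?_
  · refine Ht.of_wp ?_ (by decide)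
    simp only [wp, NExp.eval, RExp.eval, hk']
    intro j hj
    rw [Store.setR_rarr]
    grind
  replace h1 : ∀ j : Fin n, m1.rarr 3 0 j = (fun _ => 0 : Fin n → ℝ) j := fun j => h1 j j.isLt
  have hE1 := hE.of_frame hF1 rfl
  refine (Ht.of_wp (K := 2) (Q := fun m => m.nvar 12 = t) ?_ le_rfl).cons
    (K2 := 370 * (n * (c.S p t).card)) (by omega) fun m2 hF2 h₂ => ?_
  · simp [hF1.n 4 rfl, ht']
  have hE2 := hE1.of_frame hF2 rfl
  refine (Ht.of_wp (K := 4) (Q := fun m => m.nvar 10 = c.fs p) ?_ le_rfl).cons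
    (K2 := 360 * (n * (c.S p t).card)) (by omega) fun m3 hF3 h3 => ?_
  · simp [hF2.n 5 rfl, hF1.n 5 rfl, hp', hE2.fs p hp]
  have hE3 := hE2.of_frame hF3 rfl
  refine (ht_rowMinP c hE3 h3 ht (by rw [hF3.n 12 rfl, h₂]) (w := fun _ => 0) fun j => by
    rw [hF3.R 3 rfl, hF2.R 3 rfl, h1]).cons (K2 := 300 * (n * (c.S p t).card))
    (by omega) fun m4 hF4 h4 => ?_
  have hE4 := hE3.of_frame hF4 rfl
  refine (Ht.of_wp (K := 2) (Q := fun m => (∃ i ∈ c.B p, ∃ j ∈ c.B t, realPart a i j = m.rvar 0)) ?_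
    le_rfl).cons (K2 := 290 * (n * (c.S p t).card)) (by omega) fun m5 hF5 h5 => ?_
  · obtain ⟨⟨j, hj, hj'⟩, -⟩ := h4
    exact ⟨c.fs p, (c.mem _ _).mpr (c.nb_fs p hp), j, hj, by simpa using hj'⟩
  have hE5 := hE4.of_frame hF5 rfl
  refine (Ht.for (N := n) (fun k m => (∃ i ∈ c.B p, ∃ j ∈ c.B t, realPart a i j = m.rvar 0) ∧
    ∀ i ∈ c.B p, (i : ℕ) < k → ∀ j ∈ c.B t, m.rvar 0 ≤ realPart a i j)
    (fun k => if h : k < n then (if ⟨k, h⟩ ∈ c.B p then 100 * n else 10) else 0) rfl rfl (by decide)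
    hE5.hn (fun k m v h => h) ⟨h5, by simp⟩ fun k m6 hk hF hk' _ hI => ?_).conseq ?_
    fun m' hF' h => ?_
  · have hE6 := hE5.of_frame hF rfl
    have e1 : m6.nvar 5 = p := by
      rw [hF.n 5 rfl, hF5.n 5 rfl, hF4.n 5 rfl, hF3.n 5 rfl, hF2.n 5 rfl, hF1.n 5 rfl, hp']
    have e2 := hE6.nb ⟨k, hk⟩
    simp only at e2
    rw [dif_pos hk]
    split_ifs with hb <;> rw [c.mem] at hb
    · refine Ht.ite_le (K := 90 * n) ?_ (fun _ => ?_) fun h => ?_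
      · simp only [Test.cost, NExp.cost]
        omega
      · refine ((ht_rowMinP c hE6 (i := ⟨k, hk⟩) hk' ht (by
          rw [hF.n 12 rfl, hF5.n 12 rfl, hF4.n 12 rfl, hF3.n 12 rfl, h₂]) (w := fun _ => 0)
          fun j => by rw [hF.R 3 rfl, hF5.R 3 rfl, hF4.R 3 rfl, hF3.R 3 rfl, hF2.R 3 rfl, h1]).seq
          (K' := 6) fun m7 hF7 h₇ => ?_).conseq (by omega) fun _ _ h => h
        refine Ht.of_wp ?_ (by decide)
        obtain ⟨⟨j0, hj0, h8⟩, h9⟩ := h₇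
        simp only [sub_zero] at h8 h9
        have e3 : m7.rvar 0 = m6.rvar 0 := hF7.r 0 rfl
        simp only [wp, Test.holds, RExp.eval, e3]
        refine ⟨fun hlt => ⟨⟨⟨k, hk⟩, (c.mem _ _).mpr hb, j0, hj0, by simpa using h8⟩,
          fun i hi hik j hj => ?_⟩, fun hge => ⟨hI.1, fun i hi hik j hj => ?_⟩⟩
        · rcases lt_succ_cases hk hik with rfl | h10
          · simpa using h9 j hj
          · simpa using hlt.le.trans (hI.2 i hi h10 j hj)
        grind
      · exact absurd (by simp [hk', e2, e1, hb]) h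
    · refine Ht.ite_le (K := 1) (by decide) (fun h => ?_) fun _ => Ht.of_wp ?_ (by decide)
      · exact absurd (by simpa [hk', e2, e1] using h) hb
      · refine ⟨hI.1, fun i hi hik => hI.2 i hi ?_⟩
        rcases lt_succ_cases hk hik with rfl | h10
        · exact absurd ((c.mem _ _).mp hi) hb
        · exact h10
  · rw [sum_add_distrib, sum_const, card_range, smul_eq_mul]
    have := sum_mem_le (c.B p) (100 * n) 10
    nlinarith
  · obtain ⟨⟨i, hi, j, hj, h6⟩, h7⟩ := h
    obtain ⟨⟨i', hi', j', hj', h8⟩, h9⟩ := minEntry_spec h2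
    refine ⟨le_antisymm ?_ ?_, fun j => ?_⟩
    · exact (h7 i' hi' i'.isLt j' hj').trans_eq h8
    · rw [← h6]
      exact h9 i hi j hj
    · rw [hF'.R 3 rfl, hF5.R 3 rfl, hF4.R 3 rfl, hF3.R 3 rfl, hF2.R 3 rfl, h1]

/-- The memory holds the indices of the pair of blocks `p`, `t`. -/
structure PairEnv (p t : ℕ) (m : Store) : Prop extends Env c m where
  hp : m.nvar 5 = p
  ht : m.nvar 4 = t

/-- The program `P` does not overwrite the data of `PairEnv`. -/
def Prog.keepsPair (P : Prog) : Bool := P.keepsEnv && !(P.wn 4) && !(P.wn 5)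

variable {c} in
theorem PairEnv.of_frame {p t : ℕ} {m m' : Store} (h : PairEnv c p t m) {P : Prog}
    (hF : Frame P m m') (hP : P.keepsPair = true) : PairEnv c p t m' := by
  simp only [Prog.keepsPair, Bool.and_eq_true, Bool.not_eq_true'] at hP
  exact ⟨h.toEnv.of_frame hF hP.1.1, (hF.n 5 hP.2).trans h.hp, (hF.n 4 hP.1.2).trans h.ht⟩

/-- The element in variable `x` belongs to one of the blocks `p`, `t`. -/
def inS (x : ℕ) : Test :=
  .not (.and (.not (.neq (nA 2 (.var x)) (.var 5))) (.not (.neq (nA 2 (.var x)) (.var 4))))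

variable {c} in
theorem PairEnv.inS_iff {p t : ℕ} {m : Store} (h : PairEnv c p t m) {x : ℕ} {i : Fin n}
    (hi : m.nvar x = i) : (inS x).holds m ↔ i ∈ c.S p t := by
  simp [inS, hi, h.hp, h.ht, h.nb, c.mem_S]
  tauto

/-- The potentials of the normalization, into array `3`. -/
def potP : Prog := .seq minEntryP <| forP 10 2 <| .ite (inS 10) (progs
  [.nset 12 (.sub (.add (.var 4) (.var 5)) (nA 2 (.var 10))), rowMinP,
   .rput 3 (.lit 0) (.var 10) (.sub (.var 1) (.var 0))]) .skip

theorem Ctx.potStep_eq {p t : ℕ} (hp : p < r) (ht : t < r) (hpt : p ≠ t) {i : Fin n}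
    (hi : i ∈ c.S p t) (hq : q = t + p - c.nb i) {x : ℝ} (αs : ℝ)
    (hx : ∃ j ∈ c.B q, realPart a i j - w j = x) (hx' : ∀ j ∈ c.B q, x ≤ realPart a i j - w j) :
    potStep (c.S p t) αs a w i = update w i (x - αs) := by
  have key : ∃ y : ℝ, (((c.S p t).erase i).inf fun l => a i l + ((-(w l) : ℝ) : WithTop ℝ)) = y ∧
      (∃ j ∈ c.B q, realPart a i j - w j = y) ∧ ∀ j ∈ c.B q, y ≤ realPart a i j - w j := by
    rcases mem_union.mp hi with h | h <;> rw [(c.mem _ _).mp h] at hq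
    · obtain rfl : q = t := by omega
      exact potStep_value (c.data.two p hp q ht hpt) w h
    · obtain rfl : q = p := by omega
      rw [Ctx.S, union_comm]
      exact potStep_value (c.data.two t ht q hp hpt.symm) w h
  obtain ⟨y, hy, ⟨j, hj, hj'⟩, hle⟩ := key
  obtain ⟨j1, hj1, hj1'⟩ := hx
  obtain rfl : x = y := le_antisymm (hj' ▸ hx' j hj) (hj1' ▸ hle j1 hj1)
  rw [potStep, hy]
  rfl

theorem potentials_eq_foldl (S : Finset (Fin n)) : potentials S a =
    (List.finRange n).foldl (fun w i => if i ∈ S then potStep S (minEntry S a) a w i else w)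
      fun _ => 0 := by
  have : S.sort (· ≤ ·) = (List.finRange n).filter (· ∈ S) := by
    refine List.Perm.eq_of_pairwise' (r := (· ≤ ·)) (pairwise_sort _ _)
      ((List.pairwise_le_finRange n).filter _)
      ((List.perm_ext_iff_of_nodup (sort_nodup _ _) ((List.nodup_finRange n).filter _)).mpr
        fun i => by simp)
  rw [potentials, this, List.foldl_filter]
  simp

theorem ht_potP {m : Store} {p t : ℕ} (hE : PairEnv c p t m) (hp : p < r) (ht : t < r)
    (hpt : p ≠ t) :
    Ht potP m (600 * (n * (c.S p t).card)) fun m' =>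
      m'.rvar 0 = minEntry (c.S p t) a ∧ ∀ j : Fin n, m'.rarr 3 0 j = potentials (c.S p t) a j := by
  have hS1 : 1 ≤ (c.S p t).card := card_pos.mpr ((c.data.two p hp t ht hpt).ne1.mono
    subset_union_left)
  have hn : 1 ≤ n := by have := (c.fs 0).isLt; omega
  have hnS : n ≤ n * (c.S p t).card := Nat.le_mul_of_pos_right _ (by omega)
  refine (ht_minEntryP c hE.toEnv hp ht hpt hE.hp hE.ht).seq_le (K2 := 200 * (n * (c.S p t).card))
    (by omega) fun m1 hF1 h1 => ?_
  replace hE := hE.of_frame hF1 rfl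
  refine (Ht.for (N := n) (fun k m => m.rvar 0 = minEntry (c.S p t) a ∧ ∀ j : Fin n, m.rarr 3 0 j =
    ((List.finRange n).take k).foldl (fun w i => if i ∈ c.S p t then
      potStep (c.S p t) (minEntry (c.S p t) a) a w i else w) (fun _ => 0) j)
    (fun k => if h : k < n then (if ⟨k, h⟩ ∈ c.S p t then 100 * n else 20) else 0) rfl rfl (by decide)
    hE.hn (fun k m v h => h) ⟨h1.1, by simpa using h1.2⟩ fun k m2 hk hF hk' _ hI => ?_).conseq ?_
    fun m' hF' h => ?_
  · have hE2 := hE.of_frame hF rfl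
    rw [dif_pos hk]
    set w := ((List.finRange n).take k).foldl (fun w i => if i ∈ c.S p t then
      potStep (c.S p t) (minEntry (c.S p t) a) a w i else w) (fun _ => 0)
    have hstep : ((List.finRange n).take (k + 1)).foldl (fun w i => if i ∈ c.S p t then
        potStep (c.S p t) (minEntry (c.S p t) a) a w i else w) (fun _ => 0) =
        if ⟨k, hk⟩ ∈ c.S p t then potStep (c.S p t) (minEntry (c.S p t) a) a w ⟨k, hk⟩ else w := by
      rw [List.take_add_one, List.foldl_append, List.getElem?_eq_getElem (by simpa using hk)]
      simp [w]
    rw [hstep]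
    split_ifs with hb
    · refine Ht.ite_le (K := 80 * n) (by simp only [inS, Test.cost, NExp.cost]; omega)
        (fun _ => ?_) fun h => absurd ((hE2.inS_iff (i := ⟨k, hk⟩) hk').mpr hb) h
      refine (Ht.of_wp (K := 8) (Q := fun m => m.nvar 12 = t + p - c.nb ⟨k, hk⟩) ?_ le_rfl).cons
        (K2 := 70 * n) (by omega) fun m3 hF3 h3 => ?_
      · have := hE2.nb ⟨k, hk⟩
        simp only at this
        simp [hk', hE2.hp, hE2.ht, this]
      have hE3 := hE2.of_frame hF3 rfl
      have hq : t + p - c.nb ⟨k, hk⟩ < r := by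
        rcases mem_union.mp hb with h | h <;> rw [(c.mem _ _).mp h] <;> omega
      refine (ht_rowMinP c hE3.toEnv (i := ⟨k, hk⟩) ((hF3.n 10 rfl).trans hk') hq h3 fun j => by
        rw [hF3.R 3 rfl, hI.2]).cons (K2 := 6) (by omega) fun m4 hF4 h4 => Ht.of_wp ?_ (by decide)
      have e1 : m4.rvar 0 = minEntry (c.S p t) a := by rw [hF4.r 0 rfl, hF3.r 0 rfl, hI.1]
      refine ⟨e1, fun j => ?_⟩
      rw [c.potStep_eq hp ht hpt hb rfl _ h4.1 h4.2]
      simp [e1, hF4.n 10 rfl, hF3.n 10 rfl, hk', update_apply, Fin.ext_iff,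
        hF4.R 3 rfl, hF3.R 3 rfl, hI.2 j]
    · exact Ht.ite_le (K := 1) (by decide)
        (fun h => absurd ((hE2.inS_iff (i := ⟨k, hk⟩) hk').mp h) hb)
        fun _ => Ht.of_wp hI (by decide)
  · rw [sum_add_distrib, sum_const, card_range, smul_eq_mul]
    have := sum_mem_le (c.S p t) (100 * n) 20
    nlinarith
  · rw [List.take_of_length_le (by simp)] at h
    exact ⟨h.1, fun j => by rw [h.2, potentials_eq_foldl]⟩

end Potentials

section Prim

variable {n r : ℕ} {a : Fin n → Fin n → WithTop ℝ} {A1 A2 : Finset (Fin n)}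
  {e : Fin n → Fin n → ℝ} {low : ℝ}

/-- The first `k` elements of the order of `PrimData` have been found; `key i` is the largest entry
between `i` and these elements. -/
structure PrimInv (A1 A2 : Finset (Fin n)) (e : Fin n → Fin n → ℝ) (low : ℝ) (k : ℕ)
    (v : ℕ → Fin n) (d : ℕ → ℝ) (key : Fin n → ℝ) : Prop where
  inj : ∀ u < k, ∀ w < k, v u = v w → u = w
  mem : ∀ u < k, v u ∈ A1 ∪ A2
  zero : 0 < k → d 0 = low
  key_zero : k = 0 → ∀ i ∈ A1 ∪ A2, key i = low
  le : ∀ u < k, low ≤ d u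
  le_key : ∀ i ∈ A1 ∪ A2, (∀ u < k, v u ≠ i) → low ≤ key i
  greedy : ∀ k' < k, ∀ j ∈ A1 ∪ A2, (∀ u < k', v u ≠ j) →
    ∀ u < k', Opp A1 A2 (v u) j → e (v u) j ≤ d k'
  att : ∀ k' < k, d k' = low ∨ ∃ u < k', Opp A1 A2 (v u) (v k') ∧ e (v u) (v k') = d k'
  key_max : ∀ j ∈ A1 ∪ A2, (∀ u < k, v u ≠ j) → ∀ u < k, Opp A1 A2 (v u) j → e (v u) j ≤ key j
  key_att : ∀ j ∈ A1 ∪ A2, (∀ u < k, v u ≠ j) →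
    key j = low ∨ ∃ u < k, Opp A1 A2 (v u) j ∧ e (v u) j = key j

theorem PrimInv.step {k : ℕ} {v : ℕ → Fin n} {d : ℕ → ℝ} {key key' : Fin n → ℝ}
    (h : PrimInv A1 A2 e low k v d key) {x : Fin n} (hx : x ∈ A1 ∪ A2) (hxv : ∀ u < k, v u ≠ x)
    (hmax : ∀ j ∈ A1 ∪ A2, (∀ u < k, v u ≠ j) → key j ≤ key x) {v' : ℕ → Fin n} {d' : ℕ → ℝ}
    (hv : v' = update v k x) (hd : d' = update d k (key x))
    (hopp : ∀ j ∈ A1 ∪ A2, (∀ u < k, v u ≠ j) → x ≠ j → Opp A1 A2 x j →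
      key' j = max (key j) (e x j))
    (hnopp : ∀ j ∈ A1 ∪ A2, (∀ u < k, v u ≠ j) → x ≠ j → ¬ Opp A1 A2 x j → key' j = key j) :
    PrimInv A1 A2 e low (k + 1) v' d' key' := by
  subst hv hd
  have hlt : ∀ {u}, u < k → u ≠ k := fun h => h.ne
  have hcase : ∀ {u}, u < k + 1 → u < k ∨ u = k := fun h => Nat.lt_succ_iff_lt_or_eq.mp h
  have hun : ∀ {j}, (∀ u < k + 1, update v k x u ≠ j) → (∀ u < k, v u ≠ j) ∧ x ≠ j := by
    intro j hj
    refine ⟨fun u hu => ?_, ?_⟩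
    · grind
    · simpa using hj k (by omega)
  have hun' : ∀ {k' j}, k' ≤ k → (∀ u < k', update v k x u ≠ j) → ∀ u < k', v u ≠ j := by grind
  refine ⟨?_, ?_, fun _ => ?_, fun h0 => by omega, ?_, ?_, ?_, ?_, ?_, ?_⟩
  · intro u hu w hw huw
    rcases hcase hu with hu | rfl <;> rcases hcase hw with hw | rfl
    · simp only [update_of_ne (hlt hu), update_of_ne (hlt hw)] at huw
      exact h.inj u hu w hw huw
    · grind
    · grind
    · rfl
  · intro u hu
    rcases hcase hu with hu | rfl
    · rw [update_of_ne (hlt hu)]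
      exact h.mem u hu
    · simpa using hx
  · rcases Nat.eq_zero_or_pos k with rfl | hk
    · simpa using h.key_zero rfl x hx
    · rw [update_of_ne (by omega)]
      exact h.zero hk
  · intro u hu
    rcases hcase hu with hu | rfl
    · rw [update_of_ne (hlt hu)]
      exact h.le u hu
    · simpa using h.le_key x hx hxv
  · intro i hi hiv
    obtain ⟨h1, h2⟩ := hun hiv
    by_cases ho : Opp A1 A2 x i
    · exact (h.le_key i hi h1).trans (hopp i hi h1 h2 ho ▸ le_max_left _ _)
    · exact hnopp i hi h1 h2 ho ▸ h.le_key i hi h1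
  · intro k' hk' j hj hjv u hu hopp'
    rw [update_of_ne (by omega : u ≠ k)] at hopp' ⊢
    have h1 := hun' (by omega) hjv
    rcases hcase hk' with hk' | rfl
    · rw [update_of_ne (hlt hk')]
      exact h.greedy k' hk' j hj h1 u hu hopp'
    · rw [update_self]
      exact (h.key_max j hj h1 u hu hopp').trans (hmax j hj h1)
  · intro k' hk'
    rcases hcase hk' with hk' | rfl
    · rw [update_of_ne (hlt hk'), update_of_ne (hlt hk')]
      refine (h.att k' hk').imp_right fun ⟨u, hu, h1⟩ => ⟨u, hu, ?_⟩
      rwa [update_of_ne (by omega)]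
    · rw [update_self, update_self]
      refine (h.key_att x hx hxv).imp_right fun ⟨u, hu, h1⟩ => ⟨u, hu, ?_⟩
      rwa [update_of_ne (by omega)]
  · intro j hj hjv u hu ho
    obtain ⟨h1, h2⟩ := hun hjv
    rcases hcase hu with hu | rfl
    · rw [update_of_ne (hlt hu)] at ho ⊢
      refine (h.key_max j hj h1 u hu ho).trans ?_
      by_cases ho' : Opp A1 A2 x j
      · exact hopp j hj h1 h2 ho' ▸ le_max_left _ _
      · exact (hnopp j hj h1 h2 ho').ge
    grind
  · intro j hj hjv
    obtain ⟨h1, h2⟩ := hun hjv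
    have old : key' j = key j → key' j = low ∨ ∃ u < k + 1, Opp A1 A2 (update v k x u) j ∧
        e (update v k x u) j = key' j := by
      intro heq
      refine heq ▸ (h.key_att j hj h1).imp_right fun ⟨u, hu, h3⟩ => ⟨u, by omega, ?_⟩
      rwa [update_of_ne (hlt hu)]
    by_cases ho' : Opp A1 A2 x j
    · rcases max_choice (key j) (e x j) with h3 | h3
      · exact old ((hopp j hj h1 h2 ho').trans h3)
      · refine .inr ⟨k, by omega, ?_⟩
        grind
    · exact old (hnopp j hj h1 h2 ho')

theorem PrimInv.exists_unvisited {k : ℕ} {v : ℕ → Fin n} {d : ℕ → ℝ} {key : Fin n → ℝ}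
    (h : PrimInv A1 A2 e low k v d key) (hk : k < (A1 ∪ A2).card) :
    ∃ i ∈ A1 ∪ A2, ∀ u < k, v u ≠ i := by
  by_contra! hcon
  have : (A1 ∪ A2).card ≤ ((range k).image v).card := card_le_card fun i hi => by grind
  grind

theorem PrimInv.primData {v : ℕ → Fin n} {d : ℕ → ℝ} {key : Fin n → ℝ}
    (h : PrimInv A1 A2 e low (A1 ∪ A2).card v d key) (hne : (A1 ∪ A2).Nonempty) {d' : ℕ → ℝ}
    (hd : d' = update d (A1 ∪ A2).card low) :
    PrimData A1 A2 e low (A1 ∪ A2).card v d' := by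
  have hpos := card_pos.mpr hne
  have hd' : ∀ u < (A1 ∪ A2).card, d' u = d u := fun u hu => by
    rw [hd, update_of_ne hu.ne]
  refine ⟨h.inj, fun i => ⟨fun hi => ?_, ?_⟩, (hd' 0 hpos).trans (h.zero hpos),
    by rw [hd, update_self], fun u hu => hd' u hu ▸ h.le u hu, ?_, fun k hk => ?_⟩
  · have h1 : (range (A1 ∪ A2).card).image v = A1 ∪ A2 := by
      refine eq_of_subset_of_card_le (fun i hi => ?_) ?_
      · obtain ⟨u, hu, rfl⟩ := mem_image.mp hi
        exact h.mem u (mem_range.mp hu)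
      · rw [card_image_of_injOn fun u hu w hw => h.inj u (by simpa using hu) w
          (by simpa using hw), card_range]
    grind
  · rintro ⟨u, hu, rfl⟩
    exact h.mem u hu
  · intro u k l huk hkl hl ho
    rw [hd' k (by omega)]
    exact h.greedy k (by omega) (v l) (h.mem l hl)
      (fun w hw he => by have := h.inj w (by omega) l hl he; omega) u huk ho
  · rw [hd' k hk]
    exact h.att k hk

variable (c : Ctx n r a)

/-- The element with a given number. -/
def Ctx.el (x : ℕ) : Fin n := if h : x < n then ⟨x, h⟩ else c.fs 0

theorem Ctx.el_coe (i : Fin n) : c.el i = i := by simp [Ctx.el]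

/-- The order of the ground set in array `5`. -/
abbrev Ctx.v (m : Store) (u : ℕ) : Fin n := c.el (m.narr 5 0 u)

/-- The normalized entry of the elements `x`, `y`. -/
def entryE (x y : NExp) : RExp := .sub (.sub (.get 1 x y) (rA 3 x)) (rA 3 y)

theorem Ctx.opp_iff {p t : ℕ} (hpt : p ≠ t) {i j : Fin n} (hi : i ∈ c.S p t) (hj : j ∈ c.S p t) :
    Opp (c.B p) (c.B t) i j ↔ c.nb i ≠ c.nb j := by
  rw [c.mem_S] at hi hj
  simp only [Opp, c.mem]
  omega

/-- The memory holds the potentials of the pair of blocks `p`, `t`. -/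
structure NormEnv (p t : ℕ) (m : Store) : Prop extends PairEnv c p t m where
  hlt : p < r ∧ t < r ∧ p ≠ t
  low : m.rvar 0 = minEntry (c.S p t) a
  pot : ∀ j : Fin n, m.rarr 3 0 j = potentials (c.S p t) a j

/-- The program `P` does not overwrite the data of `NormEnv`. -/
def Prog.keepsNorm (P : Prog) : Bool := P.keepsPair && !(P.wr 0) && !(P.wR 3)

variable {c} {p t : ℕ} {m : Store}

theorem NormEnv.of_frame {m' : Store} (h : NormEnv c p t m) {P : Prog}
    (hF : Frame P m m') (hP : P.keepsNorm = true) : NormEnv c p t m' := by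
  simp only [Prog.keepsNorm, Bool.and_eq_true, Bool.not_eq_true'] at hP
  exact ⟨h.toPairEnv.of_frame hF hP.1.1, h.hlt, (hF.r 0 hP.1.2).trans h.low,
    fun j => by rw [hF.R 3 hP.2, h.pot]⟩

theorem NormEnv.entryE_eval (h : NormEnv c p t m) {x y : NExp} {i j : Fin n} (hi : x.eval m = i)
    (hj : y.eval m = j) : (entryE x y).eval m = normEntry a (c.S p t) i j := by
  simp [entryE, hi, hj, h.quad, h.pot, normEntry]

theorem NormEnv.card_pos (h : NormEnv c p t m) : 1 ≤ (c.S p t).card ∧ 1 ≤ n :=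
  ⟨Finset.card_pos.mpr ((c.data.two p h.hlt.1 t h.hlt.2.1 h.hlt.2.2).ne1.mono
    subset_union_left), by have := (c.fs 0).isLt; omega⟩

/-- Initialization of the algorithm of Prim: the keys in array `5`, marks for the elements that are
not yet visited in array `6`, and the number of elements in variable `13`. -/
def primInitP : Prog := .seq (.nset 13 (.lit 0)) <| forP 10 2 <| .ite (inS 10) (progs
  [.nput 6 (.lit 0) (.var 10) (.lit 1), .rput 5 (.lit 0) (.var 10) (.var 0),
   .nset 13 (.add (.var 13) (.lit 1))]) (.nput 6 (.lit 0) (.var 10) (.lit 0))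

/-- One pass of the algorithm of Prim: the order in array `5`, its inverse in array `7`, and the
keys of the elements at the time of their visit in array `4`. -/
def primStepP : Prog := progs
  [.nset 15 (.var 2),
   forP 11 2 (.ite (.and (.neq (nA 6 (.var 11)) (.lit 1)) (.not (.and (.not (.neq (.var 15) (.var 2)))
     (.not (.rlt (rA 5 (.var 15)) (rA 5 (.var 11))))))) (.nset 15 (.var 11)) .skip),
   progs [.nput 5 (.lit 0) (.var 14) (.var 15), .rput 4 (.lit 0) (.var 14) (rA 5 (.var 15)),
     .nput 6 (.lit 0) (.var 15) (.lit 0), .nput 7 (.lit 0) (.var 15) (.var 14)],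
   forP 11 2 (.ite (.and (.neq (nA 6 (.var 11)) (.lit 1)) (.and
       (.not (.neq (nA 2 (.var 11)) (nA 2 (.var 15))))
       (.rlt (rA 5 (.var 11)) (entryE (.var 15) (.var 11)))))
     (.rput 5 (.lit 0) (.var 11) (entryE (.var 15) (.var 11))) .skip)]

/-- The algorithm of Prim. -/
def primP : Prog := progs
  [primInitP, forP 14 13 primStepP, .rput 4 (.lit 0) (.var 13) (.var 0)]

/-- The state of the algorithm of Prim after `k` passes. -/
structure PrimState (c : Ctx n r a) (p t k : ℕ) (m : Store) : Prop where
  inv : PrimInv (c.B p) (c.B t) (normEntry a (c.S p t)) (minEntry (c.S p t) a) k (c.v m)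
    (m.rarr 4 0) fun i => m.rarr 5 0 i
  vis : ∀ i : Fin n, m.narr 6 0 i = 1 ↔ i ∈ c.S p t ∧ ∀ u < k, c.v m u ≠ i
  lt : ∀ u < k, m.narr 5 0 u < n
  pos : ∀ u < k, m.narr 7 0 (m.narr 5 0 u) = u

theorem ht_primInitP (hE : NormEnv c p t m) :
    Ht primInitP m (60 * n) fun m' => PrimState c p t 0 m' ∧ m'.nvar 13 = (c.S p t).card := by
  obtain ⟨-, hn⟩ := hE.card_pos
  refine (Ht.of_wp (K := 2) (Q := fun m => m.nvar 13 = 0) (by simp) le_rfl).seq_le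
    (K2 := 58 * n) (by omega) fun m1 hF1 h1 => ?_
  replace hE := hE.of_frame hF1 rfl
  refine (Ht.for_const (N := n) (fun k m => m.nvar 13 = cnt k (· ∈ c.S p t) ∧
    ∀ i : Fin n, (i : ℕ) < k → (m.narr 6 0 i = 1 ↔ i ∈ c.S p t) ∧
      (i ∈ c.S p t → m.rarr 5 0 i = minEntry (c.S p t) a)) 40 rfl rfl (by decide) hE.hn
    (fun k m v h => by simpa using h) ⟨by rw [h1, cnt_zero], by simp⟩
    fun k m' hk hF hk' _ hI => Ht.of_wp ?_ (by decide)).conseq (by omega) fun m' _ h => ?_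
  · have hE := hE.of_frame hF rfl
    have hS := hE.inS_iff (i := ⟨k, hk⟩) hk'
    simp only [progs, wp, NExp.eval, RExp.eval, hk', hS, Store.setN_nvar, Store.setR_nvar]
    refine ⟨fun h => ⟨by simp [cnt_succ hk, h, hI.1], fun i hi => ?_⟩,
      fun h => ⟨by simp [cnt_succ hk, h, hI.1], fun i hi => ?_⟩⟩
    all_goals
      rcases lt_succ_cases hk hi with rfl | hi'
      · simp [h, hE.low]
      · simpa [hi'.ne] using hI.2 i hi'
  · have hkey : ∀ i ∈ c.B p ∪ c.B t, m'.rarr 5 0 i = minEntry (c.S p t) a :=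
      fun i hi => (h.2 i i.isLt).2 hi
    refine ⟨⟨⟨by simp, by simp, by simp, fun _ => hkey, by simp, fun i hi _ => (hkey i hi).ge,
      by simp, by simp, by simp, fun i hi _ => .inl (hkey i hi)⟩,
      fun i => by grind, by simp, by simp⟩, ?_⟩
    rw [h.1, cnt_full]
    congr 1
    ext i
    simp

theorem ht_primStepP (hE : NormEnv c p t m) {k : ℕ} (hk : k < (c.S p t).card) (hk' : m.nvar 14 = k)
    (hI : PrimState c p t k m) : Ht primStepP m (150 * n) (PrimState c p t (k + 1)) := by
  obtain ⟨-, hn⟩ := hE.card_pos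
  refine (Ht.of_wp (K := 2) (Q := fun m => m.nvar 15 = n) (by simp [hE.hn]) le_rfl).cons
    (K2 := 148 * n) (by omega) fun m1 hF1 h₁ => ?_
  have hE1 := hE.of_frame hF1 rfl
  refine (Ht.for_const (N := n) (fun l m' =>
    (m'.nvar 15 = n ∧ ∀ i : Fin n, (i : ℕ) < l → m.narr 6 0 i ≠ 1) ∨ ∃ x : Fin n, m'.nvar 15 = x ∧
      m.narr 6 0 x = 1 ∧ ∀ i : Fin n, (i : ℕ) < l → m.narr 6 0 i = 1 → m.rarr 5 0 i ≤ m.rarr 5 0 x)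
    30 rfl rfl (by decide) hE1.hn (fun k m v h => by simpa using h) (.inl ⟨h₁, by simp⟩)
    fun l m' hl hF hl' _ hJ => Ht.of_wp ?_ (by decide)).cons (K2 := 100 * n) (by omega)
    fun m2 hF2 h₂ => ?_
  · have hE' := hE1.of_frame hF rfl
    have e6 : m'.narr 6 = m.narr 6 := by rw [hF.N 6 rfl, hF1.N 6 rfl]
    have e5 : m'.rarr 5 = m.rarr 5 := by rw [hF.R 5 rfl, hF1.R 5 rfl]
    simp only [wp, Test.holds, NExp.eval, RExp.eval, hl', e6, e5, hE'.hn]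
    rcases hJ with ⟨hJ, hJ'⟩ | ⟨x, hx, hx', hJ⟩
    · refine ⟨fun h => .inr ⟨⟨l, hl⟩, by simp, h.1, fun i hi hi' => ?_⟩,
        fun h => .inl ⟨hJ, fun i hi => ?_⟩⟩
      · grind
      grind
    · refine ⟨fun h => .inr ⟨⟨l, hl⟩, by simp, h.1, fun i hi hi' => ?_⟩,
        fun h => .inr ⟨x, hx, hx', fun i hi hi' => ?_⟩⟩
      · grind
      grind
  obtain ⟨x, hx, hx1, hmax⟩ : ∃ x : Fin n, m2.nvar 15 = x ∧ m.narr 6 0 x = 1 ∧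
      ∀ i : Fin n, m.narr 6 0 i = 1 → m.rarr 5 0 i ≤ m.rarr 5 0 x := by
    rcases h₂ with ⟨-, h⟩ | ⟨x, h1, h2, h3⟩
    · obtain ⟨i, hi, hi'⟩ := hI.inv.exists_unvisited hk
      exact absurd ((hI.vis i).mpr ⟨hi, hi'⟩) (h i i.isLt)
    grind
  obtain ⟨hxS, hxv⟩ := (hI.vis x).mp hx1
  have hE2 := hE1.of_frame hF2 rfl
  refine (Ht.of_wp (K := 20) (Q := fun m' => m'.rarr 5 = m.rarr 5 ∧ m'.nvar 15 = x ∧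
    m'.rarr 4 0 = update (m.rarr 4 0) k (m.rarr 5 0 x) ∧
    m'.narr 5 0 = update (m.narr 5 0) k x ∧
    m'.narr 6 0 = update (m.narr 6 0) x 0 ∧
    m'.narr 7 0 = update (m.narr 7 0) x k) ?_ (by decide)).cons (K2 := 80 * n) (by omega)
    fun m3 hF3 h₃ => ?_
  · have e1 : m2.nvar 14 = k := by rw [hF2.n 14 rfl, hF1.n 14 rfl, hk']
    simp only [progs, wp, NExp.eval, RExp.eval, e1, hx, hF2.R 5 rfl, hF1.R 5 rfl,
      Store.setN_nvar, Store.setR_nvar, Store.setN_rarr, true_and]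
    refine ⟨by funext i j; simp [hF2.R 5 rfl, hF1.R 5 rfl], ?_⟩
    simp only [funext_iff, Store.setR_rarr, Store.setN_narr, Store.setN_rarr, Store.setR_narr,
      update_apply, hF2.R 4 rfl, hF1.R 4 rfl, hF2.N 5 rfl, hF1.N 5 rfl, hF2.N 6 rfl,
      hF1.N 6 rfl, hF2.N 7 rfl, hF1.N 7 rfl]
    simp
  obtain ⟨h5, h15, h4, hv, h6, h7⟩ := h₃
  have hE3 := hE2.of_frame hF3 rfl
  have hcv : ∀ m', m'.narr 5 0 = m3.narr 5 0 → c.v m' = update (c.v m) k x := by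
    intro m' h
    funext u
    simp only [Ctx.v, h, hv, update_apply]
    split_ifs
    · exact c.el_coe x
    · rfl
  have hvis : ∀ j : Fin n, m3.narr 6 0 j = 1 ↔ m.narr 6 0 j = 1 ∧ x ≠ j := by
    intro j
    rw [h6, update_apply]
    grind
  refine (Ht.for_const (N := n) (fun l m' => ∀ j : Fin n,
    (((j : ℕ) < l ∧ m3.narr 6 0 j = 1 ∧ c.nb j ≠ c.nb x ∧
      m.rarr 5 0 j < normEntry a (c.S p t) x j) → m'.rarr 5 0 j = normEntry a (c.S p t) x j) ∧
    (¬ ((j : ℕ) < l ∧ m3.narr 6 0 j = 1 ∧ c.nb j ≠ c.nb x ∧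
      m.rarr 5 0 j < normEntry a (c.S p t) x j) → m'.rarr 5 0 j = m.rarr 5 0 j))
    60 rfl rfl (by decide) hE3.hn (fun k m v h => h) (fun j => by simp [h5])
    fun l m' hl hF hl' _ hJ => Ht.of_wp ?_ (by decide)).conseq (by omega)
    fun m4 hF4 h₄ => ?_
  · have hE' := hE3.of_frame hF rfl
    have e1 : m'.nvar 15 = x := by rw [hF.n 15 rfl, h15]
    have e2 := hE'.nb ⟨l, hl⟩
    have e3 := (hJ ⟨l, hl⟩).2 (by simp)
    have e4 := hE'.entryE_eval (x := .var 15) (y := .var 11) e1 (j := ⟨l, hl⟩) hl'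
    simp only at e2 e3
    simp only [wp, Test.holds, NExp.eval, RExp.eval, hl', e1, e2, hE'.nb x, hF.N 6 rfl, e3, e4]
    refine ⟨fun h j => ?_, fun h j => ?_⟩
    · by_cases hj : (j : ℕ) = l
      · obtain rfl : j = ⟨l, hl⟩ := Fin.ext hj
        simp [h.1, h.2]
      · have : ((j : ℕ) < l + 1 ↔ (j : ℕ) < l) := by omega
        simpa [hj, this] using hJ j
    grind
  · have hkey : ∀ j ∈ c.S p t, (∀ u < k, c.v m u ≠ j) → x ≠ j →
        (c.nb j ≠ c.nb x → m4.rarr 5 0 j = max (m.rarr 5 0 j) (normEntry a (c.S p t) x j)) ∧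
        (¬ c.nb j ≠ c.nb x → m4.rarr 5 0 j = m.rarr 5 0 j) := by
      intro j hj hjv hxj
      have h1 := (hvis j).mpr ⟨(hI.vis j).mpr ⟨hj, hjv⟩, hxj⟩
      grind
    have e5 : m4.narr 5 0 = m3.narr 5 0 := by rw [hF4.N 5 rfl]
    refine ⟨hI.inv.step hxS hxv (fun j hj hjv => hmax j ((hI.vis j).mpr ⟨hj, hjv⟩)) (hcv _ e5)
      (by rw [hF4.R 4 rfl, h4]) (fun j hj hjv hxj ho => (hkey j hj hjv hxj).1
        ((c.opp_iff hE.hlt.2.2 hxS hj).mp ho).symm) (fun j hj hjv hxj ho => (hkey j hj hjv hxj).2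
        fun h => ho ((c.opp_iff hE.hlt.2.2 hxS hj).mpr h.symm)), fun i => ?_, fun u hu => ?_,
        fun u hu => ?_⟩
    · rw [hF4.N 6 rfl, hvis, hI.vis, hcv _ e5, and_assoc]
      refine and_congr_right fun _ => ⟨fun ⟨h1, h2⟩ u hu => ?_, fun h => ⟨fun u hu => ?_, ?_⟩⟩
      · grind
      · simpa [update_apply, hu.ne] using h u (by omega)
      · simpa using h k (by omega)
    · rw [e5, hv, update_apply]
      split_ifs with h3
      · exact x.isLt
      · exact hI.lt u (by omega)
    · rw [e5, hF4.N 7 rfl, h7, hv, update_apply, update_apply]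
      by_cases h3 : u = k
      · simp [h3]
      · rw [if_neg h3, if_neg, hI.pos u (by omega)]
        intro h4
        exact hxv u (by omega) (by rw [Ctx.v, h4, c.el_coe])

/-- The memory holds the order of the ground set of the blocks `p`, `t` found by the algorithm of
Prim. -/
structure PrimEnv (c : Ctx n r a) (p t : ℕ) (m : Store) : Prop extends NormEnv c p t m where
  data : PrimData (c.B p) (c.B t) (normEntry a (c.S p t)) (minEntry (c.S p t) a) (c.S p t).card
    (c.v m) (m.rarr 4 0)
  card : m.nvar 13 = (c.S p t).card
  lt : ∀ u < (c.S p t).card, m.narr 5 0 u < n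
  pos : ∀ u < (c.S p t).card, m.narr 7 0 (m.narr 5 0 u) = u

/-- The program `P` does not overwrite the data of `PrimEnv`. -/
def Prog.keepsPrim (P : Prog) : Bool :=
  P.keepsNorm && !(P.wN 5) && !(P.wN 7) && !(P.wR 4) && !(P.wn 13)

theorem PrimEnv.of_frame {m' : Store} (h : PrimEnv c p t m) {P : Prog}
    (hF : Frame P m m') (hP : P.keepsPrim = true) : PrimEnv c p t m' := by
  simp only [Prog.keepsPrim, Bool.and_eq_true, Bool.not_eq_true'] at hP
  have h5 := hF.N 5 hP.1.1.1.2
  refine ⟨h.toNormEnv.of_frame hF hP.1.1.1.1, ?_, (hF.n 13 hP.2).trans h.card,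
    fun u hu => by rw [h5]; exact h.lt u hu, fun u hu => by
      rw [h5, hF.N 7 hP.1.1.2]; exact h.pos u hu⟩
  have : c.v m' = c.v m := by grind
  rw [this, hF.R 4 hP.1.2]
  exact h.data

theorem ht_primP (hE : NormEnv c p t m) :
    Ht primP m (300 * (n * (c.S p t).card)) (PrimEnv c p t) := by
  obtain ⟨hS, hn⟩ := hE.card_pos
  have hnS : n ≤ n * (c.S p t).card := Nat.le_mul_of_pos_right _ (by omega)
  have hnS' : (c.S p t).card ≤ n * (c.S p t).card := Nat.le_mul_of_pos_left _ (by omega)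
  refine (ht_primInitP hE).cons (K2 := 240 * (n * (c.S p t).card)) (by omega) fun m1 hF1 h1 => ?_
  have hE1 := hE.of_frame hF1 rfl
  refine (Ht.for_const (N := (c.S p t).card) (PrimState c p t) (150 * n) rfl rfl (by decide) h1.2
    (fun k m v h => ⟨h.1, h.2, h.3, h.4⟩) h1.1 fun k m' hk hF hk' _ hI =>
    ht_primStepP (hE1.of_frame hF rfl) hk hk' hI).cons (K2 := 5) (by nlinarith) fun m2 hF2 h2 => ?_
  have hE2 := hE1.of_frame hF2 rfl
  have e13 : m2.nvar 13 = (c.S p t).card := (hF2.n 13 rfl).trans h1.2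
  refine (Ht.of_wp (K := 5) (Q := fun m' => m'.rarr 4 0 =
    update (m2.rarr 4 0) (c.S p t).card (minEntry (c.S p t) a)) ?_ (by decide)).conseq
    le_rfl fun m3 hF3 h3 => ?_
  · funext u
    simp [progs, e13, hE2.low, update_apply]
  have h5 : m3.narr 5 = m2.narr 5 := hF3.N 5 rfl
  refine ⟨hE2.of_frame hF3 rfl, ?_, (hF3.n 13 rfl).trans e13, ?_, ?_⟩
  · refine PrimInv.primData (d := m2.rarr 4 0) (key := fun i => m2.rarr 5 0 i) ?_
      (card_pos.mp hS) h3
    rw [show c.v m3 = c.v m2 by grind]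
    exact h2.inv
  · rw [h5]
    exact h2.lt
  · rw [h5, hF3.N 7 rfl]
    exact h2.pos

end Prim

section Rows

variable {n : ℕ}
variable {J J' : ℕ → Prop} {M M' : ℕ → ℕ → ℕ} {W : WFam n} {w w' : ℕ → ℝ} {x0 : ℕ}

/-- The set with row `x` of `M` as its indicator vector. -/
def rset (n : ℕ) (M : ℕ → ℕ → ℕ) (x : ℕ) : Finset (Fin n) := univ.filter fun i => M x i = 1

theorem mem_rset {x : ℕ} {i : Fin n} : i ∈ rset n M x ↔ M x i = 1 := by
  simp [rset]

/-- The rows of `M` with numbers in `J` are the members of `W`, listed without repetition, and `w`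
contains their weights. -/
structure Rows (M : ℕ → ℕ → ℕ) (w : ℕ → ℝ) (J : ℕ → Prop) (W : WFam n) : Prop where
  bit : ∀ x, J x → ∀ i : Fin n, M x i = 0 ∨ M x i = 1
  inj : ∀ x y, J x → J y → rset n M x = rset n M y → x = y
  fam : ∀ X, X ∈ W.fam ↔ ∃ x, J x ∧ rset n M x = X
  wt : ∀ x, J x → W.wt (rset n M x) = w x

theorem exists_rows (w : ℕ → ℝ)
    (bit : ∀ x, J x → ∀ i : Fin n, M x i = 0 ∨ M x i = 1)
    (inj : ∀ x y, J x → J y → rset n M x = rset n M y → x = y) : ∃ W : WFam n, Rows M w J W := by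
  classical
  refine ⟨⟨univ.filter fun X => ∃ x, J x ∧ rset n M x = X, fun X =>
    if h : ∃ x, J x ∧ rset n M x = X then w h.choose else 0⟩, bit, inj, fun X => by simp,
    fun x hx => ?_⟩
  have h : ∃ y, J y ∧ rset n M y = rset n M x := ⟨x, hx, rfl⟩
  grind

theorem Rows.reindex
    (h : Rows M w J W) (φ : ℕ → ℕ) (h1 : ∀ x, J' x → J (φ x)) (h2 : ∀ y, J y → ∃ x, J' x ∧ φ x = y)
    (h3 : ∀ x y, J' x → J' y → φ x = φ y → x = y) (hM : ∀ x, J' x → ∀ i : Fin n, M' x i = M (φ x) i)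
    (hw : ∀ x, J' x → w' x = w (φ x)) : Rows M' w' J' W := by
  have hr : ∀ x, J' x → rset n M' x = rset n M (φ x) := fun x hx => by
    ext i
    rw [mem_rset, mem_rset, hM x hx i]
  refine ⟨fun x hx i => ?_, fun x y hx hy he => ?_, fun X => (h.fam X).trans ⟨?_, ?_⟩,
    fun x hx => ?_⟩
  · rw [hM x hx i]
    exact h.bit _ (h1 x hx) i
  · rw [hr x hx, hr y hy] at he
    exact h3 x y hx hy (h.inj _ _ (h1 x hx) (h1 y hy) he)
  · grind
  · grind
  · rw [hr x hx, hw x hx, h.wt _ (h1 x hx)]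

theorem Rows.congr
    (h : Rows M w J W) (hJ : ∀ x, J' x ↔ J x) (hM : ∀ x, J x → ∀ i : Fin n, M' x i = M x i)
    (hw : ∀ x, J x → w' x = w x) : Rows M' w' J' W :=
  h.reindex id (fun x => (hJ x).mp) (fun y hy => ⟨y, (hJ y).mpr hy, rfl⟩) (fun _ _ _ _ h => h)
    (fun x hx => hM x ((hJ x).mp hx)) fun x hx => hw x ((hJ x).mp hx)

theorem Rows.dec (h : Rows M w J W)
    (hx : J x0) (d : ℝ) : Rows M (fun x => if x = x0 then w x - d else w x)
      (fun x => J x ∧ (x = x0 → w x0 - d ≠ 0)) (W.dec (rset n M x0) d) := by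
  refine ⟨fun x hx => h.bit x hx.1, fun x y hx hy => h.inj x y hx.1 hy.1, fun X => ?_,
    fun x hx' => ?_⟩
  · simp only [WFam.dec, h.wt x0 hx]
    split_ifs with h0
    · rw [mem_erase, h.fam]
      exact ⟨fun ⟨h1, x, h2, h3⟩ => ⟨x, ⟨h2, fun he => absurd (he ▸ h3).symm h1⟩, h3⟩,
        fun ⟨x, ⟨h1, h2⟩, h3⟩ => ⟨fun he => h2 (h.inj x x0 h1 hx (h3.trans he)) h0, x, h1, h3⟩⟩
    · rw [h.fam]
      grind
  · simp only [WFam.dec, update_apply, h.wt x0 hx]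
    by_cases hxx : x = x0
    · simp [hxx]
    · rw [if_neg fun he => hxx (h.inj x x0 hx'.1 hx he), if_neg hxx, h.wt x hx'.1]

theorem Rows.erase (h : Rows M w J W)
    (hx : J x0) : Rows M w (fun x => J x ∧ x ≠ x0) ⟨W.fam.erase (rset n M x0), W.wt⟩ := by
  refine ⟨fun x hx => h.bit x hx.1, fun x y hx hy => h.inj x y hx.1 hy.1, fun X => ?_,
    fun x hx' => h.wt x hx'.1⟩
  rw [mem_erase, h.fam]
  exact ⟨fun ⟨h1, x, h2, h3⟩ => ⟨x, ⟨h2, fun he => absurd (he ▸ h3).symm h1⟩, h3⟩,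
    fun ⟨x, ⟨h1, h2⟩, h3⟩ => ⟨fun he => h2 (h.inj x x0 h1 hx (h3.trans he)), x, h1, h3⟩⟩

theorem Rows.put (h : Rows M w J W)
    (hbit : ∀ i : Fin n, M x0 i = 0 ∨ M x0 i = 1) (hX : rset n M x0 ∉ W.fam) :
    Rows M w (fun x => x = x0 ∨ J x) (W.put (rset n M x0) (w x0)) := by
  have hne : ∀ x, J x → rset n M x ≠ rset n M x0 := fun x hx he => hX ((h.fam _).mpr ⟨x, hx, he⟩)
  refine ⟨?_, ?_, fun X => ?_, ?_⟩
  · rintro x (rfl | hx)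
    exacts [hbit, h.bit x hx]
  · rintro x y (rfl | hx) (rfl | hy) he
    exacts [rfl, absurd he.symm (hne y hy), absurd he (hne x hx), h.inj x y hx hy he]
  · simp [WFam.put, h.fam, or_and_right, exists_or, eq_comm]
  · rintro x (rfl | hx)
    · simp [WFam.put]
    · simp only [WFam.put, update_of_ne (hne x hx), h.wt x hx]

end Rows

section Members

variable {n r : ℕ} {a : Fin n → Fin n → WithTop ℝ} {c : Ctx n r a} {p t : ℕ} {m : Store}
variable {u : ℕ}

theorem PrimEnv.nb_v (h : PrimEnv c p t m) {x : NExp} (hu : u < (c.S p t).card)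
    (hx : x.eval m = u) : (nA 5 x).eval m = c.v m u ∧ (nA 2 (nA 5 x)).eval m = c.nb (c.v m u) := by
  have h1 : m.narr 5 0 u = c.v m u := by simp [Ctx.v, Ctx.el, h.lt u hu]
  simp only [NExp.eval, hx]
  rw [h1, h.nb]
  grind

theorem PrimEnv.v_mem (h : PrimEnv c p t m) (hu : u < (c.S p t).card) :
    c.v m u ∈ c.S p t := (h.data.mem _).mpr ⟨u, hu, rfl⟩

/-- The test of condition (CB); variable `7` is set to `1` if it does not hold. -/
def cbP : Prog := forP 14 13 <| forP 15 13 <| .ite (.nlt (.var 14) (.var 15)) (progs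
  [.ite (.not (.and (.not (.neq (.var 15) (.add (.var 14) (.lit 1))))
     (.not (.rlt (rA 4 (.var 15)) (.var 1))))) (.rset 1 (rA 4 (.var 15))) .skip,
   .ite (.and (.not (.neq (nA 2 (nA 5 (.var 14))) (nA 2 (nA 5 (.var 15)))))
     (.rlt (entryE (nA 5 (.var 14)) (nA 5 (.var 15))) (.var 1))) (.nset 7 (.lit 1)) .skip]) .skip

/-- The entry of the elements at the positions `u`, `w` contradicts condition (CB). -/
def Violates (c : Ctx n r a) (p t : ℕ) (m : Store) (u w : ℕ) : Prop :=
  u < w ∧ c.nb (c.v m u) ≠ c.nb (c.v m w) ∧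
    ∀ k, u < k → k ≤ w → normEntry a (c.S p t) (c.v m u) (c.v m w) < m.rarr 4 0 k

theorem ht_cbP (hE : PrimEnv c p t m) (h7 : m.nvar 7 = 0) :
    Ht cbP m (200 * (n * (c.S p t).card)) fun m' =>
      (m'.nvar 7 = 0 → CB (c.B p) (c.B t) (normalize (c.S p t) a)) ∧
      (m'.nvar 7 ≠ 0 → ¬ CB (c.B p) (c.B t) (normalize (c.S p t) a)) := by
  obtain ⟨hS, hn⟩ := hE.card_pos
  have hSn : (c.S p t).card ≤ n := (card_le_univ _).trans_eq (Fintype.card_fin n)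
  have hS2 := Nat.mul_le_mul_right (c.S p t).card hSn
  have hS3 : (c.S p t).card ≤ n * (c.S p t).card := Nat.le_mul_of_pos_left _ (by omega)
  set N := (c.S p t).card
  refine (Ht.for_const (N := N) (fun k m' =>
    (m'.nvar 7 = 0 → ∀ u w, u < k → w < N → ¬ Violates c p t m u w) ∧
    (m'.nvar 7 ≠ 0 → ∃ u w, w < N ∧ Violates c p t m u w)) (N * 87 + 5) rfl rfl (by decide)
    hE.card (fun k m v h => by simpa using h) ⟨by simp, by simp [h7]⟩
    fun k m1 hk hF1 hk' _ hI => ?_).conseq (by nlinarith) fun m' _ h => ?_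
  · have hE1 := hE.of_frame hF1 rfl
    refine (Ht.for_const (N := N) (fun l m' =>
      (m'.nvar 7 = 0 → ∀ u w, (u < k ∧ w < N) ∨ (u = k ∧ w < l) → ¬ Violates c p t m u w) ∧
      (m'.nvar 7 ≠ 0 → ∃ u w, w < N ∧ Violates c p t m u w) ∧
      (k + 1 < l → (∃ j, k < j ∧ j < l ∧ m.rarr 4 0 j = m'.rvar 1) ∧
        ∀ j, k < j → j < l → m'.rvar 1 ≤ m.rarr 4 0 j)) 80 rfl rfl (by decide)
      hE1.card (fun k m v h => by simpa using h)
      ⟨fun h u w hu => hI.1 h u w (by omega) (by omega), hI.2, by omega⟩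
      fun l m2 hl hF2 hl' _ hJ => ?_).conseq le_rfl fun m' _ h =>
        ⟨fun h0 u w hu hw => h.1 h0 u w (by omega), h.2.1⟩
    have hE2 := hE1.of_frame hF2 rfl
    have e14 : m2.nvar 14 = k := (hF2.n 14 rfl).trans hk'
    refine Ht.ite_le (K := 75) (by decide) (fun h => ?_) fun h => Ht.of_wp ?_ (by decide)
    · simp only [Test.holds, NExp.eval, e14, hl'] at h
      refine (Ht.of_wp (K := 25) (Q := fun m' => (∃ j, k < j ∧ j < l + 1 ∧ m.rarr 4 0 j = m'.rvar 1) ∧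
        ∀ j, k < j → j < l + 1 → m'.rvar 1 ≤ m.rarr 4 0 j) ?_ (by decide)).cons (K2 := 50) le_rfl
        fun m3 hF3 h₃ => Ht.of_wp ?_ (by decide)
      · simp only [wp, Test.holds, NExp.eval, RExp.eval, e14, hl', hF2.R 4 rfl, hF1.R 4 rfl,
          Store.setr_rvar, if_true]
        grind
      · have hE3 := hE2.of_frame hF3 rfl
        have hv : c.v m3 = c.v m := by
          funext u
          simp only [Ctx.v, hF3.N 5 rfl, hF2.N 5 rfl, hF1.N 5 rfl]
        obtain ⟨e1, e2⟩ := hE3.nb_v (x := .var 14) hk ((hF3.n 14 rfl).trans e14)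
        obtain ⟨e3, e4⟩ := hE3.nb_v (x := .var 15) hl ((hF3.n 15 rfl).trans hl')
        have e5 := hE3.entryE_eval e1 e3
        rw [hv] at e2 e4 e5
        simp only [progs, wp, Test.holds, e2, e4, e5, RExp.eval]
        obtain ⟨⟨j, h2, h3, h4⟩, h5⟩ := h₃
        refine ⟨fun h1 => ⟨fun h0 => by simp at h0, fun _ => ⟨k, l, hl, h, h1.1, fun i hi hi' => ?_⟩,
          fun _ => ⟨⟨j, h2, h3, h4⟩, h5⟩⟩, fun h1 => ⟨fun h0 u w hu => ?_, fun h0 => ?_, fun _ =>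
          ⟨⟨j, h2, h3, h4⟩, h5⟩⟩⟩
        · grind
        · rw [hF3.n 7 rfl] at h0
          by_cases hw : u = k ∧ w = l
          · obtain ⟨rfl, rfl⟩ := hw
            exact fun hv => h1 ⟨hv.2.1, h4 ▸ hv.2.2 j h2 (by omega)⟩
          grind
        · rw [hF3.n 7 rfl] at h0
          exact hJ.2.1 h0
    · simp only [Test.holds, NExp.eval, e14, hl'] at h
      refine ⟨fun h0 u w hu => ?_, hJ.2.1, by omega⟩
      by_cases hw : u = k ∧ w = l
      · exact fun hv => h (hw.1 ▸ hw.2 ▸ hv.1)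
      grind
  · have hnd := (c.data.two p hE.hlt.1 t hE.hlt.2.1 hE.hlt.2.2).normData
    have key := hE.data.CB_iff hnd fun i j => by
      simp only [normEntry, realPart_symm (c.data.two p hE.hlt.1 t hE.hlt.2.1 hE.hlt.2.2) i j]
      ring
    refine ⟨fun h0 => key.mpr fun u w huw hw ho => ?_, fun h0 hCB => ?_⟩
    · by_contra! hcon
      exact h.1 h0 u w (by omega) hw ⟨huw, (c.opp_iff hE.hlt.2.2 (hE.v_mem (by omega))
        (hE.v_mem hw)).mp ho, hcon⟩
    · obtain ⟨u, w, hw, huw, ho, hlt⟩ := h.2 h0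
      obtain ⟨k, h1, h2, h3⟩ := key.mp hCB u w huw hw ((c.opp_iff hE.hlt.2.2 (hE.v_mem (by omega))
        (hE.v_mem hw)).mpr ho)
      grind

end Members

section Members

variable {n r : ℕ} {a : Fin n → Fin n → WithTop ℝ} {c : Ctx n r a} {p t : ℕ} {m : Store}
variable {k l : ℕ}

/-- Around the position in variable `14`, find the maximal interval of the order with entries that
are not smaller; its ends go to the variables `15` and `16`. -/
def intervalP : Prog := progs
  [forP 10 14 (.ite (.not (.rlt (rA 4 (.var 14)) (rA 4 (.var 10)))) (.nset 15 (.var 10)) .skip),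
   .nset 16 (.var 13),
   forP 10 13 (.ite (.and (.and (.nlt (.var 14) (.var 10)) (.neq (.var 16) (.var 13)))
     (.rlt (rA 4 (.var 10)) (rA 4 (.var 14)))) (.nset 16 (.var 10)) .skip)]

/-- Append the interval with ends in the variables `15` and `16`, with the weight in the real
variable `1`, to the list in the arrays `1`, `2`, `13`. -/
def appendP : Prog := progs
  [forP 10 2 (.ite (.and (inS 10) (.and (.not (.nlt (nA 7 (.var 10)) (.var 15)))
     (.nlt (nA 7 (.var 10)) (.var 16)))) (.nput 1 (.var 6) (.var 10) (.lit 1))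
     (.nput 1 (.var 6) (.var 10) (.lit 0))),
   progs [.rput 2 (.lit 0) (.var 6) (.var 1), .nput 13 (.lit 0) (.var 6) (.var 5),
    .nput 13 (.lit 1) (.var 6) (.lit 1),
    .ite (.neq (.var 15) (.lit 0)) (.nput 15 (.lit 0) (.var 16) (.add (.var 6) (.lit 1))) .skip,
    .nset 6 (.add (.var 6) (.lit 1))]]

/-- One pass of the listing of the members. -/
def memberStepP : Prog :=
  .ite (.rlt (.var 0) (rA 4 (.var 14))) (.seq intervalP
    (.ite (.rlt (rA 4 (.var 15)) (rA 4 (.var 14))) (.seq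
      (.ite (.rlt (rA 4 (.var 15)) (rA 4 (.var 16))) (.rset 1 (.sub (rA 4 (.var 14)) (rA 4 (.var 16))))
        (.rset 1 (.sub (rA 4 (.var 14)) (rA 4 (.var 15)))))
      (.ite (.and (.neq (.var 16) (.var 13)) (.nlt (.lit 0) (nA 15 (.var 15))))
        (.rput 2 (.lit 0) (.sub (nA 15 (.var 15)) (.lit 1))
          (.add (rA 2 (.sub (nA 15 (.var 15)) (.lit 1))) (.var 1))) appendP)) .skip)) .skip

/-- The listing of the members: appended to the rows of the array `1` and row `0` of the real
array `2`; rows `0` and `1` of the array `13` contain `p` and the mark `1`. Row `0` of the array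
`15` contains, for an initial segment that is a member, its number plus one. -/
def membersP : Prog :=
  .seq (forP 10 13 (.nput 15 (.lit 0) (.var 10) (.lit 0))) (forP 14 13 memberStepP)

theorem ht_intervalP (hE : PrimEnv c p t m) (hk : k < (c.S p t).card) (hk' : m.nvar 14 = k)
    (hlow : minEntry (c.S p t) a < m.rarr 4 0 k) :
    Ht intervalP m (60 * n) fun m' => m'.nvar 15 < k ∧ m.rarr 4 0 (m'.nvar 15) ≤ m.rarr 4 0 k ∧
      (∀ u, m'.nvar 15 < u → u < k → m.rarr 4 0 k < m.rarr 4 0 u) ∧ k < m'.nvar 16 ∧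
      m'.nvar 16 ≤ (c.S p t).card ∧ m.rarr 4 0 (m'.nvar 16) < m.rarr 4 0 k ∧
      ∀ u, k < u → u < m'.nvar 16 → m.rarr 4 0 k ≤ m.rarr 4 0 u := by
  obtain ⟨hS, hn⟩ := hE.card_pos
  have hSn : (c.S p t).card ≤ n := (card_le_univ _).trans_eq (Fintype.card_fin n)
  set N := (c.S p t).card
  refine (Ht.for_const (N := k) (fun l m' => (0 < l → m'.nvar 15 < l ∧
    m.rarr 4 0 (m'.nvar 15) ≤ m.rarr 4 0 k) ∧
    ∀ u, m'.nvar 15 < u → u < l → m.rarr 4 0 k < m.rarr 4 0 u) 20 rfl rfl (by decide) hk'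
    (fun k m v h => by simpa using h) (by simp) fun l m' hl hF hl' _ hI => Ht.of_wp ?_
    (by decide)).cons (K1 := k * (20 + 7) + 5) (K2 := n * 27 + 8) (by nlinarith) fun m1 hF1 h₁ => ?_
  · simp only [wp, Test.holds, NExp.eval, RExp.eval, hF.R 4 rfl, (hF.n 14 rfl).trans hk', hl',
      Store.setn_nvar, if_true, not_lt, not_le]
    refine ⟨fun h => ⟨fun _ => ⟨by omega, h⟩, fun u hu hu' => by omega⟩, fun h => ?_⟩
    have h0 : 0 < l := by
      by_contra h0
      obtain rfl : l = 0 := by omega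
      exact absurd (h.trans_eq hE.data.zero) (not_lt.mpr hlow.le)
    grind
  have hk0 : 0 < k := by
    by_contra h0
    obtain rfl : k = 0 := by omega
    exact hlow.ne' hE.data.zero
  refine (Ht.of_wp (K := 2) (Q := fun m' => m'.nvar 16 = N) ?_ le_rfl).cons
    (K2 := n * 27 + 6) (by omega) fun m2 hF2 h₂ => ?_
  · simp [hF1.n 13 rfl, hE.card, N]
  have e13 : m2.nvar 13 = N := by rw [hF2.n 13 rfl, hF1.n 13 rfl, hE.card]
  refine (Ht.for_const (N := N) (fun l m' =>
    (m'.nvar 16 = N ∨ (k < m'.nvar 16 ∧ m'.nvar 16 < l ∧ m.rarr 4 0 (m'.nvar 16) < m.rarr 4 0 k)) ∧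
    ∀ u, k < u → u < l → u < m'.nvar 16 → m.rarr 4 0 k ≤ m.rarr 4 0 u) 20 rfl rfl
    (by decide) e13 (fun k m v h => by simpa using h) ⟨.inl h₂, by simp⟩
    fun l m' hl hF hl' _ hI => Ht.of_wp ?_ (by decide)).conseq (by nlinarith) fun m3 hF3 h₃ => ?_
  · simp only [wp, Test.holds, NExp.eval, RExp.eval, hF.R 4 rfl, hF2.R 4 rfl, hF1.R 4 rfl,
      (hF.n 14 rfl).trans ((hF2.n 14 rfl).trans ((hF1.n 14 rfl).trans hk')), hl', hF.n 13 rfl, e13,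
      Store.setn_nvar, if_true]
    grind
  · have e15 : m3.nvar 15 = m1.nvar 15 := by rw [hF3.n 15 rfl, hF2.n 15 rfl]
    rw [e15]
    refine ⟨(h₁.1 hk0).1, (h₁.1 hk0).2, h₁.2, ?_⟩
    rcases h₃.1 with h4 | ⟨h4, h5, h6⟩
    · rw [h4]
      exact ⟨hk, le_rfl, hE.data.last.trans_lt hlow, fun u hu hu' => h₃.2 u hu hu' (by omega)⟩
    grind

/-- The weight of the member with parameters `k`, `l`, `r` is `x`, when the complementary members
with a first parameter smaller than `K` have been taken into account. -/
def WtOK (N : ℕ) (d : ℕ → ℝ) (low : ℝ) (K k l r : ℕ) (x : ℝ) : Prop :=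
  (∀ k' < K, l = 0 → IsMember N d low k' r N →
    x = d k - max (d l) (d r) + (d k' - max (d r) (d N))) ∧
  ((∀ k' < K, l = 0 → ¬ IsMember N d low k' r N) → x = d k - max (d l) (d r))

/-- In the memory `m'`, the members with a first parameter smaller than `K` have been appended to
the list in the memory `m`. -/
structure MemInv (c : Ctx n r a) (p t : ℕ) (m : Store) (K : ℕ) (m' : Store) : Prop where
  le : m.nvar 6 ≤ m'.nvar 6 ∧ m'.nvar 6 ≤ m.nvar 6 + K
  bit : ∀ x, m.nvar 6 ≤ x → x < m'.nvar 6 → ∀ i : Fin n, m'.narr 1 x i = 0 ∨ m'.narr 1 x i = 1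
  act : ∀ x, m.nvar 6 ≤ x → x < m'.nvar 6 → m'.narr 13 0 x = p ∧ m'.narr 13 1 x = 1
  row : ∀ x, m.nvar 6 ≤ x → x < m'.nvar 6 → ∃ k < K, ∃ l r,
    Kept (c.S p t).card (m.rarr 4 0) (minEntry (c.S p t) a) k l r ∧
    rset n (m'.narr 1) x = seg (c.v m) l r ∧
    WtOK (c.S p t).card (m.rarr 4 0) (minEntry (c.S p t) a) K k l r (m'.rarr 2 0 x)
  ex : ∀ k < K, ∀ l r, Kept (c.S p t).card (m.rarr 4 0) (minEntry (c.S p t) a) k l r →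
    ∃ x, m.nvar 6 ≤ x ∧ x < m'.nvar 6 ∧ rset n (m'.narr 1) x = seg (c.v m) l r
  inj : ∀ x y, m.nvar 6 ≤ x → x < m'.nvar 6 → m.nvar 6 ≤ y → y < m'.nvar 6 →
    rset n (m'.narr 1) x = rset n (m'.narr 1) y → x = y
  mark : ∀ q < (c.S p t).card, (m'.narr 15 0 q ≠ 0 → ∃ x, m'.narr 15 0 q = x + 1 ∧ m.nvar 6 ≤ x ∧
      x < m'.nvar 6 ∧ rset n (m'.narr 1) x = seg (c.v m) 0 q) ∧
    ∀ k < K, IsMember (c.S p t).card (m.rarr 4 0) (minEntry (c.S p t) a) k 0 q →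
      m'.narr 15 0 q ≠ 0
  old : ∀ x < m.nvar 6, m'.narr 1 x = m.narr 1 x ∧ m'.rarr 2 0 x = m.rarr 2 0 x ∧
    m'.narr 13 0 x = m.narr 13 0 x ∧ m'.narr 13 1 x = m.narr 13 1 x

theorem IsMember.lr {N : ℕ} {d : ℕ → ℝ} {low : ℝ} (h : IsMember N d low k l r) :
    l < r := h.lk.trans h.kr

variable {m' m'' : Store} {K : ℕ}

theorem MemInv.skip (h : MemInv c p t m K m')
    (hno : ∀ l r, ¬ IsMember (c.S p t).card (m.rarr 4 0) (minEntry (c.S p t) a) K l r)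
    (e6 : m''.nvar 6 = m'.nvar 6) (e12 : m''.narr 1 = m'.narr 1) (e13 : m''.narr 13 = m'.narr 13)
    (e15 : m''.narr 15 = m'.narr 15) (w6 : m''.rarr 2 = m'.rarr 2) :
    MemInv c p t m (K + 1) m'' := by
  have hlt : ∀ {k l r}, k < K + 1 → IsMember (c.S p t).card (m.rarr 4 0) (minEntry (c.S p t) a) k l r →
      k < K := by grind
  refine ⟨⟨by rw [e6]; exact h.le.1, by rw [e6]; have := h.le.2; omega⟩, ?_, ?_, ?_, ?_, ?_, ?_, ?_⟩
  all_goals simp only [e6, e12, e13, e15, w6]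
  · exact h.bit
  · exact h.act
  · intro x hx hx'
    obtain ⟨k, hk, l, r, h1, h2, h3⟩ := h.row x hx hx'
    exact ⟨k, by omega, l, r, h1, h2, fun k' hk' h0 hM => h3.1 k' (hlt hk' hM) h0 hM,
      fun hM => h3.2 fun k' hk' => hM k' (by omega)⟩
  · exact fun k hk l r hM => h.ex k (hlt hk hM.1) l r hM
  · exact h.inj
  · exact fun q hq => ⟨(h.mark q hq).1, fun k hk hM => (h.mark q hq).2 k (hlt hk hM) hM⟩
  · exact h.old

theorem MemInv.merge (hE : PrimEnv c p t m) (h : MemInv c p t m K m') {x : ℕ}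
    (hM : IsMember (c.S p t).card (m.rarr 4 0) (minEntry (c.S p t) a) K l (c.S p t).card)
    (hx : m'.narr 15 0 l = x + 1)
    (e6 : m''.nvar 6 = m'.nvar 6) (e12 : m''.narr 1 = m'.narr 1) (e13 : m''.narr 13 = m'.narr 13)
    (e15 : m''.narr 15 = m'.narr 15) (w6 : m''.rarr 2 0 = update (m'.rarr 2 0) x
      (m'.rarr 2 0 x + (m.rarr 4 0 K - max (m.rarr 4 0 l) (m.rarr 4 0 (c.S p t).card)))) :
    MemInv c p t m (K + 1) m'' := by
  obtain ⟨y, hy, hx1, hx2, hx3⟩ := (h.mark l (hM.lr)).1 (by omega)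
  obtain rfl : x = y := by omega
  obtain ⟨k0, hk0, l0, r0, h1, h2, h3⟩ := h.row x hx1 hx2
  obtain ⟨rfl, rfl⟩ := hE.data.seg_inj h1.1.rN h1.1.lr hM.lr.le (by
    have := hM.lk; by_contra h0; obtain rfl : l = 0 := by omega
    rw [h2] at hx3
    have h5 := (hE.data.mem_seg (u := l0) (l := l0) (r := r0) (by have := h1.1.lr; have := h1.1.rN; omega)
      h1.1.rN).mpr ⟨le_rfl, h1.1.lr⟩
    rw [hx3] at h5
    simp [seg] at h5) (h2.symm.trans hx3)
  refine ⟨⟨by grind, by rw [e6]; have := h.le.2; omega⟩, ?_, ?_, ?_, ?_, ?_, ?_, ?_⟩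
  all_goals simp only [e6, e12, e13, e15, w6]
  · exact h.bit
  · exact h.act
  · intro y hy1 hy2
    by_cases hyx : y = x
    · subst hyx
      refine ⟨k0, by omega, 0, r0, h1, h2, fun k' hk' _ hM' => ?_, fun hno => absurd hM
        (hno K (by omega) rfl)⟩
      obtain rfl := hM'.unique' hM
      rw [update_self, h3.2 fun k' hk' _ hM' => by
        have := hM'.unique' hM
        omega]
    · obtain ⟨k, hk, l', r', h4, h5, h6⟩ := h.row y hy1 hy2
      refine ⟨k, by omega, l', r', h4, h5, ?_⟩
      rw [update_of_ne hyx]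
      refine ⟨fun k' hk' h0 hM' => h6.1 k' ?_ h0 hM', fun hM => h6.2 fun k' hk' => hM k' (by omega)⟩
      rcases Nat.lt_succ_iff_lt_or_eq.mp hk' with h | rfl
      · exact h
      · obtain ⟨rfl, -⟩ := hM.unique hM'
        subst h0
        exact absurd (h.inj y x hy1 hy2 hx1 hx2 (h5.trans h2.symm)) hyx
  · intro k hk l' r' hM'
    rcases Nat.lt_succ_iff_lt_or_eq.mp hk with hk | rfl
    · exact h.ex k hk l' r' hM'
    · obtain ⟨rfl, rfl⟩ := hM.unique hM'.1
      exact absurd ⟨rfl, k0, h1.1⟩ hM'.2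
  · exact h.inj
  · refine fun q hq => ⟨(h.mark q hq).1, fun k hk hM' => ?_⟩
    rcases Nat.lt_succ_iff_lt_or_eq.mp hk with hk | rfl
    · exact (h.mark q hq).2 k hk hM'
    · obtain ⟨rfl, rfl⟩ := hM.unique hM'
      omega
  · intro y hy
    rw [update_of_ne (by omega)]
    exact h.old y hy

theorem MemInv.append (hE : PrimEnv c p t m) (h : MemInv c p t m K m') {r' : ℕ}
    (hM : Kept (c.S p t).card (m.rarr 4 0) (minEntry (c.S p t) a) K l r')
    (hrow : rset n (m''.narr 1) (m'.nvar 6) = seg (c.v m) l r')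
    (hbit : ∀ i : Fin n, m''.narr 1 (m'.nvar 6) i = 0 ∨ m''.narr 1 (m'.nvar 6) i = 1)
    (e6 : m''.nvar 6 = m'.nvar 6 + 1) (e12 : ∀ x, x ≠ m'.nvar 6 → m''.narr 1 x = m'.narr 1 x)
    (e13 : m''.narr 13 0 = update (m'.narr 13 0) (m'.nvar 6) p ∧
      m''.narr 13 1 = update (m'.narr 13 1) (m'.nvar 6) 1)
    (e15 : m''.narr 15 0 = if l = 0 then update (m'.narr 15 0) r' (m'.nvar 6 + 1)
      else m'.narr 15 0)
    (w6 : m''.rarr 2 0 = update (m'.rarr 2 0) (m'.nvar 6)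
      (m.rarr 4 0 K - max (m.rarr 4 0 l) (m.rarr 4 0 r'))) :
    MemInv c p t m (K + 1) m'' := by
  have hr : ∀ x, x ≠ m'.nvar 6 → rset n (m''.narr 1) x = rset n (m'.narr 1) x := fun x hx => by
    simp only [rset, e12 x hx]
  have hcase : ∀ {x}, x < m''.nvar 6 → x < m'.nvar 6 ∨ x = m'.nvar 6 := fun hx => by omega
  have hle := h.le
  have hnew : ∀ x, m.nvar 6 ≤ x → x < m'.nvar 6 → rset n (m'.narr 1) x ≠ seg (c.v m) l r' := by
    intro x hx hx' he
    obtain ⟨k, hk, l1, r1, h1, h2, -⟩ := h.row x hx hx'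
    obtain ⟨rfl, rfl⟩ := hE.data.seg_inj h1.1.rN h1.1.lr hM.1.rN hM.1.lr (h2.symm.trans he)
    have := h1.1.unique' hM.1
    omega
  refine ⟨⟨by omega, by omega⟩, ?_, ?_, ?_, ?_, ?_, ?_, ?_⟩
  · intro x hx hx' i
    rcases hcase hx' with hx' | rfl
    · rw [e12 x hx'.ne]
      exact h.bit x hx hx' i
    · exact hbit i
  · intro x hx hx'
    rw [e13.1, e13.2]
    rcases hcase hx' with hx' | rfl
    · simpa [hx'.ne] using h.act x hx hx'
    · simp
  · intro x hx hx'
    rw [w6]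
    rcases hcase hx' with hx' | rfl
    · obtain ⟨k, hk, l1, r1, h1, h2, h3⟩ := h.row x hx hx'
      refine ⟨k, by omega, l1, r1, h1, (hr x hx'.ne).trans h2, ?_⟩
      rw [update_of_ne hx'.ne]
      refine ⟨fun k' hk' h0 hM' => h3.1 k' ?_ h0 hM', fun hM => h3.2 fun k' hk' => hM k' (by omega)⟩
      rcases Nat.lt_succ_iff_lt_or_eq.mp hk' with h | rfl
      · exact h
      · obtain ⟨rfl, rfl⟩ := hM.1.unique hM'
        subst h0
        exact absurd ⟨rfl, k, h1.1⟩ hM.2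
    · refine ⟨K, by omega, l, r', hM, hrow, fun k' hk' h0 hM' => ?_, fun _ => by simp⟩
      have := hM'.lk
      have := hM.1.kr
      omega
  · intro k hk l1 r1 hM'
    rcases Nat.lt_succ_iff_lt_or_eq.mp hk with hk | rfl
    · obtain ⟨x, h1, h2, h3⟩ := h.ex k hk l1 r1 hM'
      grind
    · obtain ⟨rfl, rfl⟩ := hM.1.unique hM'.1
      grind
  · intro x y hx hx' hy hy' he
    rcases hcase hx' with hx' | rfl <;> rcases hcase hy' with hy' | rfl
    · rw [hr x hx'.ne, hr y hy'.ne] at he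
      exact h.inj x y hx hx' hy hy' he
    · grind
    · grind
    · rfl
  · intro q hq
    have hmq : m''.narr 15 0 q = if l = 0 ∧ q = r' then m'.nvar 6 + 1 else m'.narr 15 0 q := by
      rw [e15]
      grind
    rw [hmq]
    split_ifs with h0
    · grind
    · refine ⟨fun hne => ?_, fun k hk hM' => ?_⟩
      · obtain ⟨x, h1, h2, h3, h4⟩ := (h.mark q hq).1 hne
        grind
      · rcases Nat.lt_succ_iff_lt_or_eq.mp hk with hk | rfl
        · exact (h.mark q hq).2 k hk hM'
        · obtain ⟨rfl, rfl⟩ := hM.1.unique hM'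
          grind
  · intro x hx
    rw [e12 x (by omega), e13.1, e13.2, w6, update_of_ne (by omega),
      update_of_ne (by omega), update_of_ne (by omega)]
    exact h.old x hx

end Members

section Members

variable {n r : ℕ} {a : Fin n → Fin n → WithTop ℝ} {c : Ctx n r a} {p t : ℕ} {m m' : Store} {K : ℕ}

theorem ht_appendP (hE : PrimEnv c p t m) (hF : Frame (forP 14 13 memberStepP) m m')
    (h : MemInv c p t m K m')
    (hM : Kept (c.S p t).card (m.rarr 4 0) (minEntry (c.S p t) a) K (m'.nvar 15) (m'.nvar 16))
    (hw : m'.rvar 1 = m.rarr 4 0 K - max (m.rarr 4 0 (m'.nvar 15)) (m.rarr 4 0 (m'.nvar 16))) :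
    Ht appendP m' (100 * n) (MemInv c p t m (K + 1)) := by
  obtain ⟨hS, hn⟩ := hE.card_pos
  have hE' := hE.of_frame hF rfl
  set l := m'.nvar 15
  set q := m'.nvar 16
  refine (Ht.for_const (N := n) (fun k m1 => (∀ x, x ≠ m'.nvar 6 → m1.narr 1 x = m'.narr 1 x) ∧
    ∀ i : Fin n, (i : ℕ) < k → (m1.narr 1 (m'.nvar 6) i = 1 ↔ i ∈ seg (c.v m) l q) ∧
      (m1.narr 1 (m'.nvar 6) i = 0 ∨ m1.narr 1 (m'.nvar 6) i = 1)) 45 rfl rfl (by decide) hE'.hn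
    (fun k m v h => h) ⟨fun _ _ => rfl, by simp⟩ fun k m1 hk hF1 hk' _ hI => Ht.of_wp ?_
    (by decide)).cons (K2 := 40) (by omega) fun m2 hF2 h2 => Ht.of_wp ?_ (by decide)
  · have hE1 := hE'.of_frame hF1 rfl
    have hS := hE1.inS_iff (i := ⟨k, hk⟩) hk'
    have key : (⟨k, hk⟩ ∈ c.S p t ∧ ¬ m1.narr 7 0 k < l ∧ m1.narr 7 0 k < q) ↔
        ⟨k, hk⟩ ∈ seg (c.v m) l q := by
      rw [hE.data.mem_seg_iff hM.1.rN]
      refine and_congr_right fun hmem => ?_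
      obtain ⟨u, hu, hu'⟩ := (hE.data.mem _).mp hmem
      have h7 : m1.narr 7 0 k = u := by
        have h5 : m.narr 5 0 u = k := by
          have : c.v m u = ⟨m.narr 5 0 u, hE.lt u hu⟩ := by simp [Ctx.v, Ctx.el, hE.lt u hu]
          grind
        rw [hF1.N 7 rfl, hF.N 7 rfl, ← h5, hE.pos u hu]
      rw [h7, not_lt]
      exact ⟨fun h => ⟨u, hu, hu', h⟩, fun ⟨w, hw, hw', h⟩ =>
        hE.data.inj w hw u hu (hw'.trans hu'.symm) ▸ h⟩
    simp only [wp, Test.holds, NExp.eval, hk', hS, hF1.n 6 rfl, hF1.n 15 rfl, hF1.n 16 rfl]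
    change ((⟨k, hk⟩ ∈ c.S p t ∧ ¬ m1.narr 7 0 k < l ∧ m1.narr 7 0 k < q) → _) ∧
      (¬ (⟨k, hk⟩ ∈ c.S p t ∧ ¬ m1.narr 7 0 k < l ∧ m1.narr 7 0 k < q) → _)
    rw [key]
    refine ⟨fun h => ⟨fun x hx => ?_, fun i hi => ?_⟩, fun h => ⟨fun x hx => ?_, fun i hi => ?_⟩⟩
    · funext j
      simp [hx, hI.1 x hx]
    · rcases lt_succ_cases hk hi with rfl | hi
      · simp [h]
      · simpa [hi.ne] using hI.2 i hi
    · funext j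
      simp [hx, hI.1 x hx]
    · rcases lt_succ_cases hk hi with rfl | hi
      · simp [h]
      · simpa [hi.ne] using hI.2 i hi
  · simp only [progs, wp, Test.holds, NExp.eval, RExp.eval, Store.setN_nvar, Store.setR_nvar,
      Store.setR_narr, Store.setN_rarr, hF2.n 6 rfl, hF2.n 15 rfl, hF2.n 16 rfl, hF2.n 5 rfl,
      hF2.r 1 rfl, hE'.hp, Store.setn_nvar, Store.setn_narr, Store.setn_rarr]
    have hrow : ∀ M : ℕ → ℕ → ℕ, M (m'.nvar 6) = m2.narr 1 (m'.nvar 6) →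
        rset n M (m'.nvar 6) = seg (c.v m) l q := by
      intro M hM
      ext i
      rw [mem_rset, hM]
      grind
    refine ⟨fun h0 => h.append hE hM (hrow _ ?_) ?_ ?_ (fun x hx => ?_) ⟨?_, ?_⟩ ?_ ?_,
      fun h0 => h.append hE hM (hrow _ ?_) ?_ ?_ (fun x hx => ?_) ⟨?_, ?_⟩ ?_ ?_⟩
    all_goals first
      | (funext j; simp [h2.1 x hx]; done)
      | (funext j; simp [update_apply, hF2.N 13 rfl, hF2.R 2 rfl, hF2.N 15 rfl, h0, hw, l, q]
         done)
      | (simpa using fun i : Fin n => (h2.2 i i.isLt).2)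
      | simp

theorem ht_memberStepP (hE : PrimEnv c p t m) (hF : Frame (forP 14 13 memberStepP) m m')
    (hK : K < (c.S p t).card) (hK' : m'.nvar 14 = K) (h : MemInv c p t m K m') :
    Ht memberStepP m' (250 * n) (MemInv c p t m (K + 1)) := by
  obtain ⟨hS, hn⟩ := hE.card_pos
  have hE' := hE.of_frame hF rfl
  have h4 : m'.rarr 4 = m.rarr 4 := hF.R 4 rfl
  unfold memberStepP
  refine Ht.ite_le (K := 240 * n) (by simp only [Test.cost, RExp.cost, NExp.cost]; omega)
    (fun hb => ?_) fun hb => Ht.of_wp (h.skip (fun l q hM => hb ?_) rfl rfl rfl rfl rfl)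
      (by simp only [Prog.time]; omega)
  swap
  · simpa [hK', h4, hE'.low] using hM.low_lt
  have hlow : minEntry (c.S p t) a < m'.rarr 4 0 K := by simpa [hK', hE'.low] using hb
  refine (ht_intervalP hE' hK hK' hlow).seq_le (K2 := 180 * n) (by omega) fun m1 hF1 h₁ => ?_
  rw [h4] at h₁ hlow
  obtain ⟨h1, h2, h3, h5, h6, h7, h8⟩ := h₁
  have hE1 := hE'.of_frame hF1 rfl
  have e14 : m1.nvar 14 = K := (hF1.n 14 rfl).trans hK'
  have e4 : m1.rarr 4 = m.rarr 4 := (hF1.R 4 rfl).trans h4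
  refine Ht.ite_le (K := 170 * n) (by simp only [Test.cost, RExp.cost, NExp.cost]; omega)
    (fun hb => ?_) fun hb => Ht.of_wp (h.skip (fun l q hM => hb ?_) (hF1.n 6 rfl) (hF1.N 1 rfl)
      (hF1.N 13 rfl) (hF1.N 15 rfl) (hF1.R 2 rfl)) (by simp only [Prog.time]; omega)
  swap
  · have : l = m1.nvar 15 := by
      rcases lt_trichotomy l (m1.nvar 15) with h9 | h9 | h9
      · exact absurd (hM.between _ h9 h1) (not_lt.mpr h2)
      · exact h9
      · exact absurd (h3 _ h9 hM.lk) (not_lt.mpr hM.left.le)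
    simpa [e14, e4, ← this] using hM.left
  have hleft : m.rarr 4 0 (m1.nvar 15) < m.rarr 4 0 K := by simpa [e14, e4] using hb
  have hM : IsMember (c.S p t).card (m.rarr 4 0) (minEntry (c.S p t) a) K (m1.nvar 15)
    (m1.nvar 16) := ⟨hlow, h1, hleft, h3, h5, h6, h7, h8⟩
  refine (Ht.of_wp (K := 30) (Q := fun m2 => m2.rvar 1 = m.rarr 4 0 K -
    max (m.rarr 4 0 (m1.nvar 15)) (m.rarr 4 0 (m1.nvar 16))) ?_ (by decide)).seq_le (K2 := 140 * n)
    (by omega) fun m2 hF2 h₂ => ?_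
  · simp only [wp, Test.holds, NExp.eval, RExp.eval, e4, e14, Store.setr_rvar, if_true]
    grind
  have hF0 : Frame (forP 14 13 memberStepP) m m2 := by
    refine hF.trans ((hF1.mono ?_ ?_ ?_ ?_).trans (hF2.mono ?_ ?_ ?_ ?_))
    all_goals simp +contextual [forP, memberStepP, Prog.wn, Prog.wr, Prog.wN, Prog.wR]
  have hI : MemInv c p t m K m2 := by
    obtain ⟨g1, g2, g3, g4, g5, g6, g7, g8⟩ := h
    constructor
    all_goals simp only [hF2.n 6 rfl, hF1.n 6 rfl, hF2.N 1 rfl, hF1.N 1 rfl, hF2.N 13 rfl,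
      hF1.N 13 rfl, hF2.N 15 rfl, hF1.N 15 rfl, hF2.R 2 rfl, hF1.R 2 rfl]
    all_goals assumption
  have e15 : m2.nvar 15 = m1.nvar 15 := hF2.n 15 rfl
  have e16 : m2.nvar 16 = m1.nvar 16 := hF2.n 16 rfl
  have e13 : m2.nvar 13 = (c.S p t).card := (hF2.n 13 rfl).trans hE1.card
  rw [← e15, ← e16] at hM h₂
  refine Ht.ite_le (K := 120 * n) (by simp only [Test.cost, NExp.cost]; omega) (fun hb => ?_)
    fun hb => (ht_appendP hE hF0 hI ⟨hM, fun hc => ?_⟩ h₂).conseq (by omega) fun _ _ h => h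
  · simp only [Test.holds, NExp.eval, e13] at hb
    obtain ⟨x, hx, -⟩ := (hI.mark _ (by grind)).1 hb.2.ne'
    rw [hb.1] at hM h₂
    have hx' : m2.narr 15 0 (m2.nvar 15) - 1 = x := by omega
    refine Ht.of_wp (hI.merge hE hM hx rfl rfl rfl rfl ?_) ?_
    · funext j
      simp [hx', h₂, update_apply]
    · exact le_trans (b := 100) (by decide) (by omega)
  · obtain ⟨h9, k', hk'⟩ := hc
    refine hb ⟨by simp [h9, e13], ?_⟩
    have := (hI.mark _ (by grind)).2 k' (by have := hM.lk; have := hk'.kr; omega) hk'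
    exact Nat.pos_of_ne_zero this

/-- The rows in the list of the array `1` with numbers in `[x, y)`. -/
abbrev LRows (m : Store) (x y : ℕ) (W : WFam n) : Prop :=
  Rows (m.narr 1) (m.rarr 2 0) (fun z => x ≤ z ∧ z < y) W

/-- The rows with numbers below `b` of the list of members are not changed. -/
def SameBelow (b : ℕ) (m m' : Store) : Prop := ∀ x < b, m'.narr 1 x = m.narr 1 x ∧
  m'.rarr 2 0 x = m.rarr 2 0 x ∧ m'.narr 13 0 x = m.narr 13 0 x ∧ m'.narr 13 1 x = m.narr 13 1 x

/-- The family `W` for the pair `p`, `t` has been appended to the list of members. -/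
structure Appended (p N : ℕ) (m m' : Store) (W : WFam n) : Prop where
  le : m.nvar 6 ≤ m'.nvar 6 ∧ m'.nvar 6 ≤ m.nvar 6 + N
  rows : LRows m' (m.nvar 6) (m'.nvar 6) W
  act : ∀ x, m.nvar 6 ≤ x → x < m'.nvar 6 → m'.narr 13 0 x = p ∧ m'.narr 13 1 x = 1
  old : SameBelow (m.nvar 6) m m'

theorem ht_membersP (hE : PrimEnv c p t m) (hCB : CB (c.B p) (c.B t) (normalize (c.S p t) a)) :
    Ht membersP m (300 * (n * (c.S p t).card)) fun m' => ∃ W : WFam n,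
      Algorithm1 a (c.B p) (c.B t) (some W) ∧ Appended p (c.S p t).card m m' W := by
  obtain ⟨hS, hn⟩ := hE.card_pos
  have hnS' : (c.S p t).card ≤ n * (c.S p t).card := Nat.le_mul_of_pos_left _ (by omega)
  refine (Ht.for_const (N := (c.S p t).card) (fun k m => ∀ q < k, m.narr 15 0 q = 0) 5 rfl rfl
    (by decide) hE.card (fun k m v h => h) (by simp) fun k m1 hk hF hk' _ hI => Ht.of_wp ?_
    (by decide)).seq_le (K2 := 270 * (n * (c.S p t).card)) (by omega) fun m1 hF1 h₁ => ?_
  · simp only [wp, NExp.eval, hk']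
    intro q hq
    rw [Store.setN_narr]
    grind
  have hE1 := hE.of_frame hF1 rfl
  refine (Ht.for_const (N := (c.S p t).card) (MemInv c p t m1) (250 * n) rfl rfl (by decide) hE1.card
    (fun k m v h => ?_) ⟨by omega, by omega, by omega, by omega, by omega, by omega,
      fun q hq => ⟨fun h => absurd (h₁ q hq) h, by omega⟩, fun _ _ => ⟨rfl, rfl, rfl, rfl⟩⟩
    fun k m' hk hF hk' _ hI =>
      ht_memberStepP hE1 hF hk hk' hI).conseq (by nlinarith) fun m2 hF2 h => ?_
  · obtain ⟨g1, g2, g3, g4, g5, g6, g7, g8⟩ := h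
    constructor
    all_goals simpa only [Store.setn_nvar, Store.setn_narr, Store.setn_rarr]
  have h2 := c.data.two p hE.hlt.1 t hE.hlt.2.1 hE.hlt.2.2
  have e6 : m1.nvar 6 = m.nvar 6 := hF1.n 6 rfl
  obtain ⟨W, hW⟩ := exists_rows (J := fun z => m1.nvar 6 ≤ z ∧ z < m2.nvar 6) (m2.rarr 2 0)
    (fun x hx => h.bit x hx.1 hx.2) fun x y hx hy => h.inj x y hx.1 hx.2 hy.1 hy.2
  refine ⟨W, ⟨hCB, hE1.data.mergeComplements h2.normData (fun i j => ?_) hCB (fun X => ?_)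
    fun k l q hM => ?_⟩, ⟨e6 ▸ h.le, e6 ▸ hW, e6 ▸ h.act, fun x hx => ?_⟩⟩
  · simp only [normEntry, realPart_symm h2 i j]
    ring
  · rw [hW.fam]
    constructor
    · rintro ⟨x, hx, rfl⟩
      obtain ⟨k, hk, l, q, h1, h2, -⟩ := h.row x hx.1 hx.2
      grind
    · rintro ⟨k, l, q, h1, rfl⟩
      obtain ⟨x, h2, h3, h4⟩ := h.ex k (h1.1.kr.trans_le h1.1.rN) l q h1
      grind
  · obtain ⟨x, h2, h3, h4⟩ := h.ex k (hM.1.kr.trans_le hM.1.rN) l q hM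
    obtain ⟨k', hk', l', q', h5, h6, h7⟩ := h.row x h2 h3
    obtain ⟨rfl, rfl⟩ := hE1.data.seg_inj hM.1.rN hM.1.lr h5.1.rN h5.1.lr (h4.symm.trans h6)
    obtain rfl := hM.1.unique' h5.1
    rw [← h4, hW.wt x ⟨h2, h3⟩]
    refine ⟨fun k' l' r' hM' h0 h8 h9 => ?_, fun hno => h7.2 fun k' _ h0 => hno k' h0⟩
    subst h8 h9
    exact h7.1 k' (hM'.kr.trans_le hM'.rN) h0 hM'
  · have := h.old x (by omega)
    rwa [hF1.N 1 rfl, hF1.N 13 rfl, hF1.R 2 rfl] at this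

/-- Algorithm 1 for the pair of blocks with indices in the variables `5` and `4`; its output is
appended to the list of members, or variable `7` is set to `1`. -/
def pairP : Prog := progs [potP, primP, cbP, .ite (.neq (.var 7) (.lit 0)) membersP .skip]

theorem ht_pairP (hE : PairEnv c p t m) (hp : p < r) (ht : t < r) (hpt : p ≠ t)
    (h7 : m.nvar 7 = 0) :
    Ht pairP m (1500 * (n * (c.S p t).card)) fun m' =>
      (m'.nvar 7 ≠ 0 ∧ Algorithm1 a (c.B p) (c.B t) none) ∨ (m'.nvar 7 = 0 ∧ ∃ W : WFam n,
        Algorithm1 a (c.B p) (c.B t) (some W) ∧ Appended p (c.S p t).card m m' W) := by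
  have hpos : 1 ≤ n * (c.S p t).card := by
    have : 1 ≤ (c.S p t).card := card_pos.mpr
      ((c.data.two p hp t ht hpt).ne1.mono subset_union_left)
    have : 1 ≤ n := by have := (c.fs 0).isLt; omega
    nlinarith
  refine (ht_potP c hE hp ht hpt).cons (K2 := 900 * (n * (c.S p t).card)) (by omega)
    fun m1 hF1 h1 => ?_
  have hE1 : NormEnv c p t m1 := ⟨hE.of_frame hF1 rfl, ⟨hp, ht, hpt⟩, h1.1, h1.2⟩
  refine (ht_primP hE1).cons (K2 := 600 * (n * (c.S p t).card)) (by omega) fun m2 hF2 hE2 => ?_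
  have e7 : m2.nvar 7 = 0 := by rw [hF2.n 7 rfl, hF1.n 7 rfl, h7]
  refine (ht_cbP hE2 e7).cons (K2 := 400 * (n * (c.S p t).card)) (by omega) fun m3 hF3 h3 => ?_
  have hE3 := hE2.of_frame hF3 rfl
  refine Ht.ite_le (K := 300 * (n * (c.S p t).card)) (by simp only [Test.cost, NExp.cost]; omega)
    (fun h0 => (ht_membersP hE3 (h3.1 h0)).conseq le_rfl fun m4 hF4 h4 => ?_)
    fun h0 => Ht.of_wp (.inl ⟨h0, h3.2 h0⟩) (by simp only [Prog.time]; omega)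
  obtain ⟨W, hW, hA⟩ := h4
  have e6 : m3.nvar 6 = m.nvar 6 := by rw [hF3.n 6 rfl, hF2.n 6 rfl, hF1.n 6 rfl]
  obtain ⟨g1, g2, g3, g4⟩ := hA
  refine .inr ⟨(hF4.n 7 rfl).trans h0, W, hW, ⟨e6 ▸ g1, e6 ▸ g2, e6 ▸ g3, fun x hx => ?_⟩⟩
  have := g4 x (by omega)
  rwa [hF3.N 1 rfl, hF3.N 13 rfl, hF3.R 2 rfl, hF2.N 1 rfl, hF2.N 13 rfl, hF2.R 2 rfl,
    hF1.N 1 rfl, hF1.N 13 rfl, hF1.R 2 rfl] at this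

end Members

section Matching

variable {n : ℕ} {B : ℕ → Finset (Fin n)} {t : ℕ} {fs : ℕ → Fin n}
variable {X : ℕ → Finset (Fin n)} {X0 Xs Y : Finset (Fin n)}

/-- `X` and `Y` induce the same bipartition of the block `A`, which contains `e`. -/
def Agree (A : Finset (Fin n)) (e : Fin n) (X Y : Finset (Fin n)) : Prop :=
  ∀ i ∈ A, ((i ∈ X ↔ e ∈ X) ↔ (i ∈ Y ↔ e ∈ Y))

/-- Whether the version of `X` that agrees with `X0` in `e` contains `e'`. -/
def Ori (e e' : Fin n) (X0 X : Finset (Fin n)) : Prop := e' ∈ X ↔ (e ∈ X ↔ e ∈ X0)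

theorem isComposition_of_agree (hB : DisjBlocks B) (hfs : ∀ q ≤ t, fs q ∈ B q) {o : Prop} (hX0 : IsCut B (range t) X0)
    (hcut : ∀ p ∈ cutIdx B (range t) X0, Cuts (B p) (X p) ∧ Cuts (B t) (X p))
    (hp : ∀ p ∈ cutIdx B (range t) X0, Agree (B p) (fs p) (X p) X0 ∧ Agree (B t) (fs t) (X p) Y ∧
      (Ori (fs p) (fs t) X0 (X p) ↔ o))
    (ht : ∀ i ∈ B t, (i ∈ Xs ↔ ((i ∈ Y ↔ fs t ∈ Y) ↔ o))) (hXs : ∀ i ∉ B t, (i ∈ Xs ↔ i ∈ X0)) :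
    IsComposition B t X0 X Xs := by
  have hcuts : ∀ p < t, Cuts (B p) Xs ↔ Cuts (B p) X0 := fun p hpt => by
    have : ∀ i ∈ B p, (i ∈ Xs ↔ i ∈ X0) := fun i hi => hXs i (hB.not_mem hpt.ne i hi)
    simp only [cuts_iff]
    grind
  obtain ⟨p, hp', q, hq', hpq, h1, h2⟩ := hX0.2
  rw [mem_range] at hp' hq'
  refine ⟨⟨fun i hi => ?_, p, by simp; omega, q, by simp; omega, hpq, (hcuts p hp').mpr h1,
    (hcuts q hq').mpr h2⟩, (cutEquiv_iff (hB.on _)).mpr ⟨fun p hp => hcuts p (mem_range.mp hp), True,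
      fun p hp _ i hi => by grind⟩, fun p hpP => ?_⟩
  · rw [mem_biUnion]
    by_cases hit : i ∈ B t
    · grind
    · obtain ⟨q, hq, hi⟩ := mem_biUnion.mp (hX0.1 ((hXs i hit).mp hi))
      grind
  · have hpt : p < t := (mem_cutIdx_range.mp hpP).1
    refine (cutEquiv_pair_iff (hB.not_mem hpt.ne) (hcut p hpP).1 (hcut p hpP).2).mpr
      ⟨fs p ∈ X p ↔ fs p ∈ X0, fun i hi => ?_⟩
    obtain ⟨h3, h4, h5⟩ := hp p hpP
    rcases mem_union.mp hi with hi | hi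
    · rw [hXs i (hB.not_mem hpt.ne i hi)]
      have := h3 i hi
      clear hcuts hXs ht hp h4 h5
      grind
    · rw [ht i hi, ← h4 i hi, ← h5, Ori]
      clear hcuts hXs ht hp h3 h4 h5
      grind

theorem IsComposition.agree (hB : DisjBlocks B) (hfs : ∀ q ≤ t, fs q ∈ B q) (h : IsComposition B t X0 X Xs)
    (hcut : ∀ p ∈ cutIdx B (range t) X0, Cuts (B p) (X p) ∧ Cuts (B t) (X p)) :
    ∃ o : Prop, ∀ p ∈ cutIdx B (range t) X0, Agree (B p) (fs p) (X p) X0 ∧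
      Agree (B t) (fs t) (X p) Xs ∧ (Ori (fs p) (fs t) X0 (X p) ↔ o) := by
  obtain ⟨h1, ε, h2⟩ := (cutEquiv_iff (hB.on _)).mp h.2.1
  refine ⟨fs t ∈ Xs ↔ ε, fun p hp => ?_⟩
  obtain ⟨hpt, hc⟩ := mem_cutIdx.mp hp
  have hpt' := mem_range.mp hpt
  obtain ⟨δ, h3⟩ := (cutEquiv_pair_iff (hB.not_mem hpt'.ne) (hcut p hp).1 (hcut p hp).2).mp (h.2.2 p hp)
  have hp' : ∀ i ∈ B p, (i ∈ Xs ↔ (i ∈ X0 ↔ ε)) ∧ (i ∈ Xs ↔ (i ∈ X p ↔ δ)) := fun i hi =>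
    ⟨h2 p hpt ((h1 p hpt).mpr hc) i hi, h3 i (mem_union_left _ hi)⟩
  have ht' : ∀ i ∈ B t, (i ∈ Xs ↔ (i ∈ X p ↔ δ)) := fun i hi => h3 i (mem_union_right _ hi)
  have h4 := hp' _ (hfs p hpt'.le)
  have h5 := ht' _ (hfs t le_rfl)
  refine ⟨fun i hi => ?_, fun i hi => ?_, ?_⟩
  · grind
  · grind
  · unfold Ori
    grind

theorem cutEquiv_of_ori {p : ℕ} (hd : ∀ i ∈ B p, i ∉ B t) {X : Finset (Fin n)}
    (h1 : Cuts (B p) X) (h2 : Cuts (B t) X) (hX : Agree (B p) (fs p) X X0)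
    (hY : Agree (B p) (fs p) Y X0) (ht : Agree (B t) (fs t) X Y)
    (ho : Ori (fs p) (fs t) X0 X ↔ Ori (fs p) (fs t) X0 Y) : CutEquiv B {p, t} Y X := by
  refine (cutEquiv_pair_iff hd h1 h2).mpr ⟨fs p ∈ Y ↔ fs p ∈ X, fun i hi => ?_⟩
  unfold Ori at ho
  rcases mem_union.mp hi with hi | hi
  · have := hX i hi
    have := hY i hi
    grind
  · have := ht i hi
    grind

end Matching

section Ids

variable {n r : ℕ} {a : Fin n → Fin n → WithTop ℝ} {c : Ctx n r a} {m : Store} {g : ℕ}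

/-- One refinement of the numbers of the bipartitions, by the element in variable `12`. -/
def refineP : Prog := progs
  [forP 10 9 (.seq (.nput 6 (.lit 0) (.var 10) (.lit 0)) (.nput 6 (.lit 1) (.var 10) (.lit 0))),
   progs [.nset 13 (.lit 0), .nset 14 (nA 2 (.var 12)), .nset 15 (nA 3 (.var 14))],
   forP 10 9 (progs
    [.ite (.neq (.get 1 (.var 10) (.var 12)) (.get 1 (.var 10) (.var 15))) (.nset 16 (.lit 0))
      (.seq (.nset 16 (.lit 1)) (.nput 10 (.var 10) (.var 14) (.lit 1))),
     .ite (.neq (.get 6 (.var 16) (.get 9 (.var 10) (.var 14))) (.lit 0)) (.seq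
      (.nset 13 (.add (.var 13) (.lit 1)))
      (.nput 6 (.var 16) (.get 9 (.var 10) (.var 14)) (.var 13))) .skip,
     .nput 9 (.var 10) (.var 14) (.sub (.get 6 (.var 16) (.get 9 (.var 10) (.var 14))) (.lit 1))])]

/-- For every row `x` and every block `q`: a number of the bipartition of the block in array `9`,
and a mark in array `10` if the block is cut. -/
def idsP : Prog := .seq
  (forP 10 9 (forP 11 3 (.seq (.nput 9 (.var 10) (.var 11) (.lit 0))
    (.nput 10 (.var 10) (.var 11) (.lit 0)))))
  (forP 12 2 refineP)

/-- The element `i` of row `x` agrees with the first element of its block. -/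
def Ctx.Same (c : Ctx n r a) (m : Store) (x : ℕ) (i : Fin n) : Prop :=
  m.narr 1 x i = m.narr 1 x (c.fs (c.nb i))

/-- The numbers are correct with respect to the first `k` elements; `M` are the rows. -/
def IdInv (c : Ctx n r a) (g : ℕ) (m : Store) (k : ℕ) (m' : Store) : Prop :=
  ∀ x < g, ∀ q < r, m'.narr 9 x q < g ∧
    (m'.narr 10 x q = 1 ↔ ∃ i ∈ c.B q, (i : ℕ) < k ∧ ¬ c.Same m x i) ∧
    ∀ y < g, (m'.narr 9 x q = m'.narr 9 y q ↔
      ∀ i ∈ c.B q, (i : ℕ) < k → (c.Same m x i ↔ c.Same m y i))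

open Classical in
theorem ht_refineP (hE : Env c m) {k : ℕ} (hk : k < n) (hk' : m.nvar 12 = k) (hg : m.nvar 9 = g)
    (hI : IdInv c g m k m) : Ht refineP m (100 * (g + 1)) (IdInv c g m (k + 1)) := by
  set q0 := c.nb ⟨k, hk⟩
  have hq0 : q0 < r := c.nb_lt _
  refine (Ht.for_const (N := g) (fun k m => ∀ x < k, m.narr 6 0 x = 0 ∧ m.narr 6 1 x = 0) 10 rfl rfl
    (by decide) hg (fun k m v h => h) (by simp) fun l m1 hl hF hl' _ hJ => Ht.of_wp ?_
    (by decide)).cons (K2 := 80 * (g + 1)) (by omega) fun m1 hF1 h₁ => ?_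
  · simp only [wp, NExp.eval, hl', Store.setN_nvar, Store.setN_narr]
    grind
  refine (Ht.of_wp (K := 15) (Q := fun m => m.nvar 13 = 0 ∧ m.nvar 14 = q0 ∧
    m.nvar 15 = c.fs q0) ?_ (by decide)).cons (K2 := 79 * g + 5) (by omega) fun m2 hF2 h₂ => ?_
  · have hE := hE.of_frame hF1 rfl
    have h2 := hE.nb ⟨k, hk⟩
    simp only at h2
    simp [progs, hF1.n 12 rfl, hk', h2, hE.fs q0 hq0, q0]
  obtain ⟨e13, e14, e15⟩ := h₂
  have e10 : m2.narr 10 = m.narr 10 := by rw [hF2.N 10 rfl, hF1.N 10 rfl]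
  have e9 : m2.narr 9 = m.narr 9 := by rw [hF2.N 9 rfl, hF1.N 9 rfl]
  let b : ℕ → ℕ := fun x => if c.Same m x ⟨k, hk⟩ then 0 else 1
  have hb : ∀ x, b x < 2 := fun x => by grind
  refine (Ht.for_const (N := g) (fun l m' =>
    (∀ x q, q ≠ q0 ∨ l ≤ x → m'.narr 9 x q = m.narr 9 x q) ∧
    (∀ x < l, m'.narr 6 (b x) (m.narr 9 x q0) = m'.narr 9 x q0 + 1) ∧
    (m'.nvar 13 ≤ l ∧ ∀ d < 2, ∀ j < g, m'.narr 6 d j ≤ m'.nvar 13) ∧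
    (∀ d < 2, ∀ j < g, ∀ d' < 2, ∀ j' < g, m'.narr 6 d j ≠ 0 → m'.narr 6 d j = m'.narr 6 d' j' →
      d = d' ∧ j = j') ∧
    ∀ x q, m'.narr 10 x q = 1 ↔ m.narr 10 x q = 1 ∨ (x < l ∧ q = q0 ∧ ¬ c.Same m x ⟨k, hk⟩))
    65 rfl rfl (by decide) ((hF2.n 9 rfl).trans ((hF1.n 9 rfl).trans hg))
    (fun k m v h => by simpa using h) ?_ fun l m' hl hF hl' _ hJ => ?_).conseq (by omega)
    fun m3 hF3 h₃ => ?_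
  · have h6 : ∀ d < 2, ∀ j < g, m2.narr 6 d j = 0 := fun d hd j hj => by
      rw [hF2.N 6 rfl]
      grind
    grind
  · obtain ⟨h1, h2, ⟨h3, h4⟩, h5, h6⟩ := hJ
    have e12 : m'.nvar 12 = k := by rw [hF.n 12 rfl, hF2.n 12 rfl, hF1.n 12 rfl, hk']
    have e14' : m'.nvar 14 = q0 := (hF.n 14 rfl).trans e14
    have e1 : m'.narr 1 = m.narr 1 := by rw [hF.N 1 rfl, hF2.N 1 rfl, hF1.N 1 rfl]
    have hid := h1 l q0 (.inr le_rfl)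
    have hlt := (hI l hl q0 hq0).1
    have hsame : m'.narr 1 l k = m'.narr 1 l (c.fs q0) ↔ c.Same m l ⟨k, hk⟩ := by rw [e1]; rfl
    refine (Ht.of_wp (K := 25) (Q := fun m'' => m''.nvar 16 = b l ∧ m''.nvar 13 = m'.nvar 13 ∧
      m''.narr 9 = m'.narr 9 ∧ m''.narr 6 = m'.narr 6 ∧ m''.nvar 10 = l ∧ m''.nvar 14 = q0 ∧
      ∀ x q, m''.narr 10 x q = 1 ↔ m.narr 10 x q = 1 ∨ (x < l + 1 ∧ q = q0 ∧
        ¬ c.Same m x ⟨k, hk⟩)) ?_ (by decide)).cons (K2 := 40) le_rfl fun m4 hF4 h₄ => ?_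
    · have e17 : (m'.setn 16 1).nvar 10 = l ∧ (m'.setn 16 1).nvar 14 = q0 := by simp [hl', e14']
      simp only [wp, Test.holds, NExp.eval, hl', e12, e14', (hF.n 15 rfl).trans e15, hsame, e17]
      refine ⟨fun h => ?_, fun h => ?_⟩ <;>
        refine ⟨by simp [b, h], by simp, by funext; simp, by funext; simp, by simp [hl'],
          by simp [e14'], fun x q => ?_⟩
      · simp only [Store.setn_narr, h6]
        grind
      · by_cases h7 : x = l ∧ q = q0
        · simp [h7, h]
        · simp only [Store.setN_narr, Store.setn_narr, true_and, h7, if_false, h6]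
          grind
    obtain ⟨f16, f13, f9, f6, f10, f14, f0⟩ := h₄
    refine Ht.of_wp ?_ (by decide)
    simp only [progs, wp, Test.holds, NExp.eval, f16, f10, f14, f9, f6, f13, hid]
    refine ⟨fun h0 => ⟨fun x q hx => ?_, fun x hx => ?_, ?_, ?_, fun x q => ?_⟩,
      fun h0 => ⟨fun x q hx => ?_, fun x hx => ?_, ?_, ?_, fun x q => ?_⟩⟩
    · have : ¬ (x = l ∧ q = q0) := by omega
      simpa [f16, f10, f14, f9, hid, this] using h1 x q (by omega)
    · rcases Nat.lt_succ_iff_lt_or_eq.mp hx with hx | rfl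
      · have := h2 x hx
        have h7 : ¬ (b x = b l ∧ m.narr 9 x q0 = m.narr 9 l q0) := fun h8 => by grind
        simpa [f16, f10, f14, f9, hid, h7, hx.ne, f6] using this
      · simp [f16, f10, f14, f9, hid]
    · refine ⟨by simp; omega, fun d hd j hj => ?_⟩
      have := h4 d hd j hj
      simp [f16, f10, f14, f9, hid, f6]
      split_ifs <;> omega
    · intro d hd j hj d' hd' j' hj'
      have g1 := h4 d hd j hj
      have g2 := h4 d' hd' j' hj'
      have g3 := h5 d hd j hj d' hd' j' hj'
      simp [f16, f10, f14, f9, hid, f6]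
      split_ifs <;> omega
    · simpa using f0 x q
    · have : ¬ (x = l ∧ q = q0) := by omega
      simpa [f16, f10, f14, f9, hid, this] using h1 x q (by omega)
    · rcases Nat.lt_succ_iff_lt_or_eq.mp hx with hx | rfl
      · simpa [f9, hx.ne, f6] using h2 x hx
      · simp [f6]
        omega
    · exact ⟨by simp; omega, fun d hd j hj => by simpa [f6, f13] using h4 d hd j hj⟩
    · simpa [f6] using h5
    · simpa using f0 x q
  · obtain ⟨h1, h2, ⟨h3, h4⟩, h5, h6⟩ := h₃
    intro x hx q hq
    have hcase : ∀ i ∈ c.B q, (i : ℕ) < k + 1 → (i : ℕ) < k ∨ (q = q0 ∧ i = ⟨k, hk⟩) := by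
      intro i hi hik
      rcases lt_succ_cases hk hik with rfl | h
      · exact .inr ⟨((c.mem _ _).mp hi).symm, rfl⟩
      · exact .inl h
    have hmem : q = q0 → ⟨k, hk⟩ ∈ c.B q := fun h => (c.mem _ _).mpr h.symm
    obtain ⟨g1, g2, g3⟩ := hI x hx q hq
    refine ⟨?_, ?_, fun y hy => ?_⟩
    · by_cases hqq : q = q0
      · grind
      grind
    · rw [h6, g2]
      constructor
      · rintro (⟨i, hi, hik, hs⟩ | ⟨-, hqq, hs⟩)
        exacts [⟨i, hi, by omega, hs⟩, ⟨_, hmem hqq, by simp, hs⟩]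
      grind
    · have step : (∀ i ∈ c.B q, (i : ℕ) < k + 1 → (c.Same m x i ↔ c.Same m y i)) ↔
          (∀ i ∈ c.B q, (i : ℕ) < k → (c.Same m x i ↔ c.Same m y i)) ∧
            (q = q0 → (c.Same m x ⟨k, hk⟩ ↔ c.Same m y ⟨k, hk⟩)) := by
        refine ⟨fun h => ⟨fun i hi hik => h i hi (by omega), fun hqq => h _ (hmem hqq) (by simp)⟩,
          fun h i hi hik => ?_⟩
        rcases hcase i hi hik with h' | ⟨h', rfl⟩
        exacts [h.1 i hi h', h.2 h']
      rw [step, ← g3 y hy]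
      by_cases hqq : q = q0
      · subst hqq
        have g4 := h2 x hx
        have g5 := h2 y hy
        have g6 := (hI y hy q0 hq).1
        have g7 : b x = b y ↔ (c.Same m x ⟨k, hk⟩ ↔ c.Same m y ⟨k, hk⟩) := by
          simp only [b]
          by_cases c.Same m x ⟨k, hk⟩ <;> by_cases c.Same m y ⟨k, hk⟩ <;> simp [*]
        rw [← g7]
        refine ⟨fun he => ?_, fun ⟨he, he'⟩ => ?_⟩
        · have := h5 _ (hb x) _ g1 _ (hb y) _ g6 (by omega) (by omega)
          grind
        grind
      grind

/-- The numbers and marks computed by `idsP`. -/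
def IdOK (c : Ctx n r a) (g : ℕ) (m : Store) : Prop := ∀ x < g, ∀ q < r, m.narr 9 x q < g ∧
  (m.narr 10 x q = 1 ↔ Cuts (c.B q) (rset n (m.narr 1) x)) ∧
  ∀ y < g, (m.narr 9 x q = m.narr 9 y q ↔
    Agree (c.B q) (c.fs q) (rset n (m.narr 1) x) (rset n (m.narr 1) y))

theorem ht_idsP (hE : Env c m) (hg : m.nvar 9 = g) (hrn : r ≤ n)
    (hbit : ∀ x < g, ∀ i : Fin n, m.narr 1 x i = 0 ∨ m.narr 1 x i = 1) :
    Ht idsP m (300 * ((g + 1) * n)) (IdOK c g) := by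
  have hn : 1 ≤ n := by have := (c.fs 0).isLt; omega
  have hgr : g * r ≤ g * n := Nat.mul_le_mul_left _ hrn
  refine (Ht.for_const (N := g) (fun k m' => ∀ x < k, ∀ q < r, m'.narr 9 x q = 0 ∧ m'.narr 10 x q = 0)
    (r * 17 + 5) rfl rfl (by decide) hg (fun k m v h => h) (by simp)
    fun k m1 hk hF1 hk' _ hI => ?_).seq_le (K2 := 200 * ((g + 1) * n)) (by nlinarith)
    fun m1 hF1 h₁ => ?_
  · refine (Ht.for_const (N := r) (fun l m' => ∀ x q, (x < k ∧ q < r) ∨ (x = k ∧ q < l) →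
      m'.narr 9 x q = 0 ∧ m'.narr 10 x q = 0) 10 rfl rfl (by decide)
      ((hF1.n 3 rfl).trans hE.hr) (fun k m v h => h) (fun x q h => hI x (by omega) q (by omega))
      fun l m2 hl hF2 hl' _ hJ => Ht.of_wp ?_ (by decide)).conseq le_rfl fun m' _ h x hx q hq =>
      h x q (by omega)
    simp only [wp, NExp.eval, hl', (hF2.n 10 rfl).trans hk', Store.setN_nvar]
    intro x q hx
    by_cases h : x = k ∧ q = l
    · simp [h]
    · simpa [h] using hJ x q (by omega)
  have hE1 := hE.of_frame hF1 rfl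
  have e1 : m1.narr 1 = m.narr 1 := hF1.N 1 rfl
  refine (Ht.for_const (N := n) (IdInv c g m) (100 * (g + 1)) rfl rfl (by decide) hE1.hn
    (fun k m v h => h) (fun x hx q hq => ?_) fun k m2 hk hF hk' _ hI => ?_).conseq (by nlinarith)
    fun m2 hF2 h => ?_
  · grind
  · have e2 : ∀ x i, c.Same m2 x i ↔ c.Same m x i := fun x i => by
      simp only [Ctx.Same, hF.N 1 rfl, e1]
    have e3 : ∀ k m', IdInv c g m2 k m' ↔ IdInv c g m k m' := fun k m' => by simp only [IdInv, e2]
    exact (ht_refineP (hE1.of_frame hF rfl) hk hk' ((hF.n 9 rfl).trans ((hF1.n 9 rfl).trans hg))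
      ((e3 _ _).mpr hI)).conseq le_rfl fun _ _ => (e3 _ _).mp
  · intro x hx q hq
    obtain ⟨h1, h2, h3⟩ := h x hx q hq
    rw [hF2.N 1 rfl, e1]
    have hs : ∀ x < g, ∀ i ∈ c.B q, (c.Same m x i ↔
        (i ∈ rset n (m.narr 1) x ↔ c.fs q ∈ rset n (m.narr 1) x)) := by
      intro x hx i hi
      rw [Ctx.Same, (c.mem _ _).mp hi, mem_rset, mem_rset]
      grind
    refine ⟨h1, h2.trans ⟨?_, fun hc => ?_⟩, fun y hy => (h3 y hy).trans ?_⟩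
    · rintro ⟨i, hi, -, h4⟩
      rw [hs x hx i hi] at h4
      have h5 := (c.mem _ _).mpr (c.nb_fs q hq)
      rw [cuts_iff]
      grind
    · by_contra! hcon
      obtain ⟨⟨i, hi, hi'⟩, j, hj, hj'⟩ := cuts_iff.mp hc
      grind
    · exact forall_congr' fun i => ⟨fun h hi => by grind,
        fun h hi _ => by grind⟩

end Ids

section Step

variable {n r : ℕ} {a : Fin n → Fin n → WithTop ℝ} {c : Ctx n r a} {t f g : ℕ} {W' : WFam n}
  {L : ℕ → WFam n} {m m' : Store} {s : Alg2State n}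

theorem Agree.symm {A : Finset (Fin n)} {e : Fin n} {X Y : Finset (Fin n)} (h : Agree A e X Y) :
    Agree A e Y X := fun i hi => (h i hi).symm

theorem Agree.trans {A : Finset (Fin n)} {e : Fin n} {X Y Z : Finset (Fin n)} (h : Agree A e X Y)
    (h' : Agree A e Y Z) : Agree A e X Z := fun i hi => (h i hi).trans (h' i hi)

/-- The set in row `x` of the list. -/
abbrev Store.row (n : ℕ) (m : Store) (x : ℕ) : Finset (Fin n) := rset n (m.narr 1) x

/-- The rows of the list with property `J` are the members of `W`. -/
abbrev Store.Lists (m : Store) (J : ℕ → Prop) (W : WFam n) : Prop :=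
  Rows (m.narr 1) (m.rarr 2 0) J W

/-- The input of a run of the loop of Algorithm 2. -/
structure StageData (c : Ctx n r a) (t f g : ℕ) (W' : WFam n) (L : ℕ → WFam n) : Prop where
  lt : t < r
  le : f ≤ g
  out : StageOutput (realPart a) c.B t W'
  pairs : ∀ p < t, Algorithm1 a (c.B p) (c.B t) (some (L p))

theorem StageData.pairOutput (h : StageData c t f g W' L) :
    ∀ p < t, PairOutput a (c.B p) (c.B t) (L p) := fun p hp =>
  (c.data.two p (hp.trans h.lt) t h.lt hp.ne).pairOutput (h.pairs p hp)

/-- The memory represents the state `s` of the loop of Algorithm 2. -/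
structure StRel (c : Ctx n r a) (t f g : ℕ) (W' : WFam n) (L : ℕ → WFam n) (m : Store)
    (s : Alg2State n) : Prop where
  run : Relation.ReflTransGen (Alg2Step c.B t) (startState W' L) s
  old : m.Lists (fun x => x < f ∧ m.narr 13 1 x = 1) s.old
  pairs : ∀ p < t, m.Lists (fun x => (f ≤ x ∧ x < g) ∧ m.narr 13 0 x = p ∧ m.narr 13 1 x = 1) (s.pairs p)
  new : m.Lists (fun x => x < m.nvar 6 ∧ m.narr 13 1 x = 2) s.new
  act : ∀ x < m.nvar 6, m.narr 13 1 x ≤ 2 ∧ (g ≤ x → m.narr 13 1 x = 2)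
  cur : g ≤ m.nvar 6
  id : IdOK c g m
  ncut : ∀ x < f, m.narr 11 0 x = (cutIdx c.B (range t) (m.row n x)).card
  pOf : ∀ x, f ≤ x → x < g → m.narr 13 0 x < t

/-- `0` or `1` if row `x` matches row `b`, depending on the orientation, and `2` otherwise. -/
def orv (f t b : ℕ) (m : Store) (x : ℕ) : ℕ :=
  if ¬ x < f ∧ m.narr 13 1 x = 1 ∧ m.narr 10 b (m.narr 13 0 x) = 1 ∧
      m.narr 9 x (m.narr 13 0 x) = m.narr 9 b (m.narr 13 0 x) then
    if m.narr 1 x (m.narr 3 0 (m.narr 13 0 x)) = m.narr 1 b (m.narr 3 0 (m.narr 13 0 x)) then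
      m.narr 1 x (m.narr 3 0 t) else 1 - m.narr 1 x (m.narr 3 0 t)
  else 2

/-- The matching rows that are equivalent to row `x`. -/
def cls (f g t b : ℕ) (m : Store) (x : ℕ) : Finset ℕ :=
  (range g).filter fun y => orv f t b m y = orv f t b m x ∧ m.narr 9 y t = m.narr 9 x t

section

variable (hD : StageData c t f g W' L) (hE : Env c m) (h : StRel c t f g W' L m s)
include hD h
variable {b x x0 : ℕ}

theorem StRel.loopInv : LoopInv a c.B t W' L s :=
  loopInv_of_run c.data.disj hD.out hD.pairOutput h.run

theorem StRel.cut (hb : b < f ∧ m.narr 13 1 b = 1) : IsCut c.B (range t) (m.row n b) :=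
  hD.out.cut _ ((h.loopInv hD).old_sub ((h.old.fam _).mpr ⟨b, hb, rfl⟩))

theorem StRel.pair_mem {p : ℕ} (hp : p < t)
    (hx : (f ≤ x ∧ x < g) ∧ m.narr 13 0 x = p ∧ m.narr 13 1 x = 1) : m.row n x ∈ (L p).fam :=
  (h.loopInv hD).pairs_sub p (((h.pairs p hp).fam _).mpr ⟨x, hx, rfl⟩)

include hE

theorem StRel.orv_ne (hb : b < f ∧ m.narr 13 1 b = 1) (hx : x < g) :
    orv f t b m x ≠ 2 ↔ f ≤ x ∧ m.narr 13 1 x = 1 ∧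
      m.narr 13 0 x ∈ cutIdx c.B (range t) (m.row n b) ∧
      Agree (c.B (m.narr 13 0 x)) (c.fs (m.narr 13 0 x)) (m.row n x) (m.row n b) := by
  have hfg := hD.le
  have htr := hD.lt
  unfold orv
  by_cases hf : f ≤ x ∧ m.narr 13 1 x = 1
  · have hp := h.pOf x hf.1 hx
    have h1 := (h.id b (by omega) _ (hp.trans htr)).2.1
    have h2 := (h.id x hx _ (hp.trans htr)).2.2 b (by omega)
    rw [mem_cutIdx_range, ← h1, ← h2]
    have h3 := (h.pairs _ hp).bit x ⟨⟨hf.1, hx⟩, rfl, hf.2⟩ (c.fs t)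
    rw [hE.fs t htr]
    grind
  grind

theorem StRel.orv_ori (hb : b < f ∧ m.narr 13 1 b = 1) (hx : x < g)
    (ho : orv f t b m x ≠ 2) : orv f t b m x ≤ 1 ∧ (Ori (c.fs (m.narr 13 0 x)) (c.fs t) (m.row n b)
      (m.row n x) ↔ orv f t b m x = 1) := by
  have htr := hD.lt
  obtain ⟨h1, h2, h3, h4⟩ := (h.orv_ne hD hE hb hx).mp ho
  have hp := h.pOf x h1 hx
  have h5 := (h.pairs _ hp).bit x ⟨⟨h1, hx⟩, rfl, h2⟩
  have h6 := h5 (c.fs t)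
  have h7 := h5 (c.fs (m.narr 13 0 x))
  have h8 := h.old.bit b hb (c.fs (m.narr 13 0 x))
  unfold orv at ho ⊢
  rw [if_pos (by grind)]
  unfold Ori
  rw [mem_rset, mem_rset, mem_rset, hE.fs t htr, hE.fs _ (hp.trans htr)]
  grind

theorem StRel.cls_injOn (hb : b < f ∧ m.narr 13 1 b = 1) (ho : orv f t b m x0 ≠ 2) :
    ∀ x ∈ cls f g t b m x0, ∀ y ∈ cls f g t b m x0, m.narr 13 0 x = m.narr 13 0 y → x = y := by
  have htr := hD.lt
  intro x hx y hy hxy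
  obtain ⟨hx, hx1, hx2⟩ := mem_filter.mp hx
  obtain ⟨hy, hy1, hy2⟩ := mem_filter.mp hy
  rw [mem_range] at hx hy
  obtain ⟨h1, h2, -, h3⟩ := (h.orv_ne hD hE hb hx).mp (hx1 ▸ ho)
  obtain ⟨h4, h5, -, h6⟩ := (h.orv_ne hD hE hb hy).mp (hy1 ▸ ho)
  have h7 := (h.orv_ori hD hE hb hx (hx1 ▸ ho)).2
  have h8 := (h.orv_ori hD hE hb hy (hy1 ▸ ho)).2
  have hp := h.pOf x h1 hx
  rw [← hxy] at h6 h8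
  have h9 := h.pair_mem hD hp ⟨⟨h1, hx⟩, rfl, h2⟩
  have h10 := h.pair_mem hD hp ⟨⟨h4, hy⟩, hxy.symm, h5⟩
  have hL := hD.pairOutput _ hp
  refine (h.pairs _ hp).inj x y ⟨⟨h1, hx⟩, rfl, h2⟩ ⟨⟨h4, hy⟩, hxy.symm, h5⟩
    (hL.eq_of_cutEquiv (c.data.disj.not_mem hp.ne) h10 h9
      (cutEquiv_of_ori (c.data.disj.not_mem hp.ne) (hL.cut1 _ h9) (hL.cut2 _ h9) h3 h6
      (((h.id x hx t htr).2.2 y hy).mp (hx2.trans hy2.symm)) ?_)).symm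
  grind

theorem StRel.exists_tuple (hb : b < f ∧ m.narr 13 1 b = 1) (ho : orv f t b m x0 ≠ 2)
    (hc : m.narr 11 0 b ≤ (cls f g t b m x0).card) :
    ∃ φ : ℕ → ℕ, (∀ p ∈ cutIdx c.B (range t) (m.row n b), φ p ∈ cls f g t b m x0 ∧
      m.narr 13 0 (φ p) = p) ∧ ∀ x ∈ cls f g t b m x0,
      m.narr 13 0 x ∈ cutIdx c.B (range t) (m.row n b) ∧ φ (m.narr 13 0 x) = x := by
  have h1 : (cls f g t b m x0).image (m.narr 13 0) ⊆ cutIdx c.B (range t) (m.row n b) := fun p hp => by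
    obtain ⟨x, hx, rfl⟩ := mem_image.mp hp
    obtain ⟨hx, hx1, -⟩ := mem_filter.mp hx
    exact ((h.orv_ne hD hE hb (mem_range.mp hx)).mp (hx1 ▸ ho)).2.2.1
  have hinj := h.cls_injOn hD hE hb ho
  have h2 := eq_of_subset_of_card_le h1 (by
    rw [card_image_of_injOn fun x hx y hy => hinj x hx y hy, ← h.ncut b hb.1]
    exact hc)
  have h3 : ∀ p ∈ cutIdx c.B (range t) (m.row n b), ∃ x ∈ cls f g t b m x0, m.narr 13 0 x = p :=
    fun p hp => mem_image.mp (h2 ▸ hp)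
  choose! φ hφ using h3
  refine ⟨φ, hφ, fun x hx => ?_⟩
  grind

theorem StRel.not_available (hb : b < f ∧ m.narr 13 1 b = 1)
    (hc : ∀ x < g, orv f t b m x ≠ 2 → (cls f g t b m x).card < m.narr 11 0 b) :
    ¬ ∃ X, Available c.B t s (m.row n b) X := by
  rintro ⟨X, ⟨-, Xs, hXs⟩, hX⟩
  have htr := hD.lt
  have h1 : ∀ p ∈ cutIdx c.B (range t) (m.row n b), ∃ x,
      ((f ≤ x ∧ x < g) ∧ m.narr 13 0 x = p ∧ m.narr 13 1 x = 1) ∧ m.row n x = X p := fun p hp =>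
    ((h.pairs p (mem_cutIdx_range.mp hp).1).fam _).mp (hX p hp)
  choose! φ hφ using h1
  obtain ⟨o, ho⟩ := hXs.agree (fs := c.fs) c.data.disj (fun q hq => (c.mem _ _).mpr
    (c.nb_fs q (by omega))) fun p hp => by
      obtain ⟨h2, h3⟩ := hφ p hp
      have hp' := (mem_cutIdx_range.mp hp).1
      have := h.pair_mem hD hp' h2
      rw [h3] at this
      exact ⟨(hD.pairOutput p hp').cut1 _ this, (hD.pairOutput p hp').cut2 _ this⟩
  have h2 : ∀ p ∈ cutIdx c.B (range t) (m.row n b), φ p < g ∧ orv f t b m (φ p) ≠ 2 ∧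
      (orv f t b m (φ p) = 1 ↔ o) ∧ orv f t b m (φ p) ≤ 1 := fun p hp => by
    obtain ⟨⟨h2, h3, h4⟩, h5⟩ := hφ p hp
    obtain ⟨h6, h7, h8⟩ := ho p hp
    have h9 := (h.orv_ne hD hE hb h2.2).mpr ⟨h2.1, h4, h3.symm ▸ hp, by grind⟩
    have h10 := h.orv_ori hD hE hb h2.2 h9
    grind
  obtain ⟨-, p, hp, -, -, -, hcut, -⟩ := h.cut hD hb
  have hp := mem_cutIdx.mpr ⟨hp, hcut⟩
  refine absurd (hc _ (h2 p hp).1 (h2 p hp).2.1) (not_lt.mpr ?_)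
  rw [h.ncut b hb.1]
  refine card_le_card_of_injOn φ (fun q hq => ?_) fun q hq q' hq' he => ?_
  · have hq : q ∈ cutIdx c.B (range t) (m.row n b) := hq
    have e1 := h2 p hp
    have e2 := h2 q hq
    refine mem_coe.mpr (mem_filter.mpr ⟨mem_range.mpr e2.1, by grind, ?_⟩)
    rw [(h.id _ e2.1 t htr).2.2 _ e1.1]
    have e3 := (ho p hp).2.1
    have e4 := (ho q hq).2.1
    rw [← (hφ p hp).2] at e3
    rw [← (hφ q hq).2] at e4
    exact e4.trans e3.symm
  grind

end

end Step

section Update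

variable {n r : ℕ} {a : Fin n → Fin n → WithTop ℝ} {c : Ctx n r a} {t f g : ℕ} {W' : WFam n}
  {L : ℕ → WFam n} {m m' : Store} {s s' : Alg2State n}
variable {b : ℕ}

/-- The marks of the rows and the first `g` rows are the same in both memories. -/
structure SameRows (g : ℕ) (m m' : Store) : Prop where
  id : m'.narr 9 = m.narr 9
  cut : m'.narr 10 = m.narr 10
  ncut : m'.narr 11 = m.narr 11
  pOf : m'.narr 13 0 = m.narr 13 0
  row : ∀ x < g, m'.narr 1 x = m.narr 1 x

theorem SameRows.set_eq (h : SameRows g m m') {x : ℕ} (hx : x < g) : m'.row n x = m.row n x := by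
  ext i
  rw [mem_rset, mem_rset, h.row x hx]

/-- The number of the rows of the first two kinds that have not been removed. -/
def Store.left (g : ℕ) (m : Store) : ℕ := ((range g).filter fun x => m.narr 13 1 x = 1).card

theorem left_lt (hb : b < g) (h1 : m.narr 13 1 b = 1) (h2 : m'.narr 13 1 b ≠ 1)
    (h : ∀ x < g, m'.narr 13 1 x = 1 → m.narr 13 1 x = 1) : m'.left g < m.left g := by
  refine card_lt_card (Finset.ssubset_iff_subset_ne.mpr ⟨fun x hx => ?_, fun he => ?_⟩)
  · grind
  · have : b ∈ (range g).filter fun x => m.narr 13 1 x = 1 := by simp [hb, h1]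
    grind

variable (hD : StageData c t f g W' L) (h : StRel c t f g W' L m s)
include hD h

theorem StRel.update (hk : SameRows g m m')
    (run : Relation.ReflTransGen (Alg2Step c.B t) (startState W' L) s')
    (old : m'.Lists (fun x => x < f ∧ m'.narr 13 1 x = 1) s'.old)
    (pairs : ∀ p < t, m'.Lists (fun x => (f ≤ x ∧ x < g) ∧ m'.narr 13 0 x = p ∧ m'.narr 13 1 x = 1)
      (s'.pairs p))
    (new : m'.Lists (fun x => x < m'.nvar 6 ∧ m'.narr 13 1 x = 2) s'.new)
    (act : ∀ x < m'.nvar 6, m'.narr 13 1 x ≤ 2 ∧ (g ≤ x → m'.narr 13 1 x = 2))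
    (cur : g ≤ m'.nvar 6) : StRel c t f g W' L m' s' := by
  have e : ∀ x < g, rset n (m'.narr 1) x = rset n (m.narr 1) x := fun x => hk.set_eq
  refine ⟨run, old, pairs, new, act, cur, fun x hx q hq => ?_, fun x hx => ?_, ?_⟩
  · obtain ⟨h1, h2, h3⟩ := h.id x hx q hq
    rw [hk.id, hk.cut, e x hx]
    grind
  · rw [hk.ncut, hk.set_eq (hx.trans_le hD.le), h.ncut x hx]
  · rw [hk.pOf]
    exact h.pOf

theorem StRel.selectable (hb : b < f ∧ m.narr 13 1 b = 1)
    (hmax : ∀ x < f, m.narr 13 1 x = 1 → m.narr 11 0 x ≤ m.narr 11 0 b) :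
    Selectable c.B t s (m.row n b) := by
  refine ⟨(h.old.fam _).mpr ⟨b, hb, rfl⟩, fun Y hY hlt => ?_⟩
  obtain ⟨x, hx, rfl⟩ := (h.old.fam _).mp hY
  have h1 := hmax x hx.1 hx.2
  rw [h.ncut x hx.1, h.ncut b hb.1] at h1
  have h2 : cutIdx c.B (range t) (m.row n b) ⊆ cutIdx c.B (range t) (m.row n x) := fun p hp => by
    obtain ⟨h3, h4⟩ := mem_cutIdx.mp hp
    refine mem_cutIdx.mpr ⟨h3, ?_⟩
    obtain ⟨⟨i, hi, -⟩, -⟩ := cuts_iff.mp h4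
    obtain ⟨q, hq, hc, hi'⟩ := mem_cutSupport.mp (hlt.1 (mem_cutSupport.mpr ⟨p, h3, h4, hi⟩))
    rwa [c.data.disj p q i hi hi']
  refine hlt.2 (by rw [cutSupport, cutSupport, eq_of_subset_of_card_le h2 h1])

theorem StRel.keep (hb : b < f ∧ m.narr 13 1 b = 1)
    (hmax : ∀ x < f, m.narr 13 1 x = 1 → m.narr 11 0 x ≤ m.narr 11 0 b)
    (hno : ¬ ∃ X, Available c.B t s (m.row n b) X) (hk : SameRows g m m') (h1 : m'.narr 1 = m.narr 1)
    (hw : m'.rarr 2 = m.rarr 2) (h6 : m'.nvar 6 = m.nvar 6)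
    (hA : ∀ x, m'.narr 13 1 x = if x = b then 2 else m.narr 13 1 x) :
    (∃ s', StRel c t f g W' L m' s') ∧ m'.left g < m.left g := by
  have hfg := hD.le
  have hcur := h.cur
  have hnew : m.row n b ∉ s.new.fam := fun hc => (h.loopInv hD).nonred_keep
    ((h.old.fam _).mpr ⟨b, hb, rfl⟩) _ hc (CutEquiv.refl _ _ _)
  have hold := h.old.wt b hb
  refine ⟨⟨_, h.update hD hk (h.run.tail (.keep s _ (h.selectable hD hb hmax) hno)) ?_ (fun p hp => ?_)
    ?_ (fun x hx => ?_) (h6 ▸ h.cur)⟩, left_lt (hb.1.trans_le hfg) hb.2 (by simp [hA])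
    fun x _ h2 => by grind⟩
  · refine (h.old.erase hb).congr (fun x => ?_) (by simp [h1]) (by simp [hw])
    grind
  · refine (h.pairs p hp).congr (fun x => ?_) (by simp [h1]) (by simp [hw])
    rw [hA, hk.pOf]
    grind
  · refine ((hold ▸ h.new.put (h.old.bit b hb) hnew)).congr (fun x => ?_) (by simp [h1]) (by simp [hw])
    grind
  · rw [hA]
    have := h.act x (by omega)
    grind

/-- Row `x` takes part in the composition of row `b` with the rows matching it that are equivalent
to row `x0`. -/
def Sel (f g t b : ℕ) (m : Store) (x0 x : ℕ) : Prop := x = b ∨ x ∈ cls f g t b m x0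

open Classical in
theorem StRel.compose (hE : Env c m) {b x0 : ℕ} {d : ℝ} (hb : b < f ∧ m.narr 13 1 b = 1)
    (hmax : ∀ x < f, m.narr 13 1 x = 1 → m.narr 11 0 x ≤ m.narr 11 0 b) (hx0 : x0 < g)
    (ho : orv f t b m x0 ≠ 2) (hc : m.narr 11 0 b ≤ (cls f g t b m x0).card) (hk : SameRows g m m')
    (hd : ∃ x, Sel f g t b m x0 x ∧ m.rarr 2 0 x = d) (hd' : ∀ x, Sel f g t b m x0 x → d ≤ m.rarr 2 0 x)
    (h1 : ∀ x ≠ m.nvar 6, m'.narr 1 x = m.narr 1 x)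
    (hXs : ∀ i : Fin n, m'.narr 1 (m.nvar 6) i = if c.nb i = t then
      if m.narr 1 x0 i = m.narr 1 x0 (c.fs t) then orv f t b m x0 else 1 - orv f t b m x0
      else m.narr 1 b i)
    (hw : ∀ x, m'.rarr 2 0 x = if x = m.nvar 6 then d else if Sel f g t b m x0 x then
      m.rarr 2 0 x - d else m.rarr 2 0 x) (h6 : m'.nvar 6 = m.nvar 6 + 1)
    (hA : ∀ x, m'.narr 13 1 x = if x = m.nvar 6 then 2 else
      if Sel f g t b m x0 x ∧ ¬ 0 < m.rarr 2 0 x - d then 0 else m.narr 13 1 x) :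
    (∃ s', StRel c t f g W' L m' s') ∧ m'.left g < m.left g := by
  have hfg := hD.le
  have htr := hD.lt
  have hcur := h.cur
  obtain ⟨φ, hφ, hφ'⟩ := h.exists_tuple hD hE hb ho hc
  have hcls : ∀ x ∈ cls f g t b m x0, (f ≤ x ∧ x < g) ∧ m.narr 13 1 x = 1 ∧ orv f t b m x = orv f t b m x0 ∧
      Agree (c.B (m.narr 13 0 x)) (c.fs (m.narr 13 0 x)) (m.row n x) (m.row n b) ∧
      Agree (c.B t) (c.fs t) (m.row n x) (m.row n x0) ∧ (Ori (c.fs (m.narr 13 0 x)) (c.fs t) (m.row n b)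
      (m.row n x) ↔ orv f t b m x0 = 1) := fun x hx => by
    obtain ⟨hx, h2, h3⟩ := mem_filter.mp hx
    rw [mem_range] at hx
    obtain ⟨h4, h5, -, h6⟩ := (h.orv_ne hD hE hb hx).mp (h2 ▸ ho)
    exact ⟨⟨h4, hx⟩, h5, h2, h6, ((h.id x hx t htr).2.2 x0 hx0).mp h3,
      h2 ▸ (h.orv_ori hD hE hb hx (h2 ▸ ho)).2⟩
  have hselA : ∀ x, Sel f g t b m x0 x → x < g ∧ m.narr 13 1 x = 1 := by
    rintro x (rfl | hx)
    exacts [⟨by omega, hb.2⟩, ⟨(hcls x hx).1.2, (hcls x hx).2.1⟩]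
  have hφJ : ∀ p ∈ cutIdx c.B (range t) (m.row n b),
      (f ≤ φ p ∧ φ p < g) ∧ m.narr 13 0 (φ p) = p ∧ m.narr 13 1 (φ p) = 1 := fun p hp =>
    ⟨(hcls _ (hφ p hp).1).1, (hφ p hp).2, (hcls _ (hφ p hp).1).2.1⟩
  have hφL : ∀ p ∈ cutIdx c.B (range t) (m.row n b), m.row n (φ p) ∈ (s.pairs p).fam := fun p hp =>
    ((h.pairs p (mem_cutIdx_range.mp hp).1).fam _).mpr ⟨_, hφJ p hp, rfl⟩
  have hcuts : ∀ p ∈ cutIdx c.B (range t) (m.row n b), Cuts (c.B p) (m.row n (φ p)) ∧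
      Cuts (c.B t) (m.row n (φ p)) := fun p hp => by
    have h2 := (mem_cutIdx_range.mp hp).1
    have h3 := (h.loopInv hD).pairs_sub p (hφL p hp)
    exact ⟨(hD.pairOutput p h2).cut1 _ h3, (hD.pairOutput p h2).cut2 _ h3⟩
  have ho1 := (h.orv_ori hD hE hb hx0 ho).1
  have hx₀J := (h.orv_ne hD hE hb hx0).mp ho
  have hbit0 := (h.pairs _ (h.pOf x0 hx₀J.1 hx0)).bit x0 ⟨⟨hx₀J.1, hx0⟩, rfl, hx₀J.2.1⟩
  have hcomp : IsComposition c.B t (m.row n b) (fun p => m.row n (φ p)) (m'.row n (m.nvar 6)) := by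
    refine isComposition_of_agree (fs := c.fs) (Y := m.row n x0) (o := orv f t b m x0 = 1) c.data.disj
      (fun q hq => (c.mem _ _).mpr (c.nb_fs q (by omega))) (h.cut hD hb) hcuts (fun p hp => ?_)
      (fun i hi => ?_) fun i hi => ?_
    · grind
    · have h2 := hbit0 i
      have h3 := hbit0 (c.fs t)
      simp only [mem_rset, hXs, (c.mem i t).mp hi, if_true]
      split_ifs <;> grind
    · simp only [mem_rset, hXs, if_neg fun hc => hi ((c.mem i t).mpr hc)]
  have hnew : m'.row n (m.nvar 6) ∉ s.new.fam := fun hc => (h.loopInv hD).nonred_compose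
    ((h.old.fam _).mpr ⟨b, hb, rfl⟩) hφL hcomp _ hc (CutEquiv.refl _ _ _)
  have hIdx : ∀ p ∈ cutIdx c.B (range t) (m.row n b), IsCut c.B {p, t} (m.row n (φ p)) := fun p hp => by
    have h2 := (mem_cutIdx_range.mp hp).1
    refine ⟨fun i hi => ?_, p, by simp, t, by simp, h2.ne, hcuts p hp⟩
    have := (hD.pairOutput p h2).sub _ ((h.loopInv hD).pairs_sub p (hφL p hp)) hi
    simpa using this
  have hleast : IsLeast (insert (s.old.wt (m.row n b)) {y | ∃ p ∈ cutIdx c.B (range t) (m.row n b),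
      y = (s.pairs p).wt (m.row n (φ p))}) d := by
    have hwp : ∀ p ∈ cutIdx c.B (range t) (m.row n b), (s.pairs p).wt (m.row n (φ p)) =
        m.rarr 2 0 (φ p) := fun p hp => (h.pairs p (mem_cutIdx_range.mp hp).1).wt _ (hφJ p hp)
    rw [h.old.wt b hb]
    constructor
    · obtain ⟨x, rfl | hx, rfl⟩ := hd
      · exact .inl rfl
      · obtain ⟨h2, h3⟩ := hφ' x hx
        exact .inr ⟨_, h2, by rw [hwp _ h2, h3]⟩
    · rintro y (rfl | ⟨p, hp, rfl⟩)
      · exact hd' b (.inl rfl)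
      · rw [hwp p hp]
        exact hd' _ (.inr (hφ p hp).1)
  have hrow : ∀ x < m.nvar 6, ∀ i : Fin n, m'.narr 1 x i = m.narr 1 x i := fun x hx i => by
    rw [h1 x hx.ne]
  have hdec : ∀ {J J' : ℕ → Prop} {W : WFam n} {y : ℕ}, m.Lists J W → J y → Sel f g t b m x0 y →
      (∀ x, J x → x < g) → (∀ x, J x → Sel f g t b m x0 x → x = y) →
      (∀ x, J' x ↔ J x ∧ m'.narr 13 1 x = 1) → (∀ x, J x → m.narr 13 1 x = 1) →
      m'.Lists J' (W.dec (m.row n y) d) := by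
    intro J J' W y hW hy hsy hJ huniq hJ' hJA
    refine (hW.dec hy d).congr (fun x => ?_) (fun x hx => hrow x ((hJ x hx.1).trans_le hcur))
      fun x hx => ?_
    · rw [hJ']
      refine and_congr_right fun hx => ?_
      have h2 := hJ x hx
      rw [hA, if_neg (by omega), hJA x hx]
      by_cases hxy : x = y
      · have := hd' y hsy
        simp only [hxy, hsy, true_and, not_lt, forall_const]
        split_ifs with h3
        · grind
        · simp only [true_iff]
          exact fun h4 => h3 h4.le
      · have hns : ¬ Sel f g t b m x0 x := fun hs => hxy (huniq x hx hs)
        simp [hxy, hns]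
    · have h2 := hJ x hx.1
      rw [hw, if_neg (by omega)]
      by_cases hxy : x = y
      · simp [hxy, hsy]
      · have hns : ¬ Sel f g t b m x0 x := fun hs => hxy (huniq x hx.1 hs)
        simp [hxy, hns]
  refine ⟨⟨_, h.update hD hk (h.run.tail (.compose s _ _ _ d (h.selectable hD hb hmax)
    ⟨⟨hIdx, _, hcomp⟩, hφL⟩ hcomp hleast)) ?_ (fun p hp => ?_) ?_ (fun x hx => ?_) (by omega)⟩, ?_⟩
  · refine hdec h.old hb (.inl rfl) (fun x hx => by omega) (fun x hx hs => ?_) (fun x => ?_)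
      fun x hx => hx.2
    · rcases hs with rfl | hs
      · rfl
      · have := (hcls x hs).1
        omega
    · rw [and_assoc]
      refine and_congr_right fun hx => ⟨fun h2 => ⟨?_, h2⟩, fun h2 => h2.2⟩
      rw [hA, if_neg (by omega)] at h2
      split_ifs at h2
      exact h2
  · have hA1 : ∀ x, f ≤ x ∧ x < g → m'.narr 13 1 x = 1 → m.narr 13 1 x = 1 := fun x hx h2 => by
      rw [hA, if_neg (by omega)] at h2
      split_ifs at h2
      exact h2
    have hJ' : ∀ x, ((f ≤ x ∧ x < g) ∧ m'.narr 13 0 x = p ∧ m'.narr 13 1 x = 1) ↔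
        ((f ≤ x ∧ x < g) ∧ m.narr 13 0 x = p ∧ m.narr 13 1 x = 1) ∧ m'.narr 13 1 x = 1 := fun x => by
      rw [hk.pOf]
      exact ⟨fun ⟨h2, h3, h4⟩ => ⟨⟨h2, h3, hA1 x h2 h4⟩, h4⟩, fun ⟨⟨h2, h3, _⟩, h4⟩ => ⟨h2, h3, h4⟩⟩
    simp only
    split_ifs with hpc
    · refine hdec (h.pairs p hp) (hφJ p hpc) (.inr (hφ p hpc).1) (fun x hx => hx.1.2)
        (fun x hx hs => ?_) hJ' fun x hx => hx.2.2
      rcases hs with rfl | hs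
      · omega
      · rw [← (hφ' x hs).2, hx.2.1]
    · have hns : ∀ x, f ≤ x ∧ x < g → m.narr 13 0 x = p → ¬ Sel f g t b m x0 x := by
        rintro x hx hxp (rfl | hs)
        · omega
        · exact hpc (hxp ▸ (hφ' x hs).1)
      refine (h.pairs p hp).congr (fun x => (hJ' x).trans (and_iff_left_of_imp fun hx => ?_))
        (fun x hx => hrow x (by omega)) fun x hx => ?_
      · rw [hA, if_neg (by omega), if_neg fun h2 => hns x hx.1 hx.2.1 h2.1]
        exact hx.2.2
      · rw [hw, if_neg (by omega), if_neg (hns x hx.1 hx.2.1)]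
  · have hns : ∀ x, m.narr 13 1 x = 2 → ¬ Sel f g t b m x0 x := fun x hx hs => by
      have := (hselA x hs).2
      omega
    have hN : m'.Lists (fun x => x < m.nvar 6 ∧ m.narr 13 1 x = 2) s.new :=
      h.new.congr (fun x => Iff.rfl) (fun x hx => hrow x hx.1) fun x hx => by
        rw [hw, if_neg hx.1.ne, if_neg (hns x hx.2)]
    have hput := hN.put (x0 := m.nvar 6) (fun i => ?_) hnew
    · rw [hw, if_pos rfl] at hput
      refine hput.congr (fun x => ?_) (fun _ _ _ => rfl) fun _ _ => rfl
      rw [hA, h6]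
      split_ifs with h2 h3
      · simp [h2]
      · simp [h2, (hselA x h3.1).2]
      · simp only [h2, false_or]
        omega
    · rw [hXs]
      have := h.old.bit b hb i
      split_ifs <;> omega
  · rw [hA]
    split_ifs with h2 h3
    · omega
    · have := hselA x h3.1
      omega
    · exact h.act x (by omega)
  · obtain ⟨x, hx, hxd⟩ := hd
    have h2 := hselA x hx
    refine left_lt h2.1 h2.2 ?_ fun y hy h3 => ?_
    · rw [hA, if_neg (by omega), if_pos ⟨hx, by simp [hxd]⟩]
      decide
    · rw [hA, if_neg (by omega)] at h3
      split_ifs at h3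
      exact h3

end Update

section Iteration

variable {n r : ℕ} {a : Fin n → Fin n → WithTop ℝ} {c : Ctx n r a} {t f g b x0 : ℕ} {W' : WFam n}
  {L : ℕ → WFam n} {m m' : Store} {s : Alg2State n}

/-- Select a remaining row of the first kind that cuts as many blocks as possible. -/
def selP : Prog := .seq (.nset 13 (.var 9)) (forP 10 8 (.ite (.and
  (.neq (.get 13 (.lit 1) (.var 10)) (.lit 1)) (.not (.and (.not (.neq (.var 13) (.var 9)))
    (.not (.nlt (nA 11 (.var 13)) (nA 11 (.var 10))))))) (.nset 13 (.var 10)) .skip))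

theorem ht_selP (h8 : m.nvar 8 = f) (h9 : m.nvar 9 = g) (hfg : f ≤ g) :
    Ht selP m (50 * (g + 1)) fun m' => (m'.nvar 13 = g ∧ ∀ x < f, m.narr 13 1 x ≠ 1) ∨
      ∃ b, (b < f ∧ m.narr 13 1 b = 1) ∧ m'.nvar 13 = b ∧
        ∀ x < f, m.narr 13 1 x = 1 → m.narr 11 0 x ≤ m.narr 11 0 b := by
  refine (Ht.of_wp (K := 2) (Q := fun m' => m'.nvar 13 = g) (by simp [wp, h9]) (by decide)).seq_le
    (K2 := f * 42 + 5) (by omega) fun m1 hF1 h13 => ?_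
  refine Ht.for_const (N := f) (fun k m' => (m'.nvar 13 = g ∧ ∀ x < k, m.narr 13 1 x ≠ 1) ∨
      ∃ b, (b < f ∧ m.narr 13 1 b = 1) ∧ m'.nvar 13 = b ∧
        ∀ x < k, m.narr 13 1 x = 1 → m.narr 11 0 x ≤ m.narr 11 0 b) 35 rfl rfl (by decide)
      ((hF1.n 8 rfl).trans h8) (fun k m v h => by simpa using h) (.inl ⟨h13, by simp⟩)
      fun k m2 hk hF hk' _ hI => Ht.of_wp ?_ (by decide)
  have e9 : m2.nvar 9 = g := by rw [hF.n 9 rfl, hF1.n 9 rfl, h9]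
  simp only [wp, Test.holds, NExp.eval, hk', e9, hF.N 13 rfl, hF1.N 13 rfl, hF.N 11 rfl,
    hF1.N 11 rfl, Store.setn_nvar, if_true]
  grind

/-- Compare all rows with the row in variable `13`, count the equivalent matching rows, and look for
a matching row that is equivalent to enough others. -/
def matchP : Prog := progs
  [forP 10 9 (progs [.nput 6 (.lit 0) (.var 10) (.lit 0), .nput 6 (.lit 1) (.var 10) (.lit 0),
    .nput 6 (.lit 2) (.var 10) (.lit 0), .nset 15 (nA 13 (.var 10)),
    .ite (.and (.not (.nlt (.var 10) (.var 8))) (.and (.neq (.get 13 (.lit 1) (.var 10)) (.lit 1))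
        (.and (.neq (.get 10 (.var 13) (.var 15)) (.lit 1))
          (.neq (.get 9 (.var 10) (.var 15)) (.get 9 (.var 13) (.var 15))))))
      (.ite (.neq (.get 1 (.var 10) (nA 3 (.var 15))) (.get 1 (.var 13) (nA 3 (.var 15))))
        (.nput 7 (.lit 0) (.var 10) (.get 1 (.var 10) (nA 3 (.var 4))))
        (.nput 7 (.lit 0) (.var 10) (.sub (.lit 1) (.get 1 (.var 10) (nA 3 (.var 4))))))
      (.nput 7 (.lit 0) (.var 10) (.lit 2))]),
   forP 10 9 (.nput 6 (nA 7 (.var 10)) (.get 9 (.var 10) (.var 4))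
    (.add (.get 6 (nA 7 (.var 10)) (.get 9 (.var 10) (.var 4))) (.lit 1))),
   .nset 14 (.var 9),
   forP 10 9 (.ite (.and (.not (.neq (nA 7 (.var 10)) (.lit 2))) (.not (.nlt
    (.get 6 (nA 7 (.var 10)) (.get 9 (.var 10) (.var 4))) (nA 11 (.var 13))))) (.nset 14 (.var 10)) .skip)]

/-- The natural variables that are constant during the loop. -/
structure LoopVars (t f g : ℕ) (m : Store) : Prop where
  t : m.nvar 4 = t
  f : m.nvar 8 = f
  g : m.nvar 9 = g

theorem LoopVars.of_frame {P : Prog} (h : LoopVars t f g m) (hF : Frame P m m')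
    (hP : (!(P.wn 4) && !(P.wn 8) && !(P.wn 9)) = true) : LoopVars t f g m' := by
  simp only [Bool.and_eq_true, Bool.not_eq_true'] at hP
  exact ⟨(hF.n 4 hP.1.1).trans h.t, (hF.n 8 hP.1.2).trans h.f, (hF.n 9 hP.2).trans h.g⟩

theorem ht_matchP (hD : StageData c t f g W' L) (hE : Env c m) (h : StRel c t f g W' L m s)
    (hV : LoopVars t f g m) (hb : b < f ∧ m.narr 13 1 b = 1) (h13 : m.nvar 13 = b) :
    Ht matchP m (200 * (g + 1)) fun m' => (∀ x < g, m'.narr 7 0 x = orv f t b m x) ∧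
      ((m'.nvar 14 = g ∧ ∀ x < g, orv f t b m x ≠ 2 → (cls f g t b m x).card < m.narr 11 0 b) ∨
        ∃ x0 < g, m'.nvar 14 = x0 ∧ orv f t b m x0 ≠ 2 ∧
          m.narr 11 0 b ≤ (cls f g t b m x0).card) := by
  have hle : ∀ x < g, orv f t b m x ≤ 2 ∧ m.narr 9 x t < g := fun x hx => by
    refine ⟨?_, (h.id x hx t hD.lt).1⟩
    by_cases h1 : orv f t b m x = 2
    · exact h1.le
    · exact (h.orv_ori hD hE hb hx h1).1.trans (by omega)
  have hsucc : ∀ {x k}, x < k + 1 → x < k ∨ x = k := by omega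
  refine (Ht.for_const (N := g) (fun k m' => ∀ x < k, m'.narr 7 0 x = orv f t b m x ∧
    m'.narr 6 0 x = 0 ∧ m'.narr 6 1 x = 0 ∧ m'.narr 6 2 x = 0) 90 rfl rfl (by decide) hV.g
    (fun k m v h => h) (by simp) fun k m1 hk hF hk' _ hI => ?_).cons
    (K2 := 100 * g + 50) (by omega) fun m1 hF1 h₁ => ?_
  · refine Ht.of_wp ?_ (by decide)
    have hV1 := hV.of_frame hF rfl
    have e13 : m1.nvar 13 = b := (hF.n 13 rfl).trans h13
    simp only [progs, wp, Test.holds, NExp.eval, hk', e13, hF.N 13 rfl, hF.N 10 rfl, hF.N 9 rfl,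
      hF.N 1 rfl, hF.N 3 rfl, hV1.t, hV1.f, Store.setn_nvar, Store.setN_nvar, Store.setn_narr, Store.setN_narr]
    refine ⟨fun h1 => ⟨fun h2 x hx => ?_, fun h2 x hx => ?_⟩, fun h1 x hx => ?_⟩
    all_goals
      have e1 : x ≠ k → x < k := by omega
      by_cases hxk : x = k
    · simp at h1 h2
      simp [hxk, orv, h1, h2]
    · grind
    · simp at h1 h2
      simp [hxk, orv, h1, h2]
    · grind
    · simp at h1
      simp [hxk, orv]
      grind
    grind
  have hV1 := hV.of_frame hF1 rfl
  refine (Ht.for_const (N := g) (fun k m' => ∀ o ≤ 2, ∀ j < g, m'.narr 6 o j =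
    ((range k).filter fun y => orv f t b m y = o ∧ m.narr 9 y t = j).card) 25 rfl rfl (by decide) hV1.g
    (fun k m v h => h) (fun o ho j hj => ?_) fun k m2 hk hF hk' _ hI => Ht.of_wp ?_ (by decide)).cons
    (K2 := 60 * g + 20) (by omega) fun m2 hF2 h₂ => ?_
  · interval_cases o <;> simp [h₁ j hj]
  · have e7 : m2.narr 7 0 k = orv f t b m k := by rw [hF.N 7 rfl, (h₁ k hk).1]
    have e9 : m2.narr 9 k t = m.narr 9 k t := by rw [hF.N 9 rfl, hF1.N 9 rfl]
    simp only [wp, NExp.eval, hk', e7, (hV1.of_frame hF rfl).t, e9]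
    intro o ho j hj
    rw [Store.setN_narr, range_add_one, filter_insert]
    by_cases h3 : orv f t b m k = o ∧ m.narr 9 k t = j
    · rw [if_pos h3, if_pos ⟨rfl, h3.1.symm, h3.2.symm⟩, card_insert_of_notMem (by simp), h3.1, h3.2,
        hI o ho j hj]
    · rw [if_neg h3, if_neg (by omega), hI o ho j hj]
  have hV2 := hV1.of_frame hF2 rfl
  refine (Ht.of_wp (K := 2) (Q := fun m' => m'.nvar 14 = g) (by simp [wp, hV2.g]) (by decide)).cons
    (K2 := 60 * g + 10) (by omega) fun m3 hF3 h₃ => ?_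
  refine (Ht.for_const (N := g) (fun k m' =>
    (m'.nvar 14 = g ∧ ∀ x < k, orv f t b m x ≠ 2 → (cls f g t b m x).card < m.narr 11 0 b) ∨
        ∃ x0 < g, m'.nvar 14 = x0 ∧ orv f t b m x0 ≠ 2 ∧ m.narr 11 0 b ≤ (cls f g t b m x0).card)
    40 rfl rfl (by decide) (hV2.of_frame hF3 rfl).g (fun k m v h => by simpa using h)
    (.inl ⟨h₃, by simp⟩) fun k m4 hk hF hk' _ hI => Ht.of_wp ?_ (by decide)).conseq (by omega)
    fun m' hF h' => ⟨fun x hx => ?_, h'⟩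
  · have e7 : m4.narr 7 0 k = orv f t b m k := by
      rw [hF.N 7 rfl, hF3.N 7 rfl, hF2.N 7 rfl, (h₁ k hk).1]
    have e9 : m4.narr 9 k t = m.narr 9 k t := by rw [hF.N 9 rfl, hF3.N 9 rfl, hF2.N 9 rfl, hF1.N 9 rfl]
    have e11 : m4.narr 11 = m.narr 11 := by
      rw [hF.N 11 rfl, hF3.N 11 rfl, hF2.N 11 rfl, hF1.N 11 rfl]
    have e13 : m4.nvar 13 = b := by rw [hF.n 13 rfl, hF3.n 13 rfl, hF2.n 13 rfl, hF1.n 13 rfl, h13]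
    have e6 : m4.narr 6 (orv f t b m k) (m.narr 9 k t) = (cls f g t b m k).card := by
      rw [hF.N 6 rfl, hF3.N 6 rfl, h₂ _ (hle k hk).1 _ (hle k hk).2]
      rfl
    simp only [wp, Test.holds, NExp.eval, hk', e7, ((hV2.of_frame hF3 rfl).of_frame hF rfl).t, e9, e6,
      e11, e13, Store.setn_nvar, if_true]
    refine ⟨fun h4 => .inr ⟨k, hk, rfl, h4.1, not_lt.mp h4.2⟩, fun h4 => ?_⟩
    refine hI.imp_left fun h5 => ⟨h5.1, fun x hx h6 => ?_⟩
    grind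
  · rw [hF.N 7 rfl, hF3.N 7 rfl, hF2.N 7 rfl, (h₁ x hx).1]

/-- Row `10` is row `13`, or matches it and is equivalent to row `14`. -/
def selT : Test := .not (.and (.not (.neq (.var 10) (.var 13))) (.not (.and
  (.neq (nA 7 (.var 10)) (nA 7 (.var 14)))
  (.neq (.get 9 (.var 10) (.var 4)) (.get 9 (.var 14) (.var 4))))))

theorem selT_holds {x : ℕ} (hx : x < g) (hx0 : x0 < g) (h10 : m'.nvar 10 = x)
    (h13 : m'.nvar 13 = b) (h14 : m'.nvar 14 = x0) (h4 : m'.nvar 4 = t)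
    (h7 : ∀ x < g, m'.narr 7 0 x = orv f t b m x) (h9 : m'.narr 9 = m.narr 9) :
    selT.holds m' ↔ Sel f g t b m x0 x := by
  simp only [selT, Test.holds, NExp.eval, h10, h13, h14, h4, h7 x hx, h7 x0 hx0, h9, Sel, cls, mem_filter,
    mem_range, hx, true_and]
  tauto

/-- Compose row `13` with the rows that match it and are equivalent to row `14`. -/
def composeP : Prog := progs
  [.rset 0 (rA 2 (.var 13)),
   forP 10 9 (.ite (.and selT (.rlt (rA 2 (.var 10)) (.var 0))) (.rset 0 (rA 2 (.var 10))) .skip),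
   .seq (.nset 15 (.get 1 (.var 14) (nA 3 (.var 4)))) (.nset 16 (nA 7 (.var 14))),
   forP 10 2 (.ite (.neq (nA 2 (.var 10)) (.var 4))
    (.ite (.neq (.get 1 (.var 14) (.var 10)) (.var 15)) (.nput 1 (.var 6) (.var 10) (.var 16))
      (.nput 1 (.var 6) (.var 10) (.sub (.lit 1) (.var 16))))
    (.nput 1 (.var 6) (.var 10) (.get 1 (.var 13) (.var 10)))),
   forP 10 9 (.ite selT (.seq (.rput 2 (.lit 0) (.var 10) (.sub (rA 2 (.var 10)) (.var 0)))
    (.ite (.rlt .zero (rA 2 (.var 10))) .skip (.nput 13 (.lit 1) (.var 10) (.lit 0)))) .skip),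
   progs [.rput 2 (.lit 0) (.var 6) (.var 0), .nput 13 (.lit 1) (.var 6) (.lit 2),
    .nset 6 (.add (.var 6) (.lit 1))]]

open Classical in
theorem ht_composeP (hE : Env c m) (hV : LoopVars t f g m) (htr : t < r) (hfg : f ≤ g) (hb : b < f)
    (hx0 : x0 < g) (hcur : g ≤ m.nvar 6) (h13 : m.nvar 13 = b) (h14 : m.nvar 14 = x0) {m0 : Store}
    (h7 : ∀ x < g, m.narr 7 0 x = orv f t b m0 x) (h9 : m.narr 9 = m0.narr 9) :
    Ht composeP m (200 * (g + n + 1)) fun m' => ∃ d : ℝ,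
      (∃ x, Sel f g t b m0 x0 x ∧ m.rarr 2 0 x = d) ∧
      (∀ x, Sel f g t b m0 x0 x → d ≤ m.rarr 2 0 x) ∧
      (∀ x ≠ m.nvar 6, m'.narr 1 x = m.narr 1 x) ∧
      (∀ i : Fin n, m'.narr 1 (m.nvar 6) i = if c.nb i = t then
        if m.narr 1 x0 i = m.narr 1 x0 (c.fs t) then orv f t b m0 x0 else 1 - orv f t b m0 x0
        else m.narr 1 b i) ∧
      (∀ x, m'.rarr 2 0 x = if x = m.nvar 6 then d else if Sel f g t b m0 x0 x then
        m.rarr 2 0 x - d else m.rarr 2 0 x) ∧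
      m'.nvar 6 = m.nvar 6 + 1 ∧
      (∀ x, m'.narr 13 1 x = if x = m.nvar 6 then 2 else
        if Sel f g t b m0 x0 x ∧ ¬ 0 < m.rarr 2 0 x - d then 0 else m.narr 13 1 x) ∧
      m'.narr 13 0 = m.narr 13 0 := by
  have hsg : ∀ x, Sel f g t b m0 x0 x → x < g := by
    rintro x (rfl | hx)
    exacts [by omega, mem_range.mp (mem_filter.mp hx).1]
  have hsucc : ∀ {x k}, x < k + 1 → x < k ∨ x = k := by omega
  refine (Ht.of_wp (K := 4) (Q := fun m' => m'.rvar 0 = m.rarr 2 0 b) (by simp [wp, h13])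
    (by decide)).cons (K2 := 199 * (g + n) + 190) (by omega) fun m1 hF1 h1 => ?_
  have hV1 := hV.of_frame hF1 rfl
  refine (Ht.for_const (N := g) (fun k m' => (∃ x, Sel f g t b m0 x0 x ∧ m.rarr 2 0 x = m'.rvar 0) ∧
    ∀ x < k, Sel f g t b m0 x0 x → m'.rvar 0 ≤ m.rarr 2 0 x) 40 rfl rfl (by decide) hV1.g
    (fun k m v h => h) ⟨⟨b, .inl rfl, h1.symm⟩, by simp⟩ fun k m2 hk hF hk' _ hI =>
    Ht.of_wp ?_ (by decide)).cons (K2 := 150 * g + 199 * n + 180) (by omega) fun m2 hF2 h2 => ?_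
  · have hs := selT_holds (m := m0) (m' := m2) hk hx0 hk'
      (by rw [hF.n 13 rfl, hF1.n 13 rfl, h13]) (by rw [hF.n 14 rfl, hF1.n 14 rfl, h14])
      (hV1.of_frame hF rfl).t (by rw [hF.N 7 rfl, hF1.N 7 rfl]; exact h7)
      (by rw [hF.N 9 rfl, hF1.N 9 rfl, h9])
    simp only [wp, Test.holds, hs, RExp.eval, NExp.eval, hk', hF.R 2 rfl, hF1.R 2 rfl, Store.setr_rvar,
      if_true]
    refine ⟨fun h3 => ⟨⟨k, h3.1, rfl⟩, fun x hx hxs => ?_⟩, fun h3 => ⟨hI.1, fun x hx hxs => ?_⟩⟩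
    all_goals rcases hsucc hx with hx | rfl
    · exact h3.2.le.trans (hI.2 x hx hxs)
    · exact le_rfl
    · grind
    grind
  obtain ⟨hd, hd'⟩ := h2
  set d := m2.rvar 0
  have hV2 := hV1.of_frame hF2 rfl
  refine (Ht.of_wp (K := 20) (Q := fun m' => m'.nvar 15 = m.narr 1 x0 (c.fs t) ∧
    m'.nvar 16 = orv f t b m0 x0) ?_ (by decide)).cons (K2 := 150 * g + 199 * n + 160) (by omega)
    fun m3 hF3 h₃ => ?_
  · simp [wp, hV2.t, hF2.n 14 rfl, hF1.n 14 rfl, h14, ((hE.of_frame hF1 rfl).of_frame hF2 rfl).fs t htr,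
      hF2.N 1 rfl, hF1.N 1 rfl, hF2.N 7 rfl, hF1.N 7 rfl, h7 x0 hx0]
  have hE3 := ((hE.of_frame hF1 rfl).of_frame hF2 rfl).of_frame hF3 rfl
  have e6 : m3.nvar 6 = m.nvar 6 := by rw [hF3.n 6 rfl, hF2.n 6 rfl, hF1.n 6 rfl]
  have e1 : m3.narr 1 = m.narr 1 := by rw [hF3.N 1 rfl, hF2.N 1 rfl, hF1.N 1 rfl]
  have e13 : m3.nvar 13 = b := by rw [hF3.n 13 rfl, hF2.n 13 rfl, hF1.n 13 rfl, h13]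
  have e14 : m3.nvar 14 = x0 := by rw [hF3.n 14 rfl, hF2.n 14 rfl, hF1.n 14 rfl, h14]
  have hV3 := hV2.of_frame hF3 rfl
  refine (Ht.for_const (N := n) (fun k m' => (∀ x ≠ m.nvar 6, m'.narr 1 x = m.narr 1 x) ∧
    ∀ i : Fin n, (i : ℕ) < k → m'.narr 1 (m.nvar 6) i = if c.nb i = t then
      if m.narr 1 x0 i = m.narr 1 x0 (c.fs t) then orv f t b m0 x0 else 1 - orv f t b m0 x0
      else m.narr 1 b i) 40 rfl rfl (by decide) hE3.hn (fun k m v h => h)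
    ⟨fun x _ => by rw [e1], by simp⟩ fun k m4 hk hF hk' _ hI => Ht.of_wp ?_ (by decide)).cons
    (K2 := 150 * g + 150) (by omega) fun m4 hF4 h₄ => ?_
  · have h5 := (hE3.of_frame hF rfl).nb ⟨k, hk⟩
    simp only at h5
    simp only [wp, Test.holds, NExp.eval, hk', h5, (hV3.of_frame hF rfl).t, hF.n 14 rfl, e14,
      hF.n 13 rfl, e13, hF.n 15 rfl, h₃.1, hF.n 16 rfl, h₃.2, hF.n 6 rfl, e6,
      hI.1 x0 (by omega), hI.1 b (by omega)]
    refine ⟨fun h8 => ⟨fun h10 => ?_, fun h10 => ?_⟩, fun h8 => ?_⟩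
    all_goals
      refine ⟨fun x hx => ?_, fun i hi => ?_⟩
      · funext j
        simp [hx, hI.1 x hx]
      · rcases lt_succ_cases hk hi with rfl | hi'
        · simp [h8]
          try simp [h10]
        · simpa [hi'.ne] using hI.2 i hi'
  have hV4 := hV3.of_frame hF4 rfl
  have e2 : m4.rarr 2 = m.rarr 2 := by rw [hF4.R 2 rfl, hF3.R 2 rfl, hF2.R 2 rfl, hF1.R 2 rfl]
  have eN : m4.narr 13 = m.narr 13 := by rw [hF4.N 13 rfl, hF3.N 13 rfl, hF2.N 13 rfl, hF1.N 13 rfl]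
  have ed : m4.rvar 0 = d := by rw [hF4.r 0 rfl, hF3.r 0 rfl]
  refine (Ht.for_const (N := g) (fun k m' => (∀ x, m'.rarr 2 0 x = if x < k ∧ Sel f g t b m0 x0 x then
      m.rarr 2 0 x - d else m.rarr 2 0 x) ∧ m'.narr 13 0 = m.narr 13 0 ∧
    ∀ x, m'.narr 13 1 x = if (x < k ∧ Sel f g t b m0 x0 x) ∧ ¬ 0 < m.rarr 2 0 x - d then 0
      else m.narr 13 1 x) 60 rfl rfl (by decide) hV4.g (fun k m v h => h)
    ⟨fun x => by simp [e2], by rw [eN], fun x => by simp [eN]⟩ fun k m5 hk hF hk' _ hI =>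
    Ht.of_wp ?_ (by decide)).cons (K2 := 20) (by omega) fun m5 hF5 h₅ => Ht.of_wp ?_ (by decide)
  · have hs := selT_holds (m := m0) (m' := m5) hk hx0 hk'
      (by rw [hF.n 13 rfl, hF4.n 13 rfl, e13]) (by rw [hF.n 14 rfl, hF4.n 14 rfl, e14])
      (hV4.of_frame hF rfl).t
      (by rw [hF.N 7 rfl, hF4.N 7 rfl, hF3.N 7 rfl, hF2.N 7 rfl, hF1.N 7 rfl]; exact h7)
      (by rw [hF.N 9 rfl, hF4.N 9 rfl, hF3.N 9 rfl, hF2.N 9 rfl, hF1.N 9 rfl, h9])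
    obtain ⟨g1, g2, g3⟩ := hI
    have g4 := g1 k
    simp only [lt_irrefl, false_and, if_false] at g4
    have hlt : ∀ x, x ≠ k → (x < k + 1 ↔ x < k) := by omega
    simp only [wp, Test.holds, hs, RExp.eval, NExp.eval, hk', g4, (hF.r 0 rfl).trans ed,
      Store.setR_rarr, Store.setR_nvar]
    refine ⟨fun h6 => ⟨fun h8 => ⟨fun x => ?_, g2, fun x => ?_⟩,
      fun h8 => ⟨fun x => ?_, ?_, fun x => ?_⟩⟩, fun h6 => ⟨fun x => ?_, g2, fun x => ?_⟩⟩
    · by_cases hx : x = k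
      · simp [hx, h6]
      · simp [hx, g1, hlt]
    · by_cases hx : x = k
      · simp at h8
        simp [hx, h6, g3, h8]
      · simp [g3, hlt x hx]
    · by_cases hx : x = k
      · simp [hx, h6]
      · simp [hx, g1, hlt]
    · funext j
      simp [g2]
    · by_cases hx : x = k
      · simp at h8
        simp [hx, h6, h8]
      · simp [hx, g3, hlt]
    · by_cases hx : x = k
      · simp [hx, h6, g4]
      · simp [g1, hlt x hx]
    · by_cases hx : x = k
      · simp [hx, h6, g3]
      · simp [g3, hlt x hx]
  · obtain ⟨g1, g2, g3⟩ := h₅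
    have e6' : m5.nvar 6 = m.nvar 6 := by rw [hF5.n 6 rfl, hF4.n 6 rfl, e6]
    have hd5 : m5.rvar 0 = d := by rw [hF5.r 0 rfl, ed]
    have hlt : ∀ x, (x < g ∧ Sel f g t b m0 x0 x) ↔ Sel f g t b m0 x0 x := fun x =>
      and_iff_right_of_imp (hsg x)
    simp only [progs, wp, NExp.eval, RExp.eval, e6', hd5]
    refine ⟨d, hd, fun x hx => hd' x (hsg x hx) hx, fun x hx => ?_, fun i => ?_, fun x => ?_, ?_,
      fun x => ?_, ?_⟩
    · funext j
      simp [hF5.N 1 rfl, h₄.1 x hx]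
    · simp [hF5.N 1 rfl, h₄.2 i i.isLt]
    · simp [g1, hlt]
    · simp [e6']
    · simp [g3, hlt, e6']
    · funext j
      simp [g2]

end Iteration

section Loop

variable {n r : ℕ} {a : Fin n → Fin n → WithTop ℝ} {c : Ctx n r a} {t f g : ℕ} {W' : WFam n}
  {L : ℕ → WFam n} {m m' : Store} {s : Alg2State n}

theorem StRel.of_eq (hD : StageData c t f g W' L) (h : StRel c t f g W' L m s)
    (hN : ∀ A, A = 1 ∨ A = 9 ∨ A = 10 ∨ A = 11 ∨ A = 13 → m'.narr A = m.narr A)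
    (hR : m'.rarr 2 = m.rarr 2) (h6 : m'.nvar 6 = m.nvar 6) : StRel c t f g W' L m' s := by
  have e1 := hN 1 (by simp)
  have e13 := hN 13 (by simp)
  refine h.update hD ⟨hN 9 (by simp), hN 10 (by simp), hN 11 (by simp), by rw [e13], by simp [e1]⟩
    h.run ?_ ?_ ?_ ?_ (h6 ▸ h.cur)
  all_goals simp only [Store.Lists, e1, e13, hR, h6]
  exacts [h.old, h.pairs, h.new, h.act]

/-- One pass through the loop of Algorithm 2. -/
def iterP : Prog := .seq selP (.ite (.neq (.var 13) (.var 9)) .skip (.seq matchP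
  (.ite (.neq (.var 14) (.var 9)) (.nput 13 (.lit 1) (.var 13) (.lit 2)) composeP)))

/-- The memory represents a state after `l` passes through the loop. -/
def LoopI (c : Ctx n r a) (t f g : ℕ) (W' : WFam n) (L : ℕ → WFam n) (l : ℕ) (m : Store) : Prop :=
  ∃ s, StRel c t f g W' L m s ∧ m.nvar 6 ≤ g + l ∧
    ((∀ x < f, m.narr 13 1 x ≠ 1) ∨ m.left g + l ≤ g)

theorem ht_iterP (hD : StageData c t f g W' L) (hE : Env c m) (hV : LoopVars t f g m) {l : ℕ}
    (h : LoopI c t f g W' L l m) :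
    Ht iterP m (500 * (g + n + 1)) (LoopI c t f g W' L (l + 1)) := by
  obtain ⟨s, h, hc, hl⟩ := h
  have hfg := hD.le
  refine (ht_selP hV.f hV.g hD.le).seq_le (K2 := 450 * (g + n + 1)) (by omega) fun m1 hF1 h1 => ?_
  have hV1 := hV.of_frame hF1 rfl
  have hE1 := hE.of_frame hF1 rfl
  have hR : StRel c t f g W' L m1 s := h.of_eq hD (by
    rintro A (rfl | rfl | rfl | rfl | rfl) <;> exact hF1.N _ rfl) (hF1.R 2 rfl) (hF1.n 6 rfl)
  have e6 : m1.nvar 6 = m.nvar 6 := hF1.n 6 rfl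
  rw [← hF1.N 13 rfl, ← hF1.N 11 rfl] at h1
  simp only [Store.left, ← hF1.N 13 rfl] at hl
  refine Ht.ite_le (K := 440 * (g + n + 1)) (by simp only [Test.cost, NExp.cost]; omega)
    (fun hb => Ht.of_wp ?_ ?_) fun hb => ?_
  · simp only [Test.holds, NExp.eval, hV1.g] at hb
    refine ⟨s, hR, by omega, .inl ?_⟩
    grind
  · simp only [Prog.time]; omega
  simp only [Test.holds, NExp.eval, hV1.g] at hb
  obtain ⟨b, hbA, h13, hmax⟩ := h1.resolve_left fun h => hb h.1
  have hl' : m1.left g + l ≤ g := hl.resolve_left fun h => h b hbA.1 hbA.2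
  refine (ht_matchP hD hE1 hR hV1 hbA h13).seq_le (K2 := 230 * (g + n + 1)) (by omega)
    fun m2 hF2 h2 => ?_
  have hV2 := hV1.of_frame hF2 rfl
  have e6' : m2.nvar 6 = m1.nvar 6 := hF2.n 6 rfl
  have e1 : m2.narr 1 = m1.narr 1 := hF2.N 1 rfl
  have eR : m2.rarr 2 = m1.rarr 2 := hF2.R 2 rfl
  have eN : m2.narr 13 = m1.narr 13 := hF2.N 13 rfl
  have e13 : m2.nvar 13 = b := (hF2.n 13 rfl).trans h13
  refine Ht.ite_le (K := 200 * (g + n + 1)) (by simp only [Test.cost, NExp.cost]; omega)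
    (fun h14 => Ht.of_wp ?_ ?_) fun h14 => ?_
  · simp only [Test.holds, NExp.eval, hV2.g] at h14
    have hno := h2.2.resolve_right fun ⟨x0, hx0, h3, _⟩ => by omega
    obtain ⟨⟨s', hs'⟩, hleft⟩ := hR.keep (m' := m2.setN 13 1 b 2) hD hbA hmax
      (hR.not_available hD hE1 hbA hno.2)
      ⟨by funext; simp [hF2.N 9 rfl], by funext; simp [hF2.N 10 rfl], by funext; simp [hF2.N 11 rfl],
        by funext; simp [eN], by simp [funext_iff, e1]⟩ (by funext; simp [e1])
      (by simp [eR]) (by simp [e6']) (by simp [eN])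
    simp only [wp, NExp.eval, e13]
    refine ⟨s', hs', ?_, .inr (by omega)⟩
    simp only [Store.setN_nvar]
    omega
  · simp only [Prog.time, NExp.cost]; omega
  simp only [Test.holds, NExp.eval, hV2.g] at h14
  obtain ⟨x0, hx0, e14, ho, hcard⟩ := h2.2.resolve_left fun h => h14 h.1
  have hcur := hR.cur
  refine (ht_composeP (hE1.of_frame hF2 rfl) hV2 hD.lt hfg hbA.1 hx0 (e6' ▸ hR.cur) e13 e14 h2.1
    (hF2.N 9 rfl)).conseq le_rfl fun m3 hF3 h₃ => ?_
  simp only [e1, eR, eN, e6'] at h₃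
  obtain ⟨d, hd, hd', g1, g2, g3, g4, g5, g6⟩ := h₃
  obtain ⟨⟨s', hs'⟩, hleft⟩ := hR.compose hD hE1 hbA hmax hx0 ho hcard (m' := m3)
    ⟨by rw [hF3.N 9 rfl, hF2.N 9 rfl], by rw [hF3.N 10 rfl, hF2.N 10 rfl],
      by rw [hF3.N 11 rfl, hF2.N 11 rfl], g6, fun x hx => g1 x (by omega)⟩ hd hd' g1 g2 g3 g4
    fun x => by rw [g5 x, eR]
  exact ⟨s', hs', by omega, .inr (by omega)⟩

/-- The loop of Algorithm 2. -/
def mainP : Prog := .seq (.nset 18 (.var 9)) (forP 17 18 iterP)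

theorem ht_mainP (hD : StageData c t f g W' L) (hE : Env c m) (hV : LoopVars t f g m)
    (h : StRel c t f g W' L m s) (h6 : m.nvar 6 = g) :
    Ht mainP m (600 * ((g + 1) * (g + n + 1))) fun m' => ∃ s, StRel c t f g W' L m' s ∧
      m'.nvar 6 ≤ g + g ∧ ∀ x < f, m'.narr 13 1 x ≠ 1 := by
  have key : ∀ {m' : Store} {l : ℕ}, LoopI c t f g W' L l m' → ∀ x v, x ≠ 6 →
      LoopI c t f g W' L l (m'.setn x v) := fun ⟨s, h, h1, h2⟩ x v hx =>
    ⟨s, h.of_eq hD (fun _ _ => rfl) rfl (by simp [hx.symm]), by simpa [hx.symm] using h1, h2⟩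
  refine (Ht.of_wp (K := 2) (Q := fun m' => m'.nvar 18 = g ∧ LoopI c t f g W' L 0 m') ?_
    (by decide)).seq_le (K2 := g * (500 * (g + n + 1) + 7) + 5) (by nlinarith) fun m1 hF1 h₁ => ?_
  · refine ⟨by simp [hV.g], key ⟨s, h, by omega, .inr ?_⟩ 18 _ (by decide)⟩
    exact (card_filter_le _ _).trans_eq (card_range g)
  · refine (Ht.for_const (N := g) (LoopI c t f g W' L) _ rfl rfl (by decide) h₁.1
      (fun k m v h => key h 17 v (by decide)) h₁.2 fun k m' hk hF hk' _ hI => ht_iterP hD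
      ((hE.of_frame hF1 rfl).of_frame hF rfl) ((hV.of_frame hF1 rfl).of_frame hF rfl) hI).conseq le_rfl
      fun m' hF ⟨s, h, h1, h2⟩ => ⟨s, h, h1, h2.elim (fun h => h) fun h2 x hx hx1 => ?_⟩
    have : (filter (fun x => m'.narr 13 1 x = 1) (range g)) = ∅ := card_eq_zero.mp (by
      unfold Store.left at h2; omega)
    have h3 : x ∈ filter (fun x => m'.narr 13 1 x = 1) (range g) := by
      simp [hx1, hx.trans_le hD.le]
    grind

theorem StRel.exists_collect (hD : StageData c t f g W' L) (h : StRel c t f g W' L m s)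
    (hend : ∀ x < f, m.narr 13 1 x ≠ 1) : s.old.fam = ∅ ∧ ∃ W, Collect t s W ∧
      m.Lists (fun x => x < m.nvar 6 ∧ m.narr 13 1 x ≠ 0) W := by
  have hLI := h.loopInv hD
  have hcur := h.cur
  have hB := c.data.disj
  refine ⟨eq_empty_of_forall_notMem fun X hX => ?_, ?_⟩
  · obtain ⟨x, hx, -⟩ := (h.old.fam _).mp hX
    grind
  have hcase : ∀ x, x < m.nvar 6 ∧ m.narr 13 1 x ≠ 0 → (x < m.nvar 6 ∧ m.narr 13 1 x = 2) ∨
      ((f ≤ x ∧ x < g) ∧ m.narr 13 1 x = 1 ∧ m.narr 13 0 x < t) := fun x hx => by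
    have h1 := h.act x hx.1
    by_cases h2 : m.narr 13 1 x = 2
    · grind
    · have h3 := hend x
      have h4 := h.pOf x
      omega
  have hN : ∀ {x}, x < m.nvar 6 ∧ m.narr 13 1 x = 2 → m.row n x ∈ s.new.fam := fun hx =>
    (h.new.fam _).mpr ⟨_, hx, rfl⟩
  have hP : ∀ {x}, ((f ≤ x ∧ x < g) ∧ m.narr 13 1 x = 1 ∧ m.narr 13 0 x < t) →
      m.row n x ∈ (s.pairs (m.narr 13 0 x)).fam := fun hx =>
    ((h.pairs _ hx.2.2).fam _).mpr ⟨_, ⟨hx.1, rfl, hx.2.1⟩, rfl⟩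
  have hbit : ∀ x, x < m.nvar 6 ∧ m.narr 13 1 x ≠ 0 → ∀ i : Fin n, m.narr 1 x i = 0 ∨ m.narr 1 x i = 1 :=
    fun x hx => by
      rcases hcase x hx with hx | hx
      exacts [h.new.bit x hx, (h.pairs _ hx.2.2).bit x ⟨hx.1, rfl, hx.2.1⟩]
  have hinj : ∀ x y, x < m.nvar 6 ∧ m.narr 13 1 x ≠ 0 → y < m.nvar 6 ∧ m.narr 13 1 y ≠ 0 →
      m.row n x = m.row n y → x = y := fun x y hx hy he => by
    have hno : ∀ {x y}, x < m.nvar 6 ∧ m.narr 13 1 x = 2 → ((f ≤ y ∧ y < g) ∧ m.narr 13 1 y = 1 ∧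
        m.narr 13 0 y < t) → m.row n x ≠ m.row n y := fun hx hy he =>
      hLI.pairs_not_twoCuts hy.2.2 (hP hy) (he ▸ hLI.new_twoCuts (hN hx))
    rcases hcase x hx with hx | hx <;> rcases hcase y hy with hy | hy
    · exact h.new.inj x y hx hy he
    · grind
    · grind
    · have hpq : m.narr 13 0 x = m.narr 13 0 y := by
        by_contra hne
        refine hLI.pairs_not_cuts hy.2.2 (hP hy) hne hx.2.2.ne ?_
        have := (hD.pairOutput _ hx.2.2).cut1 _ (hLI.pairs_sub _ (hP hx))
        grind
      exact (h.pairs _ hy.2.2).inj x y ⟨hx.1, hpq, hx.2.1⟩ ⟨hy.1, rfl, hy.2.1⟩ he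
  obtain ⟨W, hW⟩ := exists_rows (m.rarr 2 0) hbit hinj
  have hw : ∀ p < t, ∀ X ∈ (s.pairs p).fam, W.wt X = (s.pairs p).wt X := fun p hp X hX => by
    obtain ⟨x, hx, rfl⟩ := ((h.pairs p hp).fam _).mp hX
    rw [(h.pairs p hp).wt x hx, hW.wt x (by omega)]
  refine ⟨W, ⟨?_, hw, fun X hX _ => ?_⟩, hW⟩
  · ext X
    rw [hW.fam, mem_union, mem_biUnion]
    constructor
    · grind
    · rintro (hX | ⟨p, hp, hX⟩)
      · obtain ⟨x, hx, rfl⟩ := (h.new.fam _).mp hX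
        grind
      · obtain ⟨x, hx, rfl⟩ := ((h.pairs p (mem_range.mp hp)).fam _).mp hX
        grind
  · obtain ⟨x, hx, rfl⟩ := (h.new.fam _).mp hX
    rw [h.new.wt x hx, hW.wt x (by omega)]

/-- Remove the rows with mark `0` from the list. -/
def compactP : Prog := progs
  [.nset 14 (.lit 0),
   forP 10 6 (.ite (.neq (.get 13 (.lit 1) (.var 10)) (.lit 0)) .skip (.seq
    (forP 11 2 (.nput 1 (.var 14) (.var 11) (.get 1 (.var 10) (.var 11))))
    (progs [.rput 2 (.lit 0) (.var 14) (rA 2 (.var 10)), .nput 13 (.lit 1) (.var 14) (.lit 1),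
      .nset 14 (.add (.var 14) (.lit 1))]))),
   .nset 6 (.var 14)]

theorem ht_compactP (hE : Env c m) {N : ℕ} (h6 : m.nvar 6 = N) {W : WFam n}
    (hW : m.Lists (fun x => x < N ∧ m.narr 13 1 x ≠ 0) W) :
    Ht compactP m (100 * ((N + 1) * (n + 1))) fun m' => m'.Lists (fun x => x < m'.nvar 6) W ∧
      ∀ x < m'.nvar 6, m'.narr 13 1 x = 1 := by
  refine (Ht.of_wp (K := 2) (Q := fun m' => m'.nvar 14 = 0) (by simp [wp]) (by decide)).cons
    (K2 := 90 * ((N + 1) * (n + 1))) (by nlinarith) fun m1 hF1 h₁ => ?_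
  have hE1 := hE.of_frame hF1 rfl
  refine (Ht.for_const (N := N) (fun l m' => m'.nvar 14 ≤ l ∧
    m'.Lists (fun x => x < m'.nvar 14 ∨ ((l ≤ x ∧ x < N) ∧ m.narr 13 1 x ≠ 0)) W ∧
    ∀ x, m'.narr 13 1 x = if x < m'.nvar 14 then 1 else m.narr 13 1 x) (n * 13 + 40) rfl rfl (by decide)
    ((hF1.n 6 rfl).trans h6) (fun k m v h => by simpa [Store.Lists] using h) ⟨h₁.le, ?_, ?_⟩
    fun l m2 hl hF hl' _ hI => ?_).cons (K2 := 2) (by nlinarith) fun m2 hF2 h₂ => Ht.of_wp ?_ (by decide)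
  · rw [Store.Lists, hF1.N 1 rfl, hF1.R 2 rfl]
    grind
  · simp [h₁, hF1.N 13 rfl]
  · obtain ⟨h1, h2, h3⟩ := hI
    have e13 : m2.narr 13 1 l = m.narr 13 1 l := by grind
    refine Ht.ite_le (K := n * 13 + 30) (by simp only [Test.cost, NExp.cost]; omega)
      (fun h0 => Ht.of_wp ⟨by omega, ?_, h3⟩ (by simp [Prog.time])) fun h0 => ?_
    · simp only [Test.holds, NExp.eval, hl', e13] at h0
      grind
    simp only [Test.holds, NExp.eval, hl', e13] at h0
    refine (Ht.for_const (N := n) (fun j m' => ∀ x i, m'.narr 1 x i =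
      if x = m2.nvar 14 ∧ i < j then m2.narr 1 l i else m2.narr 1 x i) 6 rfl rfl (by decide)
      (hE1.of_frame hF rfl).hn (fun k m v h => h) (by simp) fun j m3 hj hF3 hj' _ hJ =>
      Ht.of_wp ?_ (by decide)).seq_le (K2 := 20) (by omega) fun m3 hF3 h4 => Ht.of_wp ?_ (by decide)
    · simp only [wp, NExp.eval, hj', hF3.n 14 rfl, hF3.n 10 rfl, hl', hJ l]
      intro x i
      by_cases hx : x = m2.nvar 14
      · by_cases hi : i = j
        · simp [hx, hi]
        · have : i < j + 1 ↔ i < j := by omega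
          simp [hx, hi, hJ, this]
      · simp [hx, hJ]
    · simp only [progs, wp, NExp.eval, RExp.eval, hF3.n 14 rfl, hF3.n 10 rfl, hl', hF3.R 2 rfl,
        Store.setR_nvar, Store.setN_nvar]
      refine ⟨by simp; omega, ?_, fun x => ?_⟩
      · have h5 : l < N := hl
        refine h2.reindex (fun x => if x = m2.nvar 14 then l else x) (fun x hx => ?_) (fun y hy => ?_)
          (fun x y hx hy he => ?_) (fun x hx i => ?_) fun x hx => ?_
        · simp only [Store.setn_nvar, if_true] at hx
          grind
        · simp only [Store.setn_nvar, if_true]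
          by_cases hyl : y = l
          · grind
          · exact ⟨y, by omega, if_neg (by omega)⟩
        · simp only [Store.setn_nvar, if_true] at hx hy
          grind
        · simp only [Store.setn_narr, Store.setN_narr, Store.setR_narr, h4]
          grind
        · by_cases hx : x = m2.nvar 14 <;> simp [hx, hF3.R 2 rfl]
      · simp [hF3.N 13 rfl, h3]
        grind
  · simp only [progs, wp, NExp.eval]
    obtain ⟨h1, h2, h3⟩ := h₂
    refine ⟨h2.congr (fun x => ?_) (fun _ _ _ => rfl) fun _ _ => rfl, fun x hx => ?_⟩
    · simp only [Store.setn_nvar, if_true]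
      omega
    · simp only [Store.setn_nvar, if_true] at hx
      simp [h3, hx]

/-- The number of blocks cut by each row of the first kind. -/
def ncutP : Prog := forP 10 8 (progs [.nset 12 (.lit 0),
  forP 11 4 (.ite (.neq (.get 10 (.var 10) (.var 11)) (.lit 1)) (.nset 12 (.add (.var 12) (.lit 1)))
    .skip), .nput 11 (.lit 0) (.var 10) (.var 12)])

open Classical in
theorem ht_ncutP (hV : LoopVars t f g m) (hfg : f ≤ g) (htr : t < r) (hI : IdOK c g m) :
    Ht ncutP m (30 * ((f + 1) * (t + 1))) fun m' => ∀ x < f, m'.narr 11 0 x =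
      (cutIdx c.B (range t) (m.row n x)).card := by
  refine (Ht.for_const (N := f) (fun k m' => ∀ x < k, m'.narr 11 0 x =
      (cutIdx c.B (range t) (m.row n x)).card) (t * 20 + 15) rfl rfl (by decide) hV.f
    (fun k m v h => h) (by simp) fun k m1 hk hF hk' _ hJ => ?_).conseq (by nlinarith) fun _ _ h => h
  refine (Ht.of_wp (K := 2) (Q := fun m' => m'.nvar 12 = 0) (by simp [wp]) (by decide)).cons
    (K2 := t * 20 + 13) (by omega) fun m2 hF2 h2 => ?_
  have hV2 := (hV.of_frame hF rfl).of_frame hF2 rfl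
  refine (Ht.for_const (N := t) (fun j m' => m'.nvar 12 =
    ((range j).filter fun q => Cuts (c.B q) (m.row n k)).card) 13 rfl rfl (by decide) hV2.t
    (fun k m v h => by simpa using h) (by simp [h2]) fun j m3 hj hF3 hj' _ hJ' =>
    Ht.of_wp ?_ (by decide)).cons (K2 := 5) (by omega) fun m3 hF3 h3 => Ht.of_wp ?_ (by decide)
  · have h4 := (hI k (hk.trans_le hfg) j (hj.trans htr)).2.1
    simp only [wp, Test.holds, NExp.eval, hj', hF3.n 10 rfl, hF2.n 10 rfl, hk', hF3.N 10 rfl,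
      hF2.N 10 rfl, hF.N 10 rfl, h4, range_add_one, filter_insert, Store.setn_nvar, if_true, hJ']
    grind
  · simp only [progs, wp, NExp.eval, hF3.n 10 rfl, hF2.n 10 rfl, hk', h3]
    intro x hx
    by_cases hxk : x = k
    · simp [hxk, cutIdx]
    · simpa [hxk, hF3.N 11 rfl, hF2.N 11 rfl] using hJ x (by omega)

end Loop

section Stage

variable {n r : ℕ} {a : Fin n → Fin n → WithTop ℝ} {c : Ctx n r a} {t f g : ℕ} {W' : WFam n}
  {L : ℕ → WFam n} {m m' : Store} {s : Alg2State n}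
variable {W : WFam n}

theorem alg3Run_of_algorithm2 {B : ℕ → Finset (Fin n)} (hB : BlockData a B r) (hr : 2 ≤ r) {o : Option (WFam n)}
    (h : Algorithm2 a B 1 (emptyFam n) o) : Alg3Run a B 2 o := by
  have h0 : ∀ {L : ℕ → WFam n} {s}, Relation.ReflTransGen (Alg2Step B 1) (startState (emptyFam n) L) s →
      s = startState (emptyFam n) L := fun {L s} hs => by
    induction hs with
    | refl => rfl
    | tail _ hs ih =>
      subst ih
      cases hs with
      | compose _ _ _ _ hX => exact absurd hX.1 (by simp [startState, emptyFam])
      | keep _ hX => exact absurd hX.1 (by simp [startState, emptyFam])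
  have hfam : ∀ {L : ℕ → WFam n} {W}, Collect 1 (startState (emptyFam n) L) W → W.fam = (L 0).fam :=
    fun hW => by simpa [startState] using hW.1
  cases h with
  | failPair p hp h =>
    obtain rfl : p = 0 := by omega
    exact .init _ h
  | tooLarge L s W hL hrun hend hW hcard =>
    have hp : ∀ p < 1, PairOutput a (B p) (B 1) (L p) := fun p hp =>
      (hB.two p (by omega) 1 (by omega) (by omega)).pairOutput (hL p hp)
    refine absurd ((stageOutput_collect hB.disj (stageCorrect_empty (r := r)).1 hp hrun hend hW).card_le hB.disj
      (hp 0 one_pos).lam fun X hX => ⟨X, ?_, CutEquiv.refl _ _ _⟩) (not_le.mpr hcard)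
    rw [h0 hrun] at hW
    rwa [← hfam hW]
  | done L s W hL hrun hend hW hcard =>
    rw [h0 hrun] at hW
    obtain ⟨h1, h2, h3, h4⟩ := hL 0 one_pos
    have h5 := hfam hW
    exact .init _ ⟨h1, h5 ▸ h2, h5 ▸ h3, fun X hX => (hW.2.1 0 one_pos X (h5 ▸ hX)).trans
      (h4 X (h5 ▸ hX))⟩

theorem Rows.card {M : ℕ → ℕ → ℕ} {w : ℕ → ℝ} {N : ℕ} (h : Rows M w (fun x => x < N) W) :
    W.fam = (range N).image (rset n M) ∧ W.fam.card = N := by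
  have h1 : W.fam = (range N).image (rset n M) := by
    ext X
    simp [h.fam]
  rw [h1, card_image_of_injOn fun x hx y hy => h.inj x y (by simpa using hx) (by simpa using hy),
    card_range]
  grind

/-- Run Algorithm 1 on all pairs of blocks whose second block is the one in variable `4`. -/
def pairsP : Prog := .seq (.nset 8 (.var 6)) (forP 5 4 (.ite (.neq (.var 7) (.lit 0)) pairP .skip))

/-- The memory after `k` of the pairs have been treated without failure. -/
structure PairsI (c : Ctx n r a) (t f : ℕ) (m : Store) (k : ℕ) (L : ℕ → WFam n) (m' : Store) : Prop where
  alg : ∀ p < k, Algorithm1 a (c.B p) (c.B t) (some (L p))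
  cur : f ≤ m'.nvar 6 ∧ m'.nvar 6 ≤ f + ∑ p ∈ range k, (c.S p t).card
  rows : ∀ p < k, m'.Lists (fun x => (f ≤ x ∧ x < m'.nvar 6) ∧ m'.narr 13 0 x = p ∧ m'.narr 13 1 x = 1)
    (L p)
  act : ∀ x, f ≤ x → x < m'.nvar 6 → m'.narr 13 0 x < k ∧ m'.narr 13 1 x = 1
  old : SameBelow f m m'

theorem ht_pairsP (hE : Env c m) (ht : m.nvar 4 = t) (htr : t < r) (h6 : m.nvar 6 = f)
    (h7 : m.nvar 7 = 0) :
    Ht pairsP m (∑ p ∈ range t, (1500 * (n * (c.S p t).card) + 12) + 10) fun m' => m'.nvar 8 = f ∧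
      ((m'.nvar 7 ≠ 0 ∧ ∃ p < t, Algorithm1 a (c.B p) (c.B t) none) ∨
        (m'.nvar 7 = 0 ∧ ∃ L, PairsI c t f m t L m')) := by
  refine (Ht.of_wp (K := 2) (Q := fun m' => m'.nvar 8 = f) (by simp [wp, h6]) (by decide)).seq_le
    (K2 := ∑ p ∈ range t, ((1500 * (n * (c.S p t).card) + 5) + 7) + 5) (by grind)
    fun m1 hF1 h₁ => ?_
  refine (Ht.for (N := t) (fun k m' => (m'.nvar 7 ≠ 0 ∧ ∃ p < t, Algorithm1 a (c.B p) (c.B t) none) ∨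
        (m'.nvar 7 = 0 ∧ ∃ L, PairsI c t f m k L m')) _ rfl rfl (by decide) ((hF1.n 4 rfl).trans ht)
    (fun k m' v h => h.imp (fun h => by simpa using h) fun ⟨h1, L, h2, h3, h4, h5, h6⟩ =>
      ⟨by simpa using h1, L, h2, by simpa using h3, by simpa [Store.Lists] using h4, by simpa using h5, h6⟩)
    (.inr ⟨(hF1.n 7 rfl).trans h7, fun _ => emptyFam n, by simp, ?_, by simp, ?_, ?_⟩)
    fun k m2 hk hF hk' ht' hI => ?_).conseq le_rfl fun m' hF h => ⟨(hF.n 8 rfl).trans h₁, h⟩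
  · simp [hF1.n 6 rfl, h6]
  · rw [hF1.n 6 rfl, h6]
    omega
  · exact fun x _ => ⟨by rw [hF1.N 1 rfl], by rw [hF1.R 2 rfl], by rw [hF1.N 13 rfl], by rw [hF1.N 13 rfl]⟩
  have hE2 : PairEnv c k t m2 := ⟨(hE.of_frame hF1 rfl).of_frame hF rfl, hk', ht'⟩
  refine Ht.ite_le (K := 1500 * (n * (c.S k t).card) + 1) (by simp only [Test.cost, NExp.cost]; omega)
    (fun h0 => ?_) fun h0 => Ht.of_wp (.inl (hI.resolve_right fun h => h0 h.1)) (by simp [Prog.time])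
  obtain ⟨-, L, h2, h3, h4, h5, h6'⟩ := hI.resolve_left fun h => h.1 h0
  refine (ht_pairP hE2 (hk.trans htr) htr hk.ne h0).conseq (by omega) fun m3 _ h => ?_
  rcases h with ⟨h, h'⟩ | ⟨h, W, hW, hle, hrows, hact, hold⟩
  · grind
  have hold' : ∀ x < m2.nvar 6, ∀ i : Fin n, m3.narr 1 x i = m2.narr 1 x i := fun x hx i => by
    rw [(hold x hx).1]
  refine .inr ⟨h, fun p => if p = k then W else L p, fun p hp => ?_, ?_, fun p hp => ?_,
    fun x hx hx' => ?_, fun x hx => ?_⟩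
  · grind
  · rw [sum_range_succ]
    omega
  · split_ifs with hpk
    · refine hrows.congr (fun x => ?_) (fun _ _ _ => rfl) fun _ _ => rfl
      have g1 := hact x
      have g2 := hold x
      grind
    · refine (h4 p (by omega)).congr (fun x => ?_) (fun x hx => hold' x hx.1.2) fun x hx =>
        (hold x hx.1.2).2.1
      have g1 := hact x
      by_cases hx : x < m2.nvar 6
      · rw [(hold x hx).2.2.1, (hold x hx).2.2.2]
        omega
      · omega
  · have g1 := hact x
    by_cases hx : x < m2.nvar 6
    · have := h5 x (by assumption) hx
      rw [(hold x hx).2.2.1, (hold x hx).2.2.2]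
      omega
    · omega
  · obtain ⟨g1, g2, g3, g4⟩ := h6' x hx
    obtain ⟨k1, k2, k3, k4⟩ := hold x (by omega)
    grind

/-- Set variable `7` if the list has too many members. -/
def sizeP : Prog := progs [.nset 15 (.lit 0),
  forP 10 2 (.ite (.nlt (.var 4) (nA 2 (.var 10))) .skip (.nset 15 (.add (.var 15) (.lit 1)))),
  .ite (.nlt (.add (.var 15) (.var 15)) (.var 6)) (.nset 7 (.lit 1)) .skip]

theorem ht_sizeP (hE : Env c m) (ht : m.nvar 4 = t) (h7 : m.nvar 7 = 0) :
    Ht sizeP m (30 * (n + 1)) fun m' =>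
      (m'.nvar 7 ≠ 0 ∧ 2 * ((range (t + 1)).biUnion c.B).card < m.nvar 6) ∨
      (m'.nvar 7 = 0 ∧ m.nvar 6 ≤ 2 * ((range (t + 1)).biUnion c.B).card) := by
  classical
  refine (Ht.of_wp (K := 2) (Q := fun m' => m'.nvar 15 = 0) (by simp [wp]) (by decide)).cons
    (K2 := n * 19 + 20) (by omega) fun m1 hF1 h1 => ?_
  have hE1 := hE.of_frame hF1 rfl
  refine (Ht.for_const (N := n) (fun k m' => m'.nvar 15 = cnt k fun i => c.nb i ≤ t) 12 rfl rfl
    (by decide) hE1.hn (fun k m v h => by simpa using h) (by rw [h1, cnt_zero])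
    fun k m2 hk hF hk' _ hI => Ht.of_wp ?_ (by decide)).cons (K2 := 12) (by omega)
    fun m2 hF2 h2 => Ht.of_wp ?_ (by decide)
  · have h3 := (hE1.of_frame hF rfl).nb ⟨k, hk⟩
    simp only at h3
    simp only [wp, Test.holds, NExp.eval, hk', h3, hF.n 4 rfl, hF1.n 4 rfl, ht, cnt_succ hk,
      Store.setn_nvar, if_true, hI]
    grind
  · have h3 : (range (t + 1)).biUnion c.B = univ.filter fun i => c.nb i ≤ t := by
      ext i
      simp [c.mem, Nat.lt_succ_iff]
    rw [cnt_full, ← h3] at h2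
    simp only [progs, wp, Test.holds, NExp.eval, h2, hF2.n 6 rfl, hF1.n 6 rfl, hF2.n 7 rfl, hF1.n 7 rfl,
      h7, Store.setn_nvar, if_true]
    grind

/-- Algorithm 2 for the block in variable `4`. -/
def stageP : Prog := .seq pairsP (.ite (.neq (.var 7) (.lit 0))
  (progs [.nset 9 (.var 6), idsP, ncutP, mainP, compactP, sizeP]) .skip)

/-- The list of members represents the family `W`. -/
structure Listed (W : WFam n) (m : Store) : Prop where
  rows : m.Lists (fun x => x < m.nvar 6) W
  act : ∀ x < m.nvar 6, m.narr 13 1 x = 1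
  le : m.nvar 6 ≤ 2 * n

theorem Ctx.sum_card_le (hs : ∀ p t, p < t → t < r → (c.B t).card ≤ (c.B p).card) (htr : t < r) :
    ∑ p ∈ range t, (c.S p t).card ≤ 2 * n := by
  have h1 : ∑ p ∈ range t, (c.B p).card ≤ n := by
    rw [← card_biUnion fun p _ q _ hpq => disjoint_left.mpr (c.data.disj.not_mem hpq)]
    exact (card_le_univ _).trans_eq (Fintype.card_fin n)
  calc _ ≤ ∑ p ∈ range t, 2 * (c.B p).card := sum_le_sum fun p hp => by
        have h2 := hs p t (mem_range.mp hp) htr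
        have h3 := card_union_le (c.B p) (c.B t)
        unfold Ctx.S
        omega
    _ ≤ 2 * n := by rw [← mul_sum]; omega

theorem ht_stageP (hs : ∀ p t, p < t → t < r → (c.B t).card ≤ (c.B p).card) (hrn : r ≤ n)
    (hE : Env c m) (ht : m.nvar 4 = t) (htr : t < r) (h7 : m.nvar 7 = 0)
    (hW' : Listed W' m) (hout : StageOutput (realPart a) c.B t W') :
    Ht stageP m (100000 * n ^ 2) fun m' => (m'.nvar 7 ≠ 0 ∧ Algorithm2 a c.B t W' none) ∨
      (m'.nvar 7 = 0 ∧ ∃ W, Algorithm2 a c.B t W' (some W) ∧ Listed W m') := by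
  have hn : 1 ≤ n := by omega
  have hS := Ctx.sum_card_le hs htr
  have hcost : ∑ p ∈ range t, (1500 * (n * (c.S p t).card) + 12) + 10 ≤ 4000 * n ^ 2 := by
    rw [sum_add_distrib, ← mul_sum, ← mul_sum, sum_const, card_range, smul_eq_mul]
    nlinarith [Nat.mul_le_mul_left n hS]
  refine (ht_pairsP hE ht htr rfl h7).seq_le (K2 := 90000 * n ^ 2) (by omega) fun m1 hF1 h1 => ?_
  have hE1 := hE.of_frame hF1 rfl
  have hn2 : 1 ≤ n ^ 2 := Nat.one_le_pow _ _ hn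
  refine Ht.ite_le (K := 89990 * n ^ 2) (by simp only [Test.cost, NExp.cost]; omega) (fun h0 => ?_)
    fun h0 => Ht.of_wp (.inl ?_) (by simp only [Prog.time]; omega)
  swap
  · obtain ⟨-, p, hp, h⟩ := h1.2.resolve_right fun h => h0 h.1
    exact ⟨h0, .failPair p hp h⟩
  obtain ⟨-, L, hL, hcur, hrows, hact, hold⟩ := h1.2.resolve_left fun h => h.1 h0
  set f := m.nvar 6
  have hf := hW'.le
  generalize hg : m1.nvar 6 = g at *
  have hg4 : g ≤ 4 * n := by omega
  have hD : StageData c t f g W' L := ⟨htr, hcur.1, hout, hL⟩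
  refine (Ht.of_wp (K := 2) (Q := fun m' => LoopVars t f g m') (by exact ⟨by simpa [hF1.n 4 rfl] using ht,
    by simp [h1.1], by simp [hg]⟩) (by decide)).cons (K2 := 89980 * n ^ 2) (by omega) fun m2 hF2 hV2 => ?_
  have hE2 := hE1.of_frame hF2 rfl
  have hold' : ∀ x < f, ∀ i : Fin n, m1.narr 1 x i = m.narr 1 x i := fun x hx i => by rw [(hold x hx).1]
  have hbit : ∀ x < g, ∀ i : Fin n, m1.narr 1 x i = 0 ∨ m1.narr 1 x i = 1 := fun x hx i => by
    by_cases hxf : x < f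
    · rw [hold' x hxf]
      exact hW'.rows.bit x hxf i
    · have h2 := hact x (by omega) hx
      exact (hrows _ h2.1).bit x ⟨⟨by omega, hx⟩, rfl, h2.2⟩ i
  refine (ht_idsP hE2 hV2.g hrn (by rw [hF2.N 1 rfl]; exact hbit)).cons (K2 := 80000 * n ^ 2)
    (by nlinarith) fun m3 hF3 h3 => ?_
  have hE3 := hE2.of_frame hF3 rfl
  have hV3 := hV2.of_frame hF3 rfl
  refine (ht_ncutP hV3 hcur.1 htr h3).cons (K2 := 70000 * n ^ 2) (by nlinarith) fun m4 hF4 h4 => ?_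
  have hE4 := hE3.of_frame hF4 rfl
  have hV4 := hV3.of_frame hF4 rfl
  have e1 : m4.narr 1 = m1.narr 1 := by rw [hF4.N 1 rfl, hF3.N 1 rfl, hF2.N 1 rfl]
  have e13 : m4.narr 13 = m1.narr 13 := by rw [hF4.N 13 rfl, hF3.N 13 rfl, hF2.N 13 rfl]
  have eR : m4.rarr 2 = m1.rarr 2 := by rw [hF4.R 2 rfl, hF3.R 2 rfl, hF2.R 2 rfl]
  have e6 : m4.nvar 6 = g := by rw [hF4.n 6 rfl, hF3.n 6 rfl, hF2.n 6 rfl, hg]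
  have hact0 : ∀ x < g, m1.narr 13 1 x = 1 := fun x hx => by
    by_cases hxf : x < f
    · rw [(hold x hxf).2.2.2]
      exact hW'.act x hxf
    grind
  have hR : StRel c t f g W' L m4 (startState W' L) := by
    refine ⟨.refl, ?_, ?_, ?_, fun x hx => ?_, e6.ge, ?_, ?_, fun x hx hx' => ?_⟩
    all_goals try simp only [Store.Lists, e1, e13, eR]
    · exact hW'.rows.congr (fun x => and_iff_left_of_imp fun hx => hact0 x (hx.trans_le hcur.1)) hold'
        fun x hx => (hold x hx).2.1
    · exact hrows
    · refine ⟨fun x hx => ?_, fun x y hx => ?_, fun X => ?_, fun x hx => ?_⟩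
      · grind
      · grind
      · simp only [startState, notMem_empty, false_iff, not_exists, not_and]
        grind
      grind
    · grind
    · intro x hx q hq
      rw [hF4.N 9 rfl, hF4.N 10 rfl, hF4.N 1 rfl]
      exact h3 x hx q hq
    · intro x hx
      rw [h4 x hx, Store.row, Store.row, hF4.N 1 rfl]
    grind
  refine (ht_mainP hD hE4 hV4 hR e6).cons (K2 := 20000 * n ^ 2) (by nlinarith) fun m5 hF5 h5 => ?_
  obtain ⟨s, hRs, hle, hend⟩ := h5
  obtain ⟨hend, W, hC, hW⟩ := hRs.exists_collect hD hend
  have hE5 := hE4.of_frame hF5 rfl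
  refine (ht_compactP hE5 rfl hW).cons (K2 := 1000 * n ^ 2) (by nlinarith) fun m6 hF6 h6 => ?_
  have e7 : m6.nvar 7 = 0 := by
    rw [hF6.n 7 rfl, hF5.n 7 rfl, hF4.n 7 rfl, hF3.n 7 rfl, hF2.n 7 rfl]
    exact h0
  have e4 : m6.nvar 4 = t := by rw [hF6.n 4 rfl, hF5.n 4 rfl, hV4.t]
  have hcard := (Rows.card h6.1).2
  refine (ht_sizeP (hE5.of_frame hF6 rfl) e4 e7).conseq (by nlinarith) fun m7 hF7 h₇ => ?_
  rcases h₇ with ⟨g1, g2⟩ | ⟨g1, g2⟩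
  · exact .inl ⟨g1, .tooLarge L s W hL hRs.run hend hC (hcard.symm ▸ g2)⟩
  · refine .inr ⟨g1, W, .done L s W hL hRs.run hend hC (hcard.symm ▸ g2), ?_, ?_, ?_⟩
    · rw [Store.Lists, hF7.N 1 rfl, hF7.R 2 rfl, hF7.n 6 rfl]
      exact h6.1
    · rw [hF7.N 13 rfl, hF7.n 6 rfl]
      exact h6.2
    · rw [hF7.n 6 rfl]
      exact g2.trans (Nat.mul_le_mul_left 2 ((card_le_univ _).trans_eq (Fintype.card_fin n)))

/-- The stages of Algorithm 3. -/
def stagesP : Prog := forP 4 3 (.ite (.and (.neq (.var 7) (.lit 0)) (.not (.neq (.var 4) (.lit 0))))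
  stageP .skip)

/-- The memory after `k` blocks have been treated. -/
def StagesI (c : Ctx n r a) (k : ℕ) (m : Store) : Prop :=
  (m.nvar 7 ≠ 0 ∧ 2 ≤ k ∧ Alg3Run a c.B k none) ∨ (m.nvar 7 = 0 ∧ ∃ W, Listed W m ∧
    ((k ≤ 1 ∧ W = emptyFam n) ∨ (2 ≤ k ∧ Alg3Run a c.B k (some W))))

theorem Listed.of_eq (h : Listed W m) (h1 : m'.narr = m.narr) (h2 : m'.rarr = m.rarr)
    (h6 : m'.nvar 6 = m.nvar 6) : Listed W m' := by
  obtain ⟨g1, g2, g3⟩ := h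
  refine ⟨?_, ?_, ?_⟩ <;> grind

theorem ht_stagesP (hs : ∀ p t, p < t → t < r → (c.B t).card ≤ (c.B p).card) (hrn : r ≤ n) (hr : 2 ≤ r)
    (hE : Env c m) (h6 : m.nvar 6 = 0) (h7 : m.nvar 7 = 0) :
    Ht stagesP m (200000 * (r * n ^ 2)) (StagesI c r) := by
  have hn2 : 1 ≤ n ^ 2 := Nat.one_le_pow _ _ (by omega)
  refine (Ht.for_const (N := r) (StagesI c) (100010 * n ^ 2) rfl rfl (by decide) hE.hr
    (fun k m' v h => h.imp (fun h => by simpa using h) fun ⟨h1, W, h2, h3⟩ => ⟨by simpa using h1, W,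
      h2.of_eq rfl rfl (by simp), h3⟩) (.inr ⟨h7, emptyFam n, ⟨?_, ?_, ?_⟩, by simp⟩)
    fun k m' hk hF hk' _ hI => ?_).conseq (by nlinarith) fun _ _ h => h
  · rw [h6]
    exact ⟨by simp, by simp, by simp [emptyFam], by simp⟩
  · simp [h6]
  · omega
  refine Ht.ite_le (K := 100000 * n ^ 2) (by simp only [Test.cost, NExp.cost]; omega) (fun h0 => ?_)
    fun h0 => Ht.of_wp ?_ (by simp only [Prog.time]; omega)
  · simp only [Test.holds, NExp.eval, hk'] at h0
    obtain ⟨-, W', hL, hW'⟩ := hI.resolve_left fun h => h.1 h0.1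
    have hout : StageOutput (realPart a) c.B k W' := by
      rcases hW' with ⟨h1, rfl⟩ | ⟨h1, h2⟩
      · obtain rfl : k = 1 := by omega
        exact (stageCorrect_empty (a := a) (r := r)).1
      · exact (stageCorrect_of_run c.data h2 hk.le).1
    have hrun : ∀ {o}, Algorithm2 a c.B k W' o → Alg3Run a c.B (k + 1) o := fun ho => by
      rcases hW' with ⟨h1, rfl⟩ | ⟨h1, h2⟩
      · obtain rfl : k = 1 := by omega
        exact alg3Run_of_algorithm2 c.data hr ho
      · exact .extend _ _ _ h2 ho
    refine (ht_stageP hs hrn (hE.of_frame hF rfl) hk' hk h0.1 hL hout).conseq le_rfl fun m1 _ h₁ => ?_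
    rcases h₁ with ⟨h1, h2⟩ | ⟨h1, W, h2, h3⟩
    · exact .inl ⟨h1, by omega, hrun h2⟩
    · exact .inr ⟨h1, W, h3, .inr ⟨by omega, hrun h2⟩⟩
  · simp only [Test.holds, NExp.eval, hk'] at h0
    rcases hI with ⟨h1, h2, h3⟩ | ⟨h1, W, h2, h3⟩
    · exact .inl ⟨h1, by omega, .stopped _ h3⟩
    · obtain rfl : k = 0 := by grind
      exact .inr ⟨h1, W, h2, .inl ⟨le_rfl, (h3.resolve_right fun h => by omega).2⟩⟩

/-- Algorithm 3. -/
def mainProg : Prog := .seq VCSPQuadratic.initP (.seq stagesP (.ite (.neq (.var 7) (.lit 0))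
  (.seq (.nset 0 (.lit 1)) (.nset 1 (.var 6))) (.nset 0 (.lit 0))))

theorem exists_program : ∃ (P : Prog) (C : ℕ), ∀ (n r : ℕ) (I : VCSPQuadratic n r), 2 ≤ r →
    ∃ (m : Store) (T : ℕ) (o : Option (WFam n)), Exec P I.encode m T ∧ T ≤ C * (r * n ^ 2) ∧
      Represents m o ∧ I.Algorithm3 o := by
  refine ⟨mainProg, 300000, fun n r I hr => ?_⟩
  have hrn := I.two_mul_le
  have hn : n ≤ n ^ 2 := by nlinarith
  have hrn2 := Nat.mul_le_mul_left r hn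
  have hpos : 1 ≤ r * n ^ 2 := by nlinarith
  have H : Ht mainProg I.encode (300000 * (r * n ^ 2)) fun m => ∃ o, Represents m o ∧
      I.Algorithm3 o := by
    refine (I.ht_initP hr).seq_le (K2 := 299000 * (r * n ^ 2)) (by omega) fun m1 hF1 h₁ => ?_
    obtain ⟨⟨fs, hfs, hE⟩, hv, -⟩ := h₁
    refine (ht_stagesP (fun p t hpt ht => ?_) (by omega) hr hE ((hv 6 rfl).trans rfl)
      ((hv 7 rfl).trans rfl)).seq_le (K2 := 90000 * (r * n ^ 2)) (by omega) fun m2 hF2 h₂ =>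
      Ht.of_wp ⟨fun h0 => ?_, fun h0 => ?_⟩ ?_
    · have h1 := I.antitone_newOrder (show (⟨p, hpt.trans ht⟩ : Fin r) ≤ ⟨t, ht⟩ from hpt.le)
      simpa [VCSPQuadratic.ctx, VCSPQuadratic.renamed, ht, hpt.trans ht] using h1
    · obtain ⟨-, W, hW, hr'⟩ := h₂.resolve_left fun h => h.1 h0
      refine ⟨some W, ?_, I.newOrder, I.antitone_newOrder, (hr'.resolve_left fun h => by omega).2⟩
      have h1 := hW.rows
      simp only [NExp.eval, Represents]
      refine ⟨rfl, ?_, ?_, ?_, ?_⟩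
      · exact fun s hs i hi => h1.bit s hs ⟨i, hi⟩
      · exact fun x hx y hy he => h1.inj x y hx hy he
      · exact h1.card.1
      · exact fun s hs => h1.wt s hs
    · exact ⟨none, rfl, I.newOrder, I.antitone_newOrder, (h₂.resolve_right fun h => h0 h.1).2.2⟩
    · exact le_trans (b := 100) (by decide) (by omega)
  obtain ⟨m, T, h1, h2, o, h3, h4⟩ := H
  grind

end Stage

end QRM2

theorem mainTheorem4 :
    -- whatever choices are made, the answer of Algorithm 3 is a correct one
    (∀ (n r : ℕ) (I : QRM2.VCSPQuadratic n r), 2 ≤ r →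
      ∀ o : Option (QRM2.WFam n), I.Algorithm3 o → I.IsDecompositionAnswer o) ∧
    -- whatever choices are made, the loop of Algorithm 2 does not run forever
    (∀ (n : ℕ) (B : ℕ → Finset (Fin n)) (t : ℕ),
      WellFounded fun s' s : QRM2.Alg2State n => QRM2.Alg2Step B t s s') ∧
    -- Algorithm 3 can be implemented, by one program, with running time `O(r n²)`
    (∃ (P : QRM2.Prog) (C : ℕ), ∀ (n r : ℕ) (I : QRM2.VCSPQuadratic n r), 2 ≤ r →
      ∃ (m : QRM2.Store) (T : ℕ) (o : Option (QRM2.WFam n)),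
        QRM2.Exec P I.encode m T ∧ T ≤ C * (r * n ^ 2) ∧
        QRM2.Represents m o ∧ I.Algorithm3 o) :=
  ⟨fun _ _ I hr _ ho => I.isDecompositionAnswer_of_algorithm3 hr ho,
    fun _ B t => QRM2.wellFounded_alg2Step B t, QRM2.exists_program⟩
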